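/- Let $\mathbb T=\mathbb R/\mathbb Z$, $\Gamma_n=\{0,\tfrac1n,\dots,\tfrac{n-1}n\}$, and $S_nf=(f(x))_{x\in\Gamma_n}$. One observes $y_n=S_nf+\xi_n$, where for each $n$ the noise variables $\xi_n(x)$, $x\in\Gamma_n$, are independent, identically distributed and sub-Gaussian with scale parameter $\sigma>0$, i.e. $\mathbb E\,e^{\tau\xi_n(x)}\le e^{(\tau\sigma)^2/2}$ for all $\tau\in\mathbb R$. Let $\mathcal B$ be a system of intervals $[a,a+h)\subseteq[0,1]$, $0<h\le1$, and put $$\|y\|_{\mathcal B}=\sup_{I\in\mathcal B}\frac{1}{\sqrt{\#(\Gamma_n\cap I)}}\Bigl|\sum_{x\in\Gamma_n\cap I}y(x)\Bigr|,\qquad y\in\mathbb R^{\Gamma_n},$$ where intervals without grid points contribute $0$. Assume that $\mathcal B$ is regular, i.e. that for some integer $m\ge2$ it contains all intervals $[\ell m^{-j},(\ell+1)m^{-j})$ with $j\ge1$ and $0\le\ell<m^j$. A subscript $0$ on a function space denotes mean zero. Let $k\ge1$ be an integer and let $\gamma_n=C_0(\log n)^r$ with $r\ge\frac12$ and $C_0>0$,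 where moreover $C_0>\sigma\sqrt{5+2k}$ if $r=\frac12$. The MIND estimator $\hat f_{\gamma_n}$ is the minimizer of $\frac12\|D^kg\|_{L^2}^2$ over all $g\in H^k_0(\mathbb T)$ with $\|S_ng-y_n\|_{\mathcal B}\le\gamma_n$. Let $1\le s\le k$ be real and $1\le p,p',q\le\infty$. Put $$\vartheta=\begin{cases}\dfrac{k}{2k+1}& q\le4k+2,\\[2mm] \dfrac{k-1/2+1/q}{2k}& q\ge 4k+2,\end{cases}\qquad \mu=\frac{s-(\frac1p-\frac12)_+}{2s+2k+1-2(\frac1p-\frac12)_+}.$$ Let $X$ be either the Besov space $B^{k+s,p'}_{p,0}(\mathbb T)$, normed by moduli of smoothness of some fixed integer order larger than $k+s$, or the Sobolev space $W^{k+s,p}_0(\mathbb T)$, normed by $\|D^{k+s}f\|_{L^p}$ if $s$ is an integer and by the norm of $B^{k+s,p}_{p,0}(\mathbb T)$ otherwise. Elements of $X$ are identified with their continuous representatives. Then the following hold. 1. For all $n\ge1$ and all data $y_n\in\mathbb R^{\Gamma_n}$ the MIND estimator exists and is unique. 2. For every $f\in X$, as $n\to\infty$, $$\|\hat f_{\gamma_n}-f\|_{L^q}=\mathcal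 O\Bigl(n^{-\mu(1-2\vartheta)-\vartheta}(\log n)^{2r\mu(1-2\vartheta)+2r\vartheta}\Bigr)$$ both almost surely (with a deterministic constant) and in expectation. 3. If $p\ge2$ and $q\le4k+2$, then this rate is $$\mathcal O\Bigl(n^{-\frac{k+s}{2k+2s+1}}(\log n)^{\frac{2k+2s}{2k+2s+1}r}\Bigr),$$ and in expectation it holds uniformly over each ball $X_L=\{f\in X:\|f\|_X\le L\}$, $L>0$. 4. This rate is minimax up to logarithmic factors: if $p\ge2$ and $q\le4k+2$, then for every $L>0$ there is $c>0$ such that, for independent $N(0,\sigma^2)$ noise and all sufficiently large $n$, $$\inf_{\tilde f}\ \sup_{f\in X_L}\mathbb E\|\tilde f-f\|_{L^q}\ \ge\ c\,n^{-\frac{k+s}{2k+2s+1}},$$ where the infimum is over all (jointly measurable) estimators $\tilde f$ based on $y_n$. -/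

import Mathlib

open MeasureTheory ProbabilityTheory Filter
open scoped ENNReal NNReal

noncomputable section

namespace MIND

/-! Functions on the torus `𝕋 = ℝ / ℤ` are represented by `1`-periodic functions `ℝ → ℝ`;
norms and integrals are taken over one period. -/

/-- Lebesgue measure on one period. -/
def torus : Measure ℝ := volume.restrict (Set.Ioc (0 : ℝ) 1)

/-- `g` is the `j`-th weak derivative of `f` on the torus. -/
def IsWeakDeriv (j : ℕ) (f g : ℝ → ℝ) : Prop :=
  Integrable g torus ∧
    ∀ φ : ℝ → ℝ, ContDiff ℝ (⊤ : ℕ∞) φ → Function.Periodic φ 1 →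
      ∫ x, f x * iteratedDeriv j φ x ∂torus = (-1) ^ j * ∫ x, g x * φ x ∂torus

/-- The homogeneous Sobolev norm `‖D^j f‖_{L^p(𝕋)}`; it is `∞` if `f` has no weak derivative of
order `j`.  (The weak derivative is unique almost everywhere, so that the infimum is over one
value.) -/
def weakDerivNorm (j : ℕ) (p : ℝ≥0∞) (f : ℝ → ℝ) : ℝ≥0∞ :=
  ⨅ (g : ℝ → ℝ) (_ : IsWeakDeriv j f g), eLpNorm g p torus

/-- Continuous functions on the torus with mean zero. -/
structure IsCont₀ (f : ℝ → ℝ) : Prop where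
  continuous : Continuous f
  periodic : Function.Periodic f 1
  mean_zero : ∫ x, f x ∂torus = 0

/-- The space `H^k_0(𝕋)` for `k ≥ 1`, each class being represented by its continuous
representative. -/
def sobolevHilbert₀ (k : ℕ) : Set (ℝ → ℝ) :=
  {f | IsCont₀ f ∧ weakDerivNorm k 2 f < ∞}

/-- The modulus of smoothness `ϖ_m(f; t)_p = sup_{|h| ≤ t} ‖D_{h,+}^m f‖_{L^p}`. -/
def modulus (m : ℕ) (p : ℝ≥0∞) (f : ℝ → ℝ) (t : ℝ) : ℝ≥0∞ :=
  ⨆ (h : ℝ) (_ : |h| ≤ t), eLpNorm ((fwdDiff h)^[m] f) p torus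

/-- The Besov seminorm `|f|_{S, p, p', m}`. -/
def besovSeminorm (m : ℕ) (S : ℝ) (p p' : ℝ≥0∞) (f : ℝ → ℝ) : ℝ≥0∞ :=
  if p' = ∞ then
    essSup (fun t : ℝ => ENNReal.ofReal (t ^ (-S)) * modulus m p f t)
      (volume.restrict (Set.Ioi (0 : ℝ)))
  else
    (∫⁻ t in Set.Ioo (0 : ℝ) 1,
      (ENNReal.ofReal (t ^ (-S)) * modulus m p f t) ^ p'.toReal * ENNReal.ofReal (1 / t))
        ^ (1 / p'.toReal)

/-- The norm of the Besov space `B^{S,p'}_{p,0}(𝕋)`, through differences of order `m > S`. -/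
def besovNorm (m : ℕ) (S : ℝ) (p p' : ℝ≥0∞) (f : ℝ → ℝ) : ℝ≥0∞ :=
  eLpNorm f p torus + besovSeminorm m S p p' f

open Classical in
/-- The norm of the Sobolev space `W^{S,p}_0(𝕋)` of real order `S`: the norm `‖D^S f‖_{L^p}` if
`S` is an integer, and the norm of `B^{S,p}_{p,0}(𝕋)` otherwise. -/
def sobolevNorm (S : ℝ) (p : ℝ≥0∞) (f : ℝ → ℝ) : ℝ≥0∞ :=
  if (⌊S⌋₊ : ℝ) = S then weakDerivNorm ⌊S⌋₊ p f else besovNorm (⌊S⌋₊ + 1) S p p f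

/-- A system of cubes in dimension one: half-open intervals `[a, a + h) ⊆ [0, 1]`. -/
def IsIntervalSystem (B : Set (Set ℝ)) : Prop :=
  ∀ I ∈ B, ∃ a h : ℝ, 0 < h ∧ h ≤ 1 ∧ I = Set.Ico a (a + h) ∧ I ⊆ Set.Icc 0 1

/-- A regular system: it contains the `m`-partition system for some `m ≥ 2`.  (The interval
`[0, 1)`, of level `j = 0`, need not belong to the system.) -/
def IsRegular (B : Set (Set ℝ)) : Prop :=
  IsIntervalSystem B ∧
    ∃ m : ℕ, 2 ≤ m ∧ ∀ j : ℕ, 1 ≤ j → ∀ l : ℕ, l < m ^ j →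
      Set.Ico ((l : ℝ) / (m : ℝ) ^ j) (((l : ℝ) + 1) / (m : ℝ) ^ j) ∈ B

/-- The sampling operator on the grid `Γ_n = {0, 1/n, …, (n-1)/n}`. -/
def sample (n : ℕ) (f : ℝ → ℝ) : Fin n → ℝ := fun i => f ((i : ℝ) / n)

open Classical in
/-- The multiresolution norm of `y ∈ ℝ^{Γ_n}`; intervals that contain no grid point contribute
`0 / 0 = 0`. -/
def mrNorm (B : Set (Set ℝ)) (n : ℕ) (y : Fin n → ℝ) : ℝ :=
  ⨆ I : B, |∑ i ∈ Finset.univ.filter (fun i : Fin n => (i : ℝ) / n ∈ (I : Set ℝ)), y i| /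
    √((Finset.univ.filter fun i : Fin n => (i : ℝ) / n ∈ (I : Set ℝ)).card : ℝ)

/-- `g` is the estimator with smoothness order `k`, threshold `γ` and data `y`: it minimizes
`½ ‖D^k g‖²_{L²}` over all `g ∈ H^k_0(𝕋)` with `‖S_n g - y‖_B ≤ γ`. -/
def IsMIND (k : ℕ) (B : Set (Set ℝ)) (n : ℕ) (γ : ℝ) (y : Fin n → ℝ) (g : ℝ → ℝ) : Prop :=
  let feasible : Set (ℝ → ℝ) := {u | u ∈ sobolevHilbert₀ k ∧ mrNorm B n (sample n u - y) ≤ γ}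
  g ∈ feasible ∧ IsMinOn (fun u => (1 / 2 : ℝ≥0∞) * weakDerivNorm k 2 u ^ 2) feasible g

/-- The universal threshold `γ_n = C (log n)^r`. -/
def threshold (C r : ℝ) (n : ℕ) : ℝ := C * Real.log n ^ r

/-- The `L^q(𝕋)`-loss. -/
def loss (q : ℝ≥0∞) (g f : ℝ → ℝ) : ℝ≥0∞ := eLpNorm (g - f) q torus

/-- The exponent `ϑ = ϑ(k, 1, q)`; `(q⁻¹).toReal` is `1/q`, with `1/∞ = 0`. -/
def vartheta (k : ℕ) (q : ℝ≥0∞) : ℝ :=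
  if q ≤ 4 * (k : ℝ≥0∞) + 2 then (k : ℝ) / (2 * k + 1)
  else ((k : ℝ) - 1 / 2 + (q⁻¹).toReal) / (2 * k)

/-- The exponent `μ`. -/
def muExp (k : ℕ) (s : ℝ) (p : ℝ≥0∞) : ℝ :=
  (s - max ((p⁻¹).toReal - 1 / 2) 0) / (2 * s + 2 * k + 1 - 2 * max ((p⁻¹).toReal - 1 / 2) 0)

/-- For each `n`, the noise variables `ξ n i` are independent, identically distributed and
sub-Gaussian with scale parameter `σ` (hence centered). -/
structure IsNoise {Ω : Type*} [MeasurableSpace Ω] (P : Measure Ω) (σ : ℝ≥0)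
    (ξ : (n : ℕ) → Fin n → Ω → ℝ) : Prop where
  measurable : ∀ n i, Measurable (ξ n i)
  indep : ∀ n, iIndepFun (ξ n) P
  identDistrib : ∀ n i j, IdentDistrib (ξ n i) (ξ n j) P P
  subgaussian : ∀ n i, HasSubgaussianMGF (ξ n i) (σ ^ 2) P

/-- The random errors `X n` are `O(ρ n)` almost surely, as `n → ∞`. -/
def IsBigOAlmostSurely {Ω : Type*} [MeasurableSpace Ω] (P : Measure Ω)
    (X : ℕ → Ω → ℝ≥0∞) (ρ : ℕ → ℝ) : Prop :=
  ∃ C : ℝ, ∀ᵐ ω ∂P, ∀ᶠ n : ℕ in atTop, X n ω ≤ ENNReal.ofReal (C * ρ n)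

/-- The random errors `X n` are (measurable and) `O(ρ n)` in expectation, as `n → ∞`. -/
def IsBigOInExpectation {Ω : Type*} [MeasurableSpace Ω] (P : Measure Ω)
    (X : ℕ → Ω → ℝ≥0∞) (ρ : ℕ → ℝ) : Prop :=
  (∀ n : ℕ, 1 ≤ n → AEMeasurable (X n) P) ∧
    ∃ C : ℝ, ∀ᶠ n : ℕ in atTop, ∫⁻ ω, X n ω ∂P ≤ ENNReal.ofReal (C * ρ n)

/-- The `L^q`-error of the estimator `fhat` (a function of the data) for `n` noisy samples
`y_n = S_n f + ξ_n` of `f`. -/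
def error {Ω : Type*} (q : ℝ≥0∞) (fhat : (n : ℕ) → (Fin n → ℝ) → ℝ → ℝ)
    (ξ : (n : ℕ) → Fin n → Ω → ℝ) (f : ℝ → ℝ) (n : ℕ) (ω : Ω) : ℝ≥0∞ :=
  loss q (fhat n (sample n f + fun i => ξ n i ω)) f

/-- `n^{-μ(1-2ϑ)-ϑ} (log n)^{2rμ(1-2ϑ)+2rϑ}`. -/
def rate (k : ℕ) (s : ℝ) (p q : ℝ≥0∞) (r : ℝ) (n : ℕ) : ℝ :=
  (n : ℝ) ^ (-muExp k s p * (1 - 2 * vartheta k q) - vartheta k q) *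
    Real.log n ^ (2 * r * muExp k s p * (1 - 2 * vartheta k q) + 2 * r * vartheta k q)

/-- `n^{-(k+s)/(2k+2s+1)} (log n)^{r(2k+2s)/(2k+2s+1)}`. -/
def simpleRate (k : ℕ) (s r : ℝ) (n : ℕ) : ℝ :=
  (n : ℝ) ^ (-((k + s) / (2 * k + 2 * s + 1))) *
    Real.log n ^ ((2 * k + 2 * s) / (2 * k + 2 * s + 1) * r)

/-- The minimax `L^q`-risk over the class `F` for `n` observations with independent
`N(0, σ²)`-noise; the infimum is over all (jointly measurable) estimators. -/
def minimaxRisk (σ : ℝ≥0) (q : ℝ≥0∞) (n : ℕ) (F : Set (ℝ → ℝ)) : ℝ≥0∞ :=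
  ⨅ (T : (Fin n → ℝ) → ℝ → ℝ) (_ : Measurable (Function.uncurry T)),
    ⨆ f ∈ F, ∫⁻ z, loss q (T (sample n f + z)) f
      ∂(Measure.pi fun _ : Fin n => gaussianReal 0 (σ ^ 2))

end MIND

end

noncomputable section

namespace MIND

open scoped Topology ComplexConjugate

/-! ### Fourier series on the torus -/

/-! Put `δ = 2γ_n/√n` and `h = f - f̂`, where `f̂` is the estimator. As soon as the noise has
multiresolution norm at most `γ_n`, the truth `f` is feasible, and the sum of `h` over the grid
points of each partition cell is at most `2γ_n` times the root of their number (`CellBound`). On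
this event the argument is deterministic and has two halves.

Energy. `D^k f̂` is the point of least norm in a closed convex subset of `L²`, and the variational
inequality of the projection gives `‖D^k h‖² ≤ ⟨D^k f, D^k h⟩` (`sq_l2_sub_le`). The smoothness of
`f` enters only through the decay of its Fourier coefficients over the blocks `m^i ≤ |j| < m^{i+1}`
(`BlockBound`). For `p < 2`, Hölder's inequality against a trigonometric polynomial costs `1/p -
1/2` derivatives (`sum_sq_coeff_le`); below, `s` is already reduced by this loss. Above a cutoff
frequency `W` the pairing is at most a multiple of `W^{-s} ‖D^k h‖`, by Parseval. Below it, all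
derivatives are moved off `h`, the integral is replaced by a sum over the grid, and Abel summation
along the cells gives a multiple of `δ W^{k-s+1/2}` (`abs_lowFreq_pairing_le`). The best cutoff
yields `‖D^k h‖ ≲ δ^{s/(k+s+1/2)}` (`exists_l2_le`).

Interpolation. A continuous function with small cell sums takes small values in `k` separated
subcells of each cell; Taylor expansion and Lagrange interpolation then control it on the cell up to
its local energy (`abs_le_on_cell`). A stopping-time argument on the tree of cells
(`cellIntegral_pow_le_of_cells`) turns this into a bound in `L^{4k+2}`, and together with a uniform
bound into `‖h‖_q ≲ δ (E/δ)^{1-2ϑ}` whenever `E ≥ δ` bounds the energy norm and `n` is large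
compared with a power of `E/δ` (`exists_eLpNorm_le`). Inserting the energy estimate gives the rate.

Probability. Every interval meets the grid in consecutive points, so a union bound over about `n²`
sub-Gaussian sums bounds the probability of the bad event by a multiple of `n^{-(k+1/2+ε)}`.
Borel–Cantelli gives the almost sure statement. The estimator is Lipschitz in the data with a
constant of order `n^k`, so the bad event contributes only about `n^{-1/2}` to the expectation
(`exists_setLIntegral_noiseBad_le`), which never exceeds the rate.

Lower bound. Assouad's method is applied to about `n^{1/(2S+1)}` bumps with arbitrary signs, `S = k
+ s`, whose height is as large as the ball permits (`exists_le_minimaxRisk`). -/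

instance : IsProbabilityMeasure torus := ⟨by simp [torus]⟩

theorem integral_torus {E : Type*} [NormedAddCommGroup E] [NormedSpace ℝ E] (f : ℝ → E) :
    ∫ x, f x ∂torus = ∫ x in (0 : ℝ)..1, f x := by
  rw [torus, intervalIntegral.integral_of_le zero_le_one]

theorem integrable_torus_of_continuous {E : Type*} [NormedAddCommGroup E] {f : ℝ → E}
    (hf : Continuous f) : Integrable f torus :=
  (hf.intervalIntegrable 0 1).1

theorem memLp_torus_of_continuous {E : Type*} [NormedAddCommGroup E] {f : ℝ → E}
    (hf : Continuous f) (p : ℝ≥0∞) : MemLp f p torus := by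
  obtain ⟨C, hC⟩ := (isCompact_Icc (a := (0 : ℝ)) (b := 1)).exists_bound_of_continuousOn
    hf.continuousOn
  refine MemLp.of_bound (integrable_torus_of_continuous hf).aestronglyMeasurable C ?_
  refine (ae_restrict_iff' measurableSet_Ioc).2 (.of_forall fun x hx => hC x ⟨hx.1.le, hx.2⟩)

/-- The frequency `2πij`. -/
def freq (j : ℤ) : ℂ := 2 * Real.pi * Complex.I * j

/-- The character `x ↦ exp (2πijx)`. -/
def character (j : ℤ) (x : ℝ) : ℂ := Complex.exp (freq j * x)

theorem norm_freq (j : ℤ) : ‖freq j‖ = 2 * Real.pi * |(j : ℝ)| := by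
  simp [freq, abs_of_pos Real.pi_pos]

theorem freq_neg (j : ℤ) : freq (-j) = -freq j := by simp [freq]

theorem conj_freq (j : ℤ) : conj (freq j) = freq (-j) := by
  simp [freq, map_ofNat]

theorem freq_ne_zero {j : ℤ} (hj : j ≠ 0) : freq j ≠ 0 := by
  simp [freq, hj, Real.pi_ne_zero]

theorem norm_character (j : ℤ) (x : ℝ) : ‖character j x‖ = 1 := by
  rw [character, Complex.norm_exp]; simp [freq]

theorem conj_character (j : ℤ) (x : ℝ) : conj (character j x) = character (-j) x := by
  rw [character, character, ← Complex.exp_conj, map_mul, conj_freq, Complex.conj_ofReal]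

theorem character_add (j : ℤ) (x y : ℝ) :
    character j (x + y) = character j x * character j y := by
  simp [character, mul_add, Complex.exp_add]

theorem character_add_freq (i j : ℤ) (x : ℝ) :
    character (i + j) x = character i x * character j x := by
  simp [character, freq, mul_add, add_mul, Complex.exp_add]

theorem character_int (j : ℤ) (l : ℤ) : character j l = 1 := by
  rw [character, Complex.exp_eq_one_iff]
  exact ⟨j * l, by simp [freq]; ring⟩

theorem character_zero_freq (x : ℝ) : character 0 x = 1 := by simp [character, freq]

theorem character_periodic (j : ℤ) : Function.Periodic (character j) 1 := fun x => by
  have := character_int j 1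
  rw [character_add, show (1 : ℝ) = ((1 : ℤ) : ℝ) by simp, this, mul_one]

theorem hasDerivAt_character (j : ℤ) (x : ℝ) :
    HasDerivAt (character j) (freq j * character j x) x := by
  have h1 : HasDerivAt (fun y : ℝ => freq j * (y : ℂ)) (freq j) x := by
    simpa using (Complex.ofRealCLM.hasDerivAt (x := x)).const_mul (freq j)
  have := h1.cexp
  rwa [mul_comm] at this

theorem continuous_character (j : ℤ) : Continuous (character j) :=
  continuous_iff_continuousAt.2 fun x => (hasDerivAt_character j x).continuousAt

theorem contDiff_character (j : ℤ) : ContDiff ℝ (⊤ : ℕ∞) (character j) := by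
  unfold character
  exact (contDiff_const.mul Complex.ofRealCLM.contDiff).cexp

theorem fourier_eq_character (j : ℤ) (x : ℝ) :
    fourier j (x : AddCircle (1 : ℝ)) = character j x := by
  rw [fourier_coe_apply, character, freq]; simp

/-- The Fourier coefficients of a function on the torus. -/
def coeff (f : ℝ → ℝ) (j : ℤ) : ℂ := ∫ x, character (-j) x * f x ∂torus

theorem integrable_character_mul {f : ℝ → ℝ} (hf : Integrable f torus) (j : ℤ) :
    Integrable (fun x => character j x * (f x : ℂ)) torus := by
  refine hf.ofReal.bdd_mul (c := 1) (continuous_character j).aestronglyMeasurable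
    (.of_forall fun x => ?_)
  rw [norm_character]

theorem coeff_eq_fourierCoeffOn (f : ℝ → ℝ) (j : ℤ) :
    coeff f j = fourierCoeffOn (zero_lt_one' ℝ) (fun x => (f x : ℂ)) j := by
  rw [fourierCoeffOn_eq_integral, coeff, integral_torus]
  simp only [sub_zero, div_one, one_smul, smul_eq_mul]
  refine intervalIntegral.integral_congr fun x _ => ?_
  congr 1
  rw [fourier_coe_apply, character, freq]; simp

theorem coeff_neg_freq (f : ℝ → ℝ) (j : ℤ) : coeff f (-j) = conj (coeff f j) := by
  rw [coeff, coeff, ← integral_conj]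
  congr 1; ext x
  rw [map_mul, conj_character, Complex.conj_ofReal]

theorem norm_coeff_le {f : ℝ → ℝ} (j : ℤ) : ‖coeff f j‖ ≤ ∫ x, |f x| ∂torus := by
  refine (norm_integral_le_integral_norm _).trans (le_of_eq ?_)
  congr 1; ext x
  rw [norm_mul, norm_character, one_mul, Complex.norm_real, Real.norm_eq_abs]

theorem coeff_sub {f g : ℝ → ℝ} (hf : Integrable f torus) (hg : Integrable g torus) (j : ℤ) :
    coeff (f - g) j = coeff f j - coeff g j := by
  rw [coeff, coeff, coeff, ← integral_sub (integrable_character_mul hf _)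
    (integrable_character_mul hg _)]
  congr 1; ext x; simp; ring

theorem coeff_zero_of_mean {f : ℝ → ℝ} (hf : ∫ x, f x ∂torus = 0) : coeff f 0 = 0 := by
  rw [coeff]
  simp only [neg_zero, character_zero_freq, one_mul]
  rw [integral_complex_ofReal, hf, Complex.ofReal_zero]

/-- Parseval's identity. -/
theorem hasSum_sq_coeff {g : ℝ → ℝ} (hg : MemLp g 2 torus) :
    HasSum (fun j => ‖coeff g j‖ ^ 2) (∫ x, g x ^ 2 ∂torus) := by
  have h := hasSum_sq_fourierCoeffOn (f := fun x => (g x : ℂ)) (zero_lt_one' ℝ) hg.ofReal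
  simp only [← coeff_eq_fourierCoeffOn, sub_zero, inv_one, one_smul] at h
  rw [← integral_torus] at h
  convert h using 2
  simp

theorem hasSum_fourier {f : ℝ → ℝ} (hf : Continuous f) (hper : Function.Periodic f 1)
    (hs : Summable fun j => ‖coeff f j‖) (x : ℝ) :
    HasSum (fun j => coeff f j * character j x) (f x) := by
  have : Fact ((0 : ℝ) < 1) := ⟨one_pos⟩
  let F : C(AddCircle (1 : ℝ), ℂ) :=
    ⟨fun y => (hper.lift y : ℂ), Complex.continuous_ofReal.comp (continuous_coinduced_dom.2 hf)⟩
  have hF : ∀ j, fourierCoeff F j = coeff f j := fun j => by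
    rw [fourierCoeff_eq_intervalIntegral _ _ 0, coeff, integral_torus]
    simp only [zero_add, div_one, one_smul, smul_eq_mul]
    refine intervalIntegral.integral_congr fun x _ => ?_
    simp only [fourier_eq_character]
    simp [F]
  have h := has_pointwise_sum_fourier_series_of_summable (f := F)
    (by simp only [funext hF]; exact hs.of_norm) (x : AddCircle (1 : ℝ))
  simp only [hF, smul_eq_mul, fourier_eq_character] at h
  simpa [F] using h

/-- Real trigonometric polynomials. -/
def trigPoly (F : Finset ℤ) (c : ℤ → ℂ) (x : ℝ) : ℝ := (∑ j ∈ F, c j * character j x).re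

theorem contDiff_trigPoly (F : Finset ℤ) (c : ℤ → ℂ) : ContDiff ℝ (⊤ : ℕ∞) (trigPoly F c) := by
  unfold trigPoly
  exact Complex.reCLM.contDiff.comp
    (ContDiff.sum fun j _ => contDiff_const.mul (contDiff_character j))

theorem trigPoly_periodic (F : Finset ℤ) (c : ℤ → ℂ) : Function.Periodic (trigPoly F c) 1 :=
  fun x => by simp only [trigPoly, character_periodic _ x]

theorem deriv_trigPoly (F : Finset ℤ) (c : ℤ → ℂ) :
    deriv (trigPoly F c) = trigPoly F fun j => freq j * c j := by
  ext x
  have h1 : HasDerivAt (fun x : ℝ => ∑ j ∈ F, c j * character j x)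
      (∑ j ∈ F, c j * (freq j * character j x)) x :=
    HasDerivAt.fun_sum fun j _ => (hasDerivAt_character j x).const_mul (c j)
  have h2 := (Complex.reCLM.hasFDerivAt.comp_hasDerivAt x h1).deriv
  have h3 : (⇑Complex.reCLM ∘ fun x : ℝ => ∑ j ∈ F, c j * character j x) = trigPoly F c := by
    ext y; simp [trigPoly]
  rw [h3] at h2
  rw [h2, trigPoly, Complex.reCLM_apply]
  congr 1
  exact Finset.sum_congr rfl fun j _ => by ring

theorem iteratedDeriv_trigPoly (F : Finset ℤ) (c : ℤ → ℂ) (k : ℕ) :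
    iteratedDeriv k (trigPoly F c) = trigPoly F fun j => freq j ^ k * c j := by
  induction k with
  | zero => simp
  | succ k ih =>
    rw [iteratedDeriv_succ, ih, deriv_trigPoly]
    congr 1; ext j; ring

theorem abs_trigPoly_le (F : Finset ℤ) (c : ℤ → ℂ) (x : ℝ) :
    |trigPoly F c x| ≤ ∑ j ∈ F, ‖c j‖ := by
  refine (Complex.abs_re_le_norm _).trans ((norm_sum_le _ _).trans (le_of_eq ?_))
  exact Finset.sum_congr rfl fun j _ => by rw [norm_mul, norm_character, mul_one]

/-- Symmetric sets of frequencies and hermitian coefficients. -/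
structure IsHermitian (F : Finset ℤ) (c : ℤ → ℂ) : Prop where
  neg_mem : ∀ j ∈ F, -j ∈ F
  conj_apply : ∀ j, c (-j) = conj (c j)

/-- Exchanging `j` and `-j` shows that the complex sum is its own conjugate, so nothing is lost in
the real part that defines `trigPoly`. -/
theorem IsHermitian.ofReal_trigPoly {F : Finset ℤ} {c : ℤ → ℂ} (h : IsHermitian F c) (x : ℝ) :
    (trigPoly F c x : ℂ) = ∑ j ∈ F, c j * character j x := by
  rw [trigPoly, ← Complex.conj_eq_iff_re, map_sum]
  refine Finset.sum_nbij' (fun j => -j) (fun j => -j) h.neg_mem h.neg_mem (by simp) (by simp) ?_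
  intro j _
  rw [map_mul, conj_character, h.conj_apply]

theorem integral_character (j : ℤ) : ∫ x, character j x ∂torus = if j = 0 then 1 else 0 := by
  split_ifs with h
  · subst h; simp [character_zero_freq]
  · rw [integral_torus]
    have h0 := freq_ne_zero h
    have := intervalIntegral.integral_eq_sub_of_hasDerivAt (a := 0) (b := 1)
      (f := fun x => (freq j)⁻¹ * character j x) (f' := character j)
      (fun x _ => by
        have := (hasDerivAt_character j x).const_mul (freq j)⁻¹
        rwa [inv_mul_cancel_left₀ h0] at this)
      ((continuous_character j).intervalIntegrable _ _)
    rw [this]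
    have h1 := character_int j 1
    have h2 := character_int j 0
    simp only [Int.cast_one, Int.cast_zero] at h1 h2
    rw [h1, h2, sub_self]

theorem IsHermitian.coeff_trigPoly {F : Finset ℤ} {c : ℤ → ℂ} (h : IsHermitian F c) (j : ℤ) :
    coeff (trigPoly F c) j = if j ∈ F then c j else 0 := by
  have : ∀ x, character (-j) x * (trigPoly F c x : ℂ) =
      ∑ i ∈ F, c i * character (i - j) x := fun x => by
    rw [h.ofReal_trigPoly, Finset.mul_sum]
    refine Finset.sum_congr rfl fun i _ => ?_
    rw [sub_eq_add_neg, character_add_freq]; ring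
  rw [coeff, integral_congr_ae (.of_forall this), integral_finsetSum]
  · simp only [integral_const_mul, integral_character, sub_eq_zero]
    simp
  · exact fun i _ => (integrable_torus_of_continuous (continuous_character _)).const_mul _

theorem isHermitian_coeff {F : Finset ℤ} (hF : ∀ j ∈ F, -j ∈ F) (f : ℝ → ℝ) :
    IsHermitian F (coeff f) := ⟨hF, coeff_neg_freq f⟩

theorem IsHermitian.freq_pow_mul {F : Finset ℤ} {c : ℤ → ℂ} (h : IsHermitian F c) (k : ℕ) :
    IsHermitian F fun j => freq j ^ k * c j :=
  ⟨h.neg_mem, fun j => by rw [h.conj_apply, map_mul, map_pow, conj_freq]⟩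

theorem IsHermitian.integral_sq {F : Finset ℤ} {c : ℤ → ℂ} (h : IsHermitian F c) :
    ∫ x, trigPoly F c x ^ 2 ∂torus = ∑ j ∈ F, ‖c j‖ ^ 2 := by
  have h1 := hasSum_sq_coeff
    (memLp_torus_of_continuous (contDiff_trigPoly F c).continuous 2)
  refine h1.unique ?_
  have h2 := hasSum_sum_of_ne_finset_zero (f := fun j => ‖MIND.coeff (trigPoly F c) j‖ ^ 2)
    (s := F) (L := .unconditional ℤ) (fun j hj => by rw [h.coeff_trigPoly, if_neg hj]; simp)
  convert h2 using 1
  exact Finset.sum_congr rfl fun j hj => by rw [h.coeff_trigPoly, if_pos hj]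

/-! ### Weak derivatives -/

/-- The `L²`-norm on the torus. -/
def l2 (g : ℝ → ℝ) : ℝ := √(∫ x, g x ^ 2 ∂torus)

theorem l2_nonneg (g : ℝ → ℝ) : 0 ≤ l2 g := Real.sqrt_nonneg _

theorem sq_l2 (g : ℝ → ℝ) : l2 g ^ 2 = ∫ x, g x ^ 2 ∂torus :=
  Real.sq_sqrt (integral_nonneg fun _ => sq_nonneg _)

theorem integrable_mul_of_memLp_two {α : Type*} [MeasurableSpace α] {μ : Measure α} {u v : α → ℝ}
    (hu : MemLp u 2 μ) (hv : MemLp v 2 μ) : Integrable (fun x => u x * v x) μ :=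
  hu.integrable_mul hv

theorem abs_integral_mul_le {α : Type*} [MeasurableSpace α] {μ : Measure α} {u v : α → ℝ}
    (hu : MemLp u 2 μ) (hv : MemLp v 2 μ) :
    |∫ x, u x * v x ∂μ| ≤ √(∫ x, u x ^ 2 ∂μ) * √(∫ x, v x ^ 2 ∂μ) := by
  have h := integral_mul_norm_le_Lp_mul_Lq (μ := μ) (f := u) (g := v) (p := 2) (q := 2)
    (by norm_num [Real.holderConjugate_iff]) (by simpa using hu) (by simpa using hv)
  rw [Real.sqrt_eq_rpow, Real.sqrt_eq_rpow]
  simp only [Real.norm_eq_abs, Real.rpow_ofNat, sq_abs] at h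
  refine le_trans (abs_integral_le_integral_abs) (le_trans (le_of_eq ?_) h)
  simp [abs_mul]

theorem abs_integral_mul_le_l2 {u v : ℝ → ℝ} (hu : MemLp u 2 torus) (hv : MemLp v 2 torus) :
    |∫ x, u x * v x ∂torus| ≤ l2 u * l2 v := abs_integral_mul_le hu hv

theorem eLpNorm_two_eq_l2 {g : ℝ → ℝ} (hg : MemLp g 2 torus) :
    eLpNorm g 2 torus = ENNReal.ofReal (l2 g) := by
  rw [hg.eLpNorm_eq_integral_rpow_norm (by simp) (by simp), l2, Real.sqrt_eq_rpow]
  simp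

theorem integral_abs_le_l2 {g : ℝ → ℝ} (hg : MemLp g 2 torus) : ∫ x, |g x| ∂torus ≤ l2 g := by
  have h := abs_integral_mul_le_l2 hg.abs (memLp_const (1 : ℝ))
  have h1 : l2 (fun _ => 1) = 1 := by simp [l2]
  have h2 : l2 |g| = l2 g := by simp [l2]
  rw [h1, h2] at h
  simpa using (le_abs_self _).trans h

theorem l2_le_of_abs_le {g : ℝ → ℝ} {C : ℝ} (hC : 0 ≤ C)
    (h : ∀ᵐ x ∂torus, |g x| ≤ C) : l2 g ≤ C := by
  rw [l2]
  refine Real.sqrt_le_iff.2 ⟨hC, ?_⟩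
  by_cases hi : Integrable (fun x => g x ^ 2) torus
  · have := integral_mono_ae hi (integrable_const (C ^ 2)) (h.mono fun x hx => by
      simpa using pow_le_pow_left₀ (abs_nonneg _) hx 2)
    simpa using this
  · rw [integral_undef hi]; positivity

theorem periodic_iteratedDeriv {u : ℝ → ℝ} (hu : Function.Periodic u 1) (k : ℕ) :
    Function.Periodic (iteratedDeriv k u) 1 := fun x => by
  have := congrFun (iteratedDeriv_comp_add_const k u 1) x
  rw [show (fun z => u (z + 1)) = u from funext hu] at this
  exact this.symm

theorem contDiff_iteratedDeriv {u : ℝ → ℝ} (hu : ContDiff ℝ (⊤ : ℕ∞) u) (k : ℕ) :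
    ContDiff ℝ (⊤ : ℕ∞) (iteratedDeriv k u) := by
  induction k with
  | zero => simpa
  | succ k ih =>
    rw [iteratedDeriv_succ]
    exact (contDiff_infty_iff_deriv.1 ih).2

theorem hasDerivAt_iteratedDeriv {u : ℝ → ℝ} (hu : ContDiff ℝ (⊤ : ℕ∞) u) (k : ℕ) (x : ℝ) :
    HasDerivAt (iteratedDeriv k u) (iteratedDeriv (k + 1) u x) x := by
  rw [iteratedDeriv_succ]
  exact ((contDiff_iteratedDeriv hu k).differentiable (by simp)).differentiableAt.hasDerivAt

theorem integral_mul_deriv_torus {u v u' v' : ℝ → ℝ} (hu : ∀ x, HasDerivAt u (u' x) x)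
    (hv : ∀ x, HasDerivAt v (v' x) x) (hu' : Continuous u') (hv' : Continuous v')
    (pu : Function.Periodic u 1) (pv : Function.Periodic v 1) :
    ∫ x, u x * v' x ∂torus = -∫ x, u' x * v x ∂torus := by
  rw [integral_torus, integral_torus, intervalIntegral.integral_mul_deriv_eq_deriv_mul
    (fun x _ => hu x) (fun x _ => hv x) (hu'.intervalIntegrable _ _) (hv'.intervalIntegrable _ _)]
  have h1 := pu 0
  have h2 := pv 0
  rw [zero_add] at h1 h2
  rw [h1, h2]; ring

theorem integral_mul_iteratedDeriv {u v : ℝ → ℝ} (hu : ContDiff ℝ (⊤ : ℕ∞) u)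
    (hv : ContDiff ℝ (⊤ : ℕ∞) v) (pu : Function.Periodic u 1) (pv : Function.Periodic v 1)
    (k : ℕ) :
    ∫ x, u x * iteratedDeriv k v x ∂torus = (-1) ^ k * ∫ x, iteratedDeriv k u x * v x ∂torus := by
  induction k generalizing u with
  | zero => simp
  | succ k ih =>
    rw [integral_mul_deriv_torus (fun x => by simpa using hasDerivAt_iteratedDeriv hu 0 x)
      (hasDerivAt_iteratedDeriv hv k) (contDiff_iteratedDeriv hu 1).continuous
      (contDiff_iteratedDeriv hv _).continuous pu (periodic_iteratedDeriv pv k),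
      ih (contDiff_iteratedDeriv hu 1) (periodic_iteratedDeriv pu 1)]
    simp only [iteratedDeriv_one, ← iteratedDeriv_succ']
    ring

theorem isWeakDeriv_iteratedDeriv {u : ℝ → ℝ} (hu : ContDiff ℝ (⊤ : ℕ∞) u)
    (pu : Function.Periodic u 1) (k : ℕ) : IsWeakDeriv k u (iteratedDeriv k u) :=
  ⟨integrable_torus_of_continuous (contDiff_iteratedDeriv hu k).continuous,
    fun _ hφ pφ => integral_mul_iteratedDeriv hu hφ pu pφ k⟩

theorem IsWeakDeriv.sub {k : ℕ} {f₁ f₂ g₁ g₂ : ℝ → ℝ} (h₁ : IsWeakDeriv k f₁ g₁)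
    (h₂ : IsWeakDeriv k f₂ g₂) (c₁ : Continuous f₁) (c₂ : Continuous f₂) :
    IsWeakDeriv k (f₁ - f₂) (g₁ - g₂) := by
  refine ⟨h₁.1.sub h₂.1, fun φ hφ pφ => ?_⟩
  have hc := (contDiff_iteratedDeriv hφ k).continuous
  have hb : ∀ g : ℝ → ℝ, Integrable g torus → Integrable (fun x => g x * φ x) torus :=
    fun g hg => by
      obtain ⟨C, hC⟩ := (isCompact_Icc (a := (0 : ℝ)) (b := 1)).exists_bound_of_continuousOn
        hφ.continuous.continuousOn
      refine hg.mul_bdd (c := C) hφ.continuous.aestronglyMeasurable ?_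
      exact (ae_restrict_iff' measurableSet_Ioc).2 (.of_forall fun x hx => hC x ⟨hx.1.le, hx.2⟩)
  simp only [Pi.sub_apply, sub_mul]
  rw [integral_sub
    (integrable_torus_of_continuous (f := fun x => f₁ x * iteratedDeriv k φ x) (c₁.mul hc))
    (integrable_torus_of_continuous (f := fun x => f₂ x * iteratedDeriv k φ x) (c₂.mul hc)), integral_sub (hb _ h₁.1) (hb _ h₂.1),
    h₁.2 φ hφ pφ, h₂.2 φ hφ pφ]
  ring

/-- Test functions are real, so Fourier coefficients are read off weak identities through the real
part of a single mode with a free complex factor `c`. -/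
theorem integral_trigPoly_singleton_mul {f : ℝ → ℝ} (hf : Integrable f torus) (c : ℂ) (j : ℤ) :
    ∫ x, f x * trigPoly {-j} (fun _ => c) x ∂torus = (c * coeff f j).re := by
  have h := (integrable_character_mul hf (-j)).const_mul c
  rw [coeff, ← integral_const_mul, ← RCLike.re_eq_complex_re, ← integral_re h]
  congr 1; ext x
  rw [trigPoly, Finset.sum_singleton, RCLike.re_eq_complex_re, ← mul_assoc, Complex.re_mul_ofReal,
    mul_comm]

/-- The Fourier coefficients of a weak derivative. -/
theorem IsWeakDeriv.coeff_eq {k : ℕ} {f g : ℝ → ℝ} (h : IsWeakDeriv k f g)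
    (hf : Integrable f torus) (j : ℤ) : coeff g j = freq j ^ k * coeff f j := by
  -- The real parts for all `c` determine a complex number: `c = 1` gives its real part and `c = -I`
  -- its imaginary part.
  have key : ∀ c : ℂ, (c * (freq j ^ k * coeff f j)).re = (c * coeff g j).re := fun c => by
    have h1 := h.2 _ (contDiff_trigPoly {-j} fun _ => c) (trigPoly_periodic _ _)
    rw [iteratedDeriv_trigPoly, integral_trigPoly_singleton_mul h.1] at h1
    have h2 : trigPoly {-j} (fun i => freq i ^ k * c) = trigPoly {-j} fun _ => freq (-j) ^ k * c := by
      ext x; simp [trigPoly]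
    rw [h2, integral_trigPoly_singleton_mul hf, freq_neg, neg_pow] at h1
    have h3 : ((-1 : ℂ) ^ k * freq j ^ k * c * coeff f j) =
        (((-1 : ℝ) ^ k : ℝ) : ℂ) * (c * (freq j ^ k * coeff f j)) := by
      push_cast; ring
    rw [h3, Complex.re_ofReal_mul] at h1
    exact mul_left_cancel₀ (pow_ne_zero k (by norm_num)) h1
  apply Complex.ext
  · simpa using (key 1).symm
  · have := key (-Complex.I)
    simpa [mul_assoc] using this.symm

/-- `g` is a square integrable weak derivative of order `k` of `f`. -/
structure HasSobolevDeriv (k : ℕ) (f g : ℝ → ℝ) : Prop where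
  cont : IsCont₀ f
  weak : IsWeakDeriv k f g
  memLp : MemLp g 2 torus

theorem IsCont₀.integrable {f : ℝ → ℝ} (h : IsCont₀ f) : Integrable f torus :=
  integrable_torus_of_continuous h.continuous

theorem IsCont₀.sub {f g : ℝ → ℝ} (hf : IsCont₀ f) (hg : IsCont₀ g) : IsCont₀ (f - g) where
  continuous := hf.continuous.sub hg.continuous
  periodic := fun x => by simp [hf.periodic x, hg.periodic x]
  mean_zero := by
    simp only [Pi.sub_apply]
    rw [integral_sub hf.integrable hg.integrable, hf.mean_zero, hg.mean_zero, sub_zero]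

theorem IsCont₀.smul {f : ℝ → ℝ} (hf : IsCont₀ f) (c : ℝ) : IsCont₀ (c • f) where
  continuous := hf.continuous.const_smul c
  periodic := fun x => by simp [hf.periodic x]
  mean_zero := by
    simp only [Pi.smul_apply, smul_eq_mul]
    rw [integral_const_mul, hf.mean_zero, mul_zero]

theorem IsCont₀.zero : IsCont₀ 0 where
  continuous := continuous_zero
  periodic := fun _ => rfl
  mean_zero := by simp

theorem IsWeakDeriv.smul {k : ℕ} {f g : ℝ → ℝ} (h : IsWeakDeriv k f g) (c : ℝ) :
    IsWeakDeriv k (c • f) (c • g) := by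
  refine ⟨h.1.smul c, fun φ hφ pφ => ?_⟩
  simp only [Pi.smul_apply, smul_eq_mul, mul_assoc]
  rw [integral_const_mul, integral_const_mul, h.2 φ hφ pφ]
  ring

theorem HasSobolevDeriv.sub {k : ℕ} {f₁ f₂ g₁ g₂ : ℝ → ℝ} (h₁ : HasSobolevDeriv k f₁ g₁)
    (h₂ : HasSobolevDeriv k f₂ g₂) : HasSobolevDeriv k (f₁ - f₂) (g₁ - g₂) :=
  ⟨h₁.cont.sub h₂.cont, h₁.weak.sub h₂.weak h₁.cont.continuous h₂.cont.continuous,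
    h₁.memLp.sub h₂.memLp⟩

theorem HasSobolevDeriv.smul {k : ℕ} {f g : ℝ → ℝ} (h : HasSobolevDeriv k f g) (c : ℝ) :
    HasSobolevDeriv k (c • f) (c • g) :=
  ⟨h.cont.smul c, h.weak.smul c, h.memLp.const_smul c⟩

theorem HasSobolevDeriv.add {k : ℕ} {f₁ f₂ g₁ g₂ : ℝ → ℝ} (h₁ : HasSobolevDeriv k f₁ g₁)
    (h₂ : HasSobolevDeriv k f₂ g₂) : HasSobolevDeriv k (f₁ + f₂) (g₁ + g₂) := by
  have := h₁.sub (h₂.smul (-1))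
  simpa [sub_eq_add_neg] using this

theorem HasSobolevDeriv.of_contDiff {u : ℝ → ℝ} (hu : ContDiff ℝ (⊤ : ℕ∞) u) (h : IsCont₀ u)
    (k : ℕ) : HasSobolevDeriv k u (iteratedDeriv k u) :=
  ⟨h, isWeakDeriv_iteratedDeriv hu h.periodic k,
    memLp_torus_of_continuous (contDiff_iteratedDeriv hu k).continuous 2⟩

theorem HasSobolevDeriv.coeff_eq {k : ℕ} {f g : ℝ → ℝ} (h : HasSobolevDeriv k f g) (j : ℤ) :
    coeff g j = freq j ^ k * coeff f j := h.weak.coeff_eq h.cont.integrable j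

/-- The constant of the Poincaré inequality. -/
def poincareConst : ℝ := √(∑' j : ℤ, (1 / (2 * Real.pi * |(j : ℝ)|)) ^ 2)

theorem summable_freq_inv_sq : Summable fun j : ℤ => (1 / (2 * Real.pi * |(j : ℝ)|)) ^ 2 := by
  have h := (Real.summable_one_div_int_pow (p := 2)).2 one_lt_two
  refine (h.mul_left ((1 / (2 * Real.pi)) ^ 2)).congr fun j => ?_
  simp only [div_pow, mul_pow, sq_abs]; field_simp

theorem HasSobolevDeriv.norm_coeff_le {k : ℕ} (hk : 1 ≤ k) {f g : ℝ → ℝ}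
    (h : HasSobolevDeriv k f g) (j : ℤ) :
    ‖coeff f j‖ ≤ 1 / (2 * Real.pi * |(j : ℝ)|) * ‖coeff g j‖ := by
  by_cases hj : j = 0
  -- At `j = 0` the factor `1 / 0` is zero by convention, and the coefficient vanishes because the
  -- mean does.
  · subst hj; simp [coeff_zero_of_mean h.cont.mean_zero]
  · have h1 : (1 : ℝ) ≤ |(j : ℝ)| := by exact_mod_cast Int.one_le_abs hj
    have h2 : 1 ≤ 2 * Real.pi * |(j : ℝ)| := by nlinarith [Real.pi_gt_three]
    rw [h.coeff_eq, norm_mul, norm_pow, norm_freq, one_div, ← mul_assoc, ← div_eq_inv_mul]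
    refine le_mul_of_one_le_left (norm_nonneg _) ?_
    rw [one_le_div (by linarith)]
    exact le_self_pow₀ h2 (by omega)

/-- Cauchy–Schwarz against the square summable weights `1/(2π|j|)`. Absolute summability of the
coefficients is what turns `L²`-control of a derivative into uniform control of the function. -/
theorem HasSobolevDeriv.summable_coeff {k : ℕ} (hk : 1 ≤ k) {f g : ℝ → ℝ}
    (h : HasSobolevDeriv k f g) :
    (Summable fun j => ‖coeff f j‖) ∧ ∑' j, ‖coeff f j‖ ≤ poincareConst * l2 g := by
  have h1 := Real.summable_and_inner_le_Lp_mul_Lq_tsum_of_nonneg (p := 2) (q := 2)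
    (f := fun j : ℤ => 1 / (2 * Real.pi * |(j : ℝ)|)) (g := fun j => ‖coeff g j‖)
    (by norm_num [Real.holderConjugate_iff]) (fun j => by positivity) (fun j => by positivity)
    (by simpa using summable_freq_inv_sq) (by simpa using (hasSum_sq_coeff h.memLp).summable)
  have h2 := (hasSum_sq_coeff h.memLp).tsum_eq
  simp only [Real.rpow_ofNat, h2, ← Real.sqrt_eq_rpow] at h1
  have h3 := Summable.of_nonneg_of_le (fun j => norm_nonneg _) (h.norm_coeff_le hk) h1.1
  exact ⟨h3, (h3.tsum_le_tsum (h.norm_coeff_le hk) h1.1).trans h1.2⟩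

/-- The Poincaré inequality. -/
theorem HasSobolevDeriv.abs_le {k : ℕ} (hk : 1 ≤ k) {f g : ℝ → ℝ}
    (h : HasSobolevDeriv k f g) (x : ℝ) : |f x| ≤ poincareConst * l2 g := by
  obtain ⟨h1, h2⟩ := h.summable_coeff hk
  have h3 := hasSum_fourier h.cont.continuous h.cont.periodic h1 x
  have h4 := norm_tsum_le_tsum_norm (f := fun j => coeff f j * character j x)
    (by simpa [norm_character] using h1)
  rw [h3.tsum_eq] at h4
  simp only [norm_mul, norm_character, mul_one, Complex.norm_real, Real.norm_eq_abs] at h4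
  exact h4.trans h2

theorem l2_congr {g₁ g₂ : ℝ → ℝ} (h : g₁ =ᵐ[torus] g₂) : l2 g₁ = l2 g₂ := by
  rw [l2, l2, integral_congr_ae (g := fun x => g₂ x ^ 2) (h.mono fun x hx => by simp [hx])]

/-- The Poincaré inequality for the difference: on functions of mean zero, `D^k` is injective. -/
theorem HasSobolevDeriv.eq_of_ae {k : ℕ} (hk : 1 ≤ k) {f₁ f₂ g₁ g₂ : ℝ → ℝ}
    (h₁ : HasSobolevDeriv k f₁ g₁) (h₂ : HasSobolevDeriv k f₂ g₂) (h : g₁ =ᵐ[torus] g₂) :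
    f₁ = f₂ := by
  ext x
  have h1 := (h₁.sub h₂).abs_le hk x
  have h2 : l2 (g₁ - g₂) = 0 := by
    rw [l2_congr (g₂ := 0) (h.mono fun x hx => by simp [hx])]; simp [l2]
  rw [h2, mul_zero] at h1
  simpa [sub_eq_zero] using h1

/-- The difference is a weak derivative of zero, so its Fourier coefficients vanish and Parseval's
identity finishes. -/
theorem HasSobolevDeriv.ae_eq {k : ℕ} {f g₁ g₂ : ℝ → ℝ}
    (h₁ : HasSobolevDeriv k f g₁) (h₂ : HasSobolevDeriv k f g₂) : g₁ =ᵐ[torus] g₂ := by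
  have h := h₁.sub h₂
  have h1 := hasSum_sq_coeff h.memLp
  have h2 : ∀ j, coeff (g₁ - g₂) j = 0 := fun j => by
    rw [h.coeff_eq]; simp [coeff]
  simp only [h2, norm_zero, ne_eq, OfNat.ofNat_ne_zero, not_false_eq_true, zero_pow] at h1
  have h3 := h1.unique hasSum_zero
  rw [integral_eq_zero_iff_of_nonneg (fun _ => sq_nonneg _) h.memLp.integrable_sq] at h3
  filter_upwards [h3] with x hx
  simpa [sub_eq_zero] using hx

theorem HasSobolevDeriv.weakDerivNorm_eq {k : ℕ} {f g : ℝ → ℝ} (h : HasSobolevDeriv k f g) :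
    weakDerivNorm k 2 f = ENNReal.ofReal (l2 g) := by
  refine le_antisymm ((iInf₂_le g h.weak).trans (eLpNorm_two_eq_l2 h.memLp).le) ?_
  refine le_iInf₂ fun g' hg' => ?_
  by_cases h2 : eLpNorm g' 2 torus < ⊤
  · have h3 : HasSobolevDeriv k f g' := ⟨h.cont, hg', hg'.1.aestronglyMeasurable, h2⟩
    rw [eLpNorm_two_eq_l2 h3.memLp, l2_congr (h.ae_eq h3)]
  · simp [not_lt_top_iff.1 h2]

theorem mem_sobolevHilbert₀_iff {k : ℕ} {f : ℝ → ℝ} :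
    f ∈ sobolevHilbert₀ k ↔ ∃ g, HasSobolevDeriv k f g := by
  constructor
  · rintro ⟨h1, h2⟩
    obtain ⟨g, hg⟩ := iInf_lt_iff.1 h2
    obtain ⟨hg1, hg2⟩ := iInf_lt_iff.1 hg
    exact ⟨g, h1, hg1, hg1.1.aestronglyMeasurable, hg2⟩
  · rintro ⟨g, hg⟩
    exact ⟨hg.cont, by rw [hg.weakDerivNorm_eq]; exact ENNReal.ofReal_lt_top⟩

/-- The Fourier partial sum over a set of frequencies. -/
def partialSum (F : Finset ℤ) (f : ℝ → ℝ) : ℝ → ℝ := trigPoly F (coeff f)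

theorem isCont₀_partialSum {F : Finset ℤ} (hF : ∀ j ∈ F, -j ∈ F) {f : ℝ → ℝ} (hf : IsCont₀ f) :
    IsCont₀ (partialSum F f) where
  continuous := (contDiff_trigPoly _ _).continuous
  periodic := trigPoly_periodic _ _
  mean_zero := by
    have h := (isHermitian_coeff hF f).coeff_trigPoly 0
    rw [coeff_zero_of_mean hf.mean_zero, ite_self, coeff] at h
    simp only [neg_zero, character_zero_freq, one_mul] at h
    rw [integral_complex_ofReal] at h
    exact_mod_cast h

theorem sq_l2_sub_partialSum {k : ℕ} {f g : ℝ → ℝ} (h : HasSobolevDeriv k f g)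
    {F : Finset ℤ} (hF : ∀ j ∈ F, -j ∈ F) :
    l2 (g - iteratedDeriv k (partialSum F f)) ^ 2 = l2 g ^ 2 - ∑ j ∈ F, ‖coeff g j‖ ^ 2 := by
  have hc := HasSobolevDeriv.of_contDiff (contDiff_trigPoly F (coeff f))
    (isCont₀_partialSum hF h.cont) k
  have h1 := hasSum_sq_coeff (h.memLp.sub hc.memLp)
  rw [sq_l2, sq_l2]
  refine h1.unique ?_
  have h2 := (hasSum_sq_coeff h.memLp).sub
    (hasSum_sum_of_ne_finset_zero (f := fun j => if j ∈ F then ‖coeff g j‖ ^ 2 else 0)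
      (s := F) (L := .unconditional ℤ) (fun j hj => by simp [hj]))
  rw [Finset.sum_ite_mem, Finset.inter_self] at h2
  have h3 : (fun j => ‖coeff (g - iteratedDeriv k (trigPoly F (coeff f))) j‖ ^ 2) =
      fun j => ‖coeff g j‖ ^ 2 - if j ∈ F then ‖coeff g j‖ ^ 2 else 0 := funext fun j => by
    rw [coeff_sub h.weak.1 hc.weak.1, h.coeff_eq, hc.coeff_eq,
      (isHermitian_coeff hF f).coeff_trigPoly]
    split_ifs <;> simp
  rw [h3]
  exact h2

/-- The symmetric range of frequencies `-N, …, N`. -/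
def freqRange (N : ℕ) : Finset ℤ := Finset.Icc (-(N : ℤ)) N

theorem neg_mem_freqRange (N : ℕ) : ∀ j ∈ freqRange N, -j ∈ freqRange N := by
  intro j hj
  simp only [freqRange, Finset.mem_Icc] at hj ⊢
  omega

theorem tendsto_l2_sub_partialSum {k : ℕ} {f g : ℝ → ℝ} (h : HasSobolevDeriv k f g) :
    Tendsto (fun N => l2 (g - iteratedDeriv k (partialSum (freqRange N) f))) atTop (𝓝 0) := by
  have h1 : Tendsto freqRange atTop atTop := by
    refine tendsto_atTop_finset_of_monotone (fun a b hab => ?_) fun j => ⟨j.natAbs, ?_⟩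
    · exact Finset.Icc_subset_Icc (by omega) (by omega)
    · simp only [freqRange, Finset.mem_Icc]; omega
  have h2 := (hasSum_sq_coeff h.memLp).comp h1
  have h3 := h2.const_sub (l2 g ^ 2)
  rw [← sq_l2, sub_self] at h3
  have h4 := (Real.continuous_sqrt.tendsto 0).comp h3
  rw [Real.sqrt_zero] at h4
  refine h4.congr fun N => ?_
  simp only [Function.comp]
  rw [← sq_l2_sub_partialSum h (neg_mem_freqRange N), Real.sqrt_sq (l2_nonneg _)]

/-- Weak derivatives are stable under limits in `L²`. -/
theorem IsWeakDeriv.of_tendsto {k : ℕ} {f g : ℝ → ℝ} {u v : ℕ → ℝ → ℝ}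
    (h : ∀ N, IsWeakDeriv k (u N) (v N)) (hu : ∀ N, MemLp (u N) 2 torus)
    (hv : ∀ N, MemLp (v N) 2 torus) (hf : MemLp f 2 torus) (hg : MemLp g 2 torus)
    (huf : Tendsto (fun N => l2 (f - u N)) atTop (𝓝 0))
    (hvg : Tendsto (fun N => l2 (g - v N)) atTop (𝓝 0)) : IsWeakDeriv k f g := by
  refine ⟨hg.integrable one_le_two, fun φ hφ pφ => ?_⟩
  have lim : ∀ (F : ℝ → ℝ) (w : ℕ → ℝ → ℝ) (ψ : ℝ → ℝ), MemLp F 2 torus →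
      (∀ N, MemLp (w N) 2 torus) → MemLp ψ 2 torus →
      Tendsto (fun N => l2 (F - w N)) atTop (𝓝 0) →
      Tendsto (fun N => ∫ x, w N x * ψ x ∂torus) atTop (𝓝 (∫ x, F x * ψ x ∂torus)) := by
    intro F w ψ hF hw hψ hlim
    rw [tendsto_iff_dist_tendsto_zero]
    refine squeeze_zero (fun N => dist_nonneg) (fun N => ?_)
      (by simpa using hlim.mul_const (l2 ψ))
    rw [dist_comm, Real.dist_eq, ← integral_sub (integrable_mul_of_memLp_two hF hψ)
      (integrable_mul_of_memLp_two (hw N) hψ)]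
    simp only [← sub_mul]
    exact abs_integral_mul_le_l2 (hF.sub (hw N)) hψ
  have h1 := lim f u _ hf hu
    (memLp_torus_of_continuous (contDiff_iteratedDeriv hφ k).continuous 2) huf
  have h2 := lim g v _ hg hv (memLp_torus_of_continuous hφ.continuous 2) hvg
  exact tendsto_nhds_unique h1
    ((h2.const_mul ((-1) ^ k)).congr fun N => ((h N).2 φ hφ pφ).symm)

/-! ### Local estimates -/

theorem sqrt_integral_add_sq_le {α : Type*} [MeasurableSpace α] {μ : Measure α} {u v : α → ℝ}
    (hu : MemLp u 2 μ) (hv : MemLp v 2 μ) :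
    √(∫ x, (u x + v x) ^ 2 ∂μ) ≤ √(∫ x, u x ^ 2 ∂μ) + √(∫ x, v x ^ 2 ∂μ) := by
  have h := (le_abs_self _).trans (abs_integral_mul_le hu hv)
  have h1 : ∫ x, (u x + v x) ^ 2 ∂μ =
      ∫ x, u x ^ 2 ∂μ + 2 * ∫ x, u x * v x ∂μ + ∫ x, v x ^ 2 ∂μ := by
    rw [← integral_const_mul, ← integral_add hu.integrable_sq
      ((integrable_mul_of_memLp_two hu hv).const_mul 2), ← integral_add _ hv.integrable_sq]
    · congr 1; ext x; ring
    · exact hu.integrable_sq.add ((integrable_mul_of_memLp_two hu hv).const_mul 2)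
  have h2 : 0 ≤ ∫ x, u x ^ 2 ∂μ := integral_nonneg fun _ => sq_nonneg _
  have h3 : 0 ≤ ∫ x, v x ^ 2 ∂μ := integral_nonneg fun _ => sq_nonneg _
  refine Real.sqrt_le_iff.2 ⟨by positivity, ?_⟩
  rw [h1, add_sq, Real.sq_sqrt h2, Real.sq_sqrt h3]
  linarith

/-- The Taylor polynomial with `k` terms. -/
def taylorPoly (u : ℝ → ℝ) (a : ℝ) (k : ℕ) : Polynomial ℝ :=
  ∑ i ∈ Finset.range k,
    Polynomial.C (iteratedDeriv i u a / i.factorial) * (Polynomial.X - Polynomial.C a) ^ i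

theorem eval_taylorPoly (u : ℝ → ℝ) (a : ℝ) (k : ℕ) (x : ℝ) :
    (taylorPoly u a k).eval x =
      ∑ i ∈ Finset.range k, iteratedDeriv i u a / i.factorial * (x - a) ^ i := by
  simp [taylorPoly, Polynomial.eval_finsetSum]

theorem degree_taylorPoly_lt (u : ℝ → ℝ) (a : ℝ) (k : ℕ) : (taylorPoly u a k).degree < k := by
  refine (Polynomial.degree_sum_le _ _).trans_lt ?_
  rw [Finset.sup_lt_iff (by exact_mod_cast WithBot.bot_lt_coe k)]
  intro i hi
  refine (Polynomial.degree_mul_le _ _).trans_lt ?_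
  rw [Polynomial.degree_pow, Polynomial.degree_X_sub_C, nsmul_one]
  calc _ ≤ (0 : WithBot ℕ) + i := by gcongr; exact Polynomial.degree_C_le
    _ < k := by rw [zero_add]; exact_mod_cast Finset.mem_range.1 hi

/-- The induction on the Taylor remainder rests on this: differentiation commutes with forming the
polynomial, at the cost of one term. -/
theorem hasDerivAt_eval_taylorPoly (u : ℝ → ℝ) (a : ℝ) (k : ℕ) (x : ℝ) :
    HasDerivAt (fun x => (taylorPoly u a (k + 1)).eval x)
      ((taylorPoly (deriv u) a k).eval x) x := by
  have h : (taylorPoly u a (k + 1)).derivative = taylorPoly (deriv u) a k := by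
    rw [taylorPoly, Finset.sum_range_succ', Polynomial.derivative_add, Polynomial.derivative_sum]
    simp only [pow_zero, mul_one, Polynomial.derivative_C, add_zero, taylorPoly]
    refine Finset.sum_congr rfl fun i _ => ?_
    rw [Polynomial.derivative_C_mul, Polynomial.derivative_X_sub_C_pow, ← mul_assoc,
      ← iteratedDeriv_succ', Nat.add_sub_cancel, ← Polynomial.C_mul]
    congr 2
    rw [Nat.factorial_succ]
    push_cast
    have : (i : ℝ) + 1 ≠ 0 := by positivity
    field_simp
  rw [← h]
  exact Polynomial.hasDerivAt _ x

/-- Induction on `k`: the derivative of the remainder of `u` is the remainder of `deriv u`, and the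
remainder vanishes at `a`, so the mean value inequality contributes one factor `w`. The `L¹`-norm of
the top derivative later becomes an `L²`-norm by Cauchy–Schwarz. -/
theorem abs_sub_taylorPoly_le {u : ℝ → ℝ} (hu : ContDiff ℝ (⊤ : ℕ∞) u) {a w : ℝ} (hw : 0 < w)
    (k : ℕ) {x : ℝ} (hx : x ∈ Set.Icc a (a + w)) :
    |u x - (taylorPoly u a (k + 1)).eval x| ≤
      w ^ k * ∫ y in a..(a + w), |iteratedDeriv (k + 1) u y| := by
  induction k generalizing u x with
  | zero =>
    have hc := (contDiff_iteratedDeriv hu 1).continuous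
    have h1 : ∫ y in a..x, iteratedDeriv 1 u y = u x - u a :=
      intervalIntegral.integral_eq_sub_of_hasDerivAt
        (fun y _ => by simpa using hasDerivAt_iteratedDeriv hu 0 y) (hc.intervalIntegrable _ _)
    have h2 : u x - (taylorPoly u a (0 + 1)).eval x = ∫ y in a..x, iteratedDeriv 1 u y := by
      rw [h1, eval_taylorPoly]; simp
    rw [h2, pow_zero, one_mul, zero_add]
    refine (intervalIntegral.abs_integral_le_integral_abs hx.1).trans ?_
    exact intervalIntegral.integral_mono_interval le_rfl hx.1 hx.2
      (.of_forall fun _ => abs_nonneg _) (hc.abs.intervalIntegrable _ _)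
  | succ k ih =>
    have hu' : ContDiff ℝ (⊤ : ℕ∞) (deriv u) := by simpa using contDiff_iteratedDeriv hu 1
    have h1 : ∀ y ∈ Set.Icc a (a + w),
        HasDerivWithinAt (fun y => u y - (taylorPoly u a (k + 1 + 1)).eval y)
          (deriv u y - (taylorPoly (deriv u) a (k + 1)).eval y) (Set.Icc a (a + w)) y :=
      fun y _ => ((by simpa using hasDerivAt_iteratedDeriv hu 0 y : HasDerivAt u (deriv u y) y).sub
        (hasDerivAt_eval_taylorPoly u a (k + 1) y)).hasDerivWithinAt
    have h2 := (convex_Icc a (a + w)).norm_image_sub_le_of_norm_hasDerivWithin_le h1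
      (fun y hy => ih hu' hy) (Set.left_mem_Icc.2 (by linarith)) hx
    have h3 : u a - (taylorPoly u a (k + 1 + 1)).eval a = 0 := by
      rw [eval_taylorPoly, Finset.sum_range_succ']; simp
    have h4 : |x - a| ≤ w := by rw [abs_of_nonneg (by linarith [hx.1])]; linarith [hx.2]
    simp only [h3, sub_zero, Real.norm_eq_abs, ← iteratedDeriv_succ'] at h2
    refine h2.trans ?_
    have h5 : 0 ≤ ∫ y in a..(a + w), |iteratedDeriv (k + 1 + 1) u y| :=
      intervalIntegral.integral_nonneg (by linarith) fun _ _ => abs_nonneg _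
    calc _ ≤ (w ^ k * ∫ y in a..(a + w), |iteratedDeriv (k + 1 + 1) u y|) * w := by gcongr
      _ = _ := by ring

theorem memLp_restrict_of_continuous {f : ℝ → ℝ} (hf : Continuous f) (a b : ℝ) (p : ℝ≥0∞) :
    MemLp f p (volume.restrict (Set.Ioc a b)) := by
  obtain ⟨C, hC⟩ := (isCompact_Icc (a := a) (b := b)).exists_bound_of_continuousOn
    hf.continuousOn
  refine MemLp.of_bound (hf.aestronglyMeasurable) C ?_
  exact (ae_restrict_iff' measurableSet_Ioc).2 (.of_forall fun x hx => hC x ⟨hx.1.le, hx.2⟩)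

theorem integral_abs_le_sqrt {f : ℝ → ℝ} {a w : ℝ} (hw : 0 ≤ w)
    (hf : MemLp f 2 (volume.restrict (Set.Ioc a (a + w)))) :
    ∫ y in a..(a + w), |f y| ≤ √w * √(∫ y in a..(a + w), f y ^ 2) := by
  rw [intervalIntegral.integral_of_le (by linarith), intervalIntegral.integral_of_le (by linarith)]
  have h := abs_integral_mul_le (memLp_const (1 : ℝ)) hf.abs
  simp only [Pi.abs_apply, one_mul, sq_abs, one_pow, integral_const, smul_eq_mul, mul_one] at h
  simp only [measureReal_restrict_apply_univ, Real.volume_real_Ioc_of_le (by linarith : a ≤ a + w),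
    add_sub_cancel_left] at h
  exact (le_abs_self _).trans h

/-- Lagrange interpolation at the nodes `ζ i`: each factor of a basis polynomial is at most `w / (η
w)`, and there are `k - 1` factors. -/
theorem abs_eval_le_of_separated {k : ℕ} {P : Polynomial ℝ} (hP : P.degree < k) {a w η D : ℝ}
    (hw : 0 < w) (hη : 0 < η) (ζ : Fin k → ℝ) (hζ : ∀ i, ζ i ∈ Set.Icc a (a + w))
    (hsep : ∀ i j, i ≠ j → η * w ≤ |ζ i - ζ j|) (hD : ∀ i, |P.eval (ζ i)| ≤ D) {x : ℝ}
    (hx : x ∈ Set.Icc a (a + w)) : |P.eval x| ≤ k * (1 / η) ^ (k - 1) * D := by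
  have hinj : Set.InjOn ζ (Finset.univ : Finset (Fin k)) := fun i _ j _ hij => by
    by_contra hne
    have := hsep i j hne
    rw [hij, sub_self, abs_zero] at this
    nlinarith
  have h1 := Lagrange.eq_interpolate (s := Finset.univ) (v := ζ) (f := P) hinj (by simpa using hP)
  rw [h1, Lagrange.interpolate_apply, Polynomial.eval_finsetSum]
  refine (Finset.abs_sum_le_sum_abs _ _).trans ?_
  calc _ ≤ ∑ _i : Fin k, D * (1 / η) ^ (k - 1) := by
        refine Finset.sum_le_sum fun i _ => ?_
        rw [Polynomial.eval_mul, Polynomial.eval_C, abs_mul]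
        refine mul_le_mul (hD i) ?_ (abs_nonneg _) ((abs_nonneg _).trans (hD i))
        rw [Lagrange.basis, Polynomial.eval_prod, Finset.abs_prod]
        refine (Finset.prod_le_prod (g := fun _ => 1 / η) (fun _ _ => abs_nonneg _)
          fun j hj => ?_).trans (by simp)
        have hne : i ≠ j := fun h => by simp [h] at hj
        have h2 := hsep i j hne
        have h3 : 0 < |ζ i - ζ j| := lt_of_lt_of_le (by positivity) h2
        have h4 : |x - ζ j| ≤ w := by
          rw [abs_le]; constructor <;> linarith [hx.1, hx.2, (hζ j).1, (hζ j).2]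
        simp only [Lagrange.basisDivisor, Polynomial.eval_mul, Polynomial.eval_C,
          Polynomial.eval_sub, Polynomial.eval_X, abs_mul, abs_inv]
        rw [inv_mul_le_iff₀ h3]
        calc |x - ζ j| ≤ w := h4
          _ = η * w * (1 / η) := by field_simp
          _ ≤ _ := by gcongr
    _ = _ := by simp; ring

/-- The constant of the local estimate. -/
def localConst (k : ℕ) (η : ℝ) : ℝ := 1 + k * (1 / η) ^ (k - 1)

/-- Taylor polynomial plus remainder. The remainder is at most `R` on the whole interval, so the
polynomial is at most `D + R` at the nodes, and interpolation spreads this over the interval. -/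
theorem abs_le_of_separated_of_contDiff {k : ℕ} (hk : 1 ≤ k) {u : ℝ → ℝ}
    (hu : ContDiff ℝ (⊤ : ℕ∞) u)
    {a w η D : ℝ} (hw : 0 < w) (hη : 0 < η) (hD0 : 0 ≤ D) (ζ : Fin k → ℝ)
    (hζ : ∀ i, ζ i ∈ Set.Icc a (a + w))
    (hsep : ∀ i j, i ≠ j → η * w ≤ |ζ i - ζ j|) (hD : ∀ i, |u (ζ i)| ≤ D) {x : ℝ}
    (hx : x ∈ Set.Icc a (a + w)) :
    |u x| ≤ localConst k η *
      (D + w ^ (k - 1) * √w * √(∫ y in a..(a + w), iteratedDeriv k u y ^ 2)) := by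
  obtain ⟨k, rfl⟩ := Nat.exists_eq_add_of_le' hk
  rw [Nat.add_sub_cancel]
  set R := w ^ k * √w * √(∫ y in a..(a + w), iteratedDeriv (k + 1) u y ^ 2)
  have hR : ∀ y ∈ Set.Icc a (a + w), |u y - (taylorPoly u a (k + 1)).eval y| ≤ R := fun y hy => by
    refine (abs_sub_taylorPoly_le hu hw k hy).trans ?_
    refine le_of_le_of_eq ?_ (mul_assoc _ _ _).symm
    gcongr
    exact integral_abs_le_sqrt hw.le (memLp_restrict_of_continuous
      (contDiff_iteratedDeriv hu _).continuous _ _ _)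
  have h1 := abs_eval_le_of_separated (degree_taylorPoly_lt u a (k + 1)) hw hη ζ hζ hsep
    (D := D + R) (fun i => by
      have := hR _ (hζ i)
      rw [abs_sub_comm] at this
      calc _ = |((taylorPoly u a (k + 1)).eval (ζ i) - u (ζ i)) + u (ζ i)| := by ring_nf
        _ ≤ R + D := (abs_add_le _ _).trans (add_le_add this (hD i))
        _ = _ := add_comm _ _) hx
  have h2 := hR x hx
  calc |u x| = |(u x - (taylorPoly u a (k + 1)).eval x) + (taylorPoly u a (k + 1)).eval x| := by
        ring_nf
    _ ≤ R + (k + 1 : ℕ) * (1 / η) ^ (k + 1 - 1) * (D + R) :=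
        (abs_add_le _ _).trans (add_le_add h2 h1)
    _ ≤ _ := by rw [localConst]; nlinarith

theorem HasSobolevDeriv.tendsto_partialSum {k : ℕ} (hk : 1 ≤ k) {f g : ℝ → ℝ}
    (h : HasSobolevDeriv k f g) {ε : ℝ} (hε : 0 < ε) :
    ∃ N, l2 (g - iteratedDeriv k (partialSum (freqRange N) f)) < ε ∧
      ∀ x, |f x - partialSum (freqRange N) f x| < ε := by
  have h1 := tendsto_l2_sub_partialSum h
  have h2 : Tendsto (fun N => poincareConst *
      l2 (g - iteratedDeriv k (partialSum (freqRange N) f))) atTop (𝓝 0) := by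
    simpa using h1.const_mul poincareConst
  obtain ⟨N, hN1, hN2⟩ := ((h1.eventually_lt_const hε).and (h2.eventually_lt_const hε)).exists
  refine ⟨N, hN1, fun x => lt_of_le_of_lt ?_ hN2⟩
  exact (h.sub (.of_contDiff (contDiff_trigPoly _ _)
    (isCont₀_partialSum (neg_mem_freqRange N) h.cont) k)).abs_le hk x

theorem MemLp.restrict_torus {g : ℝ → ℝ} {p : ℝ≥0∞} (hg : MemLp g p torus) {a b : ℝ} (ha : 0 ≤ a)
    (hb : b ≤ 1) : MemLp g p (volume.restrict (Set.Ioc a b)) :=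
  hg.mono_measure (Measure.restrict_mono (Set.Ioc_subset_Ioc ha hb) le_rfl)

theorem integral_sq_le_sq_l2 {g : ℝ → ℝ} (hg : MemLp g 2 torus) {a b : ℝ} (ha : 0 ≤ a)
    (hab : a ≤ b) (hb : b ≤ 1) : ∫ y in a..b, g y ^ 2 ≤ l2 g ^ 2 := by
  rw [sq_l2, integral_torus]
  refine intervalIntegral.integral_mono_interval ha hab hb (.of_forall fun _ => sq_nonneg _) ?_
  exact (intervalIntegrable_iff_integrableOn_Ioc_of_le zero_le_one).2 hg.integrable_sq

/-- The local estimate for a function with a square integrable weak derivative. -/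
theorem HasSobolevDeriv.abs_le_of_separated {k : ℕ} (hk : 1 ≤ k) {f g : ℝ → ℝ}
    (h : HasSobolevDeriv k f g) {a w η D : ℝ} (ha : 0 ≤ a) (haw : a + w ≤ 1)
    (hw : 0 < w) (hη : 0 < η) (hD0 : 0 ≤ D)
    (ζ : Fin k → ℝ) (hζ : ∀ i, ζ i ∈ Set.Icc a (a + w))
    (hsep : ∀ i j, i ≠ j → η * w ≤ |ζ i - ζ j|) (hD : ∀ i, |f (ζ i)| ≤ D) {x : ℝ}
    (hx : x ∈ Set.Icc a (a + w)) :
    |f x| ≤ localConst k η * (D + w ^ (k - 1) * √w * √(∫ y in a..(a + w), g y ^ 2)) := by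
  have hC : 0 ≤ localConst k η := by rw [localConst]; positivity
  -- Fourier partial sums approximate `f` uniformly and its derivative in `L²`, so the smooth case
  -- passes to `f` up to a multiple of `ε`.
  have key : ∀ ε > 0, |f x| ≤ localConst k η *
      (D + w ^ (k - 1) * √w * √(∫ y in a..(a + w), g y ^ 2)) +
        (localConst k η * (1 + w ^ (k - 1) * √w) + 1) * ε := fun ε hε => by
    obtain ⟨N, hN1, hN2⟩ := h.tendsto_partialSum hk hε
    set u := partialSum (freqRange N) f
    have hu : ContDiff ℝ (⊤ : ℕ∞) u := contDiff_trigPoly _ _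
    have hg' := memLp_torus_of_continuous (contDiff_iteratedDeriv hu k).continuous 2
    have h1 := abs_le_of_separated_of_contDiff hk hu hw hη (D := D + ε) (by positivity) ζ hζ hsep
      (fun i => by
        have := hN2 (ζ i)
        rw [abs_sub_comm] at this
        calc |u (ζ i)| = |(u (ζ i) - f (ζ i)) + f (ζ i)| := by ring_nf
          _ ≤ _ := (abs_add_le _ _).trans (by linarith [hD i])) hx
    have h2 : √(∫ y in a..(a + w), iteratedDeriv k u y ^ 2) ≤
        √(∫ y in a..(a + w), g y ^ 2) + ε := by
      have e1 := MemLp.restrict_torus h.memLp ha haw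
      have e2 := MemLp.restrict_torus (h.memLp.sub hg') ha haw
      have e3 := sqrt_integral_add_sq_le e1 e2.neg
      have e4 : √(∫ y in a..(a + w), (g - iteratedDeriv k u) y ^ 2) ≤ ε := by
        refine le_trans ?_ hN1.le
        refine Real.sqrt_le_iff.2 ⟨l2_nonneg _, ?_⟩
        exact integral_sq_le_sq_l2 (h.memLp.sub hg') ha (by linarith) haw
      simp only [intervalIntegral.integral_of_le (by linarith : a ≤ a + w)] at e4 ⊢
      simp only [Pi.neg_apply, Pi.sub_apply, neg_sub, add_sub_cancel] at e3 e4
      have e5 : ∀ y, (iteratedDeriv k u y - g y) ^ 2 = (g y - iteratedDeriv k u y) ^ 2 :=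
        fun y => by ring
      simp only [e5] at e3
      linarith
    calc |f x| = |(f x - u x) + u x| := by ring_nf
      _ ≤ ε + localConst k η * (D + ε + w ^ (k - 1) * √w *
          (√(∫ y in a..(a + w), g y ^ 2) + ε)) := by
        refine (abs_add_le _ _).trans (add_le_add (hN2 x).le (h1.trans ?_))
        gcongr
      _ = _ := by ring
  refine le_of_forall_pos_le_add fun ε hε => ?_
  have hp : 0 < localConst k η * (1 + w ^ (k - 1) * √w) + 1 := by positivity
  have := key (ε / (localConst k η * (1 + w ^ (k - 1) * √w) + 1)) (by positivity)
  rwa [mul_div_cancel₀ _ hp.ne'] at this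

/-! ### Grid points and partition cells -/

open Classical in
/-- The indices of the grid points in a set. -/
def gridIn (n : ℕ) (I : Set ℝ) : Finset (Fin n) :=
  Finset.univ.filter fun i : Fin n => (i : ℝ) / n ∈ I

theorem mem_gridIn {n : ℕ} {I : Set ℝ} {i : Fin n} : i ∈ gridIn n I ↔ (i : ℝ) / n ∈ I := by
  simp [gridIn]

/-- Rounding up both endpoints yields a run of consecutive indices; the counts of grid points and
the union bound for the noise both rest on this. -/
theorem mem_gridIn_Ico {n : ℕ} {a b : ℝ} {i : Fin n} :
    i ∈ gridIn n (Set.Ico a b) ↔ ⌈n * a⌉₊ ≤ (i : ℕ) ∧ (i : ℕ) < ⌈n * b⌉₊ := by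
  have hn : (0 : ℝ) < n := by exact_mod_cast i.pos
  rw [mem_gridIn, Set.mem_Ico, Nat.ceil_le, Nat.lt_ceil, le_div_iff₀' hn, div_lt_iff₀' hn]

theorem card_gridIn_Ico {n : ℕ} {a b : ℝ} (hb : b ≤ 1) :
    (gridIn n (Set.Ico a b)).card = ⌈n * b⌉₊ - ⌈n * a⌉₊ := by
  have hbn : ⌈n * b⌉₊ ≤ n := Nat.ceil_le.2 (mul_le_of_le_one_right (Nat.cast_nonneg n) hb)
  rw [← Nat.card_Ico, ← Finset.card_map Fin.valEmbedding]
  congr 1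
  ext i
  simp only [Finset.mem_map, mem_gridIn_Ico, Fin.valEmbedding_apply, Finset.mem_Ico]
  constructor
  · rintro ⟨i, hi, rfl⟩; exact hi
  · intro hi; exact ⟨⟨i, by omega⟩, hi, rfl⟩

theorem card_gridIn_Ico_le {n : ℕ} {a b : ℝ} (hab : a ≤ b) (ha : 0 ≤ a) (hb : b ≤ 1) :
    ((gridIn n (Set.Ico a b)).card : ℝ) ≤ n * (b - a) + 1 := by
  have hmono : ⌈n * a⌉₊ ≤ ⌈n * b⌉₊ := Nat.ceil_mono (by gcongr)
  rw [card_gridIn_Ico hb, Nat.cast_sub hmono]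
  have h1 := Nat.ceil_lt_add_one (show (0 : ℝ) ≤ n * b by have := ha.trans hab; positivity)
  have h2 := Nat.le_ceil ((n : ℝ) * a)
  linarith

theorem le_card_gridIn_Ico {n : ℕ} {a b : ℝ} (hab : a ≤ b) (ha : 0 ≤ a) (hb : b ≤ 1) :
    n * (b - a) - 1 ≤ ((gridIn n (Set.Ico a b)).card : ℝ) := by
  have hmono : ⌈n * a⌉₊ ≤ ⌈n * b⌉₊ := Nat.ceil_mono (by gcongr)
  rw [card_gridIn_Ico hb, Nat.cast_sub hmono]
  have h1 := Nat.ceil_lt_add_one (show (0 : ℝ) ≤ n * a by positivity)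
  have h2 := Nat.le_ceil ((n : ℝ) * b)
  linarith

/-- The cells `[l m^{-j}, (l + 1) m^{-j})` of the `m`-partition system. -/
def cell (m j l : ℕ) : Set ℝ := Set.Ico ((l : ℝ) / (m : ℝ) ^ j) (((l : ℝ) + 1) / (m : ℝ) ^ j)

/-- The local sums of `f` over the cells of positive level are bounded by `Γ √#`. -/
def CellBound (m n : ℕ) (Γ : ℝ) (f : ℝ → ℝ) : Prop :=
  ∀ j : ℕ, 1 ≤ j → ∀ l : ℕ, l < m ^ j →
    |∑ i ∈ gridIn n (cell m j l), f ((i : ℝ) / n)| ≤ Γ * √((gridIn n (cell m j l)).card : ℝ)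

/-- The mean of the sampled values lies between two of them and is therefore attained inside the
interval, by the intermediate value theorem. -/
theorem exists_abs_le_of_abs_sum_le {n : ℕ} {f : ℝ → ℝ} (hf : Continuous f) {a b Γ : ℝ}
    (hcard : 0 < (gridIn n (Set.Ico a b)).card)
    (h : |∑ i ∈ gridIn n (Set.Ico a b), f ((i : ℝ) / n)| ≤
      Γ * √((gridIn n (Set.Ico a b)).card : ℝ)) :
    ∃ ζ ∈ Set.Ico a b, |f ζ| ≤ Γ / √((gridIn n (Set.Ico a b)).card : ℝ) := by
  set F := gridIn n (Set.Ico a b)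
  have hne : F.Nonempty := Finset.card_pos.1 hcard
  have hc : (0 : ℝ) < F.card := by exact_mod_cast hcard
  set A := (∑ i ∈ F, f ((i : ℝ) / n)) / F.card
  have hA : ∑ _i ∈ F, A = ∑ i ∈ F, f ((i : ℝ) / n) := by
    rw [Finset.sum_const, nsmul_eq_mul, mul_div_cancel₀ _ hc.ne']
  obtain ⟨i₁, hi₁, h₁⟩ := Finset.exists_le_of_sum_le hne hA.symm.le
  obtain ⟨i₂, hi₂, h₂⟩ := Finset.exists_le_of_sum_le hne hA.le
  obtain ⟨ζ, hζ, hζA⟩ := isPreconnected_Ico.intermediate_value (mem_gridIn.1 hi₁) (mem_gridIn.1 hi₂)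
    hf.continuousOn ⟨h₁, h₂⟩
  refine ⟨ζ, hζ, ?_⟩
  rw [hζA, abs_div, abs_of_pos hc, div_le_div_iff₀ hc (Real.sqrt_pos.2 hc)]
  calc _ ≤ Γ * √(F.card : ℝ) * √(F.card : ℝ) := by gcongr
    _ = _ := by rw [mul_assoc, Real.mul_self_sqrt hc.le]

/-- The constant of the estimate on cells. -/
def cellConst (k m : ℕ) : ℝ := localConst k (1 / (m : ℝ) ^ (2 * k)) * (√2 * (m : ℝ) ^ k)

theorem cellConst_pos (k m : ℕ) (hm : 2 ≤ m) : 0 < cellConst k m := by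
  rw [cellConst, localConst]; positivity

theorem cell_subset {m j l : ℕ} (hm : 2 ≤ m) (hl : l < m ^ j) :
    0 ≤ (l : ℝ) / (m : ℝ) ^ j ∧ (l : ℝ) / (m : ℝ) ^ j + 1 / (m : ℝ) ^ j ≤ 1 := by
  have hm0 : (0 : ℝ) < (m : ℝ) ^ j := by positivity
  refine ⟨by positivity, ?_⟩
  rw [← add_div, div_le_one hm0]
  exact_mod_cast hl

/-- The cell is cut into `m^{2k}` subcells, and each of those with offsets `0, 2, …, 2k - 2`
contains a point where `f` is small. Skipping every second subcell separates the points by at least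
one subcell width, so the local estimate applies with `η = m^{-2k}`. -/
theorem abs_le_on_cell {k m n j l : ℕ} (hk : 1 ≤ k) (hm : 2 ≤ m) {f g : ℝ → ℝ}
    (h : HasSobolevDeriv k f g) {Γ : ℝ} (hΓ : 0 ≤ Γ) (cb : CellBound m n Γ f) (hl : l < m ^ j)
    (hn : 2 * ((m : ℝ) ^ (2 * k) * (m : ℝ) ^ j) ≤ n) {x : ℝ}
    (hx : x ∈ Set.Icc ((l : ℝ) / (m : ℝ) ^ j) ((l : ℝ) / (m : ℝ) ^ j + 1 / (m : ℝ) ^ j)) :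
    |f x| ≤ cellConst k m * (Γ / √n * √((m : ℝ) ^ j) + (1 / (m : ℝ) ^ j) ^ (k - 1) *
      √(1 / (m : ℝ) ^ j) *
        √(∫ y in ((l : ℝ) / (m : ℝ) ^ j)..((l : ℝ) / (m : ℝ) ^ j + 1 / (m : ℝ) ^ j), g y ^ 2)) := by
  have hm0 : (0 : ℝ) < m := by positivity
  have hn0 : (0 : ℝ) < n := lt_of_lt_of_le (by positivity) hn
  obtain ⟨ha, hb⟩ := cell_subset hm hl
  have h2k : 2 * k < m ^ (2 * k) := lt_of_lt_of_le (Nat.lt_two_pow_self) (Nat.pow_le_pow_left hm _)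
  have hcell : ∀ c : Fin k, ∃ ζ ∈ cell m (j + 2 * k) (l * m ^ (2 * k) + 2 * c),
      |f ζ| ≤ Γ / √n * √((m : ℝ) ^ j) * (√2 * (m : ℝ) ^ k) := fun c => by
    have hc := c.2
    have hl' : l * m ^ (2 * k) + 2 * c < m ^ (j + 2 * k) := by
      calc _ < l * m ^ (2 * k) + m ^ (2 * k) := by omega
        _ = (l + 1) * m ^ (2 * k) := by ring
        _ ≤ m ^ j * m ^ (2 * k) := Nat.mul_le_mul_right _ hl
        _ = _ := (pow_add _ _ _).symm
    obtain ⟨ha', hb'⟩ := cell_subset hm hl'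
    rw [← add_div] at hb'
    have hcard := le_card_gridIn_Ico (n := n) (by gcongr; linarith) ha' hb'
    have hw : ((l * m ^ (2 * k) + 2 * c : ℕ) + 1 : ℝ) / (m : ℝ) ^ (j + 2 * k) -
        ((l * m ^ (2 * k) + 2 * c : ℕ) : ℝ) / (m : ℝ) ^ (j + 2 * k) =
          1 / (m : ℝ) ^ (j + 2 * k) := by ring
    rw [hw] at hcard
    -- With `x = n / m^{j+2k} ≥ 2`, a subcell has at least `x - 1 ≥ x / 2` grid points.
    have hq : 2 ≤ (n : ℝ) * (1 / (m : ℝ) ^ (j + 2 * k)) := by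
      rw [mul_one_div, le_div_iff₀ (by positivity), pow_add]; linarith
    have hcard2 : n / (2 * (m : ℝ) ^ (j + 2 * k)) ≤
        ((gridIn n (cell m (j + 2 * k) (l * m ^ (2 * k) + 2 * c))).card : ℝ) := by
      refine le_trans ?_ hcard
      have : n / (2 * (m : ℝ) ^ (j + 2 * k)) = (n : ℝ) * (1 / (m : ℝ) ^ (j + 2 * k)) / 2 := by
        field_simp
      rw [this]; linarith
    have hpos : 0 < n / (2 * (m : ℝ) ^ (j + 2 * k)) := by positivity
    -- The subcells have positive level even when `j = 0`, so it does no harm that the whole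
    -- interval may be missing from the system.
    obtain ⟨ζ, hζ, hfζ⟩ := exists_abs_le_of_abs_sum_le (n := n) h.cont.continuous
      (Nat.cast_pos.1 (hpos.trans_le hcard2)) (cb _ (by omega) _ hl')
    refine ⟨ζ, hζ, hfζ.trans ?_⟩
    calc _ ≤ Γ / √(n / (2 * (m : ℝ) ^ (j + 2 * k))) := by
          refine div_le_div_of_nonneg_left hΓ (Real.sqrt_pos.2 hpos) (Real.sqrt_le_sqrt hcard2)
      _ = _ := by
          rw [Real.sqrt_div hn0.le, Real.sqrt_mul zero_le_two, pow_add,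
            Real.sqrt_mul (by positivity), pow_mul' (m : ℝ) 2 k, Real.sqrt_sq (by positivity)]
          field_simp
  choose ζ hζ hfζ using hcell
  have hζ' : ∀ c : Fin k, (l : ℝ) / (m : ℝ) ^ j + 2 * c / (m : ℝ) ^ (j + 2 * k) ≤ ζ c ∧
      ζ c < (l : ℝ) / (m : ℝ) ^ j + (2 * c + 1) / (m : ℝ) ^ (j + 2 * k) := fun c => by
    have h1 := hζ c
    rw [cell, Set.mem_Ico] at h1
    push_cast at h1
    have e : (l : ℝ) / (m : ℝ) ^ j = l * (m : ℝ) ^ (2 * k) / (m : ℝ) ^ (j + 2 * k) := by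
      rw [pow_add]; field_simp
    rw [e, ← add_div, ← add_div, ← add_assoc]
    exact h1
  have hη : (0 : ℝ) < 1 / (m : ℝ) ^ (2 * k) := by positivity
  have hηw : 1 / (m : ℝ) ^ (2 * k) * (1 / (m : ℝ) ^ j) = 1 / (m : ℝ) ^ (j + 2 * k) := by
    rw [pow_add]; field_simp
  have hmain := h.abs_le_of_separated hk (w := 1 / (m : ℝ) ^ j) (η := 1 / (m : ℝ) ^ (2 * k))
    (D := Γ / √n * √((m : ℝ) ^ j) * (√2 * (m : ℝ) ^ k)) ha hb (by positivity) hη (by positivity)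
    ζ (fun c => ?_) (fun c d hcd => ?_) hfζ hx
  · refine hmain.trans ?_
    rw [cellConst, mul_assoc (localConst _ _)]
    have hC : 0 ≤ localConst k (1 / (m : ℝ) ^ (2 * k)) := by rw [localConst]; positivity
    refine mul_le_mul_of_nonneg_left ?_ hC
    rw [mul_add, mul_comm (√2 * (m : ℝ) ^ k) (Γ / √n * _)]
    refine add_le_add le_rfl (le_mul_of_one_le_left (by positivity) ?_)
    have h1 : (1 : ℝ) ≤ √2 := Real.one_le_sqrt.2 one_le_two
    have h2 : (1 : ℝ) ≤ (m : ℝ) ^ k := one_le_pow₀ (by exact_mod_cast (by omega : 1 ≤ m))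
    nlinarith
  · obtain ⟨h1, h2⟩ := hζ' c
    have hc : (2 * (c : ℝ) + 1) ≤ (m : ℝ) ^ (2 * k) := by
      have := c.2
      exact_mod_cast (by omega : 2 * (c : ℕ) + 1 ≤ m ^ (2 * k))
    have h3 : (2 * (c : ℝ) + 1) / (m : ℝ) ^ (j + 2 * k) ≤ 1 / (m : ℝ) ^ j := by
      rw [← mul_one_div, ← hηw, ← mul_assoc]
      refine mul_le_of_le_one_left (by positivity) ?_
      rw [mul_one_div, div_le_one (by positivity)]; exact hc
    have h4 : (0 : ℝ) ≤ 2 * c / (m : ℝ) ^ (j + 2 * k) := by positivity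
    exact ⟨by linarith, by linarith⟩
  · rw [hηw]
    wlog hlt : (c : ℕ) < d generalizing c d with H
    · rw [abs_sub_comm]
      exact H d c hcd.symm (by have := Fin.val_ne_of_ne hcd; omega)
    obtain ⟨h1, h2⟩ := hζ' c
    obtain ⟨h3, h4⟩ := hζ' d
    have h5 : (c : ℝ) + 1 ≤ d := by exact_mod_cast hlt
    have h6 : (2 * (c : ℝ) + 1) / (m : ℝ) ^ (j + 2 * k) + 1 / (m : ℝ) ^ (j + 2 * k) ≤
        2 * d / (m : ℝ) ^ (j + 2 * k) := by
      rw [← add_div]; gcongr; linarith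
    rw [abs_sub_comm]
    refine le_trans ?_ (le_abs_self _)
    linarith

/-! ### The interpolation inequality -/

/-- The integral over a cell. -/
def cellIntegral (m : ℕ) (F : ℝ → ℝ) (j l : ℕ) : ℝ :=
  ∫ x in ((l : ℝ) / (m : ℝ) ^ j)..(((l : ℝ) + 1) / (m : ℝ) ^ j), F x

theorem intervalIntegrable_of_torus {F : ℝ → ℝ} (hF : Integrable F torus) {a b : ℝ} (ha : 0 ≤ a)
    (hab : a ≤ b) (hb : b ≤ 1) : IntervalIntegrable F volume a b :=
  (intervalIntegrable_iff_integrableOn_Ioc_of_le hab).2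
    (hF.mono_measure (Measure.restrict_mono (Set.Ioc_subset_Ioc ha hb) le_rfl))

theorem intervalIntegrable_cell {m j l : ℕ} (hm : 2 ≤ m) (hl : l < m ^ j) {F : ℝ → ℝ}
    (hF : Integrable F torus) :
    IntervalIntegrable F volume ((l : ℝ) / (m : ℝ) ^ j) (((l : ℝ) + 1) / (m : ℝ) ^ j) := by
  obtain ⟨h1, h2⟩ := cell_subset hm hl
  rw [← add_div] at h2
  exact intervalIntegrable_of_torus hF h1 (by gcongr; linarith) h2

theorem sum_cellIntegral_children {m j l : ℕ} (hm : 2 ≤ m) (hl : l < m ^ j) {F : ℝ → ℝ}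
    (hF : Integrable F torus) :
    ∑ c ∈ Finset.range m, cellIntegral m F (j + 1) (l * m + c) = cellIntegral m F j l := by
  have hm0 : (m : ℝ) ≠ 0 := by positivity
  have h := intervalIntegral.sum_integral_adjacent_intervals (f := F) (μ := volume) (n := m)
    (a := fun c : ℕ => ((l * m + c : ℕ) : ℝ) / (m : ℝ) ^ (j + 1)) (fun c hc => by
      have hl' : l * m + c < m ^ (j + 1) := by
        calc _ < l * m + m := by omega
          _ = (l + 1) * m := by ring
          _ ≤ m ^ j * m := Nat.mul_le_mul_right _ hl
          _ = _ := (pow_succ _ _).symm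
      have := intervalIntegrable_cell hm hl' hF
      convert this using 2
      push_cast; ring)
  have e : (m : ℝ) ^ (j + 1) = (m : ℝ) ^ j * m := pow_succ _ _
  rw [cellIntegral]
  convert h using 2
  · rw [cellIntegral]; congr 2; push_cast; ring
  · push_cast; rw [e]; field_simp; ring
  · push_cast; rw [e]; field_simp

theorem sum_cellIntegral {m j : ℕ} (hm : 2 ≤ m) {F : ℝ → ℝ} (hF : Integrable F torus) :
    ∑ l ∈ Finset.range (m ^ j), cellIntegral m F j l = ∫ x, F x ∂torus := by
  have hm0 : (m : ℝ) ^ j ≠ 0 := by positivity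
  have h := intervalIntegral.sum_integral_adjacent_intervals (f := F) (μ := volume) (n := m ^ j)
    (a := fun c : ℕ => (c : ℝ) / (m : ℝ) ^ j) (fun c hc => by
      simpa using intervalIntegrable_cell hm hc hF)
  rw [integral_torus]
  convert h using 2
  · rw [cellIntegral]; congr 2; push_cast; ring
  · simp
  · push_cast; rw [div_self hm0]

theorem cellIntegral_nonneg {m : ℕ} {F : ℝ → ℝ} (hF : ∀ x, 0 ≤ F x) (j l : ℕ) :
    0 ≤ cellIntegral m F j l :=
  intervalIntegral.integral_nonneg (by gcongr; linarith) fun x _ => hF x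

/-- The threshold on the local energy is the value at which the two terms of `abs_le_on_cell`
balance. -/
theorem abs_le_on_cell_of_small {k m n j l : ℕ} (hk : 1 ≤ k) (hm : 2 ≤ m) {f g : ℝ → ℝ}
    (h : HasSobolevDeriv k f g) {Γ : ℝ} (hΓ : 0 ≤ Γ) (cb : CellBound m n Γ f) (hl : l < m ^ j)
    (hn : 2 * ((m : ℝ) ^ (2 * k) * (m : ℝ) ^ j) ≤ n)
    (hE : cellIntegral m (fun y => g y ^ 2) j l ≤ (Γ / √n) ^ 2 * ((m : ℝ) ^ j) ^ (2 * k)) {x : ℝ}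
    (hx : x ∈ Set.Icc ((l : ℝ) / (m : ℝ) ^ j) (((l : ℝ) + 1) / (m : ℝ) ^ j)) :
    |f x| ≤ 2 * cellConst k m * (Γ / √n * √((m : ℝ) ^ j)) := by
  have hW : (0 : ℝ) < (m : ℝ) ^ j := by positivity
  have hC := (cellConst_pos k m hm).le
  have h1 := abs_le_on_cell hk hm h hΓ cb hl hn (x := x) (by rwa [← add_div])
  rw [← add_div, ← cellIntegral] at h1
  refine h1.trans ?_
  rw [mul_comm 2 (cellConst k m), mul_assoc (cellConst k m)]
  refine mul_le_mul_of_nonneg_left ?_ hC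
  have h2 : √(cellIntegral m (fun y => g y ^ 2) j l) ≤ Γ / √n * ((m : ℝ) ^ j) ^ k := by
    refine Real.sqrt_le_iff.2 ⟨by positivity, hE.trans (le_of_eq ?_)⟩
    rw [mul_pow, ← pow_mul ((m : ℝ) ^ j) k 2, mul_comm k 2]
  have h3 : (1 / (m : ℝ) ^ j) ^ (k - 1) * √(1 / (m : ℝ) ^ j) *
      (Γ / √n * ((m : ℝ) ^ j) ^ k) = Γ / √n * √((m : ℝ) ^ j) := by
    obtain ⟨k, rfl⟩ := Nat.exists_eq_add_of_le' hk
    rw [Nat.add_sub_cancel, Real.sqrt_div zero_le_one, Real.sqrt_one, one_div_pow, pow_succ]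
    have : √((m : ℝ) ^ j) ≠ 0 := (Real.sqrt_pos.2 hW).ne'
    set W := (m : ℝ) ^ j
    field_simp
    rw [Real.sq_sqrt hW.le]; ring
  calc _ ≤ Γ / √n * √((m : ℝ) ^ j) + (1 / (m : ℝ) ^ j) ^ (k - 1) *
        √(1 / (m : ℝ) ^ j) * (Γ / √n * ((m : ℝ) ^ j) ^ k) := by gcongr
    _ = _ := by rw [h3]; ring

/-- A stopping-time argument on the tree of cells. Call a cell bad if its `G`-integral exceeds the
threshold `x` of its level; at the finest level `J` no cell is bad, and the induction runs up from
there. The claim for a bad cell carries a reserve `-2Am x`. If all its children are good, badness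
itself pays, since `G > x`. If some child is bad, its reserve, larger by the factor `M = m^{2k} ≥
2`, pays both for the good siblings and for the reserve of the parent. -/
theorem cellIntegral_pow_le_of_cells {k m J : ℕ} (hk : 1 ≤ k) (hm : 2 ≤ m) {F G : ℝ → ℝ}
    (hF : Integrable F torus) (hG : Integrable G torus) (hG0 : ∀ x, 0 ≤ G x) {A ε : ℝ} (hA : 0 ≤ A)
    (hε : 0 ≤ ε)
    (hgood : ∀ j ≤ J, ∀ l < m ^ j, cellIntegral m G j l ≤ ε * ((m : ℝ) ^ j) ^ (2 * k) →
      cellIntegral m F j l ≤ A * (ε * ((m : ℝ) ^ j) ^ (2 * k)))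
    (hJ : ∀ l < m ^ J, cellIntegral m G J l ≤ ε * ((m : ℝ) ^ J) ^ (2 * k)) (d : ℕ) :
    ∀ j, j + d = J → ∀ l < m ^ j, ε * ((m : ℝ) ^ j) ^ (2 * k) < cellIntegral m G j l →
      cellIntegral m F j l ≤ (A * (m : ℝ) ^ (2 * k + 1) + 2 * A * m) * cellIntegral m G j l -
        2 * A * m * (ε * ((m : ℝ) ^ j) ^ (2 * k)) := by
  induction d with
  | zero =>
    intro j hj l hl hbad
    obtain rfl : j = J := by omega
    exact absurd (hJ l hl) (not_le.2 hbad)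
  | succ d ih =>
    intro j hj l hl hbad
    have hmr : (2 : ℝ) ≤ m := by exact_mod_cast hm
    set x := ε * ((m : ℝ) ^ j) ^ (2 * k)
    have hx0 : 0 ≤ x := by positivity
    have hx' : ε * ((m : ℝ) ^ (j + 1)) ^ (2 * k) = (m : ℝ) ^ (2 * k) * x := by
      rw [pow_succ, mul_pow]; ring
    have hM : (2 : ℝ) ≤ (m : ℝ) ^ (2 * k) :=
      hmr.trans (le_self_pow₀ (by linarith) (by omega))
    set M := (m : ℝ) ^ (2 * k)
    set B := A * (m : ℝ) ^ (2 * k + 1) + 2 * A * m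
    have hB : 0 ≤ B := by positivity
    have hBm : B = A * M * m + 2 * A * m := by simp only [B, M]; ring
    have hl' : ∀ c ∈ Finset.range m, l * m + c < m ^ (j + 1) := fun c hc => by
      have hc := Finset.mem_range.1 hc
      calc _ < l * m + m := by omega
        _ = (l + 1) * m := by ring
        _ ≤ m ^ j * m := Nat.mul_le_mul_right _ hl
        _ = _ := (pow_succ _ _).symm
    have hsumF := sum_cellIntegral_children hm hl hF
    have hsumG := sum_cellIntegral_children hm hl hG
    have hchild : ∀ c ∈ Finset.range m, cellIntegral m F (j + 1) (l * m + c) ≤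
        B * cellIntegral m G (j + 1) (l * m + c) + A * M * x := fun c hc => by
      have hGc := cellIntegral_nonneg (m := m) hG0 (j + 1) (l * m + c)
      by_cases hb : cellIntegral m G (j + 1) (l * m + c) ≤ M * x
      · have := hgood (j + 1) (by omega) _ (hl' c hc) (by rwa [hx'])
        rw [hx'] at this
        nlinarith [mul_nonneg hB hGc]
      · have := ih (j + 1) (by omega) _ (hl' c hc) (by rw [hx']; exact not_le.1 hb)
        rw [hx'] at this
        have h2 : 0 ≤ 2 * A * m * (M * x) := by positivity
        have h3 : 0 ≤ A * M * x := by positivity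
        linarith
    by_cases hall : ∀ c ∈ Finset.range m, cellIntegral m G (j + 1) (l * m + c) ≤ M * x
    · have h1 : cellIntegral m F j l ≤ m * (A * (M * x)) := by
        rw [← hsumF]
        refine (Finset.sum_le_card_nsmul _ _ (A * (M * x)) fun c hc => ?_).trans (by simp)
        have := hgood (j + 1) (by omega) _ (hl' c hc) (by rw [hx']; exact hall c hc)
        rwa [hx'] at this
      have h2 : B * x ≤ B * cellIntegral m G j l := by gcongr
      rw [hBm] at h2 ⊢
      linarith
    · push Not at hall
      obtain ⟨c₀, hc₀, hb⟩ := hall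
      have hbad₀ := ih (j + 1) (by omega) _ (hl' c₀ hc₀) (by rw [hx']; exact hb)
      rw [hx'] at hbad₀
      have h1 : cellIntegral m F j l ≤
          B * cellIntegral m G j l + m * (A * M * x) - 2 * A * m * (M * x) := by
        rw [← hsumF, ← hsumG, Finset.mul_sum, ← Finset.add_sum_erase _ _ hc₀,
          ← Finset.add_sum_erase _ (fun c => B * cellIntegral m G (j + 1) (l * m + c)) hc₀]
        have h2 : ∑ c ∈ (Finset.range m).erase c₀, cellIntegral m F (j + 1) (l * m + c) ≤
            ∑ c ∈ (Finset.range m).erase c₀,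
              (B * cellIntegral m G (j + 1) (l * m + c) + A * M * x) :=
          Finset.sum_le_sum fun c hc => hchild c (Finset.mem_of_mem_erase hc)
        rw [Finset.sum_add_distrib, Finset.sum_const, Finset.card_erase_of_mem hc₀,
          Finset.card_range, nsmul_eq_mul, Nat.cast_sub (by omega)] at h2
        have h3 : 0 ≤ A * M * x := by positivity
        push_cast at h2
        linarith
      have h4 : A * m * x * 2 ≤ A * m * x * M := by gcongr
      linarith

/-- The constant of the `L^{4k+2}`-estimate. -/
def interpConst (k m : ℕ) : ℝ :=
  2 * (2 * cellConst k m) ^ (4 * k + 2) * ((m : ℝ) ^ (2 * k + 1) + 2 * m)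

/-- Rounding up to the next power of `m` costs at most the factor `m`. -/
theorem exists_level {k m : ℕ} (hk : 1 ≤ k) (hm : 2 ≤ m) {t : ℝ} (ht : 1 ≤ t) :
    ∃ J : ℕ, t ≤ ((m : ℝ) ^ J) ^ k ∧ (m : ℝ) ^ J ≤ m * t ^ (1 / (k : ℝ)) := by
  have hmr : (1 : ℝ) < m := by exact_mod_cast (by omega : 1 < m)
  have hk0 : (k : ℝ) ≠ 0 := by positivity
  set τ := t ^ (1 / (k : ℝ))
  have hτ : 1 ≤ τ := Real.one_le_rpow ht (by positivity)
  have hτk : τ ^ k = t := by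
    rw [← Real.rpow_natCast, ← Real.rpow_mul (by linarith), one_div_mul_cancel hk0, Real.rpow_one]
  obtain ⟨J, h1, h2⟩ := exists_nat_pow_near hτ hmr
  refine ⟨J + 1, ?_, ?_⟩
  · rw [← hτk]; gcongr
  · rw [pow_succ, mul_comm]; gcongr

/-- At level `J` even the global energy is below the local threshold, so all cells of that level are
good: this gives the uniform bound and starts the induction up the tree. The exponent `4k + 2` is
the one for which a good cell of width `1/W` contributes at most a multiple of `(δ √W)^{4k+2} / W`,
which is `δ^{4k}` times the threshold `δ² W^{2k}`, at every level. -/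
theorem abs_le_and_integral_pow_le {k m n J : ℕ} (hk : 1 ≤ k) (hm : 2 ≤ m) {f g : ℝ → ℝ}
    (h : HasSobolevDeriv k f g) {Γ E : ℝ} (hΓ : 0 ≤ Γ) (cb : CellBound m n Γ f)
    (hE : l2 g ≤ E) (hδE : Γ / √n ≤ E) (hJ : E ≤ Γ / √n * ((m : ℝ) ^ J) ^ k)
    (hn : 2 * ((m : ℝ) ^ (2 * k) * (m : ℝ) ^ J) ≤ n) :
    (∀ x, |f x| ≤ 2 * cellConst k m * (Γ / √n * √((m : ℝ) ^ J))) ∧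
      ∫ x, f x ^ (4 * k + 2) ∂torus ≤ interpConst k m * (Γ / √n) ^ (4 * k) * E ^ 2 := by
  have hm0 : (0 : ℝ) < m := by positivity
  set δ := Γ / √n with hδ
  have hδ0 : 0 ≤ δ := by positivity
  have hG : Integrable (fun y => g y ^ 2) torus := h.memLp.integrable_sq
  have hC := cellConst_pos k m hm
  have hJ' : ∀ l < m ^ J, cellIntegral m (fun y => g y ^ 2) J l ≤
      δ ^ 2 * ((m : ℝ) ^ J) ^ (2 * k) := fun l hl => by
    obtain ⟨ha, hb⟩ := cell_subset hm hl
    rw [← add_div] at hb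
    have h1 := integral_sq_le_sq_l2 h.memLp ha (b := ((l : ℝ) + 1) / (m : ℝ) ^ J)
      (by gcongr; linarith) hb
    calc _ ≤ l2 g ^ 2 := h1
      _ ≤ (δ * ((m : ℝ) ^ J) ^ k) ^ 2 := by
        have := l2_nonneg g
        gcongr; exact hE.trans hJ
      _ = _ := by rw [mul_pow, ← pow_mul, mul_comm k 2]
  refine ⟨fun x => ?_, ?_⟩
  · obtain ⟨y, hy, hxy⟩ := h.cont.periodic.exists_mem_Ico₀ one_pos x
    rw [hxy]
    have hWn : (0 : ℝ) < (m : ℝ) ^ J := by positivity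
    set l := ⌊y * (m : ℝ) ^ J⌋₊
    have hl1 : (l : ℝ) ≤ y * (m : ℝ) ^ J := Nat.floor_le (by have := hy.1; positivity)
    have hl2 : y * (m : ℝ) ^ J < l + 1 := Nat.lt_floor_add_one _
    have hl : l < m ^ J := by
      have : (l : ℝ) < (m : ℝ) ^ J := hl1.trans_lt (mul_lt_of_lt_one_left hWn hy.2)
      exact_mod_cast this
    exact abs_le_on_cell_of_small hk hm h hΓ cb hl hn (hJ' l hl)
      ⟨(div_le_iff₀ hWn).2 hl1, (le_div_iff₀ hWn).2 hl2.le⟩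
  · have hF : Integrable (fun y => f y ^ (4 * k + 2)) torus :=
      integrable_torus_of_continuous (h.cont.continuous.pow _)
    set A := (2 * cellConst k m) ^ (4 * k + 2) * δ ^ (4 * k) with hA
    have hA0 : 0 ≤ A := by positivity
    have hgood : ∀ j ≤ J, ∀ l < m ^ j,
        cellIntegral m (fun y => g y ^ 2) j l ≤ δ ^ 2 * ((m : ℝ) ^ j) ^ (2 * k) →
          cellIntegral m (fun y => f y ^ (4 * k + 2)) j l ≤
            A * (δ ^ 2 * ((m : ℝ) ^ j) ^ (2 * k)) := fun j hj l hl hsm => by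
      have hW : (0 : ℝ) < (m : ℝ) ^ j := by positivity
      have hnj : 2 * ((m : ℝ) ^ (2 * k) * (m : ℝ) ^ j) ≤ n := by
        refine le_trans ?_ hn
        gcongr
        exact_mod_cast (by omega : 1 ≤ m)
      have hab : (l : ℝ) / (m : ℝ) ^ j ≤ ((l : ℝ) + 1) / (m : ℝ) ^ j := by gcongr; linarith
      have h1 := intervalIntegral.norm_integral_le_of_norm_le_const (a := (l : ℝ) / (m : ℝ) ^ j)
        (b := ((l : ℝ) + 1) / (m : ℝ) ^ j) (f := fun y => f y ^ (4 * k + 2))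
        (C := (2 * cellConst k m * (δ * √((m : ℝ) ^ j))) ^ (4 * k + 2)) (fun x hx => by
          rw [Set.uIoc_of_le hab] at hx
          rw [norm_pow]
          refine pow_le_pow_left₀ (norm_nonneg _) ?_ _
          exact abs_le_on_cell_of_small hk hm h hΓ cb hl hnj hsm ⟨hx.1.le, hx.2⟩)
      refine (le_abs_self _).trans (h1.trans (le_of_eq ?_))
      have h2 : ((l : ℝ) + 1) / (m : ℝ) ^ j - (l : ℝ) / (m : ℝ) ^ j = 1 / (m : ℝ) ^ j := by ring
      have h3 : √((m : ℝ) ^ j) ^ (4 * k + 2) = ((m : ℝ) ^ j) ^ (2 * k) * (m : ℝ) ^ j := by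
        rw [show 4 * k + 2 = 2 * (2 * k + 1) by ring, pow_mul, Real.sq_sqrt hW.le, pow_succ]
      rw [h2, abs_of_pos (by positivity), mul_pow (2 * cellConst k m), mul_pow δ, h3, hA]
      field_simp
      ring
    -- The root may be good or bad; the extra term `A δ²` covers the case that it is good.
    have hmain : ∀ l < m ^ 0, cellIntegral m (fun y => f y ^ (4 * k + 2)) 0 l ≤
        (A * (m : ℝ) ^ (2 * k + 1) + 2 * A * m) * cellIntegral m (fun y => g y ^ 2) 0 l +
          A * δ ^ 2 := fun l hl => by
      have h0 := cellIntegral_nonneg (m := m) (F := fun y => g y ^ 2) (fun _ => sq_nonneg _) 0 l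
      by_cases hb : cellIntegral m (fun y => g y ^ 2) 0 l ≤ δ ^ 2 * ((m : ℝ) ^ 0) ^ (2 * k)
      · have := hgood 0 (by omega) l hl hb
        simp only [pow_zero, one_pow, mul_one] at this
        have h1 : 0 ≤ (A * (m : ℝ) ^ (2 * k + 1) + 2 * A * m) *
          cellIntegral m (fun y => g y ^ 2) 0 l := by positivity
        linarith
      · have := cellIntegral_pow_le_of_cells hk hm hF hG (fun _ => sq_nonneg _) hA0
          (sq_nonneg δ) hgood hJ' J 0 (by omega) l hl (not_le.1 hb)
        have h1 : 0 ≤ 2 * A * m * (δ ^ 2 * ((m : ℝ) ^ 0) ^ (2 * k)) := by positivity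
        have h2 : 0 ≤ A * δ ^ 2 := by positivity
        linarith
    have hl0 := hmain 0 (by simp)
    have e1 := sum_cellIntegral (j := 0) hm hF
    have e2 := sum_cellIntegral (j := 0) hm hG
    simp only [pow_zero, Finset.sum_range_one] at e1 e2
    rw [e1, e2, ← sq_l2] at hl0
    have h3 : l2 g ^ 2 ≤ E ^ 2 := pow_le_pow_left₀ (l2_nonneg g) hE 2
    have h4 : δ ^ 2 ≤ E ^ 2 := pow_le_pow_left₀ hδ0 hδE 2
    have hm1 : (1 : ℝ) ≤ (m : ℝ) ^ (2 * k + 1) + 2 * m := by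
      have : (1 : ℝ) ≤ m := by exact_mod_cast (by omega : 1 ≤ m)
      have : (0 : ℝ) ≤ (m : ℝ) ^ (2 * k + 1) := by positivity
      linarith
    calc _ ≤ (A * (m : ℝ) ^ (2 * k + 1) + 2 * A * m) * l2 g ^ 2 + A * δ ^ 2 := hl0
      _ ≤ (A * (m : ℝ) ^ (2 * k + 1) + 2 * A * m) * E ^ 2 +
          A * ((m : ℝ) ^ (2 * k + 1) + 2 * m) * E ^ 2 := by
        gcongr
        exact le_mul_of_one_le_right hA0 hm1
      _ = _ := by rw [interpConst, hA]; ring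

theorem eLpNorm_torus_eq {f : ℝ → ℝ} (hf : Continuous f) {q : ℝ≥0∞} (h0 : q ≠ 0) (ht : q ≠ ∞) :
    eLpNorm f q torus = ENNReal.ofReal ((∫ x, |f x| ^ q.toReal ∂torus) ^ q.toReal⁻¹) :=
  (memLp_torus_of_continuous hf q).eLpNorm_eq_integral_rpow_norm h0 ht

theorem eLpNorm_torus_le_of_abs_le {f : ℝ → ℝ} {C : ℝ} (h : ∀ x, |f x| ≤ C)
    (q : ℝ≥0∞) : eLpNorm f q torus ≤ ENNReal.ofReal C := by
  have := eLpNorm_le_of_ae_bound (p := q) (μ := torus) (f := f) (C := C) (.of_forall h)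
  simpa using this

/-- The interpolation inequality between the local sums over the partition system and the
derivative of order `k`. -/
theorem exists_eLpNorm_le {k m : ℕ} (hk : 1 ≤ k) (hm : 2 ≤ m) (q : ℝ≥0∞) :
    ∃ K : ℝ, 0 < K ∧ ∀ (n : ℕ) (f g : ℝ → ℝ) (Γ E : ℝ), HasSobolevDeriv k f g → CellBound m n Γ f →
      0 < Γ / √n → Γ / √n ≤ E → l2 g ≤ E →
      2 * (m : ℝ) ^ (2 * k + 1) * (E / (Γ / √n)) ^ (1 / (k : ℝ)) ≤ n →
      eLpNorm f q torus ≤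
        ENNReal.ofReal (K * (Γ / √n * (E / (Γ / √n)) ^ (1 - 2 * vartheta k q))) := by
  have hmr : (1 : ℝ) ≤ m := by exact_mod_cast (by omega : 1 ≤ m)
  have hkr : (1 : ℝ) ≤ k := by exact_mod_cast hk
  have hC := cellConst_pos k m hm
  have hI : 0 < interpConst k m := by rw [interpConst]; positivity
  set K₁ := 2 * cellConst k m * √m with hK₁
  have hK₁0 : 0 < K₁ := by positivity
  set Q : ℝ := 4 * k + 2 with hQ
  have key : ∀ (n : ℕ) (f g : ℝ → ℝ) (Γ E : ℝ), HasSobolevDeriv k f g → CellBound m n Γ f →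
      0 < Γ / √n → Γ / √n ≤ E → l2 g ≤ E →
      2 * (m : ℝ) ^ (2 * k + 1) * (E / (Γ / √n)) ^ (1 / (k : ℝ)) ≤ n →
      (∀ x, |f x| ≤ K₁ * (Γ / √n * (E / (Γ / √n)) ^ (1 / (2 * k : ℝ)))) ∧
        ∫ x, |f x| ^ Q ∂torus ≤ interpConst k m * (Γ / √n) ^ Q * (E / (Γ / √n)) ^ (2 : ℝ) := by
    intro n f g Γ E h cb hδ hδE hE hn
    have hn0 : (0 : ℝ) < √n := by
      refine Real.sqrt_pos.2 (lt_of_lt_of_le ?_ hn)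
      have : 0 < E := hδ.trans_le hδE
      positivity
    have hΓ : 0 ≤ Γ := by
      by_contra hneg
      exact absurd hδ (not_lt.2 (div_nonpos_of_nonpos_of_nonneg (not_le.1 hneg).le hn0.le))
    set δ := Γ / √n
    have ht : 1 ≤ E / δ := (one_le_div hδ).2 hδE
    obtain ⟨J, hJ1, hJ2⟩ := exists_level hk hm ht
    obtain ⟨h1, h2⟩ := abs_le_and_integral_pow_le (J := J) hk hm h hΓ cb hE hδE
      (by rwa [← div_le_iff₀' hδ]) (by
        refine le_trans ?_ hn
        calc _ ≤ 2 * ((m : ℝ) ^ (2 * k) * (m * (E / δ) ^ (1 / (k : ℝ)))) := by gcongr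
          _ = _ := by ring)
    refine ⟨fun x => (h1 x).trans ?_, ?_⟩
    · have h3 : √((m : ℝ) ^ J) ≤ √m * (E / δ) ^ (1 / (2 * k : ℝ)) := by
        refine (Real.sqrt_le_sqrt hJ2).trans (le_of_eq ?_)
        rw [Real.sqrt_mul (by positivity), Real.sqrt_eq_rpow ((E / δ) ^ (1 / (k : ℝ))),
          ← Real.rpow_mul (by linarith)]
        congr 2; field_simp
      calc _ ≤ 2 * cellConst k m * (δ * (√m * (E / δ) ^ (1 / (2 * k : ℝ)))) := by gcongr
        _ = _ := by rw [hK₁]; ring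
    · have e1 : ∀ x, |f x| ^ Q = f x ^ (4 * k + 2) := fun x => by
        rw [show Q = ((4 * k + 2 : ℕ) : ℝ) by rw [hQ]; push_cast; ring, Real.rpow_natCast,
          (by exact ⟨2 * k + 1, by ring⟩ : Even (4 * k + 2)).pow_abs]
      simp only [e1]
      replace h2 : _ ≤ interpConst k m * δ ^ (4 * k) * E ^ 2 := h2
      clear_value δ
      refine h2.trans (le_of_eq ?_)
      rw [show Q = ((4 * k + 2 : ℕ) : ℝ) by rw [hQ]; push_cast; ring, Real.rpow_natCast,
        Real.rpow_two, div_pow, pow_add]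
      field_simp
  -- Up to the critical exponent `Q = 4k + 2`, the norms increase with `q` on a probability space.
  -- Beyond it, the uniform bound serves for `q = ∞`, and otherwise `|f|^q` is split into the
  -- uniform bound to the power `q - Q` and `|f|^Q`.
  by_cases hq : q ≤ 4 * (k : ℝ≥0∞) + 2
  · refine ⟨interpConst k m ^ Q⁻¹, by positivity, fun n f g Γ E h cb hδ hδE hE hn => ?_⟩
    obtain ⟨-, h2⟩ := key n f g Γ E h cb hδ hδE hE hn
    have hE0 : 0 < E := hδ.trans_le hδE
    have hQt : (4 * (k : ℝ≥0∞) + 2).toReal = Q := by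
      rw [hQ, show 4 * (k : ℝ≥0∞) + 2 = ((4 * k + 2 : ℕ) : ℝ≥0∞) by push_cast; ring,
        ENNReal.toReal_natCast]
      push_cast; ring
    have hQ0 : Q ≠ 0 := by positivity
    refine (eLpNorm_le_eLpNorm_of_exponent_le hq h.cont.continuous.aestronglyMeasurable).trans ?_
    rw [eLpNorm_torus_eq h.cont.continuous (by simp) (by finiteness), hQt]
    refine ENNReal.ofReal_le_ofReal ?_
    set δ := Γ / √n
    calc _ ≤ (interpConst k m * δ ^ Q * (E / δ) ^ (2 : ℝ)) ^ Q⁻¹ := by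
          have : 0 ≤ ∫ x, |f x| ^ Q ∂torus := integral_nonneg fun x => by positivity
          gcongr
      _ = _ := by
        rw [Real.mul_rpow (by positivity) (by positivity), Real.mul_rpow hI.le (by positivity),
          Real.rpow_rpow_inv hδ.le hQ0, ← Real.rpow_mul (by positivity), mul_assoc]
        congr 3
        rw [vartheta, if_pos hq, hQ]; field_simp; ring
  · have hq0 : q ≠ 0 := by rintro rfl; simp at hq
    by_cases hqt : q = ∞
    · refine ⟨K₁, hK₁0, fun n f g Γ E h cb hδ hδE hE hn => ?_⟩
      obtain ⟨h1, -⟩ := key n f g Γ E h cb hδ hδE hE hn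
      refine (eLpNorm_torus_le_of_abs_le h1 q).trans (le_of_eq ?_)
      congr 4
      rw [vartheta, if_neg hq, hqt]; simp; field_simp; ring
    · set q' := q.toReal with hq'
      have hqQ : Q < q' := by
        rw [not_le] at hq
        have := ENNReal.toReal_strict_mono hqt hq
        rwa [show 4 * (k : ℝ≥0∞) + 2 = ((4 * k + 2 : ℕ) : ℝ≥0∞) by push_cast; ring,
          ENNReal.toReal_natCast, show ((4 * k + 2 : ℕ) : ℝ) = Q by rw [hQ]; push_cast; ring] at this
      have hQ0 : 0 < Q := by positivity
      have hq'0 : 0 < q' := hQ0.trans hqQ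
      refine ⟨(K₁ ^ (q' - Q) * interpConst k m) ^ q'⁻¹, by positivity,
        fun n f g Γ E h cb hδ hδE hE hn => ?_⟩
      obtain ⟨h1, h2⟩ := key n f g Γ E h cb hδ hδE hE hn
      have hE0 : 0 < E := hδ.trans_le hδE
      rw [eLpNorm_torus_eq h.cont.continuous hq0 hqt, ← hq']
      refine ENNReal.ofReal_le_ofReal ?_
      set δ := Γ / √n
      set t := E / δ
      have ht0 : 0 < t := by positivity
      have hb : ∫ x, |f x| ^ q' ∂torus ≤
          (K₁ * (δ * t ^ (1 / (2 * k : ℝ)))) ^ (q' - Q) *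
            (interpConst k m * δ ^ Q * t ^ (2 : ℝ)) := by
        refine le_trans ?_ (mul_le_mul_of_nonneg_left h2 (by positivity))
        rw [← integral_const_mul]
        refine integral_mono (integrable_torus_of_continuous ?_)
          (integrable_torus_of_continuous ?_) fun x => ?_
        · exact h.cont.continuous.abs.rpow_const fun _ => .inr hq'0.le
        · exact continuous_const.mul (h.cont.continuous.abs.rpow_const fun _ => .inr hQ0.le)
        · have e : q' = (q' - Q) + Q := by ring
          simp only []
          conv_lhs => rw [e, Real.rpow_add_of_nonneg (abs_nonneg _) (by linarith) hQ0.le]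
          gcongr
          exact h1 x
      calc _ ≤ _ := Real.rpow_le_rpow (integral_nonneg fun x => by positivity) hb (by positivity)
        _ = ((K₁ ^ (q' - Q) * interpConst k m) *
            (δ ^ q' * t ^ ((q' - Q) / (2 * k) + 2))) ^ q'⁻¹ := by
          congr 1
          rw [Real.mul_rpow hK₁0.le (by positivity), Real.mul_rpow hδ.le (by positivity),
            ← Real.rpow_mul ht0.le, Real.rpow_add ht0,
            show δ ^ q' = δ ^ (q' - Q) * δ ^ Q by rw [← Real.rpow_add hδ]; congr 1; ring,
            show 1 / (2 * k : ℝ) * (q' - Q) = (q' - Q) / (2 * k) by ring]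
          ring
        _ = _ := by
          rw [Real.mul_rpow (by positivity) (by positivity), Real.mul_rpow (x := δ ^ q')
            (by positivity) (by positivity), Real.rpow_rpow_inv hδ.le hq'0.ne',
            ← Real.rpow_mul ht0.le]
          congr 3
          rw [vartheta, if_neg hq, ENNReal.toReal_inv, ← hq', hQ]; field_simp; ring

/-! ### Sums over the grid -/

/-- The sum of the values of `F` at the grid points in `[a, b)`. -/
def gridSum (n : ℕ) (F : ℝ → ℝ) (a b : ℝ) : ℝ := ∑ i ∈ gridIn n (Set.Ico a b), F ((i : ℝ) / n)

theorem gridSum_add (n : ℕ) (F : ℝ → ℝ) {a b c : ℝ} (hab : a ≤ b) (hbc : b ≤ c) :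
    gridSum n F a b + gridSum n F b c = gridSum n F a c := by
  rw [gridSum, gridSum, gridSum, ← Finset.sum_union]
  · congr 1
    ext i
    simp only [Finset.mem_union, mem_gridIn]
    rw [← Set.mem_union, Set.Ico_union_Ico_eq_Ico hab hbc]
  · rw [Finset.disjoint_left]
    intro i hi hi'
    rw [mem_gridIn] at hi hi'
    exact absurd hi.2 (not_lt.2 hi'.1)

theorem sum_gridSum (n : ℕ) (F : ℝ → ℝ) {a : ℕ → ℝ} (ha : Monotone a) (c : ℕ) :
    ∑ i ∈ Finset.range c, gridSum n F (a i) (a (i + 1)) = gridSum n F (a 0) (a c) := by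
  induction c with
  | zero => simp [gridSum, gridIn]
  | succ c ih =>
    rw [Finset.sum_range_succ, ih, gridSum_add n F (ha (Nat.zero_le _)) (ha (Nat.le_succ _))]

theorem gridSum_zero_one (n : ℕ) (F : ℝ → ℝ) :
    gridSum n F 0 1 = ∑ i : Fin n, F ((i : ℝ) / n) := by
  rw [gridSum]
  congr 1
  ext i
  have hn : (0 : ℝ) < n := by exact_mod_cast i.pos
  have : (i : ℝ) < n := by exact_mod_cast i.2
  simp only [mem_gridIn, Finset.mem_univ, iff_true]
  exact ⟨by positivity, (div_lt_one hn).2 this⟩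

/-- Partial sums over initial parts of cells. -/
theorem CellBound.abs_gridSum_le {m n : ℕ} (hm : 2 ≤ m) {f : ℝ → ℝ} {Γ H : ℝ}
    (hΓ : 0 ≤ Γ) (cb : CellBound m n Γ f) (hH : ∀ x, |f x| ≤ H) (d : ℕ) :
    ∀ j, n ≤ m ^ (j + d) → ∀ l < m ^ j, ∀ x ∈ Set.Icc ((l : ℝ) / (m : ℝ) ^ j)
      (((l : ℝ) + 1) / (m : ℝ) ^ j), |gridSum n f ((l : ℝ) / (m : ℝ) ^ j) x| ≤
        3 * (m : ℝ) ^ 2 * Γ * √(n / (m : ℝ) ^ j) + H := by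
  have hm2 : (2 : ℝ) ≤ m := by exact_mod_cast hm
  have hH0 : 0 ≤ H := (abs_nonneg _).trans (hH 0)
  -- A cell no wider than the grid spacing has at most one grid point; this is the source of the
  -- term `H`.
  have base : ∀ j, n ≤ m ^ j → ∀ l < m ^ j, ∀ x ∈ Set.Icc ((l : ℝ) / (m : ℝ) ^ j)
      (((l : ℝ) + 1) / (m : ℝ) ^ j), |gridSum n f ((l : ℝ) / (m : ℝ) ^ j) x| ≤
        3 * (m : ℝ) ^ 2 * Γ * √(n / (m : ℝ) ^ j) + H := by
    intro j hj l hl x hx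
    have hW : (0 : ℝ) < (m : ℝ) ^ j := by positivity
    obtain ⟨ha, hb⟩ := cell_subset hm hl
    rw [← add_div] at hb
    have hcard : (gridIn n (Set.Ico ((l : ℝ) / (m : ℝ) ^ j) x)).card ≤ 1 := by
      rw [card_gridIn_Ico (hx.2.trans hb)]
      have : (n : ℝ) * x ≤ n * ((l : ℝ) / (m : ℝ) ^ j) + 1 := by
        calc (n : ℝ) * x ≤ n * (((l : ℝ) + 1) / (m : ℝ) ^ j) := by gcongr; exact hx.2
          _ = n * ((l : ℝ) / (m : ℝ) ^ j) + n / (m : ℝ) ^ j := by ring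
          _ ≤ _ := by
            gcongr
            rw [div_le_one hW]
            exact_mod_cast hj
      have h1 := Nat.ceil_mono this
      rw [Nat.ceil_add_one (by positivity)] at h1
      omega
    have h1 : |gridSum n f ((l : ℝ) / (m : ℝ) ^ j) x| ≤ H := by
      refine (Finset.abs_sum_le_sum_abs _ _).trans ?_
      refine (Finset.sum_le_card_nsmul _ _ H fun i _ => hH _).trans ?_
      rw [nsmul_eq_mul]
      exact mul_le_of_le_one_left hH0 (by exact_mod_cast hcard)
    have : 0 ≤ 3 * (m : ℝ) ^ 2 * Γ * √(n / (m : ℝ) ^ j) := by positivity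
    linarith
  induction d with
  | zero => exact base
  | succ d ih =>
    intro j hj l hl x hx
    by_cases hnj : n ≤ m ^ j
    · exact base j hnj l hl x hx
    rw [not_le] at hnj
    have hW : (0 : ℝ) < (m : ℝ) ^ j := by positivity
    have hW' : (0 : ℝ) < (m : ℝ) ^ (j + 1) := by positivity
    have hWW : (m : ℝ) ^ (j + 1) = (m : ℝ) ^ j * m := pow_succ _ _
    have hla : (l : ℝ) / (m : ℝ) ^ j = ((l * m : ℕ) : ℝ) / (m : ℝ) ^ (j + 1) := by
      rw [hWW]; push_cast; field_simp
    have hlb : ((l : ℝ) + 1) / (m : ℝ) ^ j = ((l * m + m : ℕ) : ℝ) / (m : ℝ) ^ (j + 1) := by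
      rw [hWW]; push_cast; field_simp
    -- The child that contains `x`: the children to its left enter with their full sums, bounded by
    -- `cb`, and the induction hypothesis handles the remaining part.
    obtain ⟨c, hc, hcx⟩ : ∃ c < m, x ∈ Set.Icc (((l * m + c : ℕ) : ℝ) / (m : ℝ) ^ (j + 1))
        ((((l * m + c : ℕ) : ℝ) + 1) / (m : ℝ) ^ (j + 1)) := by
      rcases hx.2.lt_or_eq with hlt | heq
      · have h1 := hx.1
        rw [hla, div_le_iff₀ hW'] at h1
        rw [hlb, lt_div_iff₀ hW'] at hlt
        have h2 : l * m ≤ ⌊x * (m : ℝ) ^ (j + 1)⌋₊ := Nat.le_floor h1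
        have h0 : 0 ≤ x * (m : ℝ) ^ (j + 1) := le_trans (by positivity) h1
        have h3 : ⌊x * (m : ℝ) ^ (j + 1)⌋₊ < l * m + m := (Nat.floor_lt h0).2 hlt
        refine ⟨⌊x * (m : ℝ) ^ (j + 1)⌋₊ - l * m, by omega, ?_⟩
        rw [Nat.add_sub_cancel' h2]
        exact ⟨(div_le_iff₀ hW').2 (Nat.floor_le h0),
          (le_div_iff₀ hW').2 (Nat.lt_floor_add_one _).le⟩
      · refine ⟨m - 1, by omega, ?_⟩
        have e : ((l * m + (m - 1) : ℕ) : ℝ) + 1 = ((l * m + m : ℕ) : ℝ) := by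
          exact_mod_cast (by omega : l * m + (m - 1) + 1 = l * m + m)
        rw [heq, hlb, e]
        exact ⟨by gcongr; omega, le_rfl⟩
    have hmono : Monotone fun c : ℕ => ((l * m + c : ℕ) : ℝ) / (m : ℝ) ^ (j + 1) := fun a b hab => by
      beta_reduce; gcongr
    have hsplit := sum_gridSum n f hmono c
    beta_reduce at hsplit
    rw [add_zero, ← hla] at hsplit
    have hlt : ∀ c < m, l * m + c < m ^ (j + 1) := fun c hc => by
      calc _ < l * m + m := by omega
        _ = (l + 1) * m := by ring
        _ ≤ m ^ j * m := Nat.mul_le_mul_right _ hl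
        _ = _ := (pow_succ _ _).symm
    have h1 := ih (j + 1) (by rw [add_assoc, add_comm 1 d]; exact hj) _ (hlt c hc) x hcx
    have hq : 1 ≤ (m : ℝ) * (n / (m : ℝ) ^ (j + 1)) := by
      rw [hWW, mul_div_assoc', mul_comm (m : ℝ) n, mul_div_mul_right _ _ (by positivity),
        one_le_div hW]
      exact_mod_cast hnj.le
    set t := (n : ℝ) / (m : ℝ) ^ (j + 1) with ht
    have ht0 : 0 ≤ t := by positivity
    have h2 : |∑ i ∈ Finset.range c, gridSum n f (((l * m + i : ℕ) : ℝ) / (m : ℝ) ^ (j + 1))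
        (((l * m + (i + 1) : ℕ) : ℝ) / (m : ℝ) ^ (j + 1))| ≤ m * (m * Γ * √t) := by
      refine (Finset.abs_sum_le_sum_abs _ _).trans ?_
      refine (Finset.sum_le_card_nsmul _ _ (m * Γ * √t) fun i hi => ?_).trans ?_
      · have hi' := hlt i ((Finset.mem_range.1 hi).trans hc)
        obtain ⟨ha', hb'⟩ := cell_subset hm hi'
        rw [← add_div] at hb'
        have h3 := cb (j + 1) (by omega) _ hi'
        have h4 := card_gridIn_Ico_le (n := n) (by gcongr; linarith) ha' hb'
        have e : (((l * m + (i + 1) : ℕ) : ℝ) / (m : ℝ) ^ (j + 1)) =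
            ((((l * m + i : ℕ) : ℝ) + 1) / (m : ℝ) ^ (j + 1)) := by push_cast; ring
        rw [e]
        refine h3.trans ?_
        have e2 : (n : ℝ) * (((l * m + i : ℕ) + 1 : ℝ) / (m : ℝ) ^ (j + 1) -
            ((l * m + i : ℕ) : ℝ) / (m : ℝ) ^ (j + 1)) = t := by rw [ht]; ring
        rw [e2] at h4
        have h5 : √((gridIn n (cell m (j + 1) (l * m + i))).card : ℝ) ≤ m * √t := by
          refine Real.sqrt_le_iff.2 ⟨by positivity, h4.trans ?_⟩
          rw [mul_pow, Real.sq_sqrt ht0]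
          nlinarith
        calc _ ≤ Γ * (m * √t) := by gcongr
          _ = _ := by ring
      · rw [Finset.card_range, nsmul_eq_mul]
        gcongr
    have h6 : √(n / (m : ℝ) ^ j) = √m * √t := by
      rw [← Real.sqrt_mul (by positivity), ht, hWW]
      congr 1; field_simp
    -- This closes the recursion: in units of `m² Γ √t`, the full children contribute `1` and the
    -- partial child `3`, and `1 + 3 ≤ 3 √m`.
    have h7 : (4 / 3 : ℝ) ≤ √m := by
      refine Real.le_sqrt_of_sq_le (by linarith)
    rw [← gridSum_add n f (a := (l : ℝ) / (m : ℝ) ^ j)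
      (b := ((l * m + c : ℕ) : ℝ) / (m : ℝ) ^ (j + 1)) (by
        rw [hla]; gcongr; omega) hcx.1, ← hsplit]
    refine (abs_add_le _ _).trans ?_
    rw [h6]
    have h8 : 0 ≤ (m : ℝ) ^ 2 * Γ * √t := by positivity
    nlinarith

/-- Abel summation in integral form: writing `u(y) = u(b) - ∫_y^b u'` exchanges the weighted sum for
the partial sums of `f`, integrated against `u'`. -/
theorem abs_gridSum_mul_le {n : ℕ} {f u u' : ℝ → ℝ} (hu : ∀ x, HasDerivAt u (u' x) x)
    (hu' : Continuous u') {a b D : ℝ} (hab : a ≤ b)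
    (hD : ∀ x ∈ Set.Icc a b, |gridSum n f a x| ≤ D) :
    |gridSum n (fun x => u x * f x) a b| ≤ D * (|u b| + ∫ x in a..b, |u' x|) := by
  classical
  set F := gridIn n (Set.Ico a b)
  have hpart : ∀ x ∈ Set.Icc a b, gridSum n f a x =
      ∑ i ∈ F, if (i : ℝ) / n < x then f ((i : ℝ) / n) else 0 := fun x hx => by
    rw [gridSum, ← Finset.sum_filter]
    congr 1
    ext i
    simp only [F, Finset.mem_filter, mem_gridIn, Set.mem_Ico]
    constructor
    · exact fun h => ⟨⟨h.1, h.2.trans_le hx.2⟩, h.2⟩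
    · exact fun h => ⟨h.1.1, h.2⟩
  have hint : ∀ y ∈ Set.Icc a b, ∫ x in a..b, (if y < x then u' x else 0) = u b - u y := by
    intro y hy
    have h1 : IntervalIntegrable (fun x => if y < x then u' x else 0) volume a b := by
      have := (hu'.intervalIntegrable (μ := volume) a b)
      rw [intervalIntegrable_iff] at this ⊢
      exact this.indicator (measurableSet_Ioi (a := y))
    have h2 := intervalIntegral.integral_add_adjacent_intervals (a := a) (b := y) (c := b)
      (h1.mono_set (by rw [Set.uIcc_of_le hy.1, Set.uIcc_of_le hab]; exact Set.Icc_subset_Icc le_rfl hy.2))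
      (h1.mono_set (by rw [Set.uIcc_of_le hy.2, Set.uIcc_of_le hab]; exact Set.Icc_subset_Icc hy.1 le_rfl))
    rw [← h2]
    have e1 : ∫ x in a..y, (if y < x then u' x else 0) = 0 := by
      rw [intervalIntegral.integral_of_le hy.1]
      refine (setIntegral_congr_fun measurableSet_Ioc fun x hx => ?_).trans (integral_zero _ _)
      simp [not_lt.2 hx.2]
    have e2 : ∫ x in y..b, (if y < x then u' x else 0) = ∫ x in y..b, u' x := by
      rw [intervalIntegral.integral_of_le hy.2, intervalIntegral.integral_of_le hy.2]
      exact setIntegral_congr_fun measurableSet_Ioc fun x hx => by simp [hx.1]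
    rw [e1, e2, zero_add, intervalIntegral.integral_eq_sub_of_hasDerivAt (fun x _ => hu x)
      (hu'.intervalIntegrable _ _)]
  have hii : ∀ i ∈ F, IntervalIntegrable
      (fun x => (if (i : ℝ) / n < x then u' x else 0) * f ((i : ℝ) / n)) volume a b := by
    intro i _
    have := (hu'.intervalIntegrable (μ := volume) a b)
    rw [intervalIntegrable_iff] at this ⊢
    exact (this.indicator (measurableSet_Ioi (a := (i : ℝ) / n))).mul_const _
  have hmain : gridSum n (fun x => u x * f x) a b = u b * gridSum n f a b -
      ∫ x in a..b, ∑ i ∈ F, (if (i : ℝ) / n < x then u' x else 0) * f ((i : ℝ) / n) := by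
    rw [intervalIntegral.integral_finsetSum hii, gridSum, gridSum, Finset.mul_sum,
      ← Finset.sum_sub_distrib]
    refine Finset.sum_congr rfl fun i hi => ?_
    have hi' := mem_gridIn.1 hi
    rw [intervalIntegral.integral_mul_const, hint _ ⟨hi'.1, hi'.2.le⟩]
    ring
  have hb : |∫ x in a..b, ∑ i ∈ F, (if (i : ℝ) / n < x then u' x else 0) * f ((i : ℝ) / n)| ≤
      ∫ x in a..b, D * |u' x| := by
    refine (intervalIntegral.abs_integral_le_integral_abs hab).trans ?_
    refine intervalIntegral.integral_mono_on hab ?_ ((hu'.abs.const_mul D).intervalIntegrable _ _)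
      fun x hx => ?_
    · refine IntervalIntegrable.abs ?_
      have := IntervalIntegrable.sum F hii
      rwa [Finset.sum_fn] at this
    · have : ∑ i ∈ F, (if (i : ℝ) / n < x then u' x else 0) * f ((i : ℝ) / n) =
          gridSum n f a x * u' x := by
        rw [hpart x hx, Finset.sum_mul]
        refine Finset.sum_congr rfl fun i _ => ?_
        split_ifs <;> ring
      rw [this, abs_mul]
      gcongr
      exact hD x hx
  rw [hmain]
  calc _ ≤ |u b * gridSum n f a b| + |∫ x in a..b, ∑ i ∈ F,
        (if (i : ℝ) / n < x then u' x else 0) * f ((i : ℝ) / n)| := abs_sub _ _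
    _ ≤ |u b| * D + ∫ x in a..b, D * |u' x| := by
      rw [abs_mul]
      gcongr
      exact hD b (Set.right_mem_Icc.2 hab)
    _ = _ := by rw [intervalIntegral.integral_const_mul]; ring

/-- Averaging `|u(b)| ≤ |u(y)| + ∫ |u'|` over `y`. This trades the boundary terms of Abel summation
for integrals that add up over the cells. -/
theorem abs_right_le_integral {u u' : ℝ → ℝ} (hu : ∀ x, HasDerivAt u (u' x) x)
    (hu' : Continuous u') {a b : ℝ} (hab : a ≤ b) :
    (b - a) * |u b| ≤ (∫ x in a..b, |u x|) + (b - a) * ∫ x in a..b, |u' x| := by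
  have hc : Continuous u := continuous_iff_continuousAt.2 fun x => (hu x).continuousAt
  have h1 : ∀ y ∈ Set.Icc a b, |u b| ≤ |u y| + ∫ x in a..b, |u' x| := fun y hy => by
    have h2 : ∫ x in y..b, u' x = u b - u y := intervalIntegral.integral_eq_sub_of_hasDerivAt
      (fun x _ => hu x) (hu'.intervalIntegrable _ _)
    have h3 : |u b - u y| ≤ ∫ x in a..b, |u' x| := by
      rw [← h2]
      refine (intervalIntegral.abs_integral_le_integral_abs hy.2).trans ?_
      exact intervalIntegral.integral_mono_interval hy.1 hy.2 le_rfl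
        (.of_forall fun _ => abs_nonneg _) (hu'.abs.intervalIntegrable _ _)
    calc |u b| = |u y + (u b - u y)| := by ring_nf
      _ ≤ _ := (abs_add_le _ _).trans (by linarith)
  have h4 := intervalIntegral.integral_mono_on (μ := volume) hab intervalIntegrable_const
    ((hc.abs.intervalIntegrable a b).add intervalIntegrable_const) h1
  rw [intervalIntegral.integral_const, intervalIntegral.integral_add (hc.abs.intervalIntegrable _ _)
    intervalIntegrable_const, intervalIntegral.integral_const] at h4
  simpa using h4

/-- The pairing of grid values with a smooth function. -/
theorem CellBound.abs_sum_mul_le {m n : ℕ} (hm : 2 ≤ m) {f u u' : ℝ → ℝ} {Γ H : ℝ}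
    (hΓ : 0 ≤ Γ) (cb : CellBound m n Γ f) (hH : ∀ x, |f x| ≤ H)
    (hu : ∀ x, HasDerivAt u (u' x) x) (hu' : Continuous u') (j : ℕ) :
    |∑ i : Fin n, u ((i : ℝ) / n) * f ((i : ℝ) / n)| ≤
      (3 * (m : ℝ) ^ 2 * Γ * √(n / (m : ℝ) ^ j) + H) *
        ((m : ℝ) ^ j * ∫ x, |u x| ∂torus + 2 * ∫ x, |u' x| ∂torus) := by
  have hc : Continuous u := continuous_iff_continuousAt.2 fun x => (hu x).continuousAt
  have hW : (0 : ℝ) < (m : ℝ) ^ j := by positivity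
  set D := 3 * (m : ℝ) ^ 2 * Γ * √(n / (m : ℝ) ^ j) + H
  have hH0 : 0 ≤ H := (abs_nonneg _).trans (hH 0)
  have hD0 : 0 ≤ D := by positivity
  have hmono : Monotone fun l : ℕ => (l : ℝ) / (m : ℝ) ^ j := fun a b hab => by
    beta_reduce; gcongr
  have h0 := sum_gridSum n (fun x => u x * f x) hmono (m ^ j)
  have e1 : ((m ^ j : ℕ) : ℝ) / (m : ℝ) ^ j = 1 := by push_cast; exact div_self hW.ne'
  beta_reduce at h0
  rw [e1, Nat.cast_zero, zero_div, gridSum_zero_one] at h0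
  rw [← h0, ← sum_cellIntegral (j := j) hm (integrable_torus_of_continuous hc.abs),
    ← sum_cellIntegral (j := j) hm (integrable_torus_of_continuous hu'.abs), Finset.mul_sum,
    Finset.mul_sum, ← Finset.sum_add_distrib, Finset.mul_sum]
  refine (Finset.abs_sum_le_sum_abs _ _).trans (Finset.sum_le_sum fun l hl => ?_)
  have hl' := Finset.mem_range.1 hl
  have hab : (l : ℝ) / (m : ℝ) ^ j ≤ ((l : ℝ) + 1) / (m : ℝ) ^ j := by gcongr; linarith
  push_cast
  refine (abs_gridSum_mul_le hu hu' hab fun x hx =>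
    cb.abs_gridSum_le hm hΓ hH n j ?_ l hl' x hx).trans ?_
  -- Depth `n` is enough for the recursion, since `n < m ^ n`.
  · exact (Nat.lt_pow_self (by omega : 1 < m)).le.trans
      (Nat.pow_le_pow_right (by omega) (by omega))
  · refine mul_le_mul_of_nonneg_left ?_ hD0
    have h1 := abs_right_le_integral hu hu' hab
    have e2 : ((l : ℝ) + 1) / (m : ℝ) ^ j - (l : ℝ) / (m : ℝ) ^ j = 1 / (m : ℝ) ^ j := by ring
    rw [e2] at h1
    have h2 : |u (((l : ℝ) + 1) / (m : ℝ) ^ j)| ≤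
        (m : ℝ) ^ j * cellIntegral m (fun x => |u x|) j l +
          cellIntegral m (fun x => |u' x|) j l := by
      have h3 := mul_le_mul_of_nonneg_left h1 hW.le
      rw [mul_add, ← mul_assoc, ← mul_assoc, mul_one_div_cancel hW.ne', one_mul, one_mul] at h3
      exact h3
    rw [← cellIntegral]
    linarith

/-- The error of the quadrature rule with nodes `i / n`. -/
theorem abs_integral_sub_sum_le {n : ℕ} (hn : 1 ≤ n) {F F' : ℝ → ℝ}
    (hF : ∀ x, HasDerivAt F (F' x) x) (hF' : Continuous F') :
    |∫ x, F x ∂torus - (1 / n : ℝ) * ∑ i : Fin n, F ((i : ℝ) / n)| ≤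
      (1 / n : ℝ) * ∫ x, |F' x| ∂torus := by
  have hc : Continuous F := continuous_iff_continuousAt.2 fun x => (hF x).continuousAt
  have hn0 : (0 : ℝ) < n := by exact_mod_cast hn
  have split : ∀ G : ℝ → ℝ, Continuous G → ∫ x, G x ∂torus =
      ∑ i ∈ Finset.range n, ∫ x in ((i : ℝ) / n)..(((i : ℝ) + 1) / n), G x := fun G hG => by
    have := intervalIntegral.sum_integral_adjacent_intervals (f := G) (μ := volume) (n := n)
      (a := fun i : ℕ => (i : ℝ) / n) (fun i _ => hG.intervalIntegrable _ _)
    rw [integral_torus]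
    simp only [Nat.cast_zero, zero_div, div_self hn0.ne', Nat.cast_add, Nat.cast_one] at this
    exact this.symm
  rw [split F hc, split _ hF'.abs, Fin.sum_univ_eq_sum_range (fun i => F ((i : ℝ) / n)),
    Finset.mul_sum, Finset.mul_sum, ← Finset.sum_sub_distrib]
  refine (Finset.abs_sum_le_sum_abs _ _).trans (Finset.sum_le_sum fun i _ => ?_)
  set a := (i : ℝ) / n
  have hb : ((i : ℝ) + 1) / n = a + 1 / n := by simp only [a]; ring
  rw [hb]
  have hw : (0 : ℝ) < 1 / n := by positivity
  have h1 : (∫ x in a..(a + 1 / n), F x) - 1 / n * F a = ∫ x in a..(a + 1 / n), (F x - F a) := by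
    rw [intervalIntegral.integral_sub (hc.intervalIntegrable _ _) intervalIntegrable_const,
      intervalIntegral.integral_const, add_sub_cancel_left, smul_eq_mul]
  rw [h1]
  have h2 := intervalIntegral.norm_integral_le_of_norm_le_const (a := a) (b := a + 1 / n)
    (f := fun x => F x - F a) (C := ∫ x in a..(a + 1 / n), |F' x|) (fun x hx => by
      rw [Set.uIoc_of_le (by linarith)] at hx
      rw [← intervalIntegral.integral_eq_sub_of_hasDerivAt (fun y _ => hF y)
        (hF'.intervalIntegrable _ _), Real.norm_eq_abs]
      refine (intervalIntegral.abs_integral_le_integral_abs hx.1.le).trans ?_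
      exact intervalIntegral.integral_mono_interval le_rfl hx.1.le hx.2
        (.of_forall fun _ => abs_nonneg _) (hF'.abs.intervalIntegrable _ _))
  rw [add_sub_cancel_left, abs_of_pos hw, mul_comm] at h2
  exact h2

/-! ### Frequency blocks -/

/-- The frequencies `|j| < m ^ J`. -/
def lowFreq (m J : ℕ) : Finset ℤ := freqRange (m ^ J - 1)

theorem mem_lowFreq {m J : ℕ} (hm : 2 ≤ m) {j : ℤ} : j ∈ lowFreq m J ↔ j.natAbs < m ^ J := by
  have : 0 < m ^ J := by positivity
  simp only [lowFreq, freqRange, Finset.mem_Icc]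
  omega

theorem neg_mem_lowFreq (m J : ℕ) : ∀ j ∈ lowFreq m J, -j ∈ lowFreq m J := neg_mem_freqRange _

theorem lowFreq_mono {m I J : ℕ} (hm : 2 ≤ m) (h : I ≤ J) : lowFreq m I ⊆ lowFreq m J := by
  intro j hj
  rw [mem_lowFreq hm] at hj ⊢
  exact hj.trans_le (Nat.pow_le_pow_right (by omega) h)

/-- The frequencies `m ^ I ≤ |j| < m ^ J`. -/
def freqBlock (m I J : ℕ) : Finset ℤ := lowFreq m J \ lowFreq m I

theorem mem_freqBlock {m I J : ℕ} (hm : 2 ≤ m) {j : ℤ} :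
    j ∈ freqBlock m I J ↔ m ^ I ≤ j.natAbs ∧ j.natAbs < m ^ J := by
  rw [freqBlock, Finset.mem_sdiff, mem_lowFreq hm, mem_lowFreq hm, not_lt, and_comm]

theorem neg_mem_freqBlock {m I J : ℕ} (hm : 2 ≤ m) :
    ∀ j ∈ freqBlock m I J, -j ∈ freqBlock m I J := by
  intro j hj
  rw [mem_freqBlock hm] at hj ⊢
  simpa using hj

/-- The Fourier coefficients of `f` decay like `m^{-iS}` over the blocks `m^i ≤ |j| < m^{i+1}`. -/
def BlockBound (m : ℕ) (S A : ℝ) (f : ℝ → ℝ) : Prop :=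
  ∀ i : ℕ, ∑ j ∈ freqBlock m i (i + 1), ‖coeff f j‖ ^ 2 ≤ (A * ((m : ℝ) ^ i) ^ (-S)) ^ 2

theorem BlockBound.sum_freq_pow_le {m : ℕ} (hm : 2 ≤ m) {S A : ℝ} {f : ℝ → ℝ}
    (h : BlockBound m S A f) (a i : ℕ) :
    ∑ j ∈ freqBlock m i (i + 1), ‖freq j ^ a * coeff f j‖ ^ 2 ≤
      ((2 * Real.pi * m) ^ a * A * ((m : ℝ) ^ i) ^ (a - S)) ^ 2 := by
  have hm0 : (0 : ℝ) < m := by positivity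
  have hW : (0 : ℝ) < (m : ℝ) ^ i := by positivity
  have hπ := Real.pi_pos
  calc _ ≤ ∑ j ∈ freqBlock m i (i + 1),
        ((2 * Real.pi * m * (m : ℝ) ^ i) ^ a) ^ 2 * ‖coeff f j‖ ^ 2 := by
        refine Finset.sum_le_sum fun j hj => ?_
        rw [norm_mul, norm_pow, norm_freq, mul_pow]
        have h1 : |(j : ℝ)| ≤ (m : ℝ) ^ (i + 1) := by
          have := ((mem_freqBlock hm).1 hj).2.le
          rw [← Int.cast_abs, Int.abs_eq_natAbs]
          exact_mod_cast this
        have h2 : 2 * Real.pi * |(j : ℝ)| ≤ 2 * Real.pi * m * (m : ℝ) ^ i := by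
          rw [pow_succ] at h1
          calc _ ≤ 2 * Real.pi * ((m : ℝ) ^ i * m) := by gcongr
            _ = _ := by ring
        gcongr
    _ ≤ ((2 * Real.pi * m * (m : ℝ) ^ i) ^ a) ^ 2 * (A * ((m : ℝ) ^ i) ^ (-S)) ^ 2 := by
        rw [← Finset.mul_sum]
        exact mul_le_mul_of_nonneg_left (h i) (by positivity)
    _ = _ := by
        rw [sub_eq_add_neg, Real.rpow_add hW, Real.rpow_natCast, mul_pow (2 * Real.pi * m)]
        ring

theorem pow_rpow_succ {m : ℕ} (hm : 2 ≤ m) (i : ℕ) (e : ℝ) :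
    ((m : ℝ) ^ (i + 1)) ^ e = (m : ℝ) ^ e * ((m : ℝ) ^ i) ^ e := by
  rw [pow_succ, Real.mul_rpow (by positivity) (by positivity), mul_comm]

/-- A geometric series summed by telescoping: as `m^{-2s} ≤ 1/2`, the quantity `W^{-2s}` of one
block is at most twice its decrease to the next level. -/
theorem BlockBound.sum_tail_le {m k : ℕ} (hm : 2 ≤ m) {s A : ℝ} {f : ℝ → ℝ}
    (hs : 1 / 2 ≤ s) (h : BlockBound m (k + s) A f) (J d : ℕ) :
    ∑ j ∈ freqBlock m J (J + d), ‖freq j ^ k * coeff f j‖ ^ 2 ≤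
      2 * ((2 * Real.pi * m) ^ k * A) ^ 2 *
        (((m : ℝ) ^ J) ^ (-(2 * s)) - ((m : ℝ) ^ (J + d)) ^ (-(2 * s))) := by
  induction d with
  | zero => simp [freqBlock]
  | succ d ih =>
    have hm2 : (2 : ℝ) ≤ m := by exact_mod_cast hm
    have hW : (0 : ℝ) < (m : ℝ) ^ (J + d) := by positivity
    have hsplit : freqBlock m J (J + (d + 1)) =
        freqBlock m J (J + d) ∪ freqBlock m (J + d) (J + d + 1) := by
      ext j
      have h1 : m ^ J ≤ m ^ (J + d) := Nat.pow_le_pow_right (by omega) (by omega)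
      have h2 : m ^ (J + d) ≤ m ^ (J + d + 1) := Nat.pow_le_pow_right (by omega) (by omega)
      simp only [Finset.mem_union, mem_freqBlock hm, ← add_assoc]
      omega
    have hdisj : Disjoint (freqBlock m J (J + d)) (freqBlock m (J + d) (J + d + 1)) := by
      rw [Finset.disjoint_left]
      intro j h1 h2
      rw [mem_freqBlock hm] at h1 h2
      omega
    rw [hsplit, Finset.sum_union hdisj]
    have h1 := h.sum_freq_pow_le hm k (J + d)
    have e1 : (((m : ℝ) ^ (J + d)) ^ ((k : ℝ) - (k + s))) ^ 2 =
        ((m : ℝ) ^ (J + d)) ^ (-(2 * s)) := by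
      rw [← Real.rpow_natCast, ← Real.rpow_mul hW.le]
      congr 1; push_cast; ring
    rw [mul_pow _ (((m : ℝ) ^ (J + d)) ^ _), e1] at h1
    have h2 : ((m : ℝ) ^ (J + (d + 1))) ^ (-(2 * s)) ≤
        1 / 2 * ((m : ℝ) ^ (J + d)) ^ (-(2 * s)) := by
      rw [← add_assoc, pow_rpow_succ hm]
      gcongr
      rw [Real.rpow_neg (by positivity), ← one_div]
      refine one_div_le_one_div_of_le two_pos (hm2.trans ?_)
      exact Real.self_le_rpow_of_one_le (by linarith) (by linarith)
    have h3 : 0 ≤ ((2 * Real.pi * m) ^ k * A) ^ 2 := by positivity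
    nlinarith

theorem trigPoly_sdiff {F G : Finset ℤ} (h : F ⊆ G) (c : ℤ → ℂ) :
    trigPoly (G \ F) c = trigPoly G c - trigPoly F c := by
  ext x
  rw [Pi.sub_apply, trigPoly, trigPoly, trigPoly, ← Complex.sub_re, Finset.sum_sdiff_eq_sub h]

theorem isWeakDeriv_zero {f : ℝ → ℝ} (hf : Integrable f torus) : IsWeakDeriv 0 f f :=
  ⟨hf, fun φ _ _ => by simp⟩

theorem tendsto_pow_sub_one {m : ℕ} (hm : 2 ≤ m) : Tendsto (fun J => m ^ J - 1) atTop atTop :=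
  (tendsto_sub_atTop_nat 1).comp (tendsto_pow_atTop_atTop_of_one_lt (by omega))

theorem IsHermitian.l2_trigPoly {F : Finset ℤ} {c : ℤ → ℂ} (h : IsHermitian F c) :
    l2 (trigPoly F c) = √(∑ j ∈ F, ‖c j‖ ^ 2) := by rw [l2, h.integral_sq]

/-- By Parseval, the squared tail beyond level `J` is the squared tail beyond level `J + d` plus
finitely many blocks; the former vanishes as `d → ∞`. -/
theorem BlockBound.l2_tail_le {m k : ℕ} (hm : 2 ≤ m) {s A : ℝ} {f g : ℝ → ℝ} (hA : 0 ≤ A)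
    (hs : 1 / 2 ≤ s) (h : BlockBound m (k + s) A f) (hfg : HasSobolevDeriv k f g) (J : ℕ) :
    l2 (g - iteratedDeriv k (partialSum (lowFreq m J) f)) ≤
      2 * ((2 * Real.pi * m) ^ k * A) * ((m : ℝ) ^ J) ^ (-s) := by
  have hπ := Real.pi_pos
  have hW : (0 : ℝ) < (m : ℝ) ^ J := by positivity
  have key : ∀ d, l2 (g - iteratedDeriv k (partialSum (lowFreq m J) f)) ^ 2 ≤
      l2 (g - iteratedDeriv k (partialSum (lowFreq m (J + d)) f)) ^ 2 +
        2 * ((2 * Real.pi * m) ^ k * A) ^ 2 * ((m : ℝ) ^ J) ^ (-(2 * s)) := fun d => by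
    rw [sq_l2_sub_partialSum hfg (neg_mem_lowFreq m _),
      sq_l2_sub_partialSum hfg (neg_mem_lowFreq m _)]
    have h1 := h.sum_tail_le hm hs J d
    rw [freqBlock, Finset.sum_sdiff_eq_sub (lowFreq_mono hm (Nat.le_add_right _ _))] at h1
    simp only [hfg.coeff_eq]
    have h2 : 0 ≤ 2 * ((2 * Real.pi * m) ^ k * A) ^ 2 * ((m : ℝ) ^ (J + d)) ^ (-(2 * s)) := by
      positivity
    linarith
  have hlim : Tendsto (fun d => l2 (g - iteratedDeriv k (partialSum (lowFreq m (J + d)) f)) ^ 2 +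
      2 * ((2 * Real.pi * m) ^ k * A) ^ 2 * ((m : ℝ) ^ J) ^ (-(2 * s))) atTop
      (𝓝 (0 ^ 2 + 2 * ((2 * Real.pi * m) ^ k * A) ^ 2 * ((m : ℝ) ^ J) ^ (-(2 * s)))) := by
    refine Tendsto.add_const _ (Tendsto.pow ?_ 2)
    exact ((tendsto_l2_sub_partialSum hfg).comp (tendsto_pow_sub_one hm)).comp
      (tendsto_add_atTop_nat J |>.congr fun d => add_comm _ _)
  have h1 := ge_of_tendsto' hlim key
  refine (Real.le_sqrt_of_sq_le h1).trans ?_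
  refine Real.sqrt_le_iff.2 ⟨by positivity, ?_⟩
  have e : (((m : ℝ) ^ J) ^ (-s)) ^ 2 = ((m : ℝ) ^ J) ^ (-(2 * s)) := by
    rw [← Real.rpow_natCast, ← Real.rpow_mul hW.le]
    congr 1; push_cast; ring
  rw [mul_pow _ (((m : ℝ) ^ J) ^ (-s)), e]
  have h2 : 0 ≤ ((2 * Real.pi * m) ^ k * A) ^ 2 * ((m : ℝ) ^ J) ^ (-(2 * s)) := by positivity
  nlinarith

/-- A continuous function with decaying blocks of Fourier coefficients has a weak derivative. -/
theorem BlockBound.exists_hasSobolevDeriv {m k : ℕ} (hk : 1 ≤ k) (hm : 2 ≤ m) {s A : ℝ}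
    {f : ℝ → ℝ} (hA : 0 ≤ A) (hs : 1 / 2 ≤ s) (h : BlockBound m (k + s) A f) (hf : IsCont₀ f) :
    ∃ g, HasSobolevDeriv k f g ∧ l2 g ≤ 2 * ((2 * Real.pi * m) ^ k * A) := by
  have hπ := Real.pi_pos
  -- No derivative is assumed to exist: those of the partial sums form a Cauchy sequence in `L²`,
  -- and the limit is a weak derivative of `f`.
  set v : ℕ → ℝ → ℝ := fun J => iteratedDeriv k (partialSum (lowFreq m J) f) with hv
  have hvL : ∀ J, MemLp (v J) 2 torus := fun J => memLp_torus_of_continuous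
    (contDiff_iteratedDeriv (contDiff_trigPoly _ _) k).continuous 2
  set B := 2 * ((2 * Real.pi * m) ^ k * A) with hB
  have hdiff : ∀ J d, l2 (v (J + d) - v J) ≤ B * ((m : ℝ) ^ J) ^ (-s) := fun J d => by
    have hW : (0 : ℝ) < (m : ℝ) ^ J := by positivity
    have e1 : v (J + d) - v J =
        trigPoly (freqBlock m J (J + d)) fun j => freq j ^ k * coeff f j := by
      simp only [hv, partialSum]
      rw [iteratedDeriv_trigPoly, iteratedDeriv_trigPoly, freqBlock,
        trigPoly_sdiff (lowFreq_mono hm (Nat.le_add_right _ _))]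
    rw [e1, ((isHermitian_coeff (neg_mem_freqBlock hm) f).freq_pow_mul k).l2_trigPoly]
    refine Real.sqrt_le_iff.2 ⟨by positivity, (h.sum_tail_le hm hs J d).trans ?_⟩
    have e : (((m : ℝ) ^ J) ^ (-s)) ^ 2 = ((m : ℝ) ^ J) ^ (-(2 * s)) := by
      rw [← Real.rpow_natCast, ← Real.rpow_mul hW.le]
      congr 1; push_cast; ring
    rw [mul_pow B, e, hB]
    have h1 : 0 ≤ ((2 * Real.pi * m) ^ k * A) ^ 2 * ((m : ℝ) ^ J) ^ (-(2 * s)) := by positivity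
    have h2 : 0 ≤ ((2 * Real.pi * m) ^ k * A) ^ 2 * ((m : ℝ) ^ (J + d)) ^ (-(2 * s)) := by
      positivity
    nlinarith
  have hdist : ∀ J d, dist ((hvL J).toLp (v J)) ((hvL (J + d)).toLp (v (J + d))) ≤
      B * ((m : ℝ) ^ J) ^ (-s) := fun J d => by
    rw [dist_comm, dist_eq_norm, ← MemLp.toLp_sub, Lp.norm_toLp,
      eLpNorm_two_eq_l2 ((hvL _).sub (hvL _)), ENNReal.toReal_ofReal (l2_nonneg _)]
    exact hdiff J d
  have hB0 : Tendsto (fun J : ℕ => B * ((m : ℝ) ^ J) ^ (-s)) atTop (𝓝 0) := by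
    have h1 : Tendsto (fun J : ℕ => (m : ℝ) ^ J) atTop atTop :=
      tendsto_pow_atTop_atTop_of_one_lt (by exact_mod_cast (by omega : 1 < m))
    simpa using ((tendsto_rpow_neg_atTop (by linarith : 0 < s)).comp h1).const_mul B
  have hcauchy : CauchySeq fun J => (hvL J).toLp (v J) := by
    refine cauchySeq_of_le_tendsto_0' (fun J => B * ((m : ℝ) ^ J) ^ (-s)) (fun J I hJI => ?_) hB0
    obtain ⟨d, rfl⟩ := Nat.exists_eq_add_of_le hJI
    exact hdist J d
  obtain ⟨G, hG⟩ := cauchySeq_tendsto_of_complete hcauchy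
  have hGL := Lp.memLp G
  have hlim : Tendsto (fun J => l2 (G - v J)) atTop (𝓝 0) := by
    have h1 := (tendsto_iff_norm_sub_tendsto_zero.1 hG)
    refine h1.congr fun J => ?_
    have e : (hvL J).toLp (v J) - G = ((hvL J).sub hGL).toLp (v J - ⇑G) := by
      rw [MemLp.toLp_sub (hvL J) hGL, Lp.toLp_coeFn]
    rw [e, Lp.norm_toLp, eLpNorm_two_eq_l2 ((hvL _).sub hGL), ENNReal.toReal_ofReal (l2_nonneg _)]
    simp only [l2, Pi.sub_apply]
    congr 2; ext x; ring
  have hfL : MemLp f 2 torus := memLp_torus_of_continuous hf.continuous 2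
  have hweak : IsWeakDeriv k f G := by
    refine IsWeakDeriv.of_tendsto (u := fun J => partialSum (lowFreq m J) f) (v := v)
      (fun J => isWeakDeriv_iteratedDeriv (contDiff_trigPoly _ _) (trigPoly_periodic _ _) k)
      (fun J => memLp_torus_of_continuous (contDiff_trigPoly _ _).continuous 2) hvL hfL hGL ?_ hlim
    have h0 : HasSobolevDeriv 0 f f := ⟨hf, isWeakDeriv_zero hf.integrable, hfL⟩
    have h1 := (tendsto_l2_sub_partialSum h0).comp (tendsto_pow_sub_one hm)
    simpa [Function.comp_def, lowFreq] using h1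
  have hfG : HasSobolevDeriv k f G := ⟨hf, hweak, hGL⟩
  refine ⟨G, hfG, ?_⟩
  have h1 := h.l2_tail_le hm hA hs hfG 0
  -- At level zero only the constant mode is removed, and `D^k` annihilates it, so the tail estimate
  -- bounds all of `G`.
  have h2 : iteratedDeriv k (partialSum (lowFreq m 0) f) = 0 := by
    rw [partialSum, iteratedDeriv_trigPoly]
    ext x
    have : lowFreq m 0 = {0} := by
      ext j; rw [mem_lowFreq hm]; simp
    simp [trigPoly, this, freq, show k ≠ 0 by omega]
  simpa [h2] using h1

/-! ### The variational source condition -/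

theorem l2_partialSum_le {k : ℕ} {f g : ℝ → ℝ} (h : HasSobolevDeriv k f g) {F : Finset ℤ}
    (hF : ∀ j ∈ F, -j ∈ F) : l2 (iteratedDeriv k (partialSum F f)) ≤ l2 g := by
  rw [partialSum, iteratedDeriv_trigPoly, ((isHermitian_coeff hF f).freq_pow_mul k).l2_trigPoly]
  refine Real.sqrt_le_iff.2 ⟨l2_nonneg _, ?_⟩
  have h1 := sum_le_hasSum F (fun j _ => by positivity) (hasSum_sq_coeff h.memLp)
  rw [← sq_l2] at h1
  simpa only [h.coeff_eq] using h1

theorem poincareConst_nonneg : 0 ≤ poincareConst := Real.sqrt_nonneg _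

theorem HasSobolevDeriv.deriv {k : ℕ} {u : ℝ → ℝ} (hu : ContDiff ℝ (⊤ : ℕ∞) u) (h : IsCont₀ u) :
    HasSobolevDeriv k (iteratedDeriv 1 u) (iteratedDeriv (k + 1) u) := by
  have hu' := contDiff_iteratedDeriv hu 1
  have e : iteratedDeriv (k + 1) u = iteratedDeriv k (iteratedDeriv 1 u) := by
    rw [iteratedDeriv_succ', iteratedDeriv_one]
  rw [e]
  refine .of_contDiff hu' ⟨hu'.continuous, periodic_iteratedDeriv h.periodic 1, ?_⟩ k
  rw [integral_torus, intervalIntegral.integral_eq_sub_of_hasDerivAt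
    (fun x _ => hasDerivAt_iteratedDeriv hu 0 x) (hu'.continuous.intervalIntegrable _ _)]
  have := h.periodic 0
  simpa [sub_eq_zero] using this

/-- For order one there is nothing to prove; for higher order the Poincaré inequality is applied to
the first derivative, which has mean zero by periodicity. -/
theorem l2_deriv_le {k : ℕ} (hk : 1 ≤ k) {u : ℝ → ℝ} (hu : ContDiff ℝ (⊤ : ℕ∞) u)
    (h : IsCont₀ u) : l2 (iteratedDeriv 1 u) ≤ (1 + poincareConst) * l2 (iteratedDeriv k u) := by
  have hP := poincareConst_nonneg
  obtain ⟨k, rfl⟩ := Nat.exists_eq_add_of_le' hk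
  have h0 := l2_nonneg (iteratedDeriv (k + 1) u)
  rcases Nat.eq_zero_or_pos k with rfl | hk'
  · rw [zero_add]; nlinarith [l2_nonneg (iteratedDeriv 1 u)]
  · have h1 := l2_le_of_abs_le (mul_nonneg hP h0)
      (.of_forall fun x => (HasSobolevDeriv.deriv (k := k) hu h).abs_le hk' x)
    linarith

/-- The quadrature error for the product of a smooth function and a Sobolev function. -/
theorem HasSobolevDeriv.abs_integral_mul_sub_sum_le {k n : ℕ} (hk : 1 ≤ k) (hn : 1 ≤ n)
    {f g u : ℝ → ℝ} (h : HasSobolevDeriv k f g) (hu : ContDiff ℝ (⊤ : ℕ∞) u) :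
    |∫ x, u x * f x ∂torus - (1 / n : ℝ) * ∑ i : Fin n, u ((i : ℝ) / n) * f ((i : ℝ) / n)| ≤
      (1 / n : ℝ) * ((l2 u + l2 (iteratedDeriv 1 u)) * ((1 + poincareConst) * l2 g)) := by
  have hP := poincareConst_nonneg
  have hn0 : (0 : ℝ) < n := by exact_mod_cast hn
  obtain ⟨U, hU⟩ := (isCompact_Icc (a := (0 : ℝ)) (b := 1)).exists_bound_of_continuousOn
    hu.continuous.continuousOn
  have hU0 : 0 ≤ U := (norm_nonneg _).trans (hU 0 (by simp))
  -- The quadrature estimate needs a differentiable integrand, so `f` is replaced by a Fourier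
  -- partial sum; this costs at most `U ε` in the integral and again in the sum.
  have key : ∀ ε > 0, |∫ x, u x * f x ∂torus -
      (1 / n : ℝ) * ∑ i : Fin n, u ((i : ℝ) / n) * f ((i : ℝ) / n)| ≤
      (1 / n : ℝ) * ((l2 u + l2 (iteratedDeriv 1 u)) * ((1 + poincareConst) * l2 g)) +
        2 * U * ε := fun ε hε => by
    obtain ⟨N, -, hN⟩ := h.tendsto_partialSum hk hε
    set v := partialSum (freqRange N) f
    have hv : ContDiff ℝ (⊤ : ℕ∞) v := contDiff_trigPoly _ _
    have hv0 : IsCont₀ v := isCont₀_partialSum (neg_mem_freqRange N) h.cont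
    have hg := l2_partialSum_le h (neg_mem_freqRange N)
    have hu1 := (contDiff_iteratedDeriv hu 1).continuous
    have hv1 := (contDiff_iteratedDeriv hv 1).continuous
    have q1 := abs_integral_sub_sum_le hn (F := fun x => u x * v x)
      (F' := fun x => iteratedDeriv 1 u x * v x + u x * iteratedDeriv 1 v x)
      (fun x => by
        simpa using (hasDerivAt_iteratedDeriv hu 0 x).fun_mul (hasDerivAt_iteratedDeriv hv 0 x))
      ((hu1.mul hv.continuous).add (hu.continuous.mul hv1))
    have q2 : ∫ x, |iteratedDeriv 1 u x * v x + u x * iteratedDeriv 1 v x| ∂torus ≤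
        (l2 u + l2 (iteratedDeriv 1 u)) * ((1 + poincareConst) * l2 g) := by
      have L : ∀ w : ℝ → ℝ, Continuous w → MemLp w 2 torus :=
        fun w hw => memLp_torus_of_continuous hw 2
      have a1 := (le_abs_self _).trans (abs_integral_mul_le_l2 (L _ hu1).abs (L _ hv.continuous).abs)
      have a2 := (le_abs_self _).trans (abs_integral_mul_le_l2 (L _ hu.continuous).abs (L _ hv1).abs)
      have a3 : ∀ w : ℝ → ℝ, l2 |w| = l2 w := fun w => by simp [l2]
      rw [a3, a3] at a1 a2
      have a4 : l2 v ≤ poincareConst * l2 g := by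
        refine (l2_le_of_abs_le (mul_nonneg hP (l2_nonneg _)) (.of_forall fun x =>
          (HasSobolevDeriv.of_contDiff hv hv0 k).abs_le hk x)).trans ?_
        gcongr
      have a5 : l2 (iteratedDeriv 1 v) ≤ (1 + poincareConst) * l2 g :=
        (l2_deriv_le hk hv hv0).trans (by gcongr)
      calc _ ≤ ∫ x, (|iteratedDeriv 1 u| x * |v| x + |u| x * |iteratedDeriv 1 v| x) ∂torus := by
            refine integral_mono (integrable_torus_of_continuous
              ((hu1.mul hv.continuous).add (hu.continuous.mul hv1)).abs)
              (integrable_torus_of_continuous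
              ((hu1.abs.mul hv.continuous.abs).add (hu.continuous.abs.mul hv1.abs))) fun x => ?_
            simp only [Pi.abs_apply, ← abs_mul]
            exact abs_add_le _ _
        _ ≤ l2 (iteratedDeriv 1 u) * l2 v + l2 u * l2 (iteratedDeriv 1 v) := by
            rw [integral_add (integrable_torus_of_continuous (f := fun x => |iteratedDeriv 1 u| x *
              |v| x) (hu1.abs.mul hv.continuous.abs)) (integrable_torus_of_continuous
              (f := fun x => |u| x * |iteratedDeriv 1 v| x) (hu.continuous.abs.mul hv1.abs))]
            exact add_le_add a1 a2
        _ ≤ l2 (iteratedDeriv 1 u) * ((1 + poincareConst) * l2 g) +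
            l2 u * ((1 + poincareConst) * l2 g) := by
            have := l2_nonneg g
            have := l2_nonneg u
            have := l2_nonneg (iteratedDeriv 1 u)
            gcongr
            nlinarith
        _ = _ := by ring
    have q3 : |∫ x, u x * f x ∂torus - ∫ x, u x * v x ∂torus| ≤ U * ε := by
      rw [← integral_sub (integrable_torus_of_continuous (f := fun x => u x * f x)
        (hu.continuous.mul h.cont.continuous)) (integrable_torus_of_continuous
        (f := fun x => u x * v x) (hu.continuous.mul hv.continuous)), integral_torus]
      have := intervalIntegral.norm_integral_le_of_norm_le_const (a := (0 : ℝ)) (b := 1)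
        (f := fun x => u x * f x - u x * v x) (C := U * ε) (fun x hx => by
          rw [Set.uIoc_of_le zero_le_one] at hx
          rw [← mul_sub, norm_mul]
          exact mul_le_mul (hU x ⟨hx.1.le, hx.2⟩) (hN x).le (norm_nonneg _) hU0)
      simpa using this
    have q4 : |(1 / n : ℝ) * ∑ i : Fin n, u ((i : ℝ) / n) * v ((i : ℝ) / n) -
        (1 / n : ℝ) * ∑ i : Fin n, u ((i : ℝ) / n) * f ((i : ℝ) / n)| ≤ U * ε := by
      rw [← mul_sub, ← Finset.sum_sub_distrib, abs_mul, abs_of_pos (by positivity), one_div,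
        inv_mul_le_iff₀ hn0]
      refine (Finset.abs_sum_le_sum_abs _ _).trans
        ((Finset.sum_le_card_nsmul _ _ (U * ε) fun i _ => ?_).trans (by simp))
      have hi : (i : ℝ) < n := by exact_mod_cast i.2
      rw [← mul_sub, abs_mul, abs_sub_comm]
      exact mul_le_mul (hU _ ⟨by positivity, (div_le_one hn0).2 hi.le⟩) (hN _).le
        (abs_nonneg _) hU0
    have q5 := q1.trans (mul_le_mul_of_nonneg_left q2 (by positivity))
    have q6 := (abs_add_le _ _).trans (add_le_add ((abs_add_le _ _).trans (add_le_add q3 q5)) q4)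
    refine le_trans (le_of_eq ?_) (q6.trans (by linarith))
    congr 1; ring
  refine le_of_forall_pos_le_add fun ε hε => ?_
  refine (key (ε / (2 * U + 1)) (by positivity)).trans (add_le_add le_rfl ?_)
  rw [mul_div_assoc', div_le_iff₀ (by positivity)]
  nlinarith

/-- Moving all `k` derivatives onto the smooth factor leaves a pairing with `f` itself, the only
quantity on which local sums give information. -/
theorem HasSobolevDeriv.integral_iteratedDeriv_mul {k : ℕ} {f g v : ℝ → ℝ}
    (h : HasSobolevDeriv k f g) (hv : ContDiff ℝ (⊤ : ℕ∞) v) (pv : Function.Periodic v 1) :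
    |∫ x, iteratedDeriv k v x * g x ∂torus| = |∫ x, iteratedDeriv (k + k) v x * f x ∂torus| := by
  have h1 := h.weak.2 _ (contDiff_iteratedDeriv hv k) (periodic_iteratedDeriv pv k)
  have h2 : iteratedDeriv k (iteratedDeriv k v) = iteratedDeriv (k + k) v := by
    rw [iteratedDeriv_eq_iterate, iteratedDeriv_eq_iterate, iteratedDeriv_eq_iterate,
      Function.iterate_add_apply]
  rw [h2] at h1
  simp only [mul_comm (iteratedDeriv _ v _)]
  rw [h1, abs_mul, abs_pow, abs_neg, abs_one, one_pow, one_mul]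

/-- The constant of the estimate for a single block. -/
def blockConst (k m : ℕ) : ℝ :=
  (2 * Real.pi * m) ^ (2 * k + 1) * (9 * (m : ℝ) ^ 2 + 5 * (1 + poincareConst))

theorem blockConst_nonneg (k m : ℕ) : 0 ≤ blockConst k m := by
  have := poincareConst_nonneg
  have := Real.pi_pos
  rw [blockConst]; positivity

/-- At the frequency scale `W = m^i` the pairing becomes an integral of `u h` with `u` oscillating
at scale `W`, and then a grid sum. The grid is summed along cells of the matching level `i`, so that
`W ‖u‖₁` and `‖u'‖₁` obey bounds of the same order. The condition `hi` keeps the quadrature error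
and the uniform bound of `h` below the main term `δ / √W`. -/
theorem abs_block_pairing_le {k m n i : ℕ} (hk : 1 ≤ k) (hm : 2 ≤ m) (hn : 1 ≤ n) {s A Γ : ℝ}
    {f h g : ℝ → ℝ} (hA : 0 ≤ A) (hΓ : 0 ≤ Γ) (hb : BlockBound m (k + s) A f)
    (hh : HasSobolevDeriv k h g) (cb : CellBound m n Γ h)
    (hi : l2 g * √((m : ℝ) ^ i) ≤ Γ / √n * n) :
    |∫ x, iteratedDeriv k (partialSum (freqBlock m i (i + 1)) f) x * g x ∂torus| ≤
      blockConst k m * A * (Γ / √n) * ((m : ℝ) ^ i) ^ (k - s + 1 / 2) := by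
  have hP := poincareConst_nonneg
  have hπ := Real.pi_gt_three
  have hm1 : (1 : ℝ) ≤ m := by exact_mod_cast (by omega : 1 ≤ m)
  have hn0 : (0 : ℝ) < n := by exact_mod_cast hn
  have hW1 : (1 : ℝ) ≤ (m : ℝ) ^ i := one_le_pow₀ hm1
  have hE := l2_nonneg g
  set F := freqBlock m i (i + 1)
  have hF := neg_mem_freqBlock (I := i) (J := i + 1) hm
  have hherm := isHermitian_coeff hF f
  rw [hh.integral_iteratedDeriv_mul (v := partialSum F f) (contDiff_trigPoly _ _)
    (trigPoly_periodic _ _)]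
  set u := iteratedDeriv (k + k) (partialSum F f) with hu
  have huc : ContDiff ℝ (⊤ : ℕ∞) u := contDiff_iteratedDeriv (contDiff_trigPoly _ _) _
  have l2u : ∀ a : ℕ, l2 (iteratedDeriv a (partialSum F f)) ≤
      (2 * Real.pi * m) ^ a * A * ((m : ℝ) ^ i) ^ ((a : ℝ) - (k + s)) := fun a => by
    rw [partialSum, iteratedDeriv_trigPoly, (hherm.freq_pow_mul a).l2_trigPoly]
    exact Real.sqrt_le_iff.2 ⟨by positivity, hb.sum_freq_pow_le hm a i⟩
  have hu1 : iteratedDeriv 1 u = iteratedDeriv (k + k + 1) (partialSum F f) := by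
    rw [iteratedDeriv_one, iteratedDeriv_succ]
  set W := (m : ℝ) ^ i with hW
  have hW0 : 0 < W := by linarith
  set X := (2 * Real.pi * m) ^ (2 * k + 1) * A * W ^ ((k : ℝ) - s) with hX
  have hX0 : 0 ≤ X := by positivity
  have hb1 : (1 : ℝ) ≤ 2 * Real.pi * m := by nlinarith
  have h1 : l2 u ≤ X := by
    refine (l2u (k + k)).trans ?_
    have e : ((k + k : ℕ) : ℝ) - (k + s) = k - s := by push_cast; ring
    rw [e, hX]
    have := pow_le_pow_right₀ hb1 (by omega : k + k ≤ 2 * k + 1)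
    gcongr
  have h2 : l2 (iteratedDeriv 1 u) ≤ X * W := by
    rw [hu1]
    refine (l2u (k + k + 1)).trans (le_of_eq ?_)
    have e : ((k + k + 1 : ℕ) : ℝ) - (k + s) = (k - s) + 1 := by push_cast; ring
    rw [e, Real.rpow_add hW0, Real.rpow_one, hX, show k + k + 1 = 2 * k + 1 by ring]
    ring
  have q1 := hh.abs_integral_mul_sub_sum_le hk hn huc
  have q2 := cb.abs_sum_mul_le hm hΓ (fun x => hh.abs_le hk x)
    (fun x => by simpa only [iteratedDeriv_zero] using hasDerivAt_iteratedDeriv huc 0 x)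
    (contDiff_iteratedDeriv huc 1).continuous i
  have a1 := integral_abs_le_l2 (memLp_torus_of_continuous huc.continuous 2)
  have a2 := integral_abs_le_l2
    (memLp_torus_of_continuous (contDiff_iteratedDeriv huc 1).continuous 2)
  rw [← hW] at q2
  set S := ∑ i : Fin n, u ((i : ℝ) / n) * h ((i : ℝ) / n)
  set δ := Γ / √n with hδ
  have hδ0 : 0 ≤ δ := by positivity
  have hsn : √(n : ℝ) * √n = n := Real.mul_self_sqrt hn0.le
  have hsW : √W * √W = W := Real.mul_self_sqrt hW0.le
  have hsn0 : 0 < √(n : ℝ) := Real.sqrt_pos.2 hn0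
  have hsW0 : 0 < √W := Real.sqrt_pos.2 hW0
  have hΓn : (1 / n : ℝ) * (Γ * √(n / W)) = δ / √W := by
    rw [Real.sqrt_div hn0.le, hδ]
    field_simp
    rw [sq, hsn, mul_comm]
  have hEn : (1 / n : ℝ) * l2 g ≤ δ / √W := by
    rw [one_div, inv_mul_le_iff₀ hn0, mul_div_assoc', le_div_iff₀ hsW0, mul_comm (n : ℝ)]
    exact hi
  have q3 : (1 / n : ℝ) * |S| ≤ (3 * (m : ℝ) ^ 2 * (δ / √W) + poincareConst * (δ / √W)) *
      (3 * (X * W)) := by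
    have e1 : W * ∫ x, |u x| ∂torus + 2 * ∫ x, |iteratedDeriv 1 u x| ∂torus ≤ 3 * (X * W) := by
      have : W * ∫ x, |u x| ∂torus ≤ W * X := by gcongr; exact a1.trans h1
      linarith [a2.trans h2]
    calc _ ≤ (1 / n : ℝ) * ((3 * (m : ℝ) ^ 2 * Γ * √(n / W) + poincareConst * l2 g) *
          (3 * (X * W))) := by
          gcongr
          refine q2.trans ?_
          gcongr
      _ = (3 * (m : ℝ) ^ 2 * ((1 / n : ℝ) * (Γ * √(n / W))) +
          poincareConst * ((1 / n : ℝ) * l2 g)) * (3 * (X * W)) := by ring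
      _ ≤ _ := by rw [hΓn]; gcongr
  have q4 : (1 / n : ℝ) * ((l2 u + l2 (iteratedDeriv 1 u)) * ((1 + poincareConst) * l2 g)) ≤
      2 * (X * W) * ((1 + poincareConst) * (δ / √W)) := by
    have : l2 u + l2 (iteratedDeriv 1 u) ≤ 2 * (X * W) := by nlinarith
    calc _ = (l2 u + l2 (iteratedDeriv 1 u)) * ((1 + poincareConst) * ((1 / n : ℝ) * l2 g)) := by
          ring
      _ ≤ _ := by gcongr
  have q5 : |∫ x, u x * h x ∂torus| ≤ (1 / n : ℝ) * |S| +
      (1 / n : ℝ) * ((l2 u + l2 (iteratedDeriv 1 u)) * ((1 + poincareConst) * l2 g)) := by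
    have e : |(1 / n : ℝ) * S| = (1 / n : ℝ) * |S| := by
      rw [abs_mul, abs_of_pos (by positivity : (0 : ℝ) < 1 / n)]
    rw [← e]
    have := abs_add_le ((1 / n : ℝ) * S) (∫ x, u x * h x ∂torus - (1 / n : ℝ) * S)
    rw [add_sub_cancel] at this
    linarith
  have e2 : X * W * (δ / √W) = (2 * Real.pi * m) ^ (2 * k + 1) * A * δ *
      W ^ ((k : ℝ) - s + 1 / 2) := by
    rw [Real.rpow_add hW0, ← Real.sqrt_eq_rpow, hX]
    have : W / √W = √W := Real.div_sqrt
    calc _ = (2 * Real.pi * m) ^ (2 * k + 1) * A * W ^ ((k : ℝ) - s) * δ * (W / √W) := by ring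
      _ = _ := by rw [this]; ring
  have h0 : 0 ≤ X * W * (δ / √W) := by positivity
  calc _ ≤ (9 * (m : ℝ) ^ 2 + 5 * (1 + poincareConst)) * (X * W * (δ / √W)) := by
        refine q5.trans ((add_le_add q3 q4).trans ?_)
        nlinarith
    _ = _ := by rw [e2, blockConst]; ring

/-- A geometric sum of ratio at least `4/3`, closed by `1 + 3 ≤ 3 · 4/3`. -/
theorem sum_pow_rpow_le {m : ℕ} (hm : 2 ≤ m) {e : ℝ} (he : 1 / 2 ≤ e) (J : ℕ) :
    ∑ i ∈ Finset.range J, ((m : ℝ) ^ i) ^ e ≤ 3 * ((m : ℝ) ^ J) ^ e := by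
  have hm2 : (2 : ℝ) ≤ m := by exact_mod_cast hm
  have h1 : (4 / 3 : ℝ) ≤ (m : ℝ) ^ e := by
    calc (4 / 3 : ℝ) ≤ √m := Real.le_sqrt_of_sq_le (by linarith)
      _ = (m : ℝ) ^ (1 / 2 : ℝ) := Real.sqrt_eq_rpow _
      _ ≤ _ := Real.rpow_le_rpow_of_exponent_le (by linarith) he
  induction J with
  | zero => simp
  | succ J ih =>
    rw [Finset.sum_range_succ, pow_rpow_succ hm]
    have : 0 ≤ ((m : ℝ) ^ J) ^ e := by positivity
    nlinarith

/-- Because `s ≤ k`, the exponent is at least `1/2`: the block bounds grow geometrically, and their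
sum is comparable to the term at the cutoff. -/
theorem abs_lowFreq_pairing_le {k m n J : ℕ} (hk : 1 ≤ k) (hm : 2 ≤ m) (hn : 1 ≤ n) {s A Γ : ℝ}
    {f h g : ℝ → ℝ} (hs : s ≤ k) (hA : 0 ≤ A) (hΓ : 0 ≤ Γ) (hb : BlockBound m (k + s) A f)
    (hh : HasSobolevDeriv k h g) (cb : CellBound m n Γ h)
    (hJ : l2 g * √((m : ℝ) ^ J) ≤ Γ / √n * n) :
    |∫ x, iteratedDeriv k (partialSum (lowFreq m J) f) x * g x ∂torus| ≤
      3 * (blockConst k m * A * (Γ / √n)) * ((m : ℝ) ^ J) ^ (k - s + 1 / 2) := by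
  have hC := blockConst_nonneg k m
  have hm1 : (1 : ℝ) ≤ m := by exact_mod_cast (by omega : 1 ≤ m)
  have hgi : ∀ F, Integrable
      (fun x => iteratedDeriv k (partialSum F f) x * g x) torus := fun F =>
    integrable_mul_of_memLp_two (memLp_torus_of_continuous
      (contDiff_iteratedDeriv (contDiff_trigPoly _ _) k).continuous 2) hh.memLp
  have hsum : ∀ I, ∫ x, iteratedDeriv k (partialSum (lowFreq m I) f) x * g x ∂torus =
      ∑ i ∈ Finset.range I,
        ∫ x, iteratedDeriv k (partialSum (freqBlock m i (i + 1)) f) x * g x ∂torus := by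
    intro I
    induction I with
    | zero =>
      have h2 : iteratedDeriv k (partialSum (lowFreq m 0) f) = 0 := by
        rw [partialSum, iteratedDeriv_trigPoly]
        ext x
        have : lowFreq m 0 = {0} := by
          ext j; rw [mem_lowFreq hm]; simp
        simp [trigPoly, this, freq, show k ≠ 0 by omega]
      simp [h2]
    | succ I ih =>
      rw [Finset.sum_range_succ, ← ih, ← integral_add (hgi _) (hgi _)]
      congr 1
      ext x
      rw [← add_mul]
      congr 1
      simp only [partialSum, iteratedDeriv_trigPoly]
      rw [freqBlock, trigPoly_sdiff (lowFreq_mono hm (Nat.le_succ _))]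
      simp
  rw [hsum]
  refine (Finset.abs_sum_le_sum_abs _ _).trans ?_
  calc _ ≤ ∑ i ∈ Finset.range J, blockConst k m * A * (Γ / √n) *
        ((m : ℝ) ^ i) ^ (k - s + 1 / 2) := by
        refine Finset.sum_le_sum fun i hi => ?_
        refine abs_block_pairing_le hk hm hn hA hΓ hb hh cb (le_trans ?_ hJ)
        have := l2_nonneg g
        gcongr
        exact (Finset.mem_range.1 hi).le
    _ ≤ blockConst k m * A * (Γ / √n) * (3 * ((m : ℝ) ^ J) ^ (k - s + 1 / 2)) := by
        rw [← Finset.mul_sum]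
        exact mul_le_mul_of_nonneg_left (sum_pow_rpow_le hm (by linarith) J) (by positivity)
    _ = _ := by ring

/-- Absorbs the energy norm of the error, which also occurs on the right of the source condition. -/
theorem le_of_sq_le_add {x y C : ℝ} (hy : 0 ≤ y) (hC : 0 ≤ C)
    (h : x ^ 2 ≤ C * (y * x + y ^ 2)) : x ≤ (C + 1) * y := by
  by_contra! hlt
  have hx : 0 ≤ x := le_trans (by positivity) hlt.le
  nlinarith [mul_nonneg hC hy, mul_nonneg hC hx, mul_nonneg hx hy]

/-- The rate in the energy norm, from the variational source condition. -/
theorem exists_l2_le {k m : ℕ} (hk : 1 ≤ k) (hm : 2 ≤ m) {s : ℝ} (hs : 1 / 2 ≤ s) (hsk : s ≤ k) :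
    ∃ K : ℝ, 0 ≤ K ∧ ∀ (n : ℕ) (A Γ : ℝ) (f gf h g : ℝ → ℝ), 1 ≤ n → 0 ≤ A →
      BlockBound m (k + s) A f → HasSobolevDeriv k f gf → HasSobolevDeriv k h g →
      CellBound m n Γ h → l2 g ^ 2 ≤ ∫ x, gf x * g x ∂torus → 0 < Γ / √n → Γ / √n ≤ 1 →
      l2 g ≤ (Γ / √n) ^ (5 / 4 : ℝ) * n →
      l2 g ≤ (K * A + 1) * (Γ / √n) ^ (s / (k + s + 1 / 2)) := by
  have hm1 : (1 : ℝ) < m := by exact_mod_cast (by omega : 1 < m)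
  have hk1 : (1 : ℝ) ≤ k := by exact_mod_cast hk
  have hC := blockConst_nonneg k m
  have hπ := Real.pi_pos
  refine ⟨max (2 * (2 * Real.pi * m) ^ k * (m : ℝ) ^ s) (3 * blockConst k m),
    le_max_of_le_right (by positivity), ?_⟩
  set K := max (2 * (2 * Real.pi * m) ^ k * (m : ℝ) ^ s) (3 * blockConst k m)
  intro n A Γ f gf h g hn hA hb hf hh cb hE hδ hδ1 hn4
  have hn0 : (0 : ℝ) < n := by exact_mod_cast hn
  have hΓ : 0 ≤ Γ := by
    have := Real.sqrt_pos.2 hn0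
    by_contra hneg
    exact absurd hδ (not_lt.2 (div_nonpos_of_nonpos_of_nonneg (not_le.1 hneg).le this.le))
  have hK0 : 0 ≤ K := le_max_of_le_right (by positivity)
  set δ := Γ / √n with hδdef
  set b : ℝ := k + s + 1 / 2 with hbdef
  have hb2 : 2 ≤ b := by linarith
  -- The cutoff `m^J` is `1/τ` up to the factor `m`. With `δ = τ^b` and `b = k + s + 1/2`, the low
  -- part `δ W^{k-s+1/2}` becomes `τ^{2s}`, the square of the tail factor `W^{-s} ≈ τ^s`, so that
  -- both fit one quadratic inequality.
  set τ := δ ^ (1 / b) with hτ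
  have hτ0 : 0 < τ := by positivity
  have hτ1 : τ ≤ 1 := Real.rpow_le_one hδ.le hδ1 (by positivity)
  obtain ⟨J, hJ1, hJ2⟩ := exists_nat_pow_near ((one_le_inv₀ hτ0).2 hτ1) hm1
  have hW0 : (0 : ℝ) < (m : ℝ) ^ J := by positivity
  have hE0 := l2_nonneg g
  -- The exponent `5/4` in the size condition is used here: since `b ≥ 2`, the factor `√(m^J)` is at
  -- most `δ^{-1/4}`.
  have hlow := abs_lowFreq_pairing_le (J := J) hk hm hn hsk hA hΓ hb hh cb (by
    have e1 : √((m : ℝ) ^ J) ≤ δ ^ (-(1 / 4) : ℝ) := by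
      rw [Real.sqrt_eq_rpow]
      calc ((m : ℝ) ^ J) ^ (1 / 2 : ℝ) ≤ (τ⁻¹) ^ (1 / 2 : ℝ) := by gcongr
        _ = δ ^ (-(1 / (2 * b))) := by
          rw [hτ, ← Real.rpow_neg hδ.le, ← Real.rpow_mul hδ.le]
          congr 1; field_simp
        _ ≤ _ := by
          refine Real.rpow_le_rpow_of_exponent_ge hδ hδ1 (neg_le_neg ?_)
          exact one_div_le_one_div_of_le (by norm_num) (by linarith)
    calc l2 g * √((m : ℝ) ^ J) ≤ (δ ^ (5 / 4 : ℝ) * n) * δ ^ (-(1 / 4) : ℝ) := by gcongr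
      _ = (δ ^ (5 / 4 : ℝ) * δ ^ (-(1 / 4) : ℝ)) * n := by ring
      _ = δ * n := by rw [← Real.rpow_add hδ]; norm_num)
  rw [← hδdef] at hlow
  have htail := hb.l2_tail_le hm hA hs hf J
  have hvL : MemLp (iteratedDeriv k (partialSum (lowFreq m J) f)) 2 torus :=
    memLp_torus_of_continuous (contDiff_iteratedDeriv (contDiff_trigPoly _ _) k).continuous 2
  have hsplit : ∫ x, gf x * g x ∂torus =
      ∫ x, (gf - iteratedDeriv k (partialSum (lowFreq m J) f)) x * g x ∂torus +
        ∫ x, iteratedDeriv k (partialSum (lowFreq m J) f) x * g x ∂torus := by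
    rw [← integral_add (integrable_mul_of_memLp_two (hf.memLp.sub hvL) hh.memLp)
      (integrable_mul_of_memLp_two hvL hh.memLp)]
    congr 1; ext x; simp only [Pi.sub_apply]; ring
  have h1 := (le_abs_self _).trans (abs_integral_mul_le_l2 (hf.memLp.sub hvL) hh.memLp)
  have h2 := (le_abs_self _).trans hlow
  have e1 : ((m : ℝ) ^ J) ^ (-s) ≤ (m : ℝ) ^ s * τ ^ s := by
    have : (m : ℝ)⁻¹ * τ⁻¹ ≤ (m : ℝ) ^ J := by
      rw [inv_mul_le_iff₀ (by positivity), mul_comm, ← pow_succ]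
      exact hJ2.le
    rw [← Real.mul_rpow (by positivity) hτ0.le, Real.rpow_neg hW0.le, ← Real.inv_rpow hW0.le]
    refine Real.rpow_le_rpow (by positivity) ?_ (by linarith)
    rw [inv_le_comm₀ hW0 (by positivity), mul_inv]
    exact this
  have e2 : δ * ((m : ℝ) ^ J) ^ ((k : ℝ) - s + 1 / 2) ≤ (τ ^ s) ^ 2 := by
    have hδτ : δ = τ ^ b := by
      rw [hτ, ← Real.rpow_mul hδ.le, one_div_mul_cancel (by linarith), Real.rpow_one]
    calc δ * ((m : ℝ) ^ J) ^ ((k : ℝ) - s + 1 / 2) ≤ τ ^ b * (τ⁻¹) ^ ((k : ℝ) - s + 1 / 2) := by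
          rw [hδτ]
          gcongr
      _ = _ := by
          rw [Real.inv_rpow hτ0.le, ← Real.rpow_neg hτ0.le, ← Real.rpow_add hτ0,
            ← Real.rpow_natCast, ← Real.rpow_mul hτ0.le]
          congr 1; rw [hbdef]; push_cast; ring
  have e3 : τ ^ s = δ ^ (s / b) := by
    rw [hτ, ← Real.rpow_mul hδ.le]; congr 1; ring
  rw [← e3]
  refine le_of_sq_le_add (by positivity) (by positivity) ?_
  refine hE.trans ?_
  rw [hsplit, mul_add]
  refine add_le_add (h1.trans ?_) (h2.trans ?_)
  · calc _ ≤ 2 * ((2 * Real.pi * m) ^ k * A) * ((m : ℝ) ^ s * τ ^ s) * l2 g := by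
          refine mul_le_mul_of_nonneg_right (htail.trans ?_) hE0
          gcongr
      _ = 2 * (2 * Real.pi * m) ^ k * (m : ℝ) ^ s * A * (τ ^ s * l2 g) := by ring
      _ ≤ _ := by
          gcongr
          exact le_max_left _ _
  · calc _ = 3 * blockConst k m * A * (δ * ((m : ℝ) ^ J) ^ ((k : ℝ) - s + 1 / 2)) := by ring
      _ ≤ _ := by
          gcongr
          exact le_max_right _ _

/-! ### Sums of smooth bumps and interpolation of grid data -/

/-- A smooth function with mean zero, supported in `[1/8, 5/8]`, that takes the value `1` at
`1/2`. -/
theorem exists_mother : ∃ φ : ℝ → ℝ, ContDiff ℝ (⊤ : ℕ∞) φ ∧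
    (∀ x, φ x ≠ 0 → 1 / 8 ≤ x ∧ x ≤ 5 / 8) ∧ φ (1 / 2) = 1 ∧ ∫ x in (0 : ℝ)..1, φ x = 0 := by
  let b : ContDiffBump (1 / 2 : ℝ) := ⟨1 / 16, 1 / 8, by norm_num, by norm_num⟩
  have hb : ∀ x, b x ≠ 0 → 3 / 8 < x ∧ x < 5 / 8 := fun x hx => by
    have : x ∈ Function.support b := hx
    rw [b.support_eq, Metric.mem_ball, Real.dist_eq, abs_lt] at this
    have h : b.rOut = 1 / 8 := rfl
    rw [h] at this
    constructor <;> linarith [this.1, this.2]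
  have hz : ∀ x, ¬ (3 / 8 < x ∧ x < 5 / 8) → b x = 0 := fun x hx => not_not.1 fun h => hx (hb x h)
  have hc : Continuous b := b.continuous
  -- Subtracting a translate of disjoint support makes the mean zero and keeps the value at `1/2`.
  refine ⟨fun x => b x - b (x + 1 / 4), b.contDiff.sub (b.contDiff.comp (by fun_prop)), ?_, ?_, ?_⟩
  · intro x hx
    by_contra hcon
    refine hx ?_
    beta_reduce
    rw [hz x (fun h => hcon ⟨by linarith, by linarith⟩),
      hz (x + 1 / 4) (fun h => hcon ⟨by linarith, by linarith⟩), sub_zero]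
  · have h1 : b (1 / 2) = 1 :=
      b.one_of_mem_closedBall (Metric.mem_closedBall_self b.rIn_pos.le)
    simp only [h1]
    rw [hz _ (by norm_num), sub_zero]
  · beta_reduce
    rw [intervalIntegral.integral_sub (g := fun x => b (x + 1 / 4)) (hc.intervalIntegrable _ _)
      ((hc.comp (by fun_prop : Continuous fun x : ℝ => x + 1 / 4)).intervalIntegrable _ _),
      intervalIntegral.integral_comp_add_right (fun x => b x) (1 / 4), sub_eq_zero]
    have e1 : ∫ x in (0 : ℝ)..(0 + 1 / 4), b x = 0 := by
      rw [intervalIntegral.integral_congr (g := fun _ => 0), intervalIntegral.integral_zero]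
      intro x hx
      rw [Set.uIcc_of_le (by norm_num)] at hx
      exact hz x fun h => by linarith [hx.2, h.1]
    have e2 : ∫ x in (1 : ℝ)..(1 + 1 / 4), b x = 0 := by
      rw [intervalIntegral.integral_congr (g := fun _ => 0), intervalIntegral.integral_zero]
      intro x hx
      rw [Set.uIcc_of_le (by norm_num)] at hx
      exact hz x fun h => by linarith [hx.1, h.2]
    have i : ∀ a c : ℝ, IntervalIntegrable (fun x => b x) volume a c :=
      fun a c => hc.intervalIntegrable _ _
    have a1 := intervalIntegral.integral_add_adjacent_intervals (i 0 (0 + 1 / 4))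
      (i (0 + 1 / 4) (1 + 1 / 4))
    have a2 := intervalIntegral.integral_add_adjacent_intervals (i 0 1) (i 1 (1 + 1 / 4))
    rw [e1, zero_add] at a1
    rw [e2, add_zero] at a2
    exact a2.trans a1.symm

/-- The mother function of the bump sums. -/
def mother : ℝ → ℝ := exists_mother.choose

theorem contDiff_mother : ContDiff ℝ (⊤ : ℕ∞) mother := exists_mother.choose_spec.1

theorem mother_supp {x : ℝ} (h : mother x ≠ 0) : 1 / 8 ≤ x ∧ x ≤ 5 / 8 :=
  exists_mother.choose_spec.2.1 x h

theorem mother_half : mother (1 / 2) = 1 := exists_mother.choose_spec.2.2.1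

theorem integral_mother : ∫ x in (0 : ℝ)..1, mother x = 0 := exists_mother.choose_spec.2.2.2

theorem iteratedDeriv_mother_supp (a : ℕ) {x : ℝ} (h : iteratedDeriv a mother x ≠ 0) :
    1 / 8 ≤ x ∧ x ≤ 5 / 8 := by
  have h1 : tsupport mother ⊆ Set.Icc (1 / 8) (5 / 8) :=
    closure_minimal (fun y hy => mother_supp hy) isClosed_Icc
  have h2 : x ∈ tsupport (iteratedFDeriv ℝ a mother) := by
    refine subset_tsupport _ fun h0 => h ?_
    rw [iteratedDeriv_eq_iteratedFDeriv, h0]; rfl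
  exact h1 (tsupport_iteratedFDeriv_subset a h2)

theorem exists_abs_iteratedDeriv_mother_le (a : ℕ) :
    ∃ C : ℝ, 0 ≤ C ∧ ∀ x, |iteratedDeriv a mother x| ≤ C := by
  obtain ⟨C, hC⟩ := (isCompact_Icc (a := (1 / 8 : ℝ)) (b := 5 / 8)).exists_bound_of_continuousOn
    (contDiff_iteratedDeriv contDiff_mother a).continuous.continuousOn
  refine ⟨max C 0, le_max_right _ _, fun x => ?_⟩
  by_cases h : iteratedDeriv a mother x = 0
  · rw [h, abs_zero]; exact le_max_right _ _
  · exact (hC x (iteratedDeriv_mother_supp a h)).trans (le_max_left _ _)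

/-- A bound for the derivative of order `a` of the mother function. -/
def motherBound (a : ℕ) : ℝ := (exists_abs_iteratedDeriv_mother_le a).choose

theorem motherBound_nonneg (a : ℕ) : 0 ≤ motherBound a :=
  (exists_abs_iteratedDeriv_mother_le a).choose_spec.1

theorem abs_iteratedDeriv_mother_le (a : ℕ) (x : ℝ) : |iteratedDeriv a mother x| ≤ motherBound a :=
  (exists_abs_iteratedDeriv_mother_le a).choose_spec.2 x

/-- The function that equals `ζ j • φ (· - j)` on `[j, j + 1)`. -/
def pieces (ζ : ℤ → ℝ) (φ : ℝ → ℝ) (t : ℝ) : ℝ := ζ ⌊t⌋ * φ (Int.fract t)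

/-- The support of `φ` stays away from the integers, so near every `t`, integers included, only one
smooth piece is visible. Derivatives may thus be taken piece by piece. -/
theorem pieces_eventuallyEq {φ : ℝ → ℝ} (hφ : ∀ x, φ x ≠ 0 → 1 / 8 ≤ x ∧ x ≤ 5 / 8) (ζ : ℤ → ℝ)
    (t : ℝ) : pieces ζ φ =ᶠ[𝓝 t] fun x => ζ ⌊t⌋ * φ (x - ⌊t⌋) := by
  have h1 := Int.floor_le t
  have h2 := Int.lt_floor_add_one t
  have hz : ∀ x, ¬ (1 / 8 ≤ x ∧ x ≤ 5 / 8) → φ x = 0 := fun x hx => not_not.1 fun h => hx (hφ x h)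
  filter_upwards [Ioo_mem_nhds (show (⌊t⌋ : ℝ) - 1 / 4 < t by linarith) h2] with x hx
  rcases le_or_gt (⌊t⌋ : ℝ) x with h | h
  · have : ⌊x⌋ = ⌊t⌋ := Int.floor_eq_iff.2 ⟨h, hx.2⟩
    rw [pieces, ← Int.self_sub_floor, this]
  · have : ⌊x⌋ = ⌊t⌋ - 1 := Int.floor_eq_iff.2 ⟨by push_cast; linarith [hx.1], by push_cast; linarith⟩
    rw [pieces, ← Int.self_sub_floor, this, hz, hz (x - ⌊t⌋), mul_zero, mul_zero]
    · rintro ⟨h3, -⟩; linarith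
    · rintro ⟨-, h3⟩; push_cast at h3; linarith [hx.1]

theorem hasDerivAt_pieces (ζ : ℤ → ℝ) (a : ℕ) (t : ℝ) :
    HasDerivAt (pieces ζ (iteratedDeriv a mother))
      (pieces ζ (iteratedDeriv (a + 1) mother) t) t := by
  have h := (pieces_eventuallyEq (fun x => iteratedDeriv_mother_supp (a + 1) (x := x)) ζ t).self_of_nhds
  rw [h]
  refine HasDerivAt.congr_of_eventuallyEq ?_
    (pieces_eventuallyEq (fun x => iteratedDeriv_mother_supp a (x := x)) ζ t)
  refine HasDerivAt.const_mul _ ?_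
  exact (hasDerivAt_iteratedDeriv contDiff_mother a (t - ⌊t⌋)).comp_sub_const t _

theorem iteratedDeriv_pieces (ζ : ℤ → ℝ) (a : ℕ) :
    iteratedDeriv a (pieces ζ mother) = pieces ζ (iteratedDeriv a mother) := by
  induction a with
  | zero => simp only [iteratedDeriv_zero]
  | succ a ih =>
    rw [iteratedDeriv_succ, ih]
    exact funext fun t => (hasDerivAt_pieces ζ a t).deriv

theorem contDiff_pieces (ζ : ℤ → ℝ) : ContDiff ℝ (⊤ : ℕ∞) (pieces ζ mother) := by
  refine contDiff_of_differentiable_iteratedDeriv fun a _ => ?_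
  rw [iteratedDeriv_pieces]
  exact fun t => (hasDerivAt_pieces ζ a t).differentiableAt

/-- The `M` bumps with heights `z` on the intervals `[(i - c)/M, (i + 1 - c)/M)` of the torus. -/
def bumpSum (M : ℕ) (c : ℝ) (z : ℕ → ℝ) (x : ℝ) : ℝ :=
  pieces (fun j => z (j % (M : ℤ)).toNat) mother (M * x + c)

variable {M : ℕ} {c : ℝ} {z : ℕ → ℝ}

theorem contDiff_bumpSum : ContDiff ℝ (⊤ : ℕ∞) (bumpSum M c z) :=
  (contDiff_pieces _).comp (by fun_prop)

theorem pieces_periodic (φ : ℝ → ℝ) :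
    Function.Periodic (pieces (fun j => z (j % (M : ℤ)).toNat) φ) M := by
  intro t
  have h1 : ⌊t + M⌋ = ⌊t⌋ + M := Int.floor_add_natCast t M
  have h2 : Int.fract (t + M) = Int.fract t := Int.fract_add_natCast t M
  simp only [pieces, h1, h2, Int.add_emod_right]

theorem bumpSum_periodic : Function.Periodic (bumpSum M c z) 1 := by
  intro x
  have := pieces_periodic (M := M) (z := z) mother (M * x + c)
  rw [bumpSum, bumpSum, ← this]
  congr 1; ring

theorem iteratedDeriv_bumpSum (a : ℕ) (x : ℝ) : iteratedDeriv a (bumpSum M c z) x =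
    (M : ℝ) ^ a * pieces (fun j => z (j % (M : ℤ)).toNat) (iteratedDeriv a mother) (M * x + c) := by
  set ζ : ℤ → ℝ := fun j => z (j % (M : ℤ)).toNat with hζ
  have h := iteratedDeriv_comp_const_mul (n := a) (f := fun y => pieces ζ mother (y + c))
    (((contDiff_pieces ζ).comp (by fun_prop)).of_le (by exact_mod_cast le_top)) (M : ℝ)
  have h2 : bumpSum M c z = fun x => (fun y => pieces ζ mother (y + c)) (M * x) := rfl
  rw [h2, h, iteratedDeriv_comp_add_const, iteratedDeriv_pieces]

theorem abs_iteratedDeriv_bumpSum_le {b : ℝ} (hM : 1 ≤ M) (hz : ∀ i < M, |z i| ≤ b) (a : ℕ)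
    (x : ℝ) : |iteratedDeriv a (bumpSum M c z) x| ≤ (M : ℝ) ^ a * (b * motherBound a) := by
  rw [iteratedDeriv_bumpSum, abs_mul, abs_of_nonneg (by positivity), pieces, abs_mul]
  have h0 : (0 : ℤ) < M := by exact_mod_cast hM
  have h := hz (⌊(M : ℝ) * x + c⌋ % (M : ℤ)).toNat (by
    have := Int.emod_lt_of_pos ⌊(M : ℝ) * x + c⌋ h0
    omega)
  refine mul_le_mul_of_nonneg_left (mul_le_mul h (abs_iteratedDeriv_mother_le _ _)
    (abs_nonneg _) ((abs_nonneg _).trans h)) (by positivity)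

theorem bumpSum_apply {i : ℕ} (hi : i < M) {x : ℝ} (h1 : (i : ℝ) ≤ M * x + c)
    (h2 : M * x + c < i + 1) : bumpSum M c z x = z i * mother (M * x + c - i) := by
  have : ⌊(M : ℝ) * x + c⌋ = i := Int.floor_eq_iff.2 ⟨by exact_mod_cast h1, by exact_mod_cast h2⟩
  have h3 : ((i : ℤ) % (M : ℤ)).toNat = i := by
    rw [Int.emod_eq_of_lt (by positivity) (by exact_mod_cast hi), Int.toNat_natCast]
  rw [bumpSum, pieces, ← Int.self_sub_floor, this]
  simp only [h3]
  norm_cast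

/-- By periodicity the shift `c` is irrelevant, and each bump has mean zero by itself, whatever its
height. -/
theorem integral_bumpSum (hM : 1 ≤ M) : ∫ x, bumpSum M c z x ∂torus = 0 := by
  have hM0 : (M : ℝ) ≠ 0 := by positivity
  set ζ : ℤ → ℝ := fun j => z (j % (M : ℤ)).toNat with hζ
  have hc : Continuous (pieces ζ mother) := (contDiff_pieces ζ).continuous
  rw [torus, ← intervalIntegral.integral_of_le zero_le_one]
  have h := intervalIntegral.integral_comp_mul_add (pieces ζ mother) hM0 c (a := 0) (b := 1)
  have h2 : ∫ x in (0 : ℝ)..1, bumpSum M c z x = ∫ x in (0 : ℝ)..1, pieces ζ mother (M * x + c) := rfl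
  rw [h2, h, mul_zero, zero_add, mul_one, add_comm,
    (pieces_periodic (M := M) (z := z) mother).intervalIntegral_add_eq c 0, zero_add]
  have h3 := intervalIntegral.sum_integral_adjacent_intervals (f := pieces ζ mother)
    (μ := volume) (a := fun i : ℕ => (i : ℝ)) (n := M) fun i _ => hc.intervalIntegrable _ _
  simp only [Nat.cast_zero] at h3
  rw [← h3, Finset.sum_eq_zero, smul_zero]
  intro i _
  have h4 : ∫ x in (i : ℝ)..((i + 1 : ℕ) : ℝ), pieces ζ mother x =
      ∫ x in (i : ℝ)..((i + 1 : ℕ) : ℝ), ζ i * mother (x - i) := by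
    rw [intervalIntegral.integral_of_le (by simp), intervalIntegral.integral_of_le (by simp),
      ← integral_Ico_eq_integral_Ioc, ← integral_Ico_eq_integral_Ioc]
    refine setIntegral_congr_fun measurableSet_Ico fun x hx => ?_
    have : ⌊x⌋ = i := Int.floor_eq_iff.2 ⟨by exact_mod_cast hx.1, by exact_mod_cast hx.2⟩
    simp only [pieces, ← Int.self_sub_floor, this, Int.cast_natCast]
  rw [h4, intervalIntegral.integral_const_mul,
    intervalIntegral.integral_comp_sub_right (fun x => mother x)]
  push_cast
  rw [sub_self, add_sub_cancel_left, integral_mother, mul_zero]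

theorem isCont₀_bumpSum (hM : 1 ≤ M) : IsCont₀ (bumpSum M c z) :=
  ⟨contDiff_bumpSum.continuous, bumpSum_periodic, integral_bumpSum hM⟩

theorem hasSobolevDeriv_bumpSum (hM : 1 ≤ M) (k : ℕ) :
    HasSobolevDeriv k (bumpSum M c z) (iteratedDeriv k (bumpSum M c z)) :=
  .of_contDiff contDiff_bumpSum (isCont₀_bumpSum hM) k

/-- A smooth interpolant of the data `z` on the grid. -/
def interpolant (n : ℕ) (z : Fin n → ℝ) : ℝ → ℝ :=
  bumpSum n (1 / 2) fun i => if h : i < n then z ⟨i, h⟩ else 0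

/-- The shift `1/2` puts every grid point where the mother function equals one. -/
theorem sample_interpolant {n : ℕ} (z : Fin n → ℝ) : sample n (interpolant n z) = z := by
  funext i
  have hn : (n : ℝ) ≠ 0 := by have := i.2; exact_mod_cast (by omega : n ≠ 0)
  have e : (n : ℝ) * (i / n) = i := by field_simp
  rw [sample, interpolant, bumpSum_apply i.2 (by rw [e]; linarith) (by rw [e]; linarith), e,
    dif_pos i.2, add_sub_cancel_left, mother_half, mul_one]

theorem hasSobolevDeriv_interpolant {n : ℕ} (hn : 1 ≤ n) (k : ℕ) (z : Fin n → ℝ) :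
    HasSobolevDeriv k (interpolant n z) (iteratedDeriv k (interpolant n z)) :=
  hasSobolevDeriv_bumpSum hn k

/-- The bumps have width `1/n`, so `k` derivatives cost `n^k`. This factor decides how rare the bad
event has to be. -/
theorem l2_interpolant_le {n : ℕ} (hn : 1 ≤ n) (k : ℕ) {z : Fin n → ℝ} {b : ℝ}
    (hz : ∀ i, |z i| ≤ b) :
    l2 (iteratedDeriv k (interpolant n z)) ≤ (n : ℝ) ^ k * (b * motherBound k) := by
  refine l2_le_of_abs_le ?_ (.of_forall fun x =>
    abs_iteratedDeriv_bumpSum_le hn (fun i hi => ?_) k x)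
  · have := (abs_nonneg _).trans (hz ⟨0, hn⟩)
    have := motherBound_nonneg k
    positivity
  · rw [dif_pos hi]; exact hz _

/-! ### The multiresolution norm -/

theorem mrNorm_eq (B : Set (Set ℝ)) (n : ℕ) (y : Fin n → ℝ) :
    mrNorm B n y = ⨆ I : B, |∑ i ∈ gridIn n I, y i| / √((gridIn n (I : Set ℝ)).card : ℝ) := rfl

/-- Only serves to bound the supremum in `mrNorm`, since an unbounded real supremum would be zero by
convention. -/
theorem mrTerm_le_sum {n : ℕ} (y : Fin n → ℝ) (I : Set ℝ) :
    |∑ i ∈ gridIn n I, y i| / √((gridIn n I).card : ℝ) ≤ ∑ i, |y i| := by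
  have h0 : 0 ≤ ∑ i, |y i| := Finset.sum_nonneg fun _ _ => abs_nonneg _
  rcases Nat.eq_zero_or_pos (gridIn n I).card with h | h
  · rw [h]; simpa using h0
  · have h1 : 1 ≤ √((gridIn n I).card : ℝ) := by
      rw [Real.one_le_sqrt]; exact_mod_cast h
    refine (div_le_self (abs_nonneg _) h1).trans ((Finset.abs_sum_le_sum_abs _ _).trans ?_)
    exact Finset.sum_le_sum_of_subset_of_nonneg (Finset.subset_univ _) fun _ _ _ => abs_nonneg _

theorem mrTerm_le_mrNorm {B : Set (Set ℝ)} {n : ℕ} (y : Fin n → ℝ) {I : Set ℝ} (hI : I ∈ B) :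
    |∑ i ∈ gridIn n I, y i| / √((gridIn n I).card : ℝ) ≤ mrNorm B n y := by
  rw [mrNorm_eq]
  exact le_ciSup (f := fun I : B => |∑ i ∈ gridIn n I, y i| / √((gridIn n (I : Set ℝ)).card : ℝ))
    ⟨∑ i, |y i|, by rintro _ ⟨J, rfl⟩; exact mrTerm_le_sum y J⟩ ⟨I, hI⟩

/-- The sign condition is needed because the supremum over an empty system is zero. -/
theorem mrNorm_le_iff {B : Set (Set ℝ)} {n : ℕ} {y : Fin n → ℝ} {γ : ℝ} (hγ : 0 ≤ γ) :
    mrNorm B n y ≤ γ ↔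
      ∀ I ∈ B, |∑ i ∈ gridIn n I, y i| / √((gridIn n I).card : ℝ) ≤ γ :=
  ⟨fun h _ hI => (mrTerm_le_mrNorm y hI).trans h, fun h => Real.iSup_le (fun I => h I I.2) hγ⟩

theorem mrNorm_add_le {B : Set (Set ℝ)} {n : ℕ} {y z : Fin n → ℝ} {a b : ℝ} (ha : 0 ≤ a)
    (hb : 0 ≤ b) (hy : mrNorm B n y ≤ a) (hz : mrNorm B n z ≤ b) : mrNorm B n (y + z) ≤ a + b := by
  rw [mrNorm_le_iff (by positivity)]
  intro I hI
  simp only [Pi.add_apply, Finset.sum_add_distrib]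
  refine (div_le_div_of_nonneg_right (abs_add_le _ _) (Real.sqrt_nonneg _)).trans ?_
  rw [add_div]
  exact add_le_add ((mrNorm_le_iff ha).1 hy I hI) ((mrNorm_le_iff hb).1 hz I hI)

theorem mrNorm_smul_le {B : Set (Set ℝ)} {n : ℕ} {y : Fin n → ℝ} {a : ℝ} (ha : 0 ≤ a) (c : ℝ)
    (hy : mrNorm B n y ≤ a) : mrNorm B n (c • y) ≤ |c| * a := by
  rw [mrNorm_le_iff (by positivity)]
  intro I hI
  simp only [Pi.smul_apply, smul_eq_mul, ← Finset.mul_sum]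
  rw [abs_mul, mul_div_assoc]
  exact mul_le_mul_of_nonneg_left ((mrNorm_le_iff ha).1 hy I hI) (abs_nonneg _)

theorem continuous_mrTerm (n : ℕ) (I : Set ℝ) :
    Continuous fun y : Fin n → ℝ => |∑ i ∈ gridIn n I, y i| / √((gridIn n I).card : ℝ) := by
  fun_prop

theorem isClosed_mrNorm_le (B : Set (Set ℝ)) (n : ℕ) {γ : ℝ} (hγ : 0 ≤ γ) :
    IsClosed {y : Fin n → ℝ | mrNorm B n y ≤ γ} := by
  simp only [mrNorm_le_iff hγ, Set.ofPred_forall]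
  exact isClosed_biInter fun I _ => isClosed_le (continuous_mrTerm n I) continuous_const

/-! ### Sobolev functions with a convergent sequence of derivatives -/

theorem HasSobolevDeriv.congr_ae {k : ℕ} {f g g' : ℝ → ℝ} (h : HasSobolevDeriv k f g)
    (hg : g =ᵐ[torus] g') : HasSobolevDeriv k f g' := by
  refine ⟨h.cont, ⟨h.weak.1.congr hg, fun φ hφ pφ => ?_⟩, h.memLp.ae_eq hg⟩
  rw [h.weak.2 φ hφ pφ]
  congr 1
  exact integral_congr_ae (hg.mono fun x hx => by simp only [hx])

/-- The Poincaré inequality turns `L²`-convergence of derivatives into uniform convergence of the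
functions, so the limit is continuous and its samples are limits. This makes the feasible set
closed. -/
theorem exists_hasSobolevDeriv_of_tendsto {k : ℕ} (hk : 1 ≤ k) {u v : ℕ → ℝ → ℝ} {g : ℝ → ℝ}
    (h : ∀ N, HasSobolevDeriv k (u N) (v N)) (hg : MemLp g 2 torus)
    (hv : Tendsto (fun N => l2 (g - v N)) atTop (𝓝 0)) :
    ∃ f, HasSobolevDeriv k f g ∧ ∀ x, Tendsto (fun N => u N x) atTop (𝓝 (f x)) := by
  have hP := poincareConst_nonneg
  have tri : ∀ N M, l2 (v N - v M) ≤ l2 (g - v N) + l2 (g - v M) := fun N M => by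
    have e := eLpNorm_sub_le (hg.sub (h M).memLp).1 (hg.sub (h N).memLp).1
      (one_le_two (α := ℝ≥0∞))
    rw [sub_sub_sub_cancel_left, eLpNorm_two_eq_l2 ((h N).memLp.sub (h M).memLp),
      eLpNorm_two_eq_l2 (hg.sub (h M).memLp), eLpNorm_two_eq_l2 (hg.sub (h N).memLp),
      ← ENNReal.ofReal_add (l2_nonneg _) (l2_nonneg _),
      ENNReal.ofReal_le_ofReal_iff (add_nonneg (l2_nonneg _) (l2_nonneg _))] at e
    linarith
  have hcau : ∀ N M x, |u N x - u M x| ≤ poincareConst * (l2 (g - v N) + l2 (g - v M)) :=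
    fun N M x => (((h N).sub (h M)).abs_le hk x).trans (mul_le_mul_of_nonneg_left (tri N M) hP)
  have hex : ∀ x, ∃ y, Tendsto (fun N => u N x) atTop (𝓝 y) := fun x => by
    refine cauchySeq_tendsto_of_complete (Metric.cauchySeq_iff'.2 fun ε hε => ?_)
    have hlim : Tendsto (fun N => poincareConst * l2 (g - v N)) atTop (𝓝 0) := by
      simpa using hv.const_mul poincareConst
    obtain ⟨N₀, hN₀⟩ := eventually_atTop.1 (hlim.eventually (gt_mem_nhds (half_pos hε)))
    refine ⟨N₀, fun N hN => ?_⟩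
    have := hcau N N₀ x
    have h1 := hN₀ N hN
    have h2 := hN₀ N₀ le_rfl
    rw [Real.dist_eq]; linarith
  choose f hf using hex
  have hlim : ∀ N x, |f x - u N x| ≤ poincareConst * l2 (g - v N) := fun N x => by
    refine le_of_tendsto_of_tendsto' (((hf x).sub_const (u N x)).abs)
      (g := fun M => poincareConst * (l2 (g - v M) + l2 (g - v N))) ?_ fun M => hcau M N x
    simpa using ((hv.add_const (l2 (g - v N))).const_mul poincareConst)
  have hunif : TendstoUniformly u f atTop := by
    rw [Metric.tendstoUniformly_iff]
    intro ε hε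
    have hl : Tendsto (fun N => poincareConst * l2 (g - v N)) atTop (𝓝 0) := by
      simpa using hv.const_mul poincareConst
    filter_upwards [hl.eventually (gt_mem_nhds hε)] with N hN x
    exact (hlim N x).trans_lt hN
  have hc : Continuous f := hunif.continuous (Frequently.of_forall fun N => (h N).cont.continuous)
  have hp : Function.Periodic f 1 := fun x =>
    tendsto_nhds_unique ((hf (x + 1)).congr fun N => (h N).cont.periodic x) (hf x)
  have hl2 : Tendsto (fun N => l2 (f - u N)) atTop (𝓝 0) := by
    refine squeeze_zero (fun N => l2_nonneg _) (fun N => l2_le_of_abs_le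
      (mul_nonneg hP (l2_nonneg _)) (.of_forall (hlim N))) ?_
    simpa using hv.const_mul poincareConst
  have hmean : ∫ x, f x ∂torus = 0 := by
    have hle : ∀ N, |∫ x, f x ∂torus| ≤ l2 (f - u N) := fun N => by
      have e : ∫ x, f x ∂torus = ∫ x, (f - u N) x ∂torus := by
        simp only [Pi.sub_apply]
        rw [integral_sub (integrable_torus_of_continuous hc) (h N).cont.integrable,
          (h N).cont.mean_zero, sub_zero]
      rw [e]
      exact (abs_integral_le_integral_abs).trans (integral_abs_le_l2
        (memLp_torus_of_continuous (hc.sub (h N).cont.continuous) 2))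
    exact abs_eq_zero.1 (le_antisymm (ge_of_tendsto' hl2 hle) (abs_nonneg _))
  refine ⟨f, ⟨⟨hc, hp, hmean⟩, ?_, hg⟩, hf⟩
  exact IsWeakDeriv.of_tendsto (fun N => (h N).weak)
    (fun N => memLp_torus_of_continuous (h N).cont.continuous 2) (fun N => (h N).memLp)
    (memLp_torus_of_continuous hc 2) hg hl2 hv

/-! ### The estimator -/

/-- `f` is feasible for the data `y`, and `g` is its derivative of order `k`. -/
def Feasible (k : ℕ) (B : Set (Set ℝ)) (n : ℕ) (γ : ℝ) (y : Fin n → ℝ) (f g : ℝ → ℝ) : Prop :=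
  HasSobolevDeriv k f g ∧ mrNorm B n (sample n f - y) ≤ γ

variable {k n : ℕ} {B : Set (Set ℝ)} {γ : ℝ} {y : Fin n → ℝ}

theorem feasible_interpolant (hn : 1 ≤ n) (hγ : 0 ≤ γ) :
    Feasible k B n γ y (interpolant n y) (iteratedDeriv k (interpolant n y)) := by
  refine ⟨hasSobolevDeriv_interpolant hn k y, (mrNorm_le_iff hγ).2 fun I _ => ?_⟩
  simp [sample_interpolant, hγ]

theorem Feasible.convexComb (hγ : 0 ≤ γ) {f₁ f₂ g₁ g₂ : ℝ → ℝ} (h₁ : Feasible k B n γ y f₁ g₁)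
    (h₂ : Feasible k B n γ y f₂ g₂) {a b : ℝ} (ha : 0 ≤ a) (hb : 0 ≤ b) (hab : a + b = 1) :
    Feasible k B n γ y (a • f₁ + b • f₂) (a • g₁ + b • g₂) := by
  refine ⟨(h₁.1.smul a).add (h₂.1.smul b), ?_⟩
  have e : sample n (a • f₁ + b • f₂) - y = a • (sample n f₁ - y) + b • (sample n f₂ - y) := by
    ext i
    simp only [sample, Pi.sub_apply, Pi.add_apply, Pi.smul_apply, smul_eq_mul]
    linear_combination (y i) * hab
  rw [e]
  have := mrNorm_add_le (mul_nonneg (abs_nonneg a) hγ) (mul_nonneg (abs_nonneg b) hγ)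
    (mrNorm_smul_le hγ a h₁.2) (mrNorm_smul_le hγ b h₂.2)
  rwa [abs_of_nonneg ha, abs_of_nonneg hb, ← add_mul, hab, one_mul] at this

theorem norm_Lp_eq_l2 (v : Lp ℝ 2 torus) : ‖v‖ = l2 v := by
  rw [Lp.norm_def, eLpNorm_two_eq_l2 (Lp.memLp v), ENNReal.toReal_ofReal (l2_nonneg _)]

theorem inner_Lp_eq (u v : Lp ℝ 2 torus) : inner ℝ u v = ∫ x, u x * v x ∂torus := by
  rw [L2.inner_def]
  simp [mul_comm]

/-- The derivatives of feasible functions form a closed convex subset of `L²`, nonempty because a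
smooth interpolant reproduces the data exactly. Projecting zero onto it gives existence together
with the variational inequality. -/
theorem exists_feasible_variational (hk : 1 ≤ k) (hn : 1 ≤ n) (hγ : 0 ≤ γ) :
    ∃ f g, Feasible k B n γ y f g ∧
      ∀ u v, Feasible k B n γ y u v → 0 ≤ ∫ x, g x * (v x - g x) ∂torus := by
  let K : Set (Lp ℝ 2 torus) := {v | ∃ f, Feasible k B n γ y f v}
  have hmem : ∀ u v, Feasible k B n γ y u v → ∃ w ∈ K, (w : ℝ → ℝ) =ᵐ[torus] v := fun u v h =>
    ⟨h.1.memLp.toLp v, ⟨u, h.1.congr_ae h.1.memLp.coeFn_toLp.symm, h.2⟩, h.1.memLp.coeFn_toLp⟩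
  have hne : K.Nonempty := by
    obtain ⟨w, hw, -⟩ := hmem _ _ (feasible_interpolant (B := B) (k := k) (y := y) hn hγ)
    exact ⟨w, hw⟩
  have hconv : Convex ℝ K := by
    rintro v₁ ⟨f₁, h₁⟩ v₂ ⟨f₂, h₂⟩ a b ha hb hab
    have h := h₁.convexComb hγ h₂ ha hb hab
    refine ⟨_, h.1.congr_ae ?_, h.2⟩
    filter_upwards [Lp.coeFn_add (a • v₁) (b • v₂), Lp.coeFn_smul a v₁, Lp.coeFn_smul b v₂]
      with x h1 h2 h3
    simp only [h1, Pi.add_apply, h2, h3]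
  have hclosed : IsClosed K := by
    refine IsSeqClosed.isClosed fun w v hw hlim => ?_
    choose u hu using hw
    have hl : Tendsto (fun N => l2 ((v : ℝ → ℝ) - w N)) atTop (𝓝 0) := by
      have := (tendsto_iff_norm_sub_tendsto_zero.1 hlim)
      refine this.congr fun N => ?_
      rw [norm_sub_rev, norm_Lp_eq_l2]
      exact l2_congr (Lp.coeFn_sub v (w N))
    obtain ⟨f, hf, hpt⟩ := exists_hasSobolevDeriv_of_tendsto hk (fun N => (hu N).1) (Lp.memLp v) hl
    have hs : Tendsto (fun N => sample n (u N) - y) atTop (𝓝 (sample n f - y)) :=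
      tendsto_pi_nhds.2 fun i => (hpt ((i : ℝ) / n)).sub_const (y i)
    have hm : sample n f - y ∈ {y : Fin n → ℝ | mrNorm B n y ≤ γ} :=
      (isClosed_mrNorm_le B n hγ).mem_of_tendsto hs (.of_forall fun N => (hu N).2)
    exact ⟨f, hf, hm⟩
  obtain ⟨v, ⟨f, hf⟩, hv⟩ := exists_norm_eq_iInf_of_complete_convex hne hclosed.isComplete hconv 0
  refine ⟨f, v, hf, fun u w hw => ?_⟩
  have h1 := (norm_eq_iInf_iff_real_inner_le_zero hconv ⟨f, hf⟩).1 hv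
  obtain ⟨w', hw', hae⟩ := hmem u w hw
  have h2 := h1 w' hw'
  rw [zero_sub, inner_neg_left, neg_nonpos, inner_Lp_eq] at h2
  refine h2.trans_eq (integral_congr_ae ?_)
  filter_upwards [Lp.coeFn_sub w' v, hae] with x h3 h4
  rw [h3, Pi.sub_apply, h4]

theorem sq_l2_eq_add {g v : ℝ → ℝ} (hg : MemLp g 2 torus) (hv : MemLp v 2 torus) :
    l2 v ^ 2 = l2 g ^ 2 + 2 * (∫ x, g x * (v x - g x) ∂torus) + l2 (v - g) ^ 2 := by
  have i1 : Integrable (fun x => g x * (v x - g x)) torus :=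
    integrable_mul_of_memLp_two hg (hv.sub hg)
  have i2 : Integrable (fun x => (v - g) x ^ 2) torus := (hv.sub hg).integrable_sq
  rw [sq_l2, sq_l2, sq_l2, ← integral_const_mul, ← integral_add hg.integrable_sq (i1.const_mul 2),
    ← integral_add (f := fun x => g x ^ 2 + 2 * (g x * (v x - g x)))
      (hg.integrable_sq.add (i1.const_mul 2)) i2]
  congr 1; ext x; simp only [Pi.sub_apply]; ring

theorem ae_eq_of_l2_sub_eq_zero {g v : ℝ → ℝ} (hg : MemLp g 2 torus) (hv : MemLp v 2 torus)
    (h : l2 (v - g) = 0) : v =ᵐ[torus] g := by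
  have h1 := eLpNorm_two_eq_l2 (hv.sub hg)
  rw [h, ENNReal.ofReal_zero, eLpNorm_eq_zero_iff (hv.sub hg).1 (by simp)] at h1
  filter_upwards [h1] with x hx
  simpa [sub_eq_zero] using hx

theorem objective_le_iff {f u g v : ℝ → ℝ} (h : HasSobolevDeriv k f g)
    (h' : HasSobolevDeriv k u v) :
    (1 / 2 : ℝ≥0∞) * weakDerivNorm k 2 f ^ 2 ≤ (1 / 2 : ℝ≥0∞) * weakDerivNorm k 2 u ^ 2 ↔
      l2 g ≤ l2 v := by
  rw [h.weakDerivNorm_eq, h'.weakDerivNorm_eq, ENNReal.mul_le_mul_iff_right (by simp) (by simp),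
    ENNReal.pow_le_pow_left_iff two_ne_zero, ENNReal.ofReal_le_ofReal_iff (l2_nonneg _)]

/-- Expanding `‖v‖²` around the projection `g₀` leaves an excess of at least `‖v - g₀‖²`. A feasible
function of no larger energy therefore has the same derivative almost everywhere, and coincides with
the projection by mean zero. -/
theorem isMIND_iff (hk : 1 ≤ k) (hn : 1 ≤ n) (hγ : 0 ≤ γ) {f : ℝ → ℝ} :
    IsMIND k B n γ y f ↔ ∃ g, Feasible k B n γ y f g ∧
      ∀ u v, Feasible k B n γ y u v → 0 ≤ ∫ x, g x * (v x - g x) ∂torus := by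
  constructor
  · rintro ⟨⟨h1, h2⟩, h3⟩
    obtain ⟨f₀, g₀, hf₀, hmin⟩ := exists_feasible_variational (B := B) (y := y) hk hn hγ
    obtain ⟨g, hg⟩ := mem_sobolevHilbert₀_iff.1 h1
    have hle := (objective_le_iff hg hf₀.1).1
      (h3 (show _ ∈ _ from ⟨mem_sobolevHilbert₀_iff.2 ⟨_, hf₀.1⟩, hf₀.2⟩))
    have h4 := hmin f g ⟨hg, h2⟩
    have h5 := sq_l2_eq_add hf₀.1.memLp hg.memLp
    have h6 : l2 (g - g₀) = 0 := by
      have := pow_le_pow_left₀ (l2_nonneg _) hle 2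
      nlinarith [l2_nonneg (g - g₀)]
    have h7 := ae_eq_of_l2_sub_eq_zero hf₀.1.memLp hg.memLp h6
    have h8 := hg.eq_of_ae hk hf₀.1 h7
    subst h8
    exact ⟨g₀, hf₀, hmin⟩
  · rintro ⟨g, hf, hmin⟩
    refine ⟨⟨mem_sobolevHilbert₀_iff.2 ⟨g, hf.1⟩, hf.2⟩, ?_⟩
    rintro u ⟨hu, hu'⟩
    obtain ⟨v, hv⟩ := mem_sobolevHilbert₀_iff.1 hu
    refine (objective_le_iff hf.1 hv).2 ?_
    have h4 := hmin u v ⟨hv, hu'⟩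
    have h5 := sq_l2_eq_add hf.1.memLp hv.memLp
    exact abs_le_of_sq_le_sq' (by nlinarith [sq_nonneg (l2 (v - g))]) (l2_nonneg _) |>.2

theorem existsUnique_isMIND (hk : 1 ≤ k) (hn : 1 ≤ n) (hγ : 0 ≤ γ) :
    ∃! f, IsMIND k B n γ y f := by
  obtain ⟨f, g, hf, hmin⟩ := exists_feasible_variational (B := B) (y := y) hk hn hγ
  refine ⟨f, (isMIND_iff hk hn hγ).2 ⟨g, hf, hmin⟩, fun f' hf' => ?_⟩
  obtain ⟨g', hf', hmin'⟩ := (isMIND_iff hk hn hγ).1 hf'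
  have h1 := hmin _ _ hf'
  have h2 := hmin' _ _ hf
  have h3 := sq_l2_eq_add hf.1.memLp hf'.1.memLp
  have h4 := sq_l2_eq_add hf'.1.memLp hf.1.memLp
  refine hf'.1.eq_of_ae hk hf.1 (ae_eq_of_l2_sub_eq_zero hf.1.memLp hf'.1.memLp ?_)
  nlinarith [sq_nonneg (l2 (g - g')), l2_nonneg (g' - g)]

/-- The basic inequality. -/
theorem sq_l2_sub_le {f g u v : ℝ → ℝ} (hf : Feasible k B n γ y f g)
    (hmin : ∀ u v, Feasible k B n γ y u v → 0 ≤ ∫ x, g x * (v x - g x) ∂torus)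
    (hu : Feasible k B n γ y u v) :
    l2 (v - g) ^ 2 ≤ ∫ x, v x * (v - g) x ∂torus := by
  have h := hmin u v hu
  have e : l2 (v - g) ^ 2 =
      ∫ x, v x * (v - g) x ∂torus - ∫ x, g x * (v x - g x) ∂torus := by
    rw [sq_l2, ← integral_sub (g := fun x => g x * (v x - g x)) (integrable_mul_of_memLp_two hu.1.memLp (hu.1.memLp.sub hf.1.memLp))
      (integrable_mul_of_memLp_two hf.1.memLp (hu.1.memLp.sub hf.1.memLp))]
    congr 1; ext x; simp only [Pi.sub_apply]; ring
  linarith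

theorem l2_le_of_variational {f g u v : ℝ → ℝ} (hf : Feasible k B n γ y f g)
    (hmin : ∀ u v, Feasible k B n γ y u v → 0 ≤ ∫ x, g x * (v x - g x) ∂torus)
    (hu : Feasible k B n γ y u v) : l2 g ≤ l2 v := by
  have h := hmin u v hu
  have h5 := sq_l2_eq_add hf.1.memLp hu.1.memLp
  exact abs_le_of_sq_le_sq' (by nlinarith [sq_nonneg (l2 (v - g))]) (l2_nonneg _) |>.2

theorem Feasible.translate {f g d e : ℝ → ℝ} (h : Feasible k B n γ y f g)
    (hd : HasSobolevDeriv k d e) : Feasible k B n γ (y + sample n d) (f + d) (g + e) := by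
  refine ⟨h.1.add hd, ?_⟩
  have : sample n (f + d) - (y + sample n d) = sample n f - y := by
    ext i; simp only [sample, Pi.sub_apply, Pi.add_apply]; ring
  rw [this]; exact h.2

/-- The estimator is a Lipschitz function of the data. -/
theorem l2_sub_le_of_variational {y' : Fin n → ℝ} {f g f' g' d e : ℝ → ℝ}
    (hf : Feasible k B n γ y f g)
    (hmin : ∀ u v, Feasible k B n γ y u v → 0 ≤ ∫ x, g x * (v x - g x) ∂torus)
    (hf' : Feasible k B n γ y' f' g')
    (hmin' : ∀ u v, Feasible k B n γ y' u v → 0 ≤ ∫ x, g' x * (v x - g' x) ∂torus)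
    (hd : HasSobolevDeriv k d e) (hs : y' = y + sample n d) :
    l2 (g' - g) ≤ l2 e := by
  -- Translation by `d` carries feasible functions for `y` to feasible functions for `y'` and back,
  -- so each minimizer can be tested against the translate of the other.
  have h1 := hf.translate hd
  rw [← hs] at h1
  have h2 := hf'.translate (hd.smul (-1))
  have h3 : y' + sample n ((-1 : ℝ) • d) = y := by
    rw [hs]; ext i; simp [sample]
  rw [h3] at h2
  have a1 := hmin' _ _ h1
  have a2 := hmin _ _ h2
  have m := hf'.1.memLp.sub hf.1.memLp
  have key : l2 (g' - g) ^ 2 + ∫ x, g' x * ((g + e) x - g' x) ∂torus +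
      ∫ x, g x * ((g' + (-1 : ℝ) • e) x - g x) ∂torus = ∫ x, e x * (g' - g) x ∂torus := by
    have i1 : Integrable (fun x => g' x * ((g + e) x - g' x)) torus :=
      integrable_mul_of_memLp_two hf'.1.memLp ((hf.1.memLp.add hd.memLp).sub hf'.1.memLp)
    have i2 : Integrable (fun x => g x * ((g' + (-1 : ℝ) • e) x - g x)) torus :=
      integrable_mul_of_memLp_two hf.1.memLp ((hf'.1.memLp.add (hd.memLp.const_smul (-1))).sub hf.1.memLp)
    rw [sq_l2]
    rw [← integral_add (f := fun x => (g' - g) x ^ 2) m.integrable_sq i1]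
    rw [← integral_add (f := fun x => (g' - g) x ^ 2 + g' x * ((g + e) x - g' x))
      (m.integrable_sq.add i1) i2]
    congr 1; ext x
    simp only [Pi.add_apply, Pi.sub_apply, Pi.smul_apply, smul_eq_mul]; ring
  have h4 := (le_abs_self _).trans (abs_integral_mul_le_l2 hd.memLp m)
  by_contra! hlt
  nlinarith [l2_nonneg e, l2_nonneg (g' - g)]

/-! ### Fourier coefficients of functions in `L^p` -/

/-- A pairing of `w` with its own partial sum makes sense for merely integrable `w` and opens the
way to Hölder's inequality. -/
theorem sum_sq_coeff_eq_integral {w : ℝ → ℝ} (hw : Integrable w torus) (F : Finset ℤ) :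
    ∑ j ∈ F, ‖coeff w j‖ ^ 2 = ∫ x, w x * trigPoly F (coeff w) x ∂torus := by
  have e : ∀ x, w x * trigPoly F (coeff w) x =
      ∑ j ∈ F, (coeff w j * (character j x * (w x : ℂ))).re := fun x => by
    rw [trigPoly, Complex.re_sum, Finset.mul_sum]
    refine Finset.sum_congr rfl fun j _ => ?_
    rw [← mul_assoc, Complex.re_mul_ofReal, mul_comm]
  have hi : ∀ j, Integrable (fun x => coeff w j * (character j x * (w x : ℂ))) torus :=
    fun j => (integrable_character_mul hw j).const_mul _
  simp_rw [e]
  rw [integral_finsetSum (f := fun j x => (coeff w j * (character j x * (w x : ℂ))).re) _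
    fun j _ => (hi j).re]
  refine Finset.sum_congr rfl fun j _ => ?_
  have h1 : ∫ x, (coeff w j * (character j x * (w x : ℂ))).re ∂torus =
      (∫ x, coeff w j * (character j x * (w x : ℂ)) ∂torus).re := integral_re (hi j)
  have h2 : ∫ x, character j x * (w x : ℂ) ∂torus = coeff w (-j) := by rw [coeff, neg_neg]
  rw [h1, integral_const_mul, h2, coeff_neg_freq, Complex.mul_conj, Complex.normSq_eq_norm_sq]
  norm_cast

/-- For `p ≥ 2` this is Bessel's inequality. For `p < 2`, let `T` be the partial sum over `N`
frequencies and `τ = ‖T‖₂`. Then `‖T‖_∞ ≤ √N τ`, hence `T` has norm at most `N^{1/p - 1/2} τ` for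
the conjugate exponent, and Hölder's inequality in the pairing of `w` with `T` reads `τ² ≤ N^{1/p -
1/2} ‖w‖_p τ`. -/
theorem sum_sq_coeff_le {p : ℝ≥0∞} (hp : 1 ≤ p) {w : ℝ → ℝ} (hw : MemLp w p torus)
    {F : Finset ℤ} (hF : ∀ j ∈ F, -j ∈ F) :
    ∑ j ∈ F, ‖coeff w j‖ ^ 2 ≤
      ((F.card : ℝ) ^ max ((p⁻¹).toReal - 1 / 2) 0 * (eLpNorm w p torus).toReal) ^ 2 := by
  rcases le_or_gt 2 p with h2 | h2
  · have hd : (p⁻¹).toReal ≤ 1 / 2 := by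
      have : (p⁻¹).toReal ≤ ((2 : ℝ≥0∞)⁻¹).toReal :=
        ENNReal.toReal_mono (by simp) (ENNReal.inv_le_inv.2 h2)
      simpa using this
    have hw2 := hw.mono_exponent h2
    rw [max_eq_right (by linarith), Real.rpow_zero, one_mul]
    have h3 := eLpNorm_le_eLpNorm_of_exponent_le h2 hw.1
    rw [eLpNorm_two_eq_l2 hw2] at h3
    have h4 := (ENNReal.ofReal_le_iff_le_toReal hw.eLpNorm_ne_top).1 h3
    calc _ ≤ l2 w ^ 2 := by
          rw [sq_l2]
          exact sum_le_hasSum _ (fun _ _ => sq_nonneg _) (hasSum_sq_coeff hw2)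
      _ ≤ _ := pow_le_pow_left₀ (l2_nonneg _) h4 2
  · have hpt : p ≠ ∞ := (h2.trans (by simp)).ne
    have hp0 : p ≠ 0 := (one_pos.trans_le hp).ne'
    obtain ⟨r, hr, rfl⟩ : ∃ r : ℝ, 1 ≤ r ∧ p = ENNReal.ofReal r :=
      ⟨p.toReal, by simpa using ENNReal.toReal_mono hpt hp, (ENNReal.ofReal_toReal hpt).symm⟩
    have hr0 : 0 < r := by linarith
    have hr2 : r < 2 := by
      have := (ENNReal.ofReal_lt_ofReal_iff (q := 2) two_pos).1 (by simpa using h2)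
      exact this
    have hd : ((ENNReal.ofReal r)⁻¹).toReal = r⁻¹ := by
      rw [← ENNReal.ofReal_inv_of_pos hr0, ENNReal.toReal_ofReal (by positivity)]
    have hd2 : (1 : ℝ) / 2 ≤ r⁻¹ := by
      rw [← one_div]; exact one_div_le_one_div_of_le hr0 hr2.le
    rw [hd, max_eq_left (by linarith)]
    have hwi : Integrable w torus := hw.integrable hp
    set T := trigPoly F (coeff w)
    have hTc : Continuous T := (contDiff_trigPoly _ _).continuous
    set τ := √(∑ j ∈ F, ‖coeff w j‖ ^ 2) with hτ
    have hs0 : 0 ≤ ∑ j ∈ F, ‖coeff w j‖ ^ 2 := Finset.sum_nonneg fun _ _ => sq_nonneg _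
    have hτ2 : τ ^ 2 = ∑ j ∈ F, ‖coeff w j‖ ^ 2 := Real.sq_sqrt hs0
    have hτ0 : 0 ≤ τ := Real.sqrt_nonneg _
    set N : ℝ := (F.card : ℝ) with hN
    have hN0 : 0 ≤ N := Nat.cast_nonneg _
    have hTb : ∀ x, |T x| ≤ √N * τ := fun x => by
      refine (abs_trigPoly_le F _ x).trans ?_
      rw [hτ, ← Real.sqrt_mul hN0]
      exact Real.le_sqrt_of_sq_le sq_sum_le_card_mul_sum_sq
    have hTi : ∫ x, T x ^ 2 ∂torus = τ ^ 2 := by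
      rw [hτ2]; exact (isHermitian_coeff hF w).integral_sq
    set X := (eLpNorm w (ENNReal.ofReal r) torus).toReal with hX
    have hXeq : X = (∫ x, ‖w x‖ ^ r ∂torus) ^ (1 / r) := by
      rw [hX, hw.eLpNorm_eq_integral_rpow_norm hp0 hpt, ENNReal.toReal_ofReal (by positivity),
        ENNReal.toReal_ofReal hr0.le, one_div]
    have key : τ ^ 2 ≤ N ^ (r⁻¹ - 1 / 2) * X * τ := by
      -- For `r = 1` the conjugate exponent is infinite, and the uniform bound of `T` is used
      -- directly.
      rcases hr.eq_or_lt with rfl | hr1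
      · have hbd : ∀ x, w x * T x ≤ √N * τ * ‖w x‖ := fun x => by
          refine (le_abs_self _).trans ?_
          rw [abs_mul, mul_comm, Real.norm_eq_abs]
          exact mul_le_mul_of_nonneg_right (hTb x) (abs_nonneg _)
        have hwT : Integrable (fun x => w x * T x) torus :=
          hwi.mul_bdd (c := √N * τ) hTc.aestronglyMeasurable (.of_forall hTb)
        have := integral_mono hwT (hwi.norm.const_mul _) hbd
        rw [← sum_sq_coeff_eq_integral hwi, ← hτ2, integral_const_mul] at this
        refine this.trans (le_of_eq ?_)
        rw [hXeq, Real.sqrt_eq_rpow]; norm_num; ring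
      · set r' := Real.conjExponent r with hr'
        have hc : r.HolderConjugate r' := Real.HolderConjugate.conjExponent hr1
        have hr'0 : 0 < r' := hc.symm.pos
        have hsum := hc.inv_add_inv_eq_one
        have hr'2 : 2 ≤ r' := by
          have : r'⁻¹ ≤ 1 / 2 := by linarith
          rw [inv_le_comm₀ hr'0 (by norm_num)] at this
          linarith
        have h3 := integral_mul_norm_le_Lp_mul_Lq hc hw (memLp_torus_of_continuous hTc _)
        have h4 : ∫ x, ‖T x‖ ^ r' ∂torus ≤ (√N * τ) ^ (r' - 2) * τ ^ 2 := by
          rw [← hTi, ← integral_const_mul]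
          refine integral_mono ?_ ?_ fun x => ?_
          · exact integrable_torus_of_continuous (by fun_prop (disch := positivity))
          · exact integrable_torus_of_continuous (by fun_prop)
          · have e : ‖T x‖ ^ r' = ‖T x‖ ^ (r' - 2) * T x ^ 2 := by
              rw [← sq_abs (T x), ← Real.norm_eq_abs, ← Real.rpow_natCast ‖T x‖ 2,
                ← Real.rpow_add_of_nonneg (norm_nonneg _) (by linarith) (by norm_num)]
              norm_num
            simp only [e]
            have h6 : ‖T x‖ ^ (r' - 2) ≤ (√N * τ) ^ (r' - 2) :=
              Real.rpow_le_rpow (norm_nonneg _) (hTb x) (by linarith)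
            gcongr
        have h5 : (∫ x, ‖T x‖ ^ r' ∂torus) ^ (1 / r') ≤ N ^ (r⁻¹ - 1 / 2) * τ := by
          refine (Real.rpow_le_rpow (integral_nonneg fun _ => by positivity) h4
            (by positivity)).trans (le_of_eq ?_)
          rcases hτ0.eq_or_lt with h0 | h0
          · rw [← h0]; simp [hr'0.ne']
          · rw [Real.mul_rpow (Real.sqrt_nonneg _) hτ0, mul_assoc, ← Real.rpow_natCast τ 2,
              ← Real.rpow_add h0, Real.mul_rpow (by positivity) (by positivity),
              Real.sqrt_eq_rpow, ← Real.rpow_mul hN0, ← Real.rpow_mul hN0, ← Real.rpow_mul h0.le]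
            have e1 : 1 / 2 * (r' - 2) * (1 / r') = r⁻¹ - 1 / 2 := by
              have : r⁻¹ = 1 - r'⁻¹ := by linarith
              rw [this]; field_simp; ring
            have e2 : (r' - 2 + (2 : ℕ)) * (1 / r') = 1 := by
              push_cast; field_simp; ring
            rw [e1, e2, Real.rpow_one]
        calc τ ^ 2 = ∫ x, w x * T x ∂torus := by rw [hτ2, sum_sq_coeff_eq_integral hwi]
          _ ≤ ∫ x, ‖w x‖ * ‖T x‖ ∂torus := by
              refine (le_abs_self _).trans (abs_integral_le_integral_abs.trans (le_of_eq ?_))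
              simp only [abs_mul, Real.norm_eq_abs]
          _ ≤ X * (N ^ (r⁻¹ - 1 / 2) * τ) := by
              rw [hXeq]
              exact h3.trans (mul_le_mul_of_nonneg_left h5 (by positivity))
          _ = _ := by ring
    rw [← hτ2]
    refine pow_le_pow_left₀ hτ0 ?_ 2
    have h0 : 0 ≤ N ^ (r⁻¹ - 1 / 2) * X := mul_nonneg (by positivity) ENNReal.toReal_nonneg
    by_contra! hlt
    nlinarith

/-! ### Fourier coefficients of differences -/

theorem coeff_fwdDiff {f : ℝ → ℝ} (hf : Continuous f) (hp : Function.Periodic f 1) (h : ℝ)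
    (j : ℤ) : coeff (fwdDiff h f) j = (character j h - 1) * coeff f j := by
  have hc : Continuous fun x => f (x + h) := by fun_prop
  have h1 : coeff (fun x => f (x + h)) j = character j h * coeff f j := by
    have e : ∀ x, character (-j) x * (f (x + h) : ℂ) =
        character j h * (character (-j) (x + h) * (f (x + h) : ℂ)) := fun x => by
      have : character j h * character (-j) h = 1 := by
        rw [← character_add_freq, add_neg_cancel, character_zero_freq]
      rw [character_add]
      linear_combination (-character (-j) x * (f (x + h) : ℂ)) * this
    have hper : Function.Periodic (fun x => character (-j) x * (f x : ℂ)) 1 := fun x => by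
      simp only [character_periodic (-j) x, hp x]
    rw [coeff, coeff]
    simp_rw [e]
    rw [integral_const_mul, integral_torus, integral_torus,
      intervalIntegral.integral_comp_add_right (fun x => character (-j) x * (f x : ℂ)), zero_add,
      add_comm 1 h, hper.intervalIntegral_add_eq h 0, zero_add]
  have h2 : fwdDiff h f = (fun x => f (x + h)) - f := rfl
  rw [h2, coeff_sub (integrable_torus_of_continuous hc) (integrable_torus_of_continuous hf), h1]
  ring

theorem fwdDiff_iterate_props {f : ℝ → ℝ} (hf : Continuous f) (hp : Function.Periodic f 1)
    (h : ℝ) (r : ℕ) : Continuous ((fwdDiff h)^[r] f) ∧ Function.Periodic ((fwdDiff h)^[r] f) 1 ∧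
      ∀ j, coeff ((fwdDiff h)^[r] f) j = (character j h - 1) ^ r * coeff f j := by
  induction r with
  | zero => exact ⟨hf, hp, fun j => by simp⟩
  | succ r ih =>
    obtain ⟨h1, h2, h3⟩ := ih
    rw [Function.iterate_succ_apply']
    refine ⟨?_, fun x => ?_, fun j => ?_⟩
    · exact (h1.comp (by fun_prop : Continuous fun x : ℝ => x + h)).sub h1
    · simp only [fwdDiff]
      rw [add_right_comm, h2, h2]
    · rw [coeff_fwdDiff h1 h2, h3, pow_succ]; ring

/-- Jordan's inequality `|sin x| ≥ (2/π)|x|` on `|x| ≤ π/2`, combined with `|e^{iφ} - 1| =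
2|sin(φ/2)|`. -/
theorem le_norm_character_sub_one {j : ℤ} {h : ℝ} (hh : |(j : ℝ)| * |h| ≤ 1 / 2) :
    4 * (|(j : ℝ)| * |h|) ≤ ‖character j h - 1‖ := by
  have e : character j h = Complex.exp (Complex.I * ((2 * Real.pi * (j * h) : ℝ) : ℂ)) := by
    rw [character, freq]; congr 1; push_cast; ring
  have hπ := Real.pi_pos
  rw [e, Complex.norm_exp_I_mul_ofReal_sub_one, Real.norm_eq_abs, abs_mul, abs_two]
  have e2 : 2 * Real.pi * (j * h) / 2 = Real.pi * (j * h) := by ring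
  have e3 : |Real.pi * (j * h)| = Real.pi * (|(j : ℝ)| * |h|) := by
    rw [abs_mul, abs_mul, abs_of_pos hπ]
  rw [e2]
  have := Real.mul_abs_le_abs_sin (x := Real.pi * (j * h)) (by rw [e3]; nlinarith)
  rw [e3] at this
  have e4 : 2 / Real.pi * (Real.pi * (|(j : ℝ)| * |h|)) = 2 * (|(j : ℝ)| * |h|) := by
    field_simp
  linarith

/-! ### Besov and Sobolev norms -/

theorem modulus_mono (r : ℕ) (p : ℝ≥0∞) (f : ℝ → ℝ) : Monotone (modulus r p f) := fun _ _ hst =>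
  iSup₂_le fun h hh => le_iSup₂ (f := fun (h : ℝ) (_ : |h| ≤ _) => eLpNorm ((fwdDiff h)^[r] f) p torus)
    h (hh.trans hst)

theorem eLpNorm_fwdDiff_le_modulus (r : ℕ) (p : ℝ≥0∞) (f : ℝ → ℝ) {h : ℝ} (hh : 0 ≤ h) :
    eLpNorm ((fwdDiff h)^[r] f) p torus ≤ modulus r p f h :=
  le_iSup₂ (f := fun (h : ℝ) (_ : |h| ≤ _) => eLpNorm ((fwdDiff h)^[r] f) p torus) h
    (abs_of_nonneg hh).le

theorem ofReal_rpow_mul_neg {t : ℝ} (ht : 0 < t) (S : ℝ) (a : ℝ≥0∞) :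
    ENNReal.ofReal (t ^ S) * (ENNReal.ofReal (t ^ (-S)) * a) = a := by
  rw [← mul_assoc, ← ENNReal.ofReal_mul (by positivity), ← Real.rpow_add ht, add_neg_cancel,
    Real.rpow_zero, ENNReal.ofReal_one, one_mul]

/-- The modulus is monotone, so its value at `h` is a lower bound on all of `(h, 2h)`, an interval
of mass at least `1/2` for `dt/t`. For `p' = ∞` a single good point of this interval suffices. -/
theorem modulus_le_besovSeminorm {r : ℕ} {S : ℝ} (hS : 0 ≤ S) {p p' : ℝ≥0∞} (hp' : 1 ≤ p')
    (f : ℝ → ℝ) {h : ℝ} (h0 : 0 < h) (h1 : 2 * h ≤ 1) :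
    modulus r p f h ≤ ENNReal.ofReal (2 * (2 * h) ^ S) * besovSeminorm r S p p' f := by
  have hh : (0 : ℝ) < 2 * h := by linarith
  rw [besovSeminorm]
  split_ifs with htop
  · set L := essSup (fun t : ℝ => ENNReal.ofReal (t ^ (-S)) * modulus r p f t)
      (volume.restrict (Set.Ioi (0 : ℝ))) with hL
    have hae := ae_restrict_of_ae_restrict_of_subset (μ := volume)
      (p := fun t => ENNReal.ofReal (t ^ (-S)) * modulus r p f t ≤ L)
      (show Set.Ioo h (2 * h) ⊆ Set.Ioi (0 : ℝ) from fun t ht => h0.trans ht.1)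
      (ENNReal.ae_le_essSup fun t : ℝ => ENNReal.ofReal (t ^ (-S)) * modulus r p f t)
    have hne : (ae (volume.restrict (Set.Ioo h (2 * h)))).NeBot := by
      rw [ae_neBot, Ne, Measure.restrict_eq_zero, Real.volume_Ioo, ENNReal.ofReal_eq_zero]
      linarith
    obtain ⟨t, ht1, ht⟩ := (hae.and (ae_restrict_mem measurableSet_Ioo)).exists
    have ht0 : 0 < t := h0.trans ht.1
    calc modulus r p f h ≤ modulus r p f t := modulus_mono r p f ht.1.le
      _ = ENNReal.ofReal (t ^ S) * (ENNReal.ofReal (t ^ (-S)) * modulus r p f t) :=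
          (ofReal_rpow_mul_neg ht0 S _).symm
      _ ≤ _ := by
          refine mul_le_mul' (ENNReal.ofReal_le_ofReal ?_) ht1
          have : t ^ S ≤ (2 * h) ^ S := Real.rpow_le_rpow ht0.le ht.2.le hS
          have h2 : 0 ≤ (2 * h) ^ S := by positivity
          linarith
  · have hr1 : 1 ≤ p'.toReal := by simpa using ENNReal.toReal_mono htop hp'
    set r' := p'.toReal
    have hr0 : 0 < r' := by linarith
    set c := ENNReal.ofReal ((2 * h) ^ (-S)) * modulus r p f h with hc
    set Q := ∫⁻ t in Set.Ioo (0 : ℝ) 1,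
      (ENNReal.ofReal (t ^ (-S)) * modulus r p f t) ^ r' * ENNReal.ofReal (1 / t)
    have hQ : c ^ r' * ENNReal.ofReal (1 / 2) ≤ Q := by
      calc c ^ r' * ENNReal.ofReal (1 / 2)
          = ∫⁻ _ in Set.Ioo h (2 * h), c ^ r' * ENNReal.ofReal (1 / (2 * h)) := by
            rw [setLIntegral_const, Real.volume_Ioo, mul_assoc,
              ← ENNReal.ofReal_mul (by positivity)]
            congr 2; field_simp; ring
        _ ≤ ∫⁻ t in Set.Ioo h (2 * h),
            (ENNReal.ofReal (t ^ (-S)) * modulus r p f t) ^ r' * ENNReal.ofReal (1 / t) := by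
            refine setLIntegral_mono' measurableSet_Ioo fun t ht => ?_
            have ht0 : 0 < t := h0.trans ht.1
            have e1 : (2 * h) ^ (-S) ≤ t ^ (-S) :=
              Real.rpow_le_rpow_of_nonpos ht0 ht.2.le (by linarith)
            have e2 : 1 / (2 * h) ≤ 1 / t := one_div_le_one_div_of_le ht0 ht.2.le
            have e3 := modulus_mono r p f ht.1.le
            rw [hc]
            gcongr
        _ ≤ Q := lintegral_mono_set fun t ht => ⟨h0.trans ht.1, ht.2.trans_le h1⟩
    have h2 : c * ENNReal.ofReal (1 / 2) ≤ Q ^ (1 / r') := by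
      calc c * ENNReal.ofReal (1 / 2)
          ≤ c * ENNReal.ofReal ((1 / 2) ^ (1 / r')) := by
            refine mul_le_mul_right (ENNReal.ofReal_le_ofReal ?_) c
            have : (1 / 2 : ℝ) ^ (1 : ℝ) ≤ (1 / 2) ^ (1 / r') :=
              Real.rpow_le_rpow_of_exponent_ge (by norm_num) (by norm_num)
                ((div_le_one hr0).2 hr1)
            simpa using this
        _ = (c ^ r' * ENNReal.ofReal (1 / 2)) ^ (1 / r') := by
            rw [ENNReal.mul_rpow_of_nonneg _ _ (by positivity), ← ENNReal.rpow_mul,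
              mul_one_div_cancel hr0.ne', ENNReal.rpow_one,
              ENNReal.ofReal_rpow_of_pos (by norm_num)]
        _ ≤ _ := ENNReal.rpow_le_rpow hQ (by positivity)
    calc modulus r p f h = ENNReal.ofReal ((2 * h) ^ S) * c := (ofReal_rpow_mul_neg hh S _).symm
      _ = ENNReal.ofReal (2 * (2 * h) ^ S) * (c * ENNReal.ofReal (1 / 2)) := by
          have e : (2 : ℝ) * (2 * h) ^ S * (1 / 2) = (2 * h) ^ S := by ring
          rw [mul_comm c (ENNReal.ofReal (1 / 2)), ← mul_assoc (ENNReal.ofReal (2 * _)),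
            ← ENNReal.ofReal_mul (p := 2 * (2 * h) ^ S) (by positivity), e]
      _ ≤ _ := by gcongr

theorem card_freqBlock_rpow_le {m i : ℕ} (hm : 2 ≤ m) {d : ℝ} (hd0 : 0 ≤ d) (hd : d ≤ 1) :
    ((freqBlock m i (i + 1)).card : ℝ) ^ d ≤ 2 * ((m : ℝ) ^ (i + 1)) ^ d := by
  have hM : 0 < m ^ (i + 1) := by positivity
  have h1 : (freqBlock m i (i + 1)).card ≤ 2 * m ^ (i + 1) := by
    refine (Finset.card_le_card Finset.sdiff_subset).trans ?_
    rw [lowFreq, freqRange, Int.card_Icc]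
    omega
  have h2 : ((freqBlock m i (i + 1)).card : ℝ) ≤ 2 * (m : ℝ) ^ (i + 1) := by exact_mod_cast h1
  refine (Real.rpow_le_rpow (Nat.cast_nonneg _) h2 hd0).trans ?_
  rw [Real.mul_rpow (by norm_num) (by positivity)]
  refine mul_le_mul_of_nonneg_right ?_ (by positivity)
  calc (2 : ℝ) ^ d ≤ 2 ^ (1 : ℝ) := Real.rpow_le_rpow_of_exponent_le (by norm_num) hd
    _ = 2 := Real.rpow_one 2

/-- The loss of smoothness in the embedding into an `L²`-scale. -/
def embedLoss (p : ℝ≥0∞) : ℝ := max ((p⁻¹).toReal - 1 / 2) 0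

theorem embedLoss_nonneg (p : ℝ≥0∞) : 0 ≤ embedLoss p := le_max_right _ _

theorem embedLoss_le {p : ℝ≥0∞} (hp : 1 ≤ p) : embedLoss p ≤ 1 / 2 := by
  have : (p⁻¹).toReal ≤ 1 := by
    simpa using ENNReal.toReal_mono ENNReal.one_ne_top (ENNReal.inv_le_one.2 hp)
  exact max_le (by linarith) (by norm_num)

theorem sum_freqBlock_le {m : ℕ} (hm : 2 ≤ m) {p : ℝ≥0∞} (hp : 1 ≤ p) {w : ℝ → ℝ}
    (hw : MemLp w p torus) (i : ℕ) :
    ∑ j ∈ freqBlock m i (i + 1), ‖coeff w j‖ ^ 2 ≤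
      (2 * ((m : ℝ) ^ (i + 1)) ^ embedLoss p * (eLpNorm w p torus).toReal) ^ 2 := by
  refine (sum_sq_coeff_le hp hw (neg_mem_freqBlock hm)).trans ?_
  refine pow_le_pow_left₀ (mul_nonneg (by positivity) ENNReal.toReal_nonneg)
    (mul_le_mul_of_nonneg_right ?_ ENNReal.toReal_nonneg) 2
  exact card_freqBlock_rpow_le hm (embedLoss_nonneg p) ((embedLoss_le hp).trans (by norm_num))

/-- A difference of order `r` and step `t` multiplies the Fourier coefficients by `(e^{2πijt} -
1)^r`. For `t = 1/(2m^{i+1})` the frequencies of the block satisfy `1/(2m) ≤ |j| t ≤ 1/2`, where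
this factor has modulus at least `m^{-r}`, so one difference, and hence the modulus of smoothness at
`t`, controls the block. -/
theorem blockBound_of_besovNorm_le {m : ℕ} (hm : 2 ≤ m) {r : ℕ} {S : ℝ} (hS : 0 ≤ S)
    {p p' : ℝ≥0∞} (hp : 1 ≤ p) (hp' : 1 ≤ p') {f : ℝ → ℝ} (hf : IsCont₀ f) {L : ℝ} (hL : 0 ≤ L)
    (h : besovNorm r S p p' f ≤ ENNReal.ofReal L) :
    BlockBound m (S - embedLoss p) (4 * (m : ℝ) ^ r * L * m ^ embedLoss p) f := by
  intro i
  have hm1 : (1 : ℝ) ≤ m := by exact_mod_cast (by omega : 1 ≤ m)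
  have hm0 : (0 : ℝ) < m := by linarith
  set M : ℝ := (m : ℝ) ^ (i + 1) with hM
  have hM2 : 2 ≤ M := by
    calc (2 : ℝ) ≤ m := by exact_mod_cast hm
      _ = (m : ℝ) ^ 1 := (pow_one _).symm
      _ ≤ M := pow_le_pow_right₀ hm1 (by omega)
  have hM0 : 0 < M := by linarith
  set t : ℝ := 1 / (2 * M) with ht
  have ht0 : 0 < t := by positivity
  have h2t : 2 * t = M⁻¹ := by rw [ht]; field_simp
  obtain ⟨w1, w2, w3⟩ := fwdDiff_iterate_props hf.continuous hf.periodic t r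
  set w := (fwdDiff t)^[r] f with hw
  have hwL := memLp_torus_of_continuous w1 p
  have hnorm : (eLpNorm w p torus).toReal ≤ 2 * M ^ (-S) * L := by
    refine ENNReal.toReal_le_of_le_ofReal (by positivity) ?_
    refine (eLpNorm_fwdDiff_le_modulus r p f ht0.le).trans ?_
    refine (modulus_le_besovSeminorm hS hp' f ht0 (by
      rw [h2t]; exact inv_le_one_of_one_le₀ (by linarith))).trans ?_
    rw [h2t, ← Real.rpow_neg_eq_inv_rpow, ENNReal.ofReal_mul (q := L) (by positivity)]
    exact mul_le_mul_right (le_add_self.trans h) _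
  have hcoef : ∀ j ∈ freqBlock m i (i + 1), ‖coeff f j‖ ^ 2 ≤ ((m : ℝ) ^ r) ^ 2 * ‖coeff w j‖ ^ 2 := by
    intro j hj
    obtain ⟨j1, j2⟩ := (mem_freqBlock hm).1 hj
    have e1 : (m : ℝ) ^ i ≤ |(j : ℝ)| := by
      rw [← Int.cast_abs, Int.abs_eq_natAbs]; exact_mod_cast j1
    have e2 : |(j : ℝ)| ≤ M := by
      rw [← Int.cast_abs, Int.abs_eq_natAbs, hM]; exact_mod_cast j2.le
    have e3 := le_norm_character_sub_one (j := j) (h := t) (by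
      rw [abs_of_pos ht0, ht]
      calc |(j : ℝ)| * (1 / (2 * M)) ≤ M * (1 / (2 * M)) := by gcongr
        _ = 1 / 2 := by field_simp)
    have e4 : 1 ≤ m * ‖character j t - 1‖ := by
      calc (1 : ℝ) ≤ m * (4 * ((m : ℝ) ^ i * t)) := by
            rw [ht, hM, pow_succ]; field_simp; norm_num
        _ ≤ m * (4 * (|(j : ℝ)| * |t|)) := by rw [abs_of_pos ht0]; gcongr
        _ ≤ _ := by gcongr
    rw [w3, norm_mul, norm_pow, ← mul_pow, ← mul_assoc, ← mul_pow]
    refine pow_le_pow_left₀ (norm_nonneg _) ?_ 2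
    exact le_mul_of_one_le_left (norm_nonneg _) (one_le_pow₀ e4)
  calc _ ≤ ∑ j ∈ freqBlock m i (i + 1), ((m : ℝ) ^ r) ^ 2 * ‖coeff w j‖ ^ 2 :=
        Finset.sum_le_sum hcoef
    _ ≤ ((m : ℝ) ^ r) ^ 2 * (2 * M ^ embedLoss p * (2 * M ^ (-S) * L)) ^ 2 := by
        rw [← Finset.mul_sum]
        refine mul_le_mul_of_nonneg_left ((sum_freqBlock_le hm hp hwL i).trans ?_) (by positivity)
        refine pow_le_pow_left₀ (mul_nonneg (by positivity) ENNReal.toReal_nonneg) ?_ 2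
        gcongr
    _ = (4 * (m : ℝ) ^ r * L * M ^ embedLoss p * M ^ (-S)) ^ 2 := by ring
    _ ≤ _ := by
        refine pow_le_pow_left₀ (by positivity) ?_ 2
        have e5 : M ^ (-S) ≤ ((m : ℝ) ^ i) ^ (-S) :=
          Real.rpow_le_rpow_of_nonpos (by positivity) (pow_le_pow_right₀ hm1 (by omega))
            (by linarith)
        have e6 : M ^ embedLoss p = m ^ embedLoss p * ((m : ℝ) ^ i) ^ embedLoss p :=
          pow_rpow_succ hm i _
        have e7 : ((m : ℝ) ^ i) ^ (-(S - embedLoss p)) =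
            ((m : ℝ) ^ i) ^ embedLoss p * ((m : ℝ) ^ i) ^ (-S) := by
          rw [← Real.rpow_add (by positivity)]; congr 1; ring
        rw [e6, e7]
        calc _ ≤ 4 * (m : ℝ) ^ r * L * (m ^ embedLoss p * ((m : ℝ) ^ i) ^ embedLoss p) *
              ((m : ℝ) ^ i) ^ (-S) := by gcongr
          _ = _ := by ring

/-- The norm is an infimum, and the strict inequality provides an actual weak derivative below the
bound; on the block its coefficients exceed those of `f` by at least `m^{ia}`. -/
theorem blockBound_of_weakDerivNorm_lt {m : ℕ} (hm : 2 ≤ m) {a : ℕ}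
    {p : ℝ≥0∞} (hp : 1 ≤ p) {f : ℝ → ℝ} (hf : IsCont₀ f) {L : ℝ} (hL : 0 ≤ L)
    (h : weakDerivNorm a p f < ENNReal.ofReal L) :
    BlockBound m (a - embedLoss p) (2 * L * m ^ embedLoss p) f := by
  intro i
  have hm1 : (1 : ℝ) ≤ m := by exact_mod_cast (by omega : 1 ≤ m)
  have hm0 : (0 : ℝ) < m := by linarith
  obtain ⟨g, hg⟩ := iInf_lt_iff.1 h
  obtain ⟨hg1, hg2⟩ := iInf_lt_iff.1 hg
  have hgp : MemLp g p torus := ⟨hg1.1.1, hg2.trans ENNReal.ofReal_lt_top⟩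
  have hn := ENNReal.toReal_le_of_le_ofReal hL hg2.le
  have hcoef : ∀ j ∈ freqBlock m i (i + 1),
      ‖coeff f j‖ ^ 2 ≤ (((m : ℝ) ^ i) ^ (-(a : ℝ))) ^ 2 * ‖coeff g j‖ ^ 2 := by
    intro j hj
    obtain ⟨j1, j2⟩ := (mem_freqBlock hm).1 hj
    have e1 : (m : ℝ) ^ i ≤ |(j : ℝ)| := by
      rw [← Int.cast_abs, Int.abs_eq_natAbs]; exact_mod_cast j1
    have e2 : (m : ℝ) ^ i ≤ ‖freq j‖ := by
      rw [norm_freq]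
      nlinarith [Real.pi_gt_three, abs_nonneg (j : ℝ)]
    rw [hg1.coeff_eq hf.integrable, norm_mul, norm_pow, ← mul_pow, ← mul_assoc, Real.rpow_neg
      (by positivity), Real.rpow_natCast]
    refine pow_le_pow_left₀ (norm_nonneg _) ?_ 2
    refine le_mul_of_one_le_left (norm_nonneg _) ?_
    rw [← inv_pow, ← mul_pow]
    refine one_le_pow₀ ?_
    rw [← div_eq_inv_mul, le_div_iff₀ (by positivity), one_mul]
    exact e2
  calc _ ≤ ∑ j ∈ freqBlock m i (i + 1), (((m : ℝ) ^ i) ^ (-(a : ℝ))) ^ 2 * ‖coeff g j‖ ^ 2 :=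
        Finset.sum_le_sum hcoef
    _ ≤ (((m : ℝ) ^ i) ^ (-(a : ℝ))) ^ 2 * (2 * ((m : ℝ) ^ (i + 1)) ^ embedLoss p * L) ^ 2 := by
        rw [← Finset.mul_sum]
        refine mul_le_mul_of_nonneg_left ((sum_freqBlock_le hm hp hgp i).trans ?_) (by positivity)
        refine pow_le_pow_left₀ (mul_nonneg (by positivity) ENNReal.toReal_nonneg) ?_ 2
        gcongr
    _ = _ := by
        rw [← mul_pow, pow_rpow_succ hm, neg_sub, sub_eq_add_neg, Real.rpow_add (by positivity)]
        ring

/-- The norms of the theorem. -/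
def IsSmoothnessNorm (S : ℝ) (p : ℝ≥0∞) (N : (ℝ → ℝ) → ℝ≥0∞) : Prop :=
  N = sobolevNorm S p ∨ ∃ (p' : ℝ≥0∞) (m : ℕ), 1 ≤ p' ∧ S < m ∧ N = besovNorm m S p p'

theorem exists_blockBound {m : ℕ} (hm : 2 ≤ m) {S : ℝ} (hS : 0 ≤ S) {p : ℝ≥0∞} (hp : 1 ≤ p)
    {N : (ℝ → ℝ) → ℝ≥0∞} (hN : IsSmoothnessNorm S p N) :
    ∃ K : ℝ, 0 ≤ K ∧ ∀ (f : ℝ → ℝ) (L : ℝ), IsCont₀ f → 0 ≤ L → N f ≤ ENNReal.ofReal L →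
      BlockBound m (S - embedLoss p) (K * (L + 1)) f := by
  have mono : ∀ {A A' : ℝ} {f : ℝ → ℝ}, 0 ≤ A → A ≤ A' → BlockBound m (S - embedLoss p) A f →
      BlockBound m (S - embedLoss p) A' f := fun {A A' f} h0 hA h i => (h i).trans (by gcongr)
  have hbes : ∀ (r : ℕ) (p' : ℝ≥0∞), 1 ≤ p' → ∃ K : ℝ, 0 ≤ K ∧ ∀ (f : ℝ → ℝ) (L : ℝ),
      IsCont₀ f → 0 ≤ L → besovNorm r S p p' f ≤ ENNReal.ofReal L →
      BlockBound m (S - embedLoss p) (K * (L + 1)) f := fun r p' hp' => by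
    refine ⟨4 * (m : ℝ) ^ r * m ^ embedLoss p, by positivity, fun f L hf hL h => ?_⟩
    refine mono (by positivity) ?_ (blockBound_of_besovNorm_le hm hS hp hp' hf hL h)
    calc _ = 4 * (m : ℝ) ^ r * m ^ embedLoss p * L := by ring
      _ ≤ _ := by gcongr; linarith
  rcases hN with rfl | ⟨p', r, hp', -, rfl⟩
  · by_cases hint : (⌊S⌋₊ : ℝ) = S
    · refine ⟨2 * m ^ embedLoss p, by positivity, fun f L hf hL h => ?_⟩
      rw [sobolevNorm, if_pos hint] at h
      -- Relaxing `L` to `L + 1` makes the inequality strict, as the infimum requires, and remains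
      -- meaningful for `L = 0`.
      have h2 := h.trans_lt ((ENNReal.ofReal_lt_ofReal_iff (by linarith)).2 (lt_add_one L))
      have h3 := blockBound_of_weakDerivNorm_lt hm hp hf (by linarith) h2
      rw [hint] at h3
      convert h3 using 1; ring
    · obtain ⟨K, hK, h⟩ := hbes (⌊S⌋₊ + 1) p hp
      refine ⟨K, hK, fun f L hf hL hN => h f L hf hL ?_⟩
      rwa [sobolevNorm, if_neg hint] at hN
  · exact hbes r p' hp'

/-! ### The noise -/

/-- The indices `c ≤ i < d`. -/
def indexInterval (n c d : ℕ) : Finset (Fin n) :=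
  Finset.univ.filter fun i : Fin n => c ≤ (i : ℕ) ∧ (i : ℕ) < d

section Noise

variable {Ω : Type*} {ξ : (n : ℕ) → Fin n → Ω → ℝ}

/-- Some local sum of the noise is large. -/
def noiseBad (ξ : (n : ℕ) → Fin n → Ω → ℝ) (γ : ℝ) (n : ℕ) : Set Ω :=
  ⋃ x ∈ Finset.range (n + 1) ×ˢ Finset.range (n + 1),
    {ω | (indexInterval n x.1 x.2).Nonempty ∧
      γ * √((indexInterval n x.1 x.2).card : ℝ) ≤ |∑ i ∈ indexInterval n x.1 x.2, ξ n i ω|}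

/-- Every interval selects a run of consecutive indices, so at most `(n + 1)²` sums have to be
watched, however rich the system `B` is. -/
theorem mrNorm_le_of_notMem_noiseBad {B : Set (Set ℝ)} (hB : IsIntervalSystem B) {n : ℕ} {γ : ℝ}
    (hγ : 0 ≤ γ) {ω : Ω} (hω : ω ∉ noiseBad ξ γ n) : mrNorm B n (fun i => ξ n i ω) ≤ γ := by
  rw [mrNorm_le_iff hγ]
  intro I hI
  obtain ⟨a, h, h0, h1, rfl, hsub⟩ := hB I hI
  have e : gridIn n (Set.Ico a (a + h)) =
      indexInterval n (min ⌈n * a⌉₊ n) (min ⌈n * (a + h)⌉₊ n) := by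
    ext i
    rw [mem_gridIn_Ico, indexInterval, Finset.mem_filter]
    have := i.2
    simp only [Finset.mem_univ, true_and]
    omega
  set c := min ⌈n * a⌉₊ n
  set d := min ⌈n * (a + h)⌉₊ n
  rcases (gridIn n (Set.Ico a (a + h))).eq_empty_or_nonempty with h2 | h2
  · rw [h2]; simpa using hγ
  · have hcard : 0 < √((gridIn n (Set.Ico a (a + h))).card : ℝ) :=
      Real.sqrt_pos.2 (by exact_mod_cast h2.card_pos)
    rw [div_le_iff₀ hcard]
    by_contra! hlt
    refine hω ?_
    rw [noiseBad, Set.mem_iUnion₂]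
    refine ⟨(c, d), ?_, ?_⟩
    · simp only [Finset.mem_product, Finset.mem_range]
      omega
    · rw [e] at h2 hlt
      exact ⟨h2, hlt.le⟩

/-- A bound for the noise whose expectation over rare events is small. -/
def noiseBound (ξ : (n : ℕ) → Fin n → Ω → ℝ) (k n : ℕ) (ω : Ω) : ℝ :=
  Real.log n + ∑ i, (n : ℝ) ^ (-((k : ℝ) + 2)) *
    (Real.exp ((k + 3) * ξ n i ω) + Real.exp (-(k + 3) * ξ n i ω))

/-- If `|ξ| > log n`, then `|ξ| ≤ e^{|ξ|} ≤ n^{-(k+2)} e^{(k+3)|ξ|}`. Such exponentials have bounded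
expectation, and the power `n^{-(k+2)}` outweighs the `n` terms of the sum and the factor `n^k` of
the crude error bound. -/
theorem abs_noise_le (k : ℕ) {n : ℕ} (i : Fin n) (ω : Ω) : |ξ n i ω| ≤ noiseBound ξ k n ω := by
  have hn1 : (1 : ℝ) ≤ n := by exact_mod_cast i.pos
  have hn0 : (0 : ℝ) < n := by linarith
  have hl := Real.log_nonneg hn1
  have hpos : ∀ i : Fin n, 0 ≤ (n : ℝ) ^ (-((k : ℝ) + 2)) *
      (Real.exp ((k + 3) * ξ n i ω) + Real.exp (-(k + 3) * ξ n i ω)) := fun i => by positivity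
  rcases le_or_gt |ξ n i ω| (Real.log n) with h | h
  · exact h.trans (le_add_of_nonneg_right (Finset.sum_nonneg fun i _ => hpos i))
  · have h1 : |ξ n i ω| ≤ (n : ℝ) ^ (-((k : ℝ) + 2)) *
        (Real.exp ((k + 3) * ξ n i ω) + Real.exp (-(k + 3) * ξ n i ω)) := by
      have h2 : Real.exp ((k + 3) * |ξ n i ω|) ≤
          Real.exp ((k + 3) * ξ n i ω) + Real.exp (-(k + 3) * ξ n i ω) := by
        rcases abs_choice (ξ n i ω) with h | h <;> rw [h]
        · exact le_add_of_nonneg_right (Real.exp_pos _).le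
        · rw [neg_mul, mul_neg]; exact le_add_of_nonneg_left (Real.exp_pos _).le
      calc |ξ n i ω| ≤ Real.exp |ξ n i ω| := by linarith [Real.add_one_le_exp |ξ n i ω|]
        _ ≤ (n : ℝ) ^ (-((k : ℝ) + 2)) * Real.exp ((k + 3) * |ξ n i ω|) := by
            rw [Real.rpow_def_of_pos hn0, ← Real.exp_add, Real.exp_le_exp]
            have : (0 : ℝ) ≤ k := Nat.cast_nonneg k
            nlinarith
        _ ≤ _ := by gcongr
    exact h1.trans ((Finset.single_le_sum (fun i _ => hpos i) (Finset.mem_univ i)).trans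
      (le_add_of_nonneg_left hl))

variable [MeasurableSpace Ω] {P : Measure Ω} {σ : ℝ≥0}

theorem measurableSet_noiseBad (hξ : IsNoise P σ ξ) (γ : ℝ) (n : ℕ) :
    MeasurableSet (noiseBad ξ γ n) := by
  refine Finset.measurableSet_biUnion _ fun x _ => ?_
  by_cases hne : (indexInterval n x.1 x.2).Nonempty
  · simp only [hne, true_and]
    refine measurableSet_le measurable_const ?_
    exact (Finset.measurable_fun_sum _ fun i _ => hξ.measurable n i).abs
  · simp only [hne, false_and]
    exact MeasurableSet.const _

variable [IsProbabilityMeasure P]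

theorem measureReal_abs_sum_ge_le (hξ : IsNoise P σ ξ) {n : ℕ} {s : Finset (Fin n)}
    (hs : s.Nonempty) {γ : ℝ} (hγ : 0 ≤ γ) :
    P.real {ω | γ * √(s.card : ℝ) ≤ |∑ i ∈ s, ξ n i ω|} ≤ 2 * Real.exp (-γ ^ 2 / (2 * σ ^ 2)) := by
  have hc : (0 : ℝ) < s.card := by exact_mod_cast hs.card_pos
  have h := HasSubgaussianMGF.sum_of_iIndepFun (hξ.indep n) (s := s) (c := fun _ => σ ^ 2)
    fun i _ => hξ.subgaussian n i
  have h0 : 0 ≤ γ * √(s.card : ℝ) := by positivity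
  have h1 := h.measure_ge_le h0
  have h2 := h.neg.measure_ge_le h0
  have e : -(γ * √(s.card : ℝ)) ^ 2 / (2 * ((∑ _i ∈ s, σ ^ 2 : ℝ≥0) : ℝ)) =
      -γ ^ 2 / (2 * σ ^ 2) := by
    rw [mul_pow, Real.sq_sqrt hc.le, Finset.sum_const]
    push_cast
    rw [nsmul_eq_mul]
    -- For `σ = 0` both quotients are zero by convention.
    rcases eq_or_ne (σ : ℝ) 0 with h | h
    · simp [h]
    · field_simp
  rw [e] at h1 h2
  have hsub : {ω | γ * √(s.card : ℝ) ≤ |∑ i ∈ s, ξ n i ω|} ⊆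
      {ω | γ * √(s.card : ℝ) ≤ ∑ i ∈ s, ξ n i ω} ∪
        {ω | γ * √(s.card : ℝ) ≤ (-fun ω => ∑ i ∈ s, ξ n i ω) ω} := fun ω hω => by
    simpa [le_abs] using hω
  calc _ ≤ _ := measureReal_mono hsub
    _ ≤ _ := measureReal_union_le _ _
    _ ≤ _ := by linarith

theorem measureReal_noiseBad_le (hξ : IsNoise P σ ξ) (n : ℕ) {γ : ℝ} (hγ : 0 ≤ γ) :
    P.real (noiseBad ξ γ n) ≤ 2 * ((n : ℝ) + 1) ^ 2 * Real.exp (-γ ^ 2 / (2 * σ ^ 2)) := by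
  calc _ ≤ ∑ x ∈ Finset.range (n + 1) ×ˢ Finset.range (n + 1), P.real
        {ω | (indexInterval n x.1 x.2).Nonempty ∧
          γ * √((indexInterval n x.1 x.2).card : ℝ) ≤ |∑ i ∈ indexInterval n x.1 x.2, ξ n i ω|} :=
        measureReal_biUnion_finset_le _ _
    _ ≤ ∑ _x ∈ Finset.range (n + 1) ×ˢ Finset.range (n + 1),
        2 * Real.exp (-γ ^ 2 / (2 * σ ^ 2)) := by
        refine Finset.sum_le_sum fun x _ => ?_
        by_cases hne : (indexInterval n x.1 x.2).Nonempty
        · simp only [hne, true_and]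
          exact measureReal_abs_sum_ge_le hξ hne hγ
        · simp only [hne, false_and, Set.ofPred_false, measureReal_empty]
          positivity
    _ = _ := by
        rw [Finset.sum_const, Finset.card_product, Finset.card_range, nsmul_eq_mul]
        push_cast; ring

/-- For `r = 1/2` the margin `ε` comes from the strict inequality for `C₀`; for larger `r` the
squared threshold outgrows every multiple of `log n`. -/
theorem exists_eventually_le_sq_threshold {k : ℕ} {r C₀ : ℝ} (hσ : 0 < σ) (hr : 1 / 2 ≤ r)
    (hC₀ : 0 < C₀) (hC₀' : r = 1 / 2 → (σ : ℝ) * √(5 + 2 * k) < C₀) :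
    ∃ ε : ℝ, 0 < ε ∧ ∀ᶠ n : ℕ in atTop,
      (5 + 2 * k + 2 * ε) * σ ^ 2 * Real.log n ≤ threshold C₀ r n ^ 2 := by
  have hσ' : (0 : ℝ) < σ := hσ
  have hlog : Tendsto (fun n : ℕ => Real.log n) atTop atTop :=
    Real.tendsto_log_atTop.comp tendsto_natCast_atTop_atTop
  rcases hr.eq_or_lt with h | h
  · have h1 := hC₀' h.symm
    have h2 : (σ : ℝ) ^ 2 * (5 + 2 * k) < C₀ ^ 2 := by
      have := pow_lt_pow_left₀ h1 (by positivity) two_ne_zero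
      rwa [mul_pow, Real.sq_sqrt (by positivity)] at this
    refine ⟨(C₀ ^ 2 / σ ^ 2 - (5 + 2 * k)) / 2, ?_, ?_⟩
    · have : 5 + 2 * (k : ℝ) < C₀ ^ 2 / σ ^ 2 := by
        rw [lt_div_iff₀ (by positivity)]; linarith
      linarith
    · filter_upwards [hlog.eventually_ge_atTop 0] with n hn
      rw [threshold, ← h, mul_pow, ← Real.sqrt_eq_rpow, Real.sq_sqrt hn]
      refine le_of_eq ?_
      field_simp; ring
  · refine ⟨1, one_pos, ?_⟩
    have h2 : Tendsto (fun n : ℕ => Real.log n ^ (2 * r - 1)) atTop atTop :=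
      (tendsto_rpow_atTop (by linarith)).comp hlog
    filter_upwards [hlog.eventually_gt_atTop 0,
      h2.eventually_ge_atTop ((5 + 2 * k + 2 * 1) * σ ^ 2 / C₀ ^ 2)] with n hn h3
    rw [div_le_iff₀ (by positivity)] at h3
    calc _ ≤ Real.log n ^ (2 * r - 1) * C₀ ^ 2 * Real.log n := by gcongr
      _ = C₀ ^ 2 * (Real.log n ^ (2 * r - 1) * Real.log n ^ (1 : ℝ)) := by
          rw [Real.rpow_one]; ring
      _ = _ := by
          rw [threshold, mul_pow, ← Real.rpow_add hn, ← Real.rpow_natCast (Real.log n ^ r),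
            ← Real.rpow_mul hn.le]
          congr 2; push_cast; ring

/-- Of the order of `n²` sums, each exceptional with probability at most `2 n^{-(5/2+k+ε)}`. This is
the origin of the constant `5 + 2k`: the resulting exponent must exceed `k + 1/2`. -/
theorem exists_measureReal_noiseBad_le (hξ : IsNoise P σ ξ) {k : ℕ} {r C₀ : ℝ} (hσ : 0 < σ)
    (hr : 1 / 2 ≤ r) (hC₀ : 0 < C₀) (hC₀' : r = 1 / 2 → (σ : ℝ) * √(5 + 2 * k) < C₀) :
    ∃ ε : ℝ, 0 < ε ∧ ∀ᶠ n : ℕ in atTop,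
      P.real (noiseBad ξ (threshold C₀ r n) n) ≤ 8 * (n : ℝ) ^ (-(k + 1 / 2 + ε)) := by
  have hσ' : (0 : ℝ) < σ := hσ
  obtain ⟨ε, hε, h⟩ := exists_eventually_le_sq_threshold (k := k) hσ hr hC₀ hC₀'
  refine ⟨ε, hε, ?_⟩
  filter_upwards [h, eventually_ge_atTop 1] with n hn hn1
  have hn1' : (1 : ℝ) ≤ n := by exact_mod_cast hn1
  have hn0 : (0 : ℝ) < n := by linarith
  have hγ : 0 ≤ threshold C₀ r n := by
    have := Real.log_nonneg hn1'
    rw [threshold]; positivity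
  have hexp : Real.exp (-threshold C₀ r n ^ 2 / (2 * σ ^ 2)) ≤ (n : ℝ) ^ (-(5 / 2 + k + ε)) := by
    rw [Real.rpow_def_of_pos hn0, Real.exp_le_exp, div_le_iff₀ (by positivity)]
    nlinarith
  calc _ ≤ 2 * ((n : ℝ) + 1) ^ 2 * Real.exp (-threshold C₀ r n ^ 2 / (2 * σ ^ 2)) :=
        measureReal_noiseBad_le hξ n hγ
    _ ≤ 2 * (2 * (n : ℝ)) ^ 2 * (n : ℝ) ^ (-(5 / 2 + k + ε)) := by gcongr; linarith
    _ = 8 * ((n : ℝ) ^ (2 : ℝ) * (n : ℝ) ^ (-(5 / 2 + k + ε))) := by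
        rw [Real.rpow_two]; ring
    _ = _ := by rw [← Real.rpow_add hn0]; congr 2; ring

/-- Borel–Cantelli: the exponent `k + 1/2 + ε` is larger than one. -/
theorem ae_eventually_notMem_noiseBad (hξ : IsNoise P σ ξ) {k : ℕ} (hk : 1 ≤ k) {r C₀ : ℝ}
    (hσ : 0 < σ) (hr : 1 / 2 ≤ r) (hC₀ : 0 < C₀)
    (hC₀' : r = 1 / 2 → (σ : ℝ) * √(5 + 2 * k) < C₀) :
    ∀ᵐ ω ∂P, ∀ᶠ n : ℕ in atTop, ω ∉ noiseBad ξ (threshold C₀ r n) n := by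
  obtain ⟨ε, hε, h⟩ := exists_measureReal_noiseBad_le (k := k) hξ hσ hr hC₀ hC₀'
  obtain ⟨n₀, hn₀⟩ := eventually_atTop.1 h
  have hk1 : (1 : ℝ) ≤ k := by exact_mod_cast hk
  have hs : Summable fun n : ℕ => P.real (noiseBad ξ (threshold C₀ r (n + n₀)) (n + n₀)) := by
    have h1 : Summable fun n : ℕ => 8 * ((n + n₀ : ℕ) : ℝ) ^ (-(k + 1 / 2 + ε)) := by
      refine ((summable_nat_add_iff (f := fun n : ℕ => (n : ℝ) ^ (-(k + 1 / 2 + ε))) n₀).2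
        (Real.summable_nat_rpow.2 ?_)).mul_left 8
      linarith
    exact h1.of_nonneg_of_le (fun _ => measureReal_nonneg) fun n => hn₀ _ (by omega)
  have h2 := ae_eventually_notMem (μ := P)
    (s := fun n => noiseBad ξ (threshold C₀ r (n + n₀)) (n + n₀)) (by
      have e : ∀ n, P (noiseBad ξ (threshold C₀ r (n + n₀)) (n + n₀)) =
          ENNReal.ofReal (P.real (noiseBad ξ (threshold C₀ r (n + n₀)) (n + n₀))) := fun n => by
        rw [ofReal_measureReal]
      simp_rw [e]
      rw [← ENNReal.ofReal_tsum_of_nonneg (fun _ => measureReal_nonneg) hs]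
      exact ENNReal.ofReal_ne_top)
  filter_upwards [h2] with ω hω
  obtain ⟨n₁, hn₁⟩ := eventually_atTop.1 hω
  refine eventually_atTop.2 ⟨n₁ + n₀, fun n hn => ?_⟩
  have := hn₁ (n - n₀) (by omega)
  rwa [Nat.sub_add_cancel (by omega)] at this

/-- On the bad event the error is only known to be of order `n^k` times the noise. The logarithmic
part of `noiseBound` is multiplied by the probability of the event, and `log n ≤ n^ε` uses up the
margin. The exponential part is integrated over the whole space, with a result of order `n^k · n ·
n^{-(k+2)}`. -/
theorem exists_setLIntegral_noiseBad_le (hξ : IsNoise P σ ξ) {k : ℕ} {r C₀ : ℝ}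
    (hσ : 0 < σ) (hr : 1 / 2 ≤ r) (hC₀ : 0 < C₀)
    (hC₀' : r = 1 / 2 → (σ : ℝ) * √(5 + 2 * k) < C₀) :
    ∃ C : ℝ, 0 ≤ C ∧ ∀ᶠ n : ℕ in atTop, ∀ a M : ℝ, 0 ≤ a → 0 ≤ M →
      ∫⁻ ω in noiseBad ξ (threshold C₀ r n) n,
        ENNReal.ofReal (a + M * ((n : ℝ) ^ k * noiseBound ξ k n ω)) ∂P ≤
      ENNReal.ofReal (C * (a + M) * (n : ℝ) ^ (-(1 / 2) : ℝ)) := by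
  obtain ⟨ε, hε, h⟩ := exists_measureReal_noiseBad_le (k := k) hξ hσ hr hC₀ hC₀'
  set E : ℝ := Real.exp (σ ^ 2 * (k + 3) ^ 2 / 2) with hE
  have hE0 : 0 < E := Real.exp_pos _
  refine ⟨8 + 2 * E, by positivity, ?_⟩
  have hlog : ∀ᶠ n : ℕ in atTop, Real.log n ≤ (n : ℝ) ^ ε := by
    have := (isLittleO_log_rpow_atTop hε).bound one_pos
    filter_upwards [tendsto_natCast_atTop_atTop.eventually this, eventually_ge_atTop 1] with n hn h1
    rw [one_mul, Real.norm_of_nonneg (r := (n : ℝ) ^ ε) (by positivity)] at hn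
    exact (le_abs_self _).trans hn
  filter_upwards [h, hlog, eventually_ge_atTop 1] with n hn hnl hn1 a M ha hM
  have hn1' : (1 : ℝ) ≤ n := by exact_mod_cast hn1
  have hn0 : (0 : ℝ) < n := by linarith
  have hl := Real.log_nonneg hn1'
  set D := noiseBad ξ (threshold C₀ r n) n
  have hk0 : (0 : ℝ) ≤ k := Nat.cast_nonneg k
  set Z : Ω → ℝ := fun ω => ∑ i, (n : ℝ) ^ (-((k : ℝ) + 2)) *
    (Real.exp ((k + 3) * ξ n i ω) + Real.exp (-(k + 3) * ξ n i ω)) with hZ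
  have hZ0 : ∀ ω, 0 ≤ Z ω := fun ω => Finset.sum_nonneg fun i _ => by positivity
  have hi1 : ∀ (t : ℝ) (i : Fin n), Integrable (fun ω => Real.exp (t * ξ n i ω)) P :=
    fun t i => (hξ.subgaussian n i).integrable_exp_mul t
  have hi2 : ∀ i : Fin n, Integrable (fun ω => (n : ℝ) ^ (-((k : ℝ) + 2)) *
      (Real.exp ((k + 3) * ξ n i ω) + Real.exp (-(k + 3) * ξ n i ω))) P :=
    fun i => ((hi1 _ i).add (hi1 _ i)).const_mul _
  have hZi : Integrable Z P := integrable_finsetSum _ fun i _ => hi2 i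
  have hmgf : ∀ (t : ℝ) (i : Fin n), ∫ ω, Real.exp (t * ξ n i ω) ∂P ≤
      Real.exp (σ ^ 2 * t ^ 2 / 2) := fun t i => by
    have := (hξ.subgaussian n i).mgf_le t
    rw [mgf] at this
    simpa using this
  have hZE : ∫ ω, Z ω ∂P ≤ n * ((n : ℝ) ^ (-((k : ℝ) + 2)) * (2 * E)) := by
    simp only [hZ]
    rw [integral_finsetSum _ fun i _ => hi2 i]
    calc _ ≤ ∑ _i : Fin n, (n : ℝ) ^ (-((k : ℝ) + 2)) * (2 * E) := by
          refine Finset.sum_le_sum fun i _ => ?_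
          rw [integral_const_mul, integral_add (hi1 _ i) (hi1 _ i)]
          have e1 := hmgf (k + 3) i
          have e2 := hmgf (-(k + 3)) i
          rw [neg_sq] at e2
          gcongr
          linarith
      _ = _ := by rw [Finset.sum_const, Finset.card_univ, Fintype.card_fin, nsmul_eq_mul]
  have hb1 : ∀ e : ℝ, e ≤ -(1 / 2) → (n : ℝ) ^ e ≤ (n : ℝ) ^ (-(1 / 2) : ℝ) := fun e he =>
    Real.rpow_le_rpow_of_exponent_le hn1' he
  have split : ∀ ω, a + M * ((n : ℝ) ^ k * noiseBound ξ k n ω) =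
      (a + M * ((n : ℝ) ^ k * Real.log n)) + M * (n : ℝ) ^ k * Z ω := fun ω => by
    rw [noiseBound]; ring
  have hc0 : 0 ≤ a + M * ((n : ℝ) ^ k * Real.log n) := by positivity
  have hcD : (a + M * ((n : ℝ) ^ k * Real.log n)) * P.real D ≤
      8 * (a + M) * (n : ℝ) ^ (-(1 / 2) : ℝ) := by
    have e1 : a + M * ((n : ℝ) ^ k * Real.log n) ≤ (a + M) * (n : ℝ) ^ (k + ε) := by
      have h1 : 1 ≤ (n : ℝ) ^ (k + ε) := Real.one_le_rpow hn1' (by positivity)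
      have h2 : (n : ℝ) ^ k * Real.log n ≤ (n : ℝ) ^ (k + ε) := by
        rw [Real.rpow_add hn0, Real.rpow_natCast]; gcongr
      nlinarith
    calc _ ≤ (a + M) * (n : ℝ) ^ (k + ε) * (8 * (n : ℝ) ^ (-(k + 1 / 2 + ε))) := by gcongr
      _ = 8 * (a + M) * ((n : ℝ) ^ (k + ε) * (n : ℝ) ^ (-(k + 1 / 2 + ε))) := by ring
      _ = _ := by rw [← Real.rpow_add hn0]; congr 2; ring
  have hZn : M * (n : ℝ) ^ k * ∫ ω, Z ω ∂P ≤ 2 * E * (a + M) * (n : ℝ) ^ (-(1 / 2) : ℝ) := by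
    calc _ ≤ M * (n : ℝ) ^ k * (n * ((n : ℝ) ^ (-((k : ℝ) + 2)) * (2 * E))) := by gcongr
      _ = 2 * E * M * ((n : ℝ) ^ (k : ℝ) * (n : ℝ) ^ (1 : ℝ) * (n : ℝ) ^ (-((k : ℝ) + 2))) := by
          rw [Real.rpow_natCast, Real.rpow_one]; ring
      _ = 2 * E * M * (n : ℝ) ^ (-1 : ℝ) := by
          rw [← Real.rpow_add hn0, ← Real.rpow_add hn0]; congr 2; ring
      _ ≤ _ := by
          have := hb1 (-1) (by norm_num)
          gcongr
          linarith
  simp_rw [split]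
  calc _ = ∫⁻ ω in D, (ENNReal.ofReal (a + M * ((n : ℝ) ^ k * Real.log n)) +
        ENNReal.ofReal (M * (n : ℝ) ^ k * Z ω)) ∂P := by
        refine lintegral_congr fun ω => ENNReal.ofReal_add hc0 ?_
        have := hZ0 ω
        positivity
    _ = ENNReal.ofReal (a + M * ((n : ℝ) ^ k * Real.log n)) * P D +
        ∫⁻ ω in D, ENNReal.ofReal (M * (n : ℝ) ^ k * Z ω) ∂P := by
        rw [lintegral_add_left measurable_const, setLIntegral_const]
    _ ≤ ENNReal.ofReal (8 * (a + M) * (n : ℝ) ^ (-(1 / 2) : ℝ)) +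
        ENNReal.ofReal (2 * E * (a + M) * (n : ℝ) ^ (-(1 / 2) : ℝ)) := by
        refine add_le_add ?_ ?_
        · rw [← ofReal_measureReal (μ := P), ← ENNReal.ofReal_mul hc0]
          exact ENNReal.ofReal_le_ofReal hcD
        · refine (setLIntegral_le_lintegral _ _).trans ?_
          rw [← ofReal_integral_eq_lintegral_ofReal (hZi.const_mul _)
            (.of_forall fun ω => by have := hZ0 ω; positivity), integral_const_mul]
          exact ENNReal.ofReal_le_ofReal hZn
    _ = _ := by
        rw [← ENNReal.ofReal_add (by positivity) (by positivity)]; congr 1; ring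

end Noise

theorem l2_sub_le {u v : ℝ → ℝ} (hu : MemLp u 2 torus) (hv : MemLp v 2 torus) :
    l2 (u - v) ≤ l2 u + l2 v := by
  have e := eLpNorm_sub_le hu.1 hv.1 (one_le_two (α := ℝ≥0∞))
  rwa [eLpNorm_two_eq_l2 (hu.sub hv), eLpNorm_two_eq_l2 hu, eLpNorm_two_eq_l2 hv,
    ← ENNReal.ofReal_add (l2_nonneg _) (l2_nonneg _),
    ENNReal.ofReal_le_ofReal_iff (add_nonneg (l2_nonneg _) (l2_nonneg _))] at e

/-! ### The error on the good event -/

/-- Both functions fit the same data, so the triangle inequality only doubles the threshold. -/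
theorem CellBound.of_feasible {m n : ℕ} {B : Set (Set ℝ)} {γ : ℝ} {y : Fin n → ℝ}
    {f u : ℝ → ℝ} (hγ : 0 ≤ γ)
    (hm : ∀ j : ℕ, 1 ≤ j → ∀ l : ℕ, l < m ^ j → cell m j l ∈ B)
    (hf : mrNorm B n (sample n f - y) ≤ γ) (hu : mrNorm B n (sample n u - y) ≤ γ) :
    CellBound m n (2 * γ) (f - u) := by
  have key : ∀ v : ℝ → ℝ, mrNorm B n (sample n v - y) ≤ γ → ∀ I ∈ B,
      |∑ i ∈ gridIn n I, (v ((i : ℝ) / n) - y i)| ≤ γ * √((gridIn n I).card : ℝ) := by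
    intro v hv I hI
    rcases (gridIn n I).eq_empty_or_nonempty with h | h
    · simp [h]
    · have hc : 0 < √((gridIn n I).card : ℝ) := Real.sqrt_pos.2 (by exact_mod_cast h.card_pos)
      exact (div_le_iff₀ hc).1 ((mrNorm_le_iff hγ).1 hv I hI)
  intro j hj l hl
  have h1 := key f hf _ (hm j hj l hl)
  have h2 := key u hu _ (hm j hj l hl)
  have e : ∑ i ∈ gridIn n (cell m j l), (f - u) ((i : ℝ) / n) =
      ∑ i ∈ gridIn n (cell m j l), (f ((i : ℝ) / n) - y i) -
        ∑ i ∈ gridIn n (cell m j l), (u ((i : ℝ) / n) - y i) := by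
    rw [← Finset.sum_sub_distrib]
    exact Finset.sum_congr rfl fun i _ => by simp
  rw [e]
  refine (abs_sub _ _).trans ?_
  linarith

theorem vartheta_nonneg {k : ℕ} (hk : 1 ≤ k) (q : ℝ≥0∞) : 0 ≤ vartheta k q := by
  have hk1 : (1 : ℝ) ≤ k := by exact_mod_cast hk
  have : 0 ≤ (q⁻¹).toReal := ENNReal.toReal_nonneg
  rw [vartheta]
  split_ifs
  · positivity
  · exact div_nonneg (by linarith) (by positivity)

theorem vartheta_le {k : ℕ} (hk : 1 ≤ k) (q : ℝ≥0∞) : vartheta k q ≤ 1 / 2 := by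
  have hk1 : (1 : ℝ) ≤ k := by exact_mod_cast hk
  rw [vartheta]
  split_ifs with h
  · rw [div_le_div_iff₀ (by positivity) (by norm_num)]; linarith
  · have h2 : (2 : ℝ≥0∞) ≤ q := le_trans (by simp) (not_le.1 h).le
    have h3 : (q⁻¹).toReal ≤ 1 / 2 := by
      have : (q⁻¹).toReal ≤ ((2 : ℝ≥0∞)⁻¹).toReal :=
        ENNReal.toReal_mono (by simp) (ENNReal.inv_le_inv.2 h2)
      simpa using this
    rw [div_le_div_iff₀ (by positivity) (by norm_num)]; linarith

/-- `((log n)^{2r} / n)^e`. -/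
def rateAt (e r : ℝ) (n : ℕ) : ℝ := (n : ℝ) ^ (-e) * Real.log n ^ (2 * r * e)

/-- The eventual size conditions on the threshold. -/
theorem eventually_threshold {C₀ r : ℝ} (hC₀ : 0 < C₀) (hr : 1 / 2 ≤ r) (G₁ G₂ : ℝ) :
    ∀ᶠ n : ℕ in atTop, 3 ≤ n ∧ 0 < threshold C₀ r n ∧ 2 * threshold C₀ r n / √n ≤ 1 ∧
      G₁ ≤ (2 * threshold C₀ r n / √n) ^ (5 / 4 : ℝ) * n ∧
      G₂ / (2 * threshold C₀ r n / √n) ≤ n := by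
  have h1 : ∀ᶠ n : ℕ in atTop, 2 * threshold C₀ r n / √n ≤ 1 := by
    have := (isLittleO_log_rpow_rpow_atTop r (show (0 : ℝ) < 1 / 2 by norm_num)).bound
      (show (0 : ℝ) < 1 / (2 * C₀) by positivity)
    filter_upwards [tendsto_natCast_atTop_atTop.eventually this, eventually_ge_atTop 3]
      with n hn h3
    have h3' : (3 : ℝ) ≤ n := by exact_mod_cast h3
    have hn0 : (0 : ℝ) < n := by linarith
    have hs : 0 < √(n : ℝ) := Real.sqrt_pos.2 hn0
    rw [← Real.sqrt_eq_rpow, Real.norm_of_nonneg hs.le] at hn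
    have h4 := (le_abs_self _).trans hn
    rw [threshold, div_le_one hs]
    calc 2 * (C₀ * Real.log n ^ r) ≤ 2 * (C₀ * (1 / (2 * C₀) * √n)) := by gcongr
      _ = √n := by field_simp
  have h2 : Tendsto (fun n : ℕ => (2 * C₀) ^ (5 / 4 : ℝ) * (n : ℝ) ^ (3 / 8 : ℝ)) atTop atTop :=
    ((tendsto_rpow_atTop (by norm_num)).comp tendsto_natCast_atTop_atTop).const_mul_atTop
      (by positivity)
  have h3 : Tendsto (fun n : ℕ => √(n : ℝ)) atTop atTop :=
    Real.tendsto_sqrt_atTop.comp tendsto_natCast_atTop_atTop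
  filter_upwards [h1, h2.eventually_ge_atTop G₁, h3.eventually_ge_atTop (|G₂| / (2 * C₀)),
    eventually_ge_atTop 3] with n h4 h5 h6 hn3
  have h3' : (3 : ℝ) ≤ n := by exact_mod_cast hn3
  have hn0 : (0 : ℝ) < n := by linarith
  have hs : 0 < √(n : ℝ) := Real.sqrt_pos.2 hn0
  have hl : 1 ≤ Real.log n := by
    rw [Real.le_log_iff_exp_le hn0]
    linarith [Real.exp_one_lt_d9]
  have hge : C₀ ≤ threshold C₀ r n := by
    rw [threshold]
    exact le_mul_of_one_le_right hC₀.le (Real.one_le_rpow hl (by linarith))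
  have hδ : 2 * C₀ / √n ≤ 2 * threshold C₀ r n / √n := by gcongr
  have hδ0 : 0 < 2 * C₀ / √n := by positivity
  refine ⟨hn3, hC₀.trans_le hge, h4, ?_, ?_⟩
  · refine h5.trans ?_
    calc (2 * C₀) ^ (5 / 4 : ℝ) * (n : ℝ) ^ (3 / 8 : ℝ)
        = (2 * C₀ / √n) ^ (5 / 4 : ℝ) * n := by
          rw [Real.div_rpow (by positivity) hs.le, Real.sqrt_eq_rpow, ← Real.rpow_mul hn0.le,
            div_mul_eq_mul_div, mul_div_assoc]
          congr 1
          rw [eq_div_iff (by positivity), ← Real.rpow_add hn0]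
          norm_num
      _ ≤ _ := by gcongr
  · rw [div_le_iff₀ (by positivity)] at h6
    calc G₂ / (2 * threshold C₀ r n / √n) ≤ |G₂| / (2 * threshold C₀ r n / √n) := by
          gcongr
          · exact (hδ0.trans_le hδ).le
          · exact le_abs_self _
      _ ≤ |G₂| / (2 * C₀ / √n) := by gcongr
      _ ≤ √n * (2 * C₀) / (2 * C₀ / √n) := by gcongr
      _ = √n * √n := by field_simp
      _ = n := Real.mul_self_sqrt hn0.le

/-- The energy estimate supplies `E = K₁ δ^β` with `β = s/(k+s+1/2)`; inserted into the
interpolation inequality it gives a multiple of `δ^{2e}`, and `δ²` is a multiple of `(log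
n)^{2r}/n`. -/
theorem exists_error_le_on_good {k m : ℕ} (hk : 1 ≤ k) (hm : 2 ≤ m) {s : ℝ} (hs : 1 / 2 ≤ s)
    (hsk : s ≤ k) {B : Set (Set ℝ)}
    (hB : ∀ j : ℕ, 1 ≤ j → ∀ l : ℕ, l < m ^ j → cell m j l ∈ B) {C₀ r : ℝ} (hC₀ : 0 < C₀)
    (hr : 1 / 2 ≤ r) (q : ℝ≥0∞) {A : ℝ} (hA : 0 ≤ A) :
    ∃ C : ℝ, 0 ≤ C ∧ ∀ᶠ n : ℕ in atTop, ∀ (f gf fh : ℝ → ℝ) (y : Fin n → ℝ),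
      BlockBound m (k + s) A f → HasSobolevDeriv k f gf → l2 gf ≤ 2 * ((2 * Real.pi * m) ^ k * A) →
      mrNorm B n (sample n f - y) ≤ threshold C₀ r n →
      IsMIND k B n (threshold C₀ r n) y fh →
      eLpNorm (f - fh) q torus ≤ ENNReal.ofReal
        (C * rateAt (s / (2 * s + 2 * k + 1) * (1 - 2 * vartheta k q) + vartheta k q) r n) := by
  obtain ⟨K, hK, hen⟩ := exists_l2_le hk hm hs hsk
  obtain ⟨K', hK', hLq⟩ := exists_eLpNorm_le hk hm q
  have hk1 : (1 : ℝ) ≤ k := by exact_mod_cast hk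
  have hm0 : (0 : ℝ) < m := by exact_mod_cast (by omega : 0 < m)
  have ht0 := vartheta_nonneg hk q
  have ht1 := vartheta_le hk q
  set th := vartheta k q
  set G := 2 * ((2 * Real.pi * m) ^ k * A)
  set K₁ := K * A + 1 with hK₁
  have hK₁1 : 1 ≤ K₁ := le_add_of_nonneg_left (mul_nonneg hK hA)
  set e := s / (2 * s + 2 * k + 1) * (1 - 2 * th) + th with he
  have he0 : 0 ≤ e := by
    have : 0 ≤ s / (2 * s + 2 * k + 1) := by positivity
    have h2 : 0 ≤ 1 - 2 * th := by linarith
    positivity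
  refine ⟨K' * (K₁ * (2 * C₀) ^ (2 * e)), by positivity, ?_⟩
  filter_upwards [eventually_threshold hC₀ hr (2 * G) (2 * m ^ (2 * k + 1) * K₁)]
    with n ⟨hn3, hγ, hδ1, h1, h2⟩ f gf fh y hb hf hG hmr hmind
  have hn1 : 1 ≤ n := by omega
  have h3' : (3 : ℝ) ≤ n := by exact_mod_cast hn3
  have hn0 : (0 : ℝ) < n := by linarith
  have hsn : 0 < √(n : ℝ) := Real.sqrt_pos.2 hn0
  have hl : 0 < Real.log n := Real.log_pos (by linarith)
  set δ := 2 * threshold C₀ r n / √n with hδ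
  have hδ0 : 0 < δ := by positivity
  obtain ⟨g, hg, hmin⟩ := (isMIND_iff hk hn1 hγ.le).1 hmind
  have hfeas : Feasible k B n (threshold C₀ r n) y f gf := ⟨hf, hmr⟩
  have hh := hf.sub hg.1
  have hcb := CellBound.of_feasible hγ.le hB hmr hg.2
  -- Minimality gives the a priori bound `2 ‖D^k f‖` for the energy norm of the error, which meets
  -- the size condition of the energy estimate once `n` is large.
  have hle := l2_le_of_variational hg hmin hfeas
  have hsub := l2_sub_le hf.memLp hg.1.memLp
  have hE := hen n A (2 * threshold C₀ r n) f gf (f - fh) (gf - g) hn1 hA hb hf hh hcb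
    (sq_l2_sub_le hg hmin hfeas) hδ0 hδ1 (by linarith)
  rw [← hδ] at hE
  set β := s / (k + s + 1 / 2) with hβ
  have hβ0 : 0 ≤ β := by positivity
  have hβ1 : β ≤ 1 := by rw [hβ, div_le_one (by positivity)]; linarith
  have hδβ : δ ≤ δ ^ β := by
    calc δ = δ ^ (1 : ℝ) := (Real.rpow_one δ).symm
      _ ≤ δ ^ β := Real.rpow_le_rpow_of_exponent_ge hδ0 hδ1 hβ1
  have hEδ : K₁ * δ ^ β / δ ≤ K₁ / δ := by
    gcongr
    exact mul_le_of_le_one_right (by linarith) (Real.rpow_le_one hδ0.le hδ1 hβ0)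
  have hge1 : 1 ≤ K₁ * δ ^ β / δ := by
    rw [one_le_div hδ0]; nlinarith
  have hn4 : 2 * (m : ℝ) ^ (2 * k + 1) * (K₁ * δ ^ β / δ) ^ (1 / (k : ℝ)) ≤ n := by
    calc _ ≤ 2 * (m : ℝ) ^ (2 * k + 1) * (K₁ * δ ^ β / δ) ^ (1 : ℝ) := by
          have := Real.rpow_le_rpow_of_exponent_le hge1 ((div_le_one (by linarith)).2 hk1)
          gcongr
      _ ≤ 2 * (m : ℝ) ^ (2 * k + 1) * (K₁ / δ) := by rw [Real.rpow_one]; gcongr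
      _ = 2 * (m : ℝ) ^ (2 * k + 1) * K₁ / δ := by ring
      _ ≤ n := h2
  refine (hLq n (f - fh) (gf - g) (2 * threshold C₀ r n) (K₁ * δ ^ β) hh hcb hδ0
    (by nlinarith) hE hn4).trans (ENNReal.ofReal_le_ofReal ?_)
  rw [← hδ, mul_assoc]
  refine mul_le_mul_of_nonneg_left ?_ hK'.le
  have e1 : K₁ * δ ^ β / δ = K₁ * δ ^ (β - 1) := by
    rw [Real.rpow_sub hδ0, Real.rpow_one]; ring
  have e2 : δ ^ (2 * e) = (2 * C₀) ^ (2 * e) * rateAt e r n := by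
    have : δ = 2 * C₀ * (Real.log n ^ r * (n : ℝ) ^ (-(1 / 2) : ℝ)) := by
      rw [hδ, threshold, Real.rpow_neg hn0.le, ← Real.sqrt_eq_rpow]; ring
    rw [this, Real.mul_rpow (x := 2 * C₀) (by positivity) (by positivity),
      Real.mul_rpow (x := Real.log n ^ r) (by positivity) (by positivity), ← Real.rpow_mul hl.le,
      ← Real.rpow_mul hn0.le, rateAt, mul_comm (Real.log n ^ _)]
    congr 3 <;> ring
  calc δ * (K₁ * δ ^ β / δ) ^ (1 - 2 * th)
      = K₁ ^ (1 - 2 * th) * (δ ^ (1 : ℝ) * δ ^ ((β - 1) * (1 - 2 * th))) := by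
        rw [e1, Real.mul_rpow (by positivity) (by positivity), ← Real.rpow_mul hδ0.le,
          Real.rpow_one]
        ring
    _ = K₁ ^ (1 - 2 * th) * δ ^ (2 * e) := by
        rw [← Real.rpow_add hδ0]
        congr 2
        rw [he, hβ]; field_simp; ring
    _ ≤ K₁ * δ ^ (2 * e) := by
        gcongr
        calc K₁ ^ (1 - 2 * th) ≤ K₁ ^ (1 : ℝ) :=
              Real.rpow_le_rpow_of_exponent_le hK₁1 (by linarith)
          _ = K₁ := Real.rpow_one _
    _ = _ := by rw [e2]; ring

/-! ### The error in general -/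

/-- The difference of the data is realised by a smooth function on the scale of the grid, so the
Lipschitz constant in the energy norm is of order `n^k`. -/
theorem l2_sub_le_of_isMIND {k n : ℕ} {B : Set (Set ℝ)} {γ : ℝ} {y y' : Fin n → ℝ}
    (hn : 1 ≤ n) {f g f' g' : ℝ → ℝ} (hf : Feasible k B n γ y f g)
    (hmin : ∀ u v, Feasible k B n γ y u v → 0 ≤ ∫ x, g x * (v x - g x) ∂torus)
    (hf' : Feasible k B n γ y' f' g')
    (hmin' : ∀ u v, Feasible k B n γ y' u v → 0 ≤ ∫ x, g' x * (v x - g' x) ∂torus) {b : ℝ}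
    (hb : ∀ i, |y' i - y i| ≤ b) : l2 (g' - g) ≤ (n : ℝ) ^ k * (b * motherBound k) := by
  refine (l2_sub_le_of_variational hf hmin hf' hmin'
    (hasSobolevDeriv_interpolant hn k (y' - y)) ?_).trans (l2_interpolant_le hn k hb)
  rw [sample_interpolant, add_sub_cancel]

theorem eLpNorm_sub_le_of_isMIND {k n : ℕ} {B : Set (Set ℝ)} {γ : ℝ} {y y' : Fin n → ℝ}
    (hk : 1 ≤ k) (hn : 1 ≤ n) (hγ : 0 ≤ γ) {f f' : ℝ → ℝ} (hf : IsMIND k B n γ y f)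
    (hf' : IsMIND k B n γ y' f') {b : ℝ} (hb : ∀ i, |y' i - y i| ≤ b) (q : ℝ≥0∞) :
    eLpNorm (f' - f) q torus ≤
      ENNReal.ofReal (poincareConst * ((n : ℝ) ^ k * (b * motherBound k))) := by
  obtain ⟨g, hg, hmin⟩ := (isMIND_iff hk hn hγ).1 hf
  obtain ⟨g', hg', hmin'⟩ := (isMIND_iff hk hn hγ).1 hf'
  refine eLpNorm_torus_le_of_abs_le (fun x => ((hg'.1.sub hg.1).abs_le hk x).trans ?_) q
  exact mul_le_mul_of_nonneg_left (l2_sub_le_of_isMIND hn hg hmin hg' hmin' hb)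
    poincareConst_nonneg

/-- A crude bound for the error, for all data. -/
theorem eLpNorm_error_le {k n : ℕ} {B : Set (Set ℝ)} {γ : ℝ} {z : Fin n → ℝ}
    (hk : 1 ≤ k) (hn : 1 ≤ n) (hγ : 0 ≤ γ) {f gf fh : ℝ → ℝ} (hf : HasSobolevDeriv k f gf)
    (hfh : IsMIND k B n γ (sample n f + z) fh) {b : ℝ} (hb : ∀ i, |z i| ≤ b) (q : ℝ≥0∞) :
    eLpNorm (fh - f) q torus ≤
      ENNReal.ofReal (poincareConst * ((n : ℝ) ^ k * (b * motherBound k) + 2 * l2 gf)) := by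
  obtain ⟨g, hg, hmin⟩ := (isMIND_iff hk hn hγ).1 hfh
  -- The comparison passes through the minimizer for noiseless data, for which `f` is feasible, so
  -- that its energy is at most that of `f`.
  obtain ⟨f₀, g₀, hf₀, hmin₀⟩ :=
    exists_feasible_variational (B := B) (y := sample n f) hk hn hγ
  have h1 := l2_sub_le_of_isMIND hn hf₀ hmin₀ hg hmin (b := b)
    (fun i => by simpa using hb i)
  have h2 : l2 g₀ ≤ l2 gf := by
    refine l2_le_of_variational hf₀ hmin₀ (u := f) ⟨hf, (mrNorm_le_iff hγ).2 fun I _ => ?_⟩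
    simp [hγ]
  have h3 := l2_sub_le (hg.1.memLp.sub hf₀.1.memLp) (hf.memLp.sub hf₀.1.memLp)
  rw [sub_sub_sub_cancel_right] at h3
  have h4 := l2_sub_le hf.memLp hf₀.1.memLp
  refine eLpNorm_torus_le_of_abs_le (fun x => ((hg.1.sub hf).abs_le hk x).trans ?_) q
  refine mul_le_mul_of_nonneg_left ?_ poincareConst_nonneg
  linarith

/-- Provides the measurability of the error: although `F` is only given pointwise by a minimization,
it is Lipschitz in the data. -/
theorem continuous_eLpNorm_error {k n : ℕ} {B : Set (Set ℝ)} {γ : ℝ} (hk : 1 ≤ k) (hn : 1 ≤ n)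
    (hγ : 0 ≤ γ) {q : ℝ≥0∞} (hq : 1 ≤ q) {F : (Fin n → ℝ) → ℝ → ℝ}
    (hF : ∀ y, IsMIND k B n γ y (F y)) {f : ℝ → ℝ} (hf : Continuous f) :
    Continuous fun y => eLpNorm (F y - f) q torus := by
  have hc : ∀ y, Continuous (F y) := fun y => (hF y).1.1.1.continuous
  have hfin : ∀ y, eLpNorm (F y - f) q torus ≠ ∞ := fun y =>
    (memLp_torus_of_continuous ((hc y).sub hf) q).eLpNorm_ne_top
  have hP := poincareConst_nonneg
  have hM := motherBound_nonneg k
  set K : ℝ≥0 := (poincareConst * ((n : ℝ) ^ k * motherBound k)).toNNReal with hK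
  have hlip : LipschitzWith K fun y => (eLpNorm (F y - f) q torus).toReal := by
    refine LipschitzWith.of_le_add_mul K fun y y' => ?_
    have h1 := eLpNorm_sub_le_of_isMIND hk hn hγ (hF y') (hF y) (b := dist y y')
      (fun i => by rw [← Real.dist_eq]; exact dist_le_pi_dist y y' i) q
    have h2 := eLpNorm_add_le (μ := torus) ((hc y').sub hf).aestronglyMeasurable
      ((hc y).sub (hc y')).aestronglyMeasurable hq
    rw [sub_add_sub_cancel'] at h2
    have h3 := h2.trans (add_le_add_right h1 _)
    refine (ENNReal.toReal_mono (by finiteness [hfin y']) h3).trans ?_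
    rw [ENNReal.toReal_add (hfin y') ENNReal.ofReal_ne_top, ENNReal.toReal_ofReal (by positivity)]
    refine le_of_eq ?_
    rw [hK, Real.coe_toNNReal _ (by positivity)]; ring
  have h := ENNReal.continuous_ofReal.comp hlip.continuous
  refine h.congr fun y => ?_
  exact ENNReal.ofReal_toReal (hfin y)

section Risk

variable {Ω : Type*} [MeasurableSpace Ω] {P : Measure Ω} {σ : ℝ≥0}
  {ξ : (n : ℕ) → Fin n → Ω → ℝ}

theorem threshold_nonneg {C₀ r : ℝ} (hC₀ : 0 < C₀) {n : ℕ} (hn : 1 ≤ n) :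
    0 ≤ threshold C₀ r n := by
  have := Real.log_nonneg (x := n) (by exact_mod_cast hn)
  rw [threshold]; positivity

theorem aemeasurable_error (hξ : IsNoise P σ ξ) {k : ℕ} (hk : 1 ≤ k) {B : Set (Set ℝ)}
    {C₀ r : ℝ} (hC₀ : 0 < C₀) {q : ℝ≥0∞} (hq : 1 ≤ q) {fhat : (n : ℕ) → (Fin n → ℝ) → ℝ → ℝ}
    (hfhat : ∀ n : ℕ, 1 ≤ n → ∀ y : Fin n → ℝ, IsMIND k B n (threshold C₀ r n) y (fhat n y))
    {f : ℝ → ℝ} (hf : Continuous f) {n : ℕ} (hn : 1 ≤ n) :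
    AEMeasurable (error q fhat ξ f n) P := by
  have h := (continuous_eLpNorm_error hk hn (threshold_nonneg hC₀ hn) hq (hfhat n hn)
    hf).measurable
  have h2 : Measurable fun ω => sample n f + fun i => ξ n i ω :=
    measurable_pi_lambda _ fun i => (hξ.measurable n i).const_add _
  exact (h.comp h2).aemeasurable

/-- Allows the contribution of the bad event, of order `n^{-1/2}`, to be absorbed into the rate; `n
≥ 3` ensures `log n ≥ 1`. -/
theorem rpow_neg_half_le_rateAt {e r : ℝ} (he0 : 0 ≤ e) (he : e ≤ 1 / 2) (hr : 0 ≤ r) {n : ℕ}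
    (hn : 3 ≤ n) : (n : ℝ) ^ (-(1 / 2) : ℝ) ≤ rateAt e r n := by
  have h3' : (3 : ℝ) ≤ n := by exact_mod_cast hn
  have hn0 : (0 : ℝ) < n := by linarith
  have hl : 1 ≤ Real.log n := by
    rw [Real.le_log_iff_exp_le hn0]
    linarith [Real.exp_one_lt_d9]
  have h1 : (n : ℝ) ^ (-(1 / 2) : ℝ) ≤ (n : ℝ) ^ (-e) :=
    Real.rpow_le_rpow_of_exponent_le (by linarith) (by linarith)
  exact h1.trans (le_mul_of_one_le_right (by positivity) (Real.one_le_rpow hl (by positivity)))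

variable [IsProbabilityMeasure P]

/-- The bounds of the error over balls: on the good event and in expectation. -/
theorem exists_error_le (hξ : IsNoise P σ ξ) (hσ : 0 < σ) {k : ℕ} (hk : 1 ≤ k) {s : ℝ}
    (hs : 1 ≤ s) (hsk : s ≤ k) {p q : ℝ≥0∞} (hp : 1 ≤ p) {N : (ℝ → ℝ) → ℝ≥0∞}
    (hN : IsSmoothnessNorm (k + s) p N) {B : Set (Set ℝ)} (hB : IsRegular B) {C₀ r : ℝ}
    (hr : 1 / 2 ≤ r) (hC₀ : 0 < C₀) (hC₀' : r = 1 / 2 → (σ : ℝ) * √(5 + 2 * k) < C₀)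
    {fhat : (n : ℕ) → (Fin n → ℝ) → ℝ → ℝ}
    (hfhat : ∀ n : ℕ, 1 ≤ n → ∀ y : Fin n → ℝ, IsMIND k B n (threshold C₀ r n) y (fhat n y))
    {L : ℝ} (hL : 0 ≤ L) :
    ∃ C : ℝ, ∀ᶠ n : ℕ in atTop, ∀ f : ℝ → ℝ, IsCont₀ f → N f ≤ ENNReal.ofReal L →
      (∀ ω ∉ noiseBad ξ (threshold C₀ r n) n,
        error q fhat ξ f n ω ≤ ENNReal.ofReal (C * rate k s p q r n)) ∧
      ∫⁻ ω, error q fhat ξ f n ω ∂P ≤ ENNReal.ofReal (C * rate k s p q r n) := by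
  obtain ⟨hsys, m, hm, hcell⟩ := hB
  have hk1 : (1 : ℝ) ≤ k := by exact_mod_cast hk
  have hd0 := embedLoss_nonneg p
  have hd1 := embedLoss_le hp
  -- The passage to the `L²`-scale costs at most `1/2`, and `s ≥ 1` leaves `s' ≥ 1/2`, as the
  -- deterministic estimates require.
  set s' := s - embedLoss p with hs'
  obtain ⟨K, hK, hblock⟩ := exists_blockBound hm (S := k + s) (by linarith) hp hN
  set A := K * (L + 1) with hA
  have hA0 : 0 ≤ A := by positivity
  obtain ⟨C₁, hC₁, hgood⟩ := exists_error_le_on_good hk hm (s := s') (by linarith) (by linarith)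
    hcell hC₀ hr q hA0
  obtain ⟨C₂, hC₂, hbad⟩ := exists_setLIntegral_noiseBad_le (k := k) hξ hσ hr hC₀ hC₀'
  have hP := poincareConst_nonneg
  have hM := motherBound_nonneg k
  have ht0 := vartheta_nonneg hk q
  have ht1 := vartheta_le hk q
  set G := 2 * ((2 * Real.pi * m) ^ k * A) with hG
  have hG0 : 0 ≤ G := by have := Real.pi_pos; positivity
  set e := s' / (2 * s' + 2 * k + 1) * (1 - 2 * vartheta k q) + vartheta k q with he
  have hrate : ∀ n, rate k s p q r n = rateAt e r n := fun n => by
    have hmu : muExp k s p = s' / (2 * s' + 2 * k + 1) := by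
      rw [muExp, hs', embedLoss]; congr 1; ring
    rw [rate, rateAt, hmu, he]
    congr 2 <;> ring
  have hmu0 : 0 ≤ s' / (2 * s' + 2 * k + 1) := div_nonneg (by linarith) (by linarith)
  have hmu1 : s' / (2 * s' + 2 * k + 1) ≤ 1 / 2 := by
    rw [div_le_div_iff₀ (by linarith) (by norm_num)]; linarith
  have he0 : 0 ≤ e := by
    have h2 : 0 ≤ 1 - 2 * vartheta k q := by linarith
    positivity
  have he1 : e ≤ 1 / 2 := by
    have : s' / (2 * s' + 2 * k + 1) * (1 - 2 * vartheta k q) ≤ 1 / 2 * (1 - 2 * vartheta k q) :=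
      mul_le_mul_of_nonneg_right hmu1 (by linarith)
    linarith
  set C₃ := C₂ * (poincareConst * (2 * G) + poincareConst * motherBound k) with hC₃
  have hC₃0 : 0 ≤ C₃ := by positivity
  refine ⟨C₁ + C₃, ?_⟩
  filter_upwards [hgood, hbad, eventually_ge_atTop 3] with n hg hb hn3 f hf hNf
  have hn1 : 1 ≤ n := by omega
  have hγ := threshold_nonneg (r := r) hC₀ hn1
  have hρ0 : 0 ≤ rateAt e r n :=
    (Real.rpow_nonneg (Nat.cast_nonneg n) _).trans
      (rpow_neg_half_le_rateAt he0 he1 (by linarith) hn3)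
  have hbl : BlockBound m (k + s') A f := by
    have := hblock f L hf hL hNf
    rwa [add_sub_assoc] at this
  obtain ⟨gf, hgf, hl2⟩ := hbl.exists_hasSobolevDeriv hk hm hA0 (by linarith) hf
  have hgood' : ∀ ω ∉ noiseBad ξ (threshold C₀ r n) n,
      error q fhat ξ f n ω ≤ ENNReal.ofReal (C₁ * rateAt e r n) := fun ω hω => by
    have h1 := mrNorm_le_of_notMem_noiseBad hsys hγ hω
    have h2 := mrNorm_smul_le hγ (-1) h1
    rw [abs_neg, abs_one, one_mul] at h2
    have h3 : sample n f - (sample n f + fun i => ξ n i ω) = (-1 : ℝ) • fun i => ξ n i ω := by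
      ext i; simp
    rw [error, loss, eLpNorm_sub_comm]
    exact hg f gf _ _ hbl hgf hl2 (by rw [h3]; exact h2) (hfhat n hn1 _)
  have hC13 : ENNReal.ofReal (C₁ * rateAt e r n) ≤ ENNReal.ofReal ((C₁ + C₃) * rateAt e r n) :=
    ENNReal.ofReal_le_ofReal (by nlinarith)
  rw [hrate]
  refine ⟨fun ω hω => (hgood' ω hω).trans hC13, ?_⟩
  rw [← lintegral_add_compl _ (measurableSet_noiseBad hξ (threshold C₀ r n) n)]
  have i1 : ∫⁻ ω in noiseBad ξ (threshold C₀ r n) n, error q fhat ξ f n ω ∂P ≤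
      ENNReal.ofReal (C₃ * rateAt e r n) := by
    refine (lintegral_mono fun ω => ?_).trans ((hb (poincareConst * (2 * G))
      (poincareConst * motherBound k) (by positivity) (by positivity)).trans
      (ENNReal.ofReal_le_ofReal ?_))
    · refine (eLpNorm_error_le hk hn1 hγ hgf (hfhat n hn1 _) (fun i => abs_noise_le k i ω) q).trans
        (ENNReal.ofReal_le_ofReal ?_)
      have : poincareConst * (2 * l2 gf) ≤ poincareConst * (2 * G) := by gcongr
      nlinarith
    · exact mul_le_mul_of_nonneg_left (rpow_neg_half_le_rateAt he0 he1 (by linarith) hn3) hC₃0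
  have i2 : ∫⁻ ω in (noiseBad ξ (threshold C₀ r n) n)ᶜ, error q fhat ξ f n ω ∂P ≤
      ENNReal.ofReal (C₁ * rateAt e r n) := by
    calc _ ≤ ∫⁻ _ω in (noiseBad ξ (threshold C₀ r n) n)ᶜ, ENNReal.ofReal (C₁ * rateAt e r n) ∂P :=
          setLIntegral_mono' (measurableSet_noiseBad hξ _ n).compl hgood'
      _ ≤ ENNReal.ofReal (C₁ * rateAt e r n) * 1 := by
          rw [setLIntegral_const]
          gcongr
          exact prob_le_one
      _ = _ := mul_one _
  refine (add_le_add i1 i2).trans (le_of_eq ?_)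
  rw [← ENNReal.ofReal_add (by positivity) (by positivity)]
  congr 1; ring

theorem rate_eq_simpleRate {k : ℕ} {s : ℝ} (hs : 0 ≤ s) {p q : ℝ≥0∞} (hp : 2 ≤ p)
    (hq : q ≤ 4 * (k : ℝ≥0∞) + 2) (r : ℝ) (n : ℕ) : rate k s p q r n = simpleRate k s r n := by
  have hd : max ((p⁻¹).toReal - 1 / 2) 0 = 0 := by
    have : (p⁻¹).toReal ≤ ((2 : ℝ≥0∞)⁻¹).toReal :=
      ENNReal.toReal_mono (by simp) (ENNReal.inv_le_inv.2 hp)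
    have h2 : ((2 : ℝ≥0∞)⁻¹).toReal = 1 / 2 := by simp
    exact max_eq_right (by linarith)
  have hk : (0 : ℝ) ≤ k := Nat.cast_nonneg k
  have h1 : 2 * (k : ℝ) + 1 ≠ 0 := by positivity
  have h2 : 2 * s + 2 * k + 1 ≠ 0 := by positivity
  have h3 : 2 * k + 2 * s + 1 ≠ 0 := by positivity
  rw [rate, simpleRate, muExp, hd, vartheta, if_pos hq, sub_zero, mul_zero, sub_zero]
  congr 2 <;> (field_simp; ring)

end Risk

/-! ### Differences of smooth functions -/

theorem abs_fwdDiff_iterate_le_two_pow {f : ℝ → ℝ} {b : ℝ} (hf : ∀ x, |f x| ≤ b) (h : ℝ) (r : ℕ)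
    (x : ℝ) : |(fwdDiff h)^[r] f x| ≤ 2 ^ r * b := by
  induction r generalizing x with
  | zero => simpa using hf x
  | succ r ih =>
    rw [Function.iterate_succ_apply', fwdDiff]
    refine (abs_sub _ _).trans ?_
    have h1 := ih (x + h)
    have h2 := ih x
    rw [pow_succ]; linarith

theorem contDiff_fwdDiff {f : ℝ → ℝ} (hf : ContDiff ℝ (⊤ : ℕ∞) f) (h : ℝ) :
    ContDiff ℝ (⊤ : ℕ∞) (fwdDiff h f) := by
  have h1 : ContDiff ℝ (⊤ : ℕ∞) fun x => f (x + h) := hf.comp (by fun_prop)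
  exact h1.sub hf

theorem iteratedDeriv_fwdDiff {f : ℝ → ℝ} (hf : ContDiff ℝ (⊤ : ℕ∞) f) (h : ℝ) (r : ℕ) :
    iteratedDeriv r (fwdDiff h f) = fwdDiff h (iteratedDeriv r f) := by
  induction r with
  | zero => simp only [iteratedDeriv_zero]
  | succ r ih =>
    rw [iteratedDeriv_succ, ih]
    funext x
    have h1 := (hasDerivAt_iteratedDeriv hf r (x + h)).comp_add_const x h
    exact (h1.sub (hasDerivAt_iteratedDeriv hf r x)).deriv

/-- Differences commute with derivatives, and the mean value inequality trades each derivative for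
one factor `|h|`. -/
theorem abs_fwdDiff_iterate_le_pow {f : ℝ → ℝ} (hf : ContDiff ℝ (⊤ : ℕ∞) f) {b : ℝ} (h : ℝ)
    (r : ℕ) (hb : ∀ x, |iteratedDeriv r f x| ≤ b) (x : ℝ) :
    |(fwdDiff h)^[r] f x| ≤ |h| ^ r * b := by
  induction r generalizing f b with
  | zero => simpa using hb x
  | succ r ih =>
    rw [Function.iterate_succ_apply, pow_succ, mul_assoc]
    refine ih (contDiff_fwdDiff hf h) fun y => ?_
    rw [iteratedDeriv_fwdDiff hf, fwdDiff]
    have := Convex.norm_image_sub_le_of_norm_hasDerivWithin_le (s := Set.univ)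
      (f := iteratedDeriv r f) (f' := iteratedDeriv (r + 1) f) (C := b) (x := y) (y := y + h)
      (fun z _ => (hasDerivAt_iteratedDeriv hf r z).hasDerivWithinAt) (fun z _ => hb z)
      convex_univ (Set.mem_univ _) (Set.mem_univ _)
    rw [Real.norm_eq_abs, Real.norm_eq_abs, add_sub_cancel_left, mul_comm] at this
    exact this

/-! ### The norms of bump sums -/

/-- A common bound for the differences of order `r` of a bump sum with unit heights. -/
def bumpConst (r : ℕ) : ℝ := motherBound r + 2 ^ r * motherBound 0

theorem bumpConst_nonneg (r : ℕ) : 0 ≤ bumpConst r := by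
  have := motherBound_nonneg r
  have := motherBound_nonneg 0
  rw [bumpConst]; positivity

/-- For steps below the bump width `1/M` the derivative of order `r` is used, beyond it the trivial
bound of a difference. -/
theorem modulus_bumpSum_le {M : ℕ} (hM : 1 ≤ M) {a : ℝ} (ha : 0 ≤ a) {z : ℕ → ℝ}
    (hz : ∀ i < M, |z i| ≤ a) (r : ℕ) (p : ℝ≥0∞) {t : ℝ} :
    modulus r p (bumpSum M 0 z) t ≤
      ENNReal.ofReal (a * bumpConst r * min ((t * M) ^ r) 1) := by
  refine iSup₂_le fun h hh => eLpNorm_torus_le_of_abs_le (fun x => ?_) p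
  have ht : 0 ≤ t := (abs_nonneg h).trans hh
  have b0 := motherBound_nonneg 0
  have br := motherBound_nonneg r
  rw [mul_min_of_nonneg _ _ (mul_nonneg ha (bumpConst_nonneg r)), mul_one]
  refine le_min ?_ ?_
  · have h1 := abs_fwdDiff_iterate_le_pow (f := bumpSum M 0 z) contDiff_bumpSum h r
      (abs_iteratedDeriv_bumpSum_le hM hz r) x
    refine h1.trans ?_
    calc |h| ^ r * ((M : ℝ) ^ r * (a * motherBound r))
        ≤ t ^ r * ((M : ℝ) ^ r * (a * bumpConst r)) := by
          gcongr
          exact le_add_of_nonneg_right (by positivity)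
      _ = _ := by rw [mul_pow]; ring
  · have h1 := abs_fwdDiff_iterate_le_two_pow (f := bumpSum M 0 z) (b := a * motherBound 0)
      (fun y => by simpa using abs_iteratedDeriv_bumpSum_le hM hz 0 y) h r x
    refine h1.trans ?_
    calc 2 ^ r * (a * motherBound 0) = a * (2 ^ r * motherBound 0) := by ring
      _ ≤ _ := by
        gcongr
        exact le_add_of_nonneg_left br

/-- In the variable `u = tM`, the weight `t^{-S}` times the bound for the modulus is `M^S` times a
function with power decay on both sides of `u = 1`; `η` is a common exponent for the two sides. -/
theorem rpow_neg_mul_min_le {M : ℕ} (hM : 1 ≤ M) {r : ℕ} {S η : ℝ} (hη0 : 0 ≤ η) (hη1 : η ≤ r - S)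
    (hη2 : η ≤ S) {t : ℝ} (ht : 0 < t) :
    t ^ (-S) * min ((t * M) ^ r) 1 ≤ (M : ℝ) ^ S * min ((t * M) ^ η) ((t * M) ^ (-η)) := by
  have hM0 : (0 : ℝ) < M := by exact_mod_cast hM
  set u := t * M with hu
  have hu0 : 0 < u := by positivity
  have e : t ^ (-S) = (M : ℝ) ^ S * u ^ (-S) := by
    rw [hu, Real.mul_rpow ht.le hM0.le, mul_left_comm, ← Real.rpow_add hM0, add_neg_cancel,
      Real.rpow_zero, mul_one]
  rw [e, mul_assoc]
  refine mul_le_mul_of_nonneg_left ?_ (by positivity)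
  rcases le_total u 1 with h | h
  · have h2 : u ^ (-S) * min (u ^ r) 1 ≤ u ^ ((r : ℝ) - S) := by
      calc _ ≤ u ^ (-S) * u ^ r := by gcongr; exact min_le_left _ _
        _ = _ := by rw [← Real.rpow_natCast, ← Real.rpow_add hu0]; congr 1; ring
    refine h2.trans (le_min ?_ ?_)
    · exact Real.rpow_le_rpow_of_exponent_ge hu0 h hη1
    · exact Real.rpow_le_rpow_of_exponent_ge hu0 h (by linarith)
  · have h2 : u ^ (-S) * min (u ^ r) 1 ≤ u ^ (-S) := by
      calc _ ≤ u ^ (-S) * 1 := by gcongr; exact min_le_right _ _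
        _ = _ := mul_one _
    refine h2.trans (le_min ?_ ?_)
    · exact Real.rpow_le_rpow_of_exponent_le h (by linarith)
    · exact Real.rpow_le_rpow_of_exponent_le h (by linarith)

/-- The measure `dt/t` is invariant under scaling, so the bound does not depend on `M`; the
dependence of the Besov seminorm on the number of bumps is thus only through `M^S`. -/
theorem lintegral_min_rpow_le {M : ℝ} (hM : 0 < M) {e : ℝ} (he : 0 < e) :
    ∫⁻ t in Set.Ioi (0 : ℝ), ENNReal.ofReal (min ((t * M) ^ e) ((t * M) ^ (-e)) * (1 / t)) ≤
      ENNReal.ofReal (2 / e) := by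
  have hM' : 0 < M⁻¹ := inv_pos.2 hM
  have i1 : IntegrableOn (fun t : ℝ => t ^ (e - 1)) (Set.Ioc 0 M⁻¹) :=
    (intervalIntegral.intervalIntegrable_rpow' (by linarith)).1
  have i2 : IntegrableOn (fun t : ℝ => t ^ (-e - 1)) (Set.Ioi M⁻¹) :=
    integrableOn_Ioi_rpow_of_lt (by linarith) hM'
  have h1 : ∫⁻ t in Set.Ioc (0 : ℝ) M⁻¹,
      ENNReal.ofReal (min ((t * M) ^ e) ((t * M) ^ (-e)) * (1 / t)) ≤ ENNReal.ofReal (1 / e) := by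
    calc _ ≤ ∫⁻ t in Set.Ioc (0 : ℝ) M⁻¹, ENNReal.ofReal (M ^ e * t ^ (e - 1)) := by
          refine setLIntegral_mono' measurableSet_Ioc fun t ht => ENNReal.ofReal_le_ofReal ?_
          have ht0 : 0 < t := ht.1
          calc _ ≤ (t * M) ^ e * (1 / t) := by gcongr; exact min_le_left _ _
            _ = _ := by
              rw [Real.mul_rpow ht0.le hM.le, Real.rpow_sub ht0, Real.rpow_one]; ring
      _ = ENNReal.ofReal (∫ t in Set.Ioc (0 : ℝ) M⁻¹, M ^ e * t ^ (e - 1)) := by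
          refine (ofReal_integral_eq_lintegral_ofReal (i1.const_mul _) ?_).symm
          refine (ae_restrict_iff' measurableSet_Ioc).2 (.of_forall fun t ht => ?_)
          have := ht.1
          simp only [Pi.zero_apply]
          positivity
      _ = _ := by
          rw [integral_const_mul, ← intervalIntegral.integral_of_le hM'.le,
            integral_rpow (Or.inl (by linarith)), sub_add_cancel, Real.zero_rpow he.ne', sub_zero,
            Real.inv_rpow hM.le]
          congr 1
          field_simp
  have h2 : ∫⁻ t in Set.Ioi M⁻¹,
      ENNReal.ofReal (min ((t * M) ^ e) ((t * M) ^ (-e)) * (1 / t)) ≤ ENNReal.ofReal (1 / e) := by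
    calc _ ≤ ∫⁻ t in Set.Ioi M⁻¹, ENNReal.ofReal (M ^ (-e) * t ^ (-e - 1)) := by
          refine setLIntegral_mono' measurableSet_Ioi fun t ht => ENNReal.ofReal_le_ofReal ?_
          have ht0 : 0 < t := hM'.trans ht
          calc _ ≤ (t * M) ^ (-e) * (1 / t) := by gcongr; exact min_le_right _ _
            _ = _ := by
              rw [Real.mul_rpow ht0.le hM.le, Real.rpow_sub ht0, Real.rpow_one]; ring
      _ = ENNReal.ofReal (∫ t in Set.Ioi M⁻¹, M ^ (-e) * t ^ (-e - 1)) := by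
          refine (ofReal_integral_eq_lintegral_ofReal (i2.const_mul _) ?_).symm
          refine (ae_restrict_iff' measurableSet_Ioi).2 (.of_forall fun t ht => ?_)
          have : 0 < t := hM'.trans ht
          simp only [Pi.zero_apply]
          positivity
      _ = _ := by
          rw [integral_const_mul, integral_Ioi_rpow_of_lt (by linarith) hM', sub_add_cancel,
            Real.inv_rpow hM.le, ← Real.rpow_neg hM.le, neg_neg, Real.rpow_neg hM.le]
          congr 1
          field_simp
  rw [← Set.Ioc_union_Ioi_eq_Ioi hM'.le]
  refine (lintegral_union_le _ _ _).trans ((add_le_add h1 h2).trans (le_of_eq ?_))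
  rw [← ENNReal.ofReal_add (by positivity) (by positivity)]
  congr 1; ring

theorem exists_besovNorm_bumpSum_le {r : ℕ} {S : ℝ} (hS : 0 < S) (hr : S < r) (p : ℝ≥0∞)
    {p' : ℝ≥0∞} (hp' : 1 ≤ p') :
    ∃ K : ℝ, 0 < K ∧ ∀ (M : ℕ) (a : ℝ) (z : ℕ → ℝ), 1 ≤ M → 0 ≤ a → (∀ i < M, |z i| ≤ a) →
      besovNorm r S p p' (bumpSum M 0 z) ≤ ENNReal.ofReal (K * (a * (M : ℝ) ^ S)) := by
  have b0 := motherBound_nonneg 0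
  have hD := bumpConst_nonneg r
  have hzero : ∀ (M : ℕ) (a : ℝ) (z : ℕ → ℝ), 1 ≤ M → 0 ≤ a → (∀ i < M, |z i| ≤ a) →
      eLpNorm (bumpSum M 0 z) p torus ≤ ENNReal.ofReal (motherBound 0 * (a * (M : ℝ) ^ S)) := by
    intro M a z hM ha hz
    refine eLpNorm_torus_le_of_abs_le (fun x => ?_) p
    have h := abs_iteratedDeriv_bumpSum_le (c := 0) hM hz 0 x
    rw [iteratedDeriv_zero, pow_zero, one_mul] at h
    refine h.trans ?_
    have : 1 ≤ (M : ℝ) ^ S := Real.one_le_rpow (by exact_mod_cast hM) hS.le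
    calc a * motherBound 0 ≤ a * motherBound 0 * (M : ℝ) ^ S :=
          le_mul_of_one_le_right (by positivity) this
      _ = _ := by ring
  set η := min (r - S) S with hη
  have hη0 : 0 < η := lt_min (by linarith) hS
  suffices hsemi : ∃ K : ℝ, 0 ≤ K ∧ ∀ (M : ℕ) (a : ℝ) (z : ℕ → ℝ), 1 ≤ M → 0 ≤ a →
      (∀ i < M, |z i| ≤ a) →
      besovSeminorm r S p p' (bumpSum M 0 z) ≤ ENNReal.ofReal (K * (a * (M : ℝ) ^ S)) by
    obtain ⟨K, hK, h⟩ := hsemi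
    refine ⟨motherBound 0 + K + 1, by positivity, fun M a z hM ha hz => ?_⟩
    rw [besovNorm]
    refine (add_le_add (hzero M a z hM ha hz) (h M a z hM ha hz)).trans ?_
    rw [← ENNReal.ofReal_add (by positivity) (by positivity)]
    refine ENNReal.ofReal_le_ofReal ?_
    have : 0 ≤ a * (M : ℝ) ^ S := by positivity
    linarith
  have key : ∀ (M : ℕ) (a : ℝ) (z : ℕ → ℝ), 1 ≤ M → 0 ≤ a → (∀ i < M, |z i| ≤ a) → ∀ t : ℝ,
      0 < t → ENNReal.ofReal (t ^ (-S)) * modulus r p (bumpSum M 0 z) t ≤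
        ENNReal.ofReal (bumpConst r * (a * (M : ℝ) ^ S) *
          min ((t * M) ^ η) ((t * M) ^ (-η))) := by
    intro M a z hM ha hz t ht
    refine (mul_le_mul_right (modulus_bumpSum_le hM ha hz r p) _).trans ?_
    rw [← ENNReal.ofReal_mul (by positivity)]
    refine ENNReal.ofReal_le_ofReal ?_
    calc t ^ (-S) * (a * bumpConst r * min ((t * M) ^ r) 1)
        = a * bumpConst r * (t ^ (-S) * min ((t * M) ^ r) 1) := by ring
      _ ≤ a * bumpConst r * ((M : ℝ) ^ S * min ((t * M) ^ η) ((t * M) ^ (-η))) := by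
          refine mul_le_mul_of_nonneg_left ?_ (by positivity)
          exact rpow_neg_mul_min_le hM hη0.le (min_le_left _ _) (min_le_right _ _) ht
      _ = _ := by ring
  by_cases htop : p' = ∞
  · refine ⟨bumpConst r, hD, fun M a z hM ha hz => ?_⟩
    have hM0 : (0 : ℝ) < M := by exact_mod_cast hM
    rw [besovSeminorm, if_pos htop]
    refine essSup_le_of_ae_le _ ((ae_restrict_iff' measurableSet_Ioi).2 (.of_forall fun t ht => ?_))
    have ht0 : 0 < t := ht
    refine (key M a z hM ha hz t ht).trans (ENNReal.ofReal_le_ofReal ?_)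
    refine mul_le_of_le_one_right (by positivity) ?_
    have hu : 0 < t * M := by positivity
    rcases le_total (t * M) 1 with h | h
    · exact (min_le_left _ _).trans (Real.rpow_le_one hu.le h hη0.le)
    · exact (min_le_right _ _).trans (Real.rpow_le_one_of_one_le_of_nonpos h (by linarith))
  · have hr1 : 1 ≤ p'.toReal := by simpa using ENNReal.toReal_mono htop hp'
    set r' := p'.toReal
    have hr0 : 0 < r' := by linarith
    refine ⟨bumpConst r * (2 / (η * r')) ^ (1 / r'), by positivity, fun M a z hM ha hz => ?_⟩
    have hM0 : (0 : ℝ) < M := by exact_mod_cast hM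
    set D := bumpConst r * (a * (M : ℝ) ^ S) with hDdef
    have hD0 : 0 ≤ D := by positivity
    rw [besovSeminorm, if_neg htop]
    have h1 : ∫⁻ t in Set.Ioo (0 : ℝ) 1,
        (ENNReal.ofReal (t ^ (-S)) * modulus r p (bumpSum M 0 z) t) ^ r' *
          ENNReal.ofReal (1 / t) ≤ ENNReal.ofReal (D ^ r' * (2 / (η * r'))) := by
      calc _ ≤ ∫⁻ t in Set.Ioo (0 : ℝ) 1, ENNReal.ofReal (D ^ r') * ENNReal.ofReal
            (min ((t * M) ^ (η * r')) ((t * M) ^ (-(η * r'))) * (1 / t)) := by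
            refine setLIntegral_mono' measurableSet_Ioo fun t ht => ?_
            have ht0 : 0 < t := ht.1
            have hu : 0 < t * M := by positivity
            have hmin0 : 0 ≤ min ((t * M) ^ η) ((t * M) ^ (-η)) := by positivity
            have e : min ((t * M) ^ η) ((t * M) ^ (-η)) ^ r' ≤
                min ((t * M) ^ (η * r')) ((t * M) ^ (-(η * r'))) := by
              refine le_min ?_ ?_
              · rw [Real.rpow_mul hu.le]
                exact Real.rpow_le_rpow hmin0 (min_le_left _ _) hr0.le
              · rw [← neg_mul, Real.rpow_mul hu.le]
                exact Real.rpow_le_rpow hmin0 (min_le_right _ _) hr0.le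
            calc _ ≤ ENNReal.ofReal (D * min ((t * M) ^ η) ((t * M) ^ (-η))) ^ r' *
                  ENNReal.ofReal (1 / t) := by
                  gcongr
                  exact key M a z hM ha hz t ht0
              _ = ENNReal.ofReal (D ^ r' * (min ((t * M) ^ η) ((t * M) ^ (-η)) ^ r' * (1 / t))) := by
                  rw [ENNReal.ofReal_rpow_of_nonneg (by positivity) hr0.le,
                    ← ENNReal.ofReal_mul (by positivity), Real.mul_rpow hD0 hmin0, mul_assoc]
              _ ≤ _ := by
                  rw [← ENNReal.ofReal_mul (by positivity)]
                  refine ENNReal.ofReal_le_ofReal ?_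
                  gcongr
        _ ≤ ENNReal.ofReal (D ^ r') * ENNReal.ofReal (2 / (η * r')) := by
            rw [lintegral_const_mul' _ _ ENNReal.ofReal_ne_top]
            refine mul_le_mul_right ?_ _
            exact (lintegral_mono_set fun t ht => ht.1).trans
              (lintegral_min_rpow_le hM0 (by positivity))
        _ = _ := by rw [← ENNReal.ofReal_mul (by positivity)]
    refine (ENNReal.rpow_le_rpow h1 (by positivity)).trans (le_of_eq ?_)
    rw [ENNReal.ofReal_rpow_of_nonneg (by positivity) (by positivity),
      Real.mul_rpow (by positivity) (by positivity), ← Real.rpow_mul hD0,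
      mul_one_div_cancel hr0.ne', Real.rpow_one, hDdef]
    congr 1; ring

theorem exists_norm_bumpSum_le {S : ℝ} (hS : 0 < S) {p : ℝ≥0∞} (hp : 1 ≤ p)
    {N : (ℝ → ℝ) → ℝ≥0∞} (hN : IsSmoothnessNorm S p N) :
    ∃ K : ℝ, 0 < K ∧ ∀ (M : ℕ) (a : ℝ) (z : ℕ → ℝ), 1 ≤ M → 0 ≤ a → (∀ i < M, |z i| ≤ a) →
      N (bumpSum M 0 z) ≤ ENNReal.ofReal (K * (a * (M : ℝ) ^ S)) := by
  rcases hN with rfl | ⟨p', r, hp', hr, rfl⟩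
  · by_cases hint : (⌊S⌋₊ : ℝ) = S
    · have hb := motherBound_nonneg ⌊S⌋₊
      refine ⟨motherBound ⌊S⌋₊ + 1, by positivity, fun M a z hM ha hz => ?_⟩
      have hM0 : (0 : ℝ) < M := by exact_mod_cast hM
      rw [sobolevNorm, if_pos hint]
      refine (iInf₂_le _ (isWeakDeriv_iteratedDeriv contDiff_bumpSum bumpSum_periodic _)).trans ?_
      refine eLpNorm_torus_le_of_abs_le (fun x => ?_) p
      refine (abs_iteratedDeriv_bumpSum_le hM hz _ x).trans ?_
      have e : (M : ℝ) ^ S = (M : ℝ) ^ ⌊S⌋₊ := by rw [← Real.rpow_natCast, hint]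
      rw [e]
      have : 0 ≤ a * (M : ℝ) ^ ⌊S⌋₊ := by positivity
      linarith
    · obtain ⟨K, hK, h⟩ := exists_besovNorm_bumpSum_le (r := ⌊S⌋₊ + 1) hS
        (by push_cast; exact Nat.lt_floor_add_one S) p hp
      refine ⟨K, hK, fun M a z hM ha hz => ?_⟩
      rw [sobolevNorm, if_neg hint]
      exact h M a z hM ha hz
  · exact exists_besovNorm_bumpSum_le hS hr p hp'

/-! ### Shifts of Gaussian noise -/

/-- The density of a shifted Gaussian vector. -/
def shiftDensity {n : ℕ} (v : ℝ≥0) (b z : Fin n → ℝ) : ℝ :=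
  ∏ i, Real.exp (b i * z i / v - b i ^ 2 / (2 * v))

theorem measurable_shiftDensity {n : ℕ} (v : ℝ≥0) (b : Fin n → ℝ) :
    Measurable (shiftDensity v b) := by
  unfold shiftDensity
  fun_prop

theorem gaussianReal_eq_withDensity {v : ℝ≥0} (hv : v ≠ 0) (b : ℝ) :
    gaussianReal b v = (gaussianReal 0 v).withDensity
      fun x => ENNReal.ofReal (Real.exp (b * x / v - b ^ 2 / (2 * v))) := by
  have hv' : (v : ℝ) ≠ 0 := by exact_mod_cast hv
  rw [gaussianReal_of_var_ne_zero b hv, gaussianReal_of_var_ne_zero 0 hv,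
    ← withDensity_mul _ (measurable_gaussianPDF 0 v) (by fun_prop)]
  congr 1
  funext x
  have e : -(x - b) ^ 2 / (2 * v) = -(x - 0) ^ 2 / (2 * v) + (b * x / v - b ^ 2 / (2 * v)) := by
    field_simp
    ring
  rw [Pi.mul_apply, gaussianPDF, gaussianPDF, gaussianPDFReal, gaussianPDFReal,
    ← ENNReal.ofReal_mul (by positivity), e, Real.exp_add, ← mul_assoc]

/-- The finite-dimensional Cameron–Martin formula, checked on boxes, where both sides factor into
one-dimensional Gaussian measures. -/
theorem map_add_pi_gaussianReal {n : ℕ} {v : ℝ≥0} (hv : v ≠ 0) (b : Fin n → ℝ) :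
    (Measure.pi fun _ : Fin n => gaussianReal 0 v).map (fun z => b + z) =
      (Measure.pi fun _ : Fin n => gaussianReal 0 v).withDensity
        fun z => ENNReal.ofReal (shiftDensity v b z) := by
  have h1 : (Measure.pi fun _ : Fin n => gaussianReal 0 v).map (fun z => b + z) =
      Measure.pi fun i : Fin n => gaussianReal (b i) v := by
    have := Measure.pi_map_pi (μ := fun _ : Fin n => gaussianReal 0 v)
      (f := fun i x => b i + x) (fun i => by fun_prop)
    simp only [gaussianReal_map_const_add, zero_add] at this
    exact this
  rw [h1]
  refine Measure.pi_eq fun s hs => ?_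
  rw [withDensity_apply _ (MeasurableSet.univ_pi hs),
    ← lintegral_indicator (MeasurableSet.univ_pi hs)]
  have e : ∀ z : Fin n → ℝ, (Set.univ.pi s).indicator
      (fun z => ENNReal.ofReal (shiftDensity v b z)) z =
      ∏ i, (s i).indicator
        (fun x => ENNReal.ofReal (Real.exp (b i * x / v - b i ^ 2 / (2 * v)))) (z i) := by
    intro z
    by_cases hz : z ∈ Set.univ.pi s
    · rw [Set.indicator_of_mem hz, shiftDensity,
        ENNReal.ofReal_prod_of_nonneg fun i _ => (Real.exp_pos _).le]
      exact Finset.prod_congr rfl fun i _ => by rw [Set.indicator_of_mem (hz i trivial)]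
    · rw [Set.indicator_of_notMem hz]
      obtain ⟨i, hi⟩ : ∃ i, z i ∉ s i := by simpa using hz
      exact (Finset.prod_eq_zero (Finset.mem_univ i) (Set.indicator_of_notMem hi _)).symm
  simp_rw [e]
  have hmeas : ∀ i, Measurable ((s i).indicator
      fun x => ENNReal.ofReal (Real.exp (b i * x / v - b i ^ 2 / (2 * v)))) :=
    fun i => Measurable.indicator (by fun_prop) (hs i)
  rw [lintegral_prod_eq_prod_lintegral_of_indepFun Finset.univ
    (fun i (z : Fin n → ℝ) => (s i).indicator
      (fun x => ENNReal.ofReal (Real.exp (b i * x / v - b i ^ 2 / (2 * v)))) (z i))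
    (iIndepFun_pi fun i => (hmeas i).aemeasurable)
    fun i => (hmeas i).comp (measurable_pi_apply i)]
  refine Finset.prod_congr rfl fun i _ => ?_
  rw [(measurePreserving_eval (fun _ : Fin n => gaussianReal 0 v) i).lintegral_comp (hmeas i),
    lintegral_indicator (hs i), gaussianReal_eq_withDensity hv (b i), withDensity_apply _ (hs i)]

theorem lintegral_shiftDensity {n : ℕ} {v : ℝ≥0} (hv : v ≠ 0) (b : Fin n → ℝ) :
    ∫⁻ z, ENNReal.ofReal (shiftDensity v b z) ∂(Measure.pi fun _ : Fin n => gaussianReal 0 v) =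
      1 := by
  have h := congrArg (fun μ => μ Set.univ) (map_add_pi_gaussianReal hv b)
  simp only [withDensity_apply _ MeasurableSet.univ, Measure.restrict_univ] at h
  rw [← h, Measure.map_apply (by fun_prop) MeasurableSet.univ, Set.preimage_univ, measure_univ]

theorem shiftDensity_pos {n : ℕ} (v : ℝ≥0) (b z : Fin n → ℝ) : 0 < shiftDensity v b z :=
  Finset.prod_pos fun _ _ => Real.exp_pos _

/-- The linear terms cancel. For two means placed symmetrically about their midpoint, the product of
the likelihoods is therefore a constant. -/
theorem shiftDensity_mul_neg {n : ℕ} (v : ℝ≥0) (b z : Fin n → ℝ) :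
    shiftDensity v b z * shiftDensity v (-b) z = Real.exp (-(∑ i, b i ^ 2) / v) := by
  rw [shiftDensity, shiftDensity, ← Finset.prod_mul_distrib, neg_div, Finset.sum_div,
    ← Finset.sum_neg_distrib, Real.exp_sum]
  refine Finset.prod_congr rfl fun i _ => ?_
  rw [← Real.exp_add]
  congr 1
  simp only [Pi.neg_apply]
  rcases eq_or_ne (v : ℝ) 0 with h | h
  · simp [h]
  · field_simp; ring

/-- By the arithmetic-geometric inequality, `x + (e/4) y ≥ √(e x y) = e`. Integrated for two
densities of mass one, this bounds the overlap `∫ min` from below by `e/2`. -/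
theorem le_min_add {x y e : ℝ} (hx : 0 < x) (hy : 0 < y) (he : x * y = e) :
    e ≤ min x y + e / 4 * (x + y) := by
  have he0 : 0 < e := by rw [← he]; positivity
  have key : ∀ x y : ℝ, 0 < x → 0 < y → x * y = e → e ≤ x + e / 4 * (x + y) := by
    intro x y hx hy he
    have h1 : e ^ 2 ≤ (x + e / 4 * y) ^ 2 := by
      have : (x + e / 4 * y) ^ 2 = (x - e / 4 * y) ^ 2 + e * (x * y) := by ring
      rw [this, he]
      nlinarith [sq_nonneg (x - e / 4 * y)]
    have h2 := (abs_le_of_sq_le_sq' h1 (by positivity)).2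
    have h3 : 0 ≤ e / 4 * x := by positivity
    linarith
  rcases le_total x y with h | h
  · rw [min_eq_left h]; exact key x y hx hy he
  · rw [min_eq_right h, add_comm x y]; exact key y x hy hx (by rw [mul_comm]; exact he)

/-- Two Gaussian shift hypotheses that are close cannot be told apart. -/
theorem le_lintegral_add_lintegral {n : ℕ} {v : ℝ≥0} (hv : v ≠ 0) (u b : Fin n → ℝ)
    {G₁ G₂ : (Fin n → ℝ) → ℝ≥0∞} (h₁ : Measurable G₁) (h₂ : Measurable G₂) {D : ℝ≥0∞}
    (hD : ∀ y, D ≤ G₁ y + G₂ y) :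
    D * ENNReal.ofReal (Real.exp (-(∑ i, b i ^ 2) / v) / 2) ≤
      ∫⁻ z, G₁ (u + b + z) ∂(Measure.pi fun _ : Fin n => gaussianReal 0 v) +
        ∫⁻ z, G₂ (u - b + z) ∂(Measure.pi fun _ : Fin n => gaussianReal 0 v) := by
  set π := Measure.pi fun _ : Fin n => gaussianReal 0 v
  have shift : ∀ (c : Fin n → ℝ) {G : (Fin n → ℝ) → ℝ≥0∞}, Measurable G →
      ∫⁻ z, G (u + c + z) ∂π = ∫⁻ z, ENNReal.ofReal (shiftDensity v c z) * G (u + z) ∂π := by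
    intro c G hG
    have hG' : Measurable fun z => G (u + z) := hG.comp (by fun_prop)
    have e := lintegral_map (μ := π) hG' (show Measurable fun z : Fin n → ℝ => c + z by fun_prop)
    rw [map_add_pi_gaussianReal hv, lintegral_withDensity_eq_lintegral_mul _
      (measurable_shiftDensity v c).ennreal_ofReal hG'] at e
    simp only [add_assoc]
    exact e.symm
  set e := Real.exp (-(∑ i, b i ^ 2) / v) with he
  have he0 : 0 < e := Real.exp_pos _
  have mb := measurable_shiftDensity v b
  have mnb := measurable_shiftDensity v (-b)
  have msum : Measurable fun z => ENNReal.ofReal (shiftDensity v b z) +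
      ENNReal.ofReal (shiftDensity v (-b) z) := mb.ennreal_ofReal.add mnb.ennreal_ofReal
  have mprod : Measurable fun z => ENNReal.ofReal (shiftDensity v b z) * G₁ (u + z) :=
    mb.ennreal_ofReal.mul (h₁.comp (by fun_prop))
  have hmin : ENNReal.ofReal (e / 2) ≤
      ∫⁻ z, ENNReal.ofReal (min (shiftDensity v b z) (shiftDensity v (-b) z)) ∂π := by
    have h3 : ENNReal.ofReal e ≤
        ∫⁻ z, ENNReal.ofReal (min (shiftDensity v b z) (shiftDensity v (-b) z)) ∂π +
          ENNReal.ofReal (e / 2) := by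
      calc ENNReal.ofReal e = ∫⁻ _z, ENNReal.ofReal e ∂π := by
            rw [lintegral_const, measure_univ, mul_one]
        _ ≤ ∫⁻ z, (ENNReal.ofReal (min (shiftDensity v b z) (shiftDensity v (-b) z)) +
              ENNReal.ofReal (e / 4) * (ENNReal.ofReal (shiftDensity v b z) +
                ENNReal.ofReal (shiftDensity v (-b) z))) ∂π := by
            refine lintegral_mono fun z => ?_
            have p1 := shiftDensity_pos v b z
            have p2 := shiftDensity_pos v (-b) z
            rw [← ENNReal.ofReal_add p1.le p2.le, ← ENNReal.ofReal_mul (by positivity),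
              ← ENNReal.ofReal_add (by positivity) (by positivity)]
            exact ENNReal.ofReal_le_ofReal (le_min_add p1 p2 (shiftDensity_mul_neg v b z))
        _ = _ := by
            rw [lintegral_add_left (mb.min mnb).ennreal_ofReal,
              lintegral_const_mul _ msum,
              lintegral_add_left mb.ennreal_ofReal, lintegral_shiftDensity hv,
              lintegral_shiftDensity hv, one_add_one_eq_two, ← ENNReal.ofReal_ofNat 2,
              ← ENNReal.ofReal_mul (by positivity)]
            congr 2; ring
    have h4 : ENNReal.ofReal e = ENNReal.ofReal (e / 2) + ENNReal.ofReal (e / 2) := by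
      rw [← ENNReal.ofReal_add (by positivity) (by positivity)]; congr 1; ring
    rw [h4] at h3
    exact (ENNReal.add_le_add_iff_right ENNReal.ofReal_ne_top).1 h3
  rw [sub_eq_add_neg, shift b h₁, shift (-b) h₂, ← lintegral_add_left mprod]
  calc D * ENNReal.ofReal (e / 2) ≤ D * ∫⁻ z, ENNReal.ofReal
        (min (shiftDensity v b z) (shiftDensity v (-b) z)) ∂π := by gcongr
    _ = ∫⁻ z, D * ENNReal.ofReal (min (shiftDensity v b z) (shiftDensity v (-b) z)) ∂π :=
        (lintegral_const_mul _ (mb.min mnb).ennreal_ofReal).symm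
    _ ≤ _ := by
        refine lintegral_mono fun z => ?_
        calc _ ≤ (G₁ (u + z) + G₂ (u + z)) *
              ENNReal.ofReal (min (shiftDensity v b z) (shiftDensity v (-b) z)) := by
              gcongr; exact hD _
          _ ≤ _ := by
              rw [add_mul, mul_comm (G₁ _), mul_comm (G₂ _)]
              gcongr
              · exact min_le_left _ _
              · exact min_le_right _ _

/-! ### The minimax lower bound -/

/-- Heights `± a`, with signs prescribed by `θ`. -/
def signs {M : ℕ} (a : ℝ) (θ : Fin M → Bool) (i : ℕ) : ℝ :=
  if h : i < M then (if θ ⟨i, h⟩ then a else -a) else 0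

theorem abs_signs_le {M : ℕ} {a : ℝ} (ha : 0 ≤ a) (θ : Fin M → Bool) (i : ℕ) :
    |signs a θ i| ≤ a := by
  unfold signs
  split_ifs <;> simp [abs_of_nonneg ha, ha]

/-- Change the sign of the height number `i`. -/
def flipSign {M : ℕ} (i : Fin M) (θ : Fin M → Bool) : Fin M → Bool := Function.update θ i (!θ i)

theorem flipSign_involutive {M : ℕ} (i : Fin M) : Function.Involutive (flipSign i) := by
  intro θ
  simp [flipSign]

theorem signs_flipSign_self {M : ℕ} (a : ℝ) (i : Fin M) (θ : Fin M → Bool) :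
    signs a (flipSign i θ) i = -signs a θ i := by
  simp only [signs, i.2, dite_true, Fin.eta, flipSign, Function.update_self]
  cases θ i <;> simp

theorem signs_flipSign_of_ne {M : ℕ} (a : ℝ) {i : Fin M} (θ : Fin M → Bool) {l : ℕ} (hl : l ≠ i) :
    signs a (flipSign i θ) l = signs a θ l := by
  unfold signs
  by_cases h : l < M
  · have : (⟨l, h⟩ : Fin M) ≠ i := fun e => hl (by rw [← e])
    simp only [h, dite_true, flipSign, Function.update_of_ne this]
  · simp only [h, dite_false]

theorem abs_signs {M : ℕ} {a : ℝ} (ha : 0 ≤ a) (θ : Fin M → Bool) (i : Fin M) :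
    |signs a θ i| = a := by
  simp only [signs, i.2, dite_true]
  split_ifs <;> simp [abs_of_nonneg ha]

theorem bumpSum_eq_of_mem {M : ℕ} {z : ℕ → ℝ} {l : ℕ} (hl : l < M) {x : ℝ}
    (hx : x ∈ Set.Ico ((l : ℝ) / M) ((l + 1 : ℝ) / M)) :
    bumpSum M 0 z x = z l * mother (M * x - l) := by
  have hM : (0 : ℝ) < M := by exact_mod_cast (Nat.zero_le l).trans_lt hl
  have h1 := (div_le_iff₀' hM).1 hx.1
  have h2 := (lt_div_iff₀' hM).1 hx.2
  have := bumpSum_apply (c := 0) (z := z) hl (x := x) (by simpa using h1) (by simpa using h2)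
  simpa using this

theorem bumpSum_flipSign_eq {M : ℕ} (a : ℝ) (i : Fin M) (θ : Fin M → Bool) {x : ℝ}
    (hx : x ∈ Set.Ico (0 : ℝ) 1)
    (hxi : x ∉ Set.Ico (((i : ℕ) : ℝ) / M) (((i : ℕ) + 1 : ℝ) / M)) :
    bumpSum M 0 (signs a (flipSign i θ)) x = bumpSum M 0 (signs a θ) x := by
  have hM : (0 : ℝ) < M := by exact_mod_cast (Nat.zero_le _).trans_lt i.2
  have h0 : (0 : ℝ) ≤ M * x := by have := hx.1; positivity
  have hlt : ⌊(M : ℝ) * x⌋₊ < M := by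
    rw [Nat.floor_lt h0]; nlinarith [hx.2]
  have hmem : x ∈ Set.Ico ((⌊(M : ℝ) * x⌋₊ : ℝ) / M) ((⌊(M : ℝ) * x⌋₊ + 1 : ℝ) / M) :=
    ⟨(div_le_iff₀' hM).2 (Nat.floor_le h0), (lt_div_iff₀' hM).2 (Nat.lt_floor_add_one _)⟩
  rw [bumpSum_eq_of_mem hlt hmem, bumpSum_eq_of_mem hlt hmem, signs_flipSign_of_ne]
  intro e
  rw [e] at hmem
  exact hxi hmem

/-- The `L¹`-norm of the mother function. -/
def motherMass : ℝ := ∫ x in (0 : ℝ)..1, |mother x|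

theorem motherMass_pos : 0 < motherMass := by
  refine intervalIntegral.integral_pos zero_lt_one contDiff_mother.continuous.abs.continuousOn
    (fun x _ => abs_nonneg _) ⟨1 / 2, by norm_num, ?_⟩
  rw [mother_half]; norm_num

theorem lintegral_cell_mother {M : ℕ} (i : Fin M) :
    ∫⁻ x in Set.Ioo (((i : ℕ) : ℝ) / M) (((i : ℕ) + 1 : ℝ) / M), ‖mother (M * x - (i : ℕ))‖ₑ =
      ENNReal.ofReal (motherMass / M) := by
  have hM : (0 : ℝ) < M := by exact_mod_cast (Nat.zero_le _).trans_lt i.2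
  have hle : ((i : ℕ) : ℝ) / M ≤ ((i : ℕ) + 1 : ℝ) / M := by gcongr; linarith
  have hc : Continuous fun x : ℝ => mother (M * x - (i : ℕ)) :=
    contDiff_mother.continuous.comp (by fun_prop)
  have hint : Integrable (fun x : ℝ => mother (M * x - (i : ℕ)))
      (volume.restrict (Set.Ioo (((i : ℕ) : ℝ) / M) (((i : ℕ) + 1 : ℝ) / M))) :=
    (hc.integrableOn_Icc (a := ((i : ℕ) : ℝ) / M) (b := ((i : ℕ) + 1 : ℝ) / M)).mono_set
      Set.Ioo_subset_Icc_self
  rw [← ofReal_integral_norm_eq_lintegral_enorm hint, ← integral_Ioc_eq_integral_Ioo,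
    ← intervalIntegral.integral_of_le hle]
  congr 1
  have := intervalIntegral.integral_comp_mul_sub (fun x => |mother x|) hM.ne' ((i : ℕ) : ℝ)
    (a := ((i : ℕ) : ℝ) / M) (b := ((i : ℕ) + 1 : ℝ) / M)
  simp only [Real.norm_eq_abs]
  rw [this, mul_div_cancel₀ _ hM.ne', mul_div_cancel₀ _ hM.ne', sub_self, add_sub_cancel_left,
    smul_eq_mul, motherMass, div_eq_inv_mul]

/-- A flipped sign changes only the samples in one cell, and there are at most `n/M + 1` of these.
-/
theorem sum_sq_sample_flipSign_le {M : ℕ} {a : ℝ} (ha : 0 ≤ a) (i : Fin M) (θ : Fin M → Bool)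
    (n : ℕ) :
    ∑ j, (((1 / 2 : ℝ) • (sample n (bumpSum M 0 (signs a θ)) -
        sample n (bumpSum M 0 (signs a (flipSign i θ))))) j) ^ 2 ≤
      ((n : ℝ) / M + 1) * (a * motherBound 0) ^ 2 := by
  have hM : (0 : ℝ) < M := by exact_mod_cast (Nat.zero_le _).trans_lt i.2
  have hM1 : 1 ≤ M := by exact_mod_cast hM
  have hb : ∀ (η : Fin M → Bool) (x : ℝ), |bumpSum M 0 (signs a η) x| ≤ a * motherBound 0 := by
    intro η x
    simpa using abs_iteratedDeriv_bumpSum_le (c := 0) hM1 (fun l _ => abs_signs_le ha η l) 0 x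
  set J := Set.Ico (((i : ℕ) : ℝ) / M) (((i : ℕ) + 1 : ℝ) / M) with hJ
  have hzero : ∀ j : Fin n, j ∉ gridIn n J → (((1 / 2 : ℝ) • (sample n (bumpSum M 0 (signs a θ)) -
        sample n (bumpSum M 0 (signs a (flipSign i θ))))) j) ^ 2 = 0 := by
    intro j hj
    rw [mem_gridIn] at hj
    have hn : (0 : ℝ) < n := by exact_mod_cast (Nat.zero_le _).trans_lt j.2
    have := bumpSum_flipSign_eq a i θ (x := (j : ℝ) / n)
      ⟨by positivity, by rw [div_lt_one hn]; exact_mod_cast j.2⟩ hj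
    simp [sample, this]
  rw [← Finset.sum_subset (Finset.subset_univ (gridIn n J)) fun j _ hj => hzero j hj]
  have hcard : ((gridIn n J).card : ℝ) ≤ (n : ℝ) / M + 1 := by
    have h := card_gridIn_Ico_le (n := n) (a := ((i : ℕ) : ℝ) / M) (b := ((i : ℕ) + 1 : ℝ) / M)
      (by gcongr; linarith) (by positivity)
      (by rw [div_le_one hM]; exact_mod_cast i.2)
    have e : (n : ℝ) * (((i : ℕ) + 1 : ℝ) / M - ((i : ℕ) : ℝ) / M) = n / M := by ring
    rwa [e] at h
  calc _ ≤ ∑ _j ∈ gridIn n J, (a * motherBound 0) ^ 2 := by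
        refine Finset.sum_le_sum fun j _ => ?_
        rw [sq_le_sq, abs_of_nonneg (mul_nonneg ha (motherBound_nonneg 0))]
        have h1 := hb θ ((j : ℝ) / n)
        have h2 := hb (flipSign i θ) ((j : ℝ) / n)
        have h3 := abs_sub (bumpSum M 0 (signs a θ) ((j : ℝ) / n))
          (bumpSum M 0 (signs a (flipSign i θ)) ((j : ℝ) / n))
        simp only [Pi.smul_apply, Pi.sub_apply, sample, smul_eq_mul, abs_mul]
        rw [abs_of_pos (by norm_num : (0 : ℝ) < 1 / 2)]
        linarith
    _ = ((gridIn n J).card : ℝ) * (a * motherBound 0) ^ 2 := by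
        rw [Finset.sum_const, nsmul_eq_mul]
    _ ≤ _ := by gcongr

/-- On the cell the two bump sums differ by twice a bump, so by the triangle inequality no `g` is
close to both. -/
theorem le_cell_error_add {M : ℕ} {a : ℝ} (ha : 0 ≤ a) (i : Fin M) (θ : Fin M → Bool) {g : ℝ → ℝ}
    (hg : Measurable g) :
    ENNReal.ofReal (2 * a * motherMass / M) ≤
      (∫⁻ x in Set.Ioo (((i : ℕ) : ℝ) / M) (((i : ℕ) + 1 : ℝ) / M),
          ‖g x - bumpSum M 0 (signs a θ) x‖ₑ) +
        ∫⁻ x in Set.Ioo (((i : ℕ) : ℝ) / M) (((i : ℕ) + 1 : ℝ) / M),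
          ‖g x - bumpSum M 0 (signs a (flipSign i θ)) x‖ₑ := by
  have h1 : Measurable fun x => ‖g x - bumpSum M 0 (signs a θ) x‖ₑ :=
    (hg.sub contDiff_bumpSum.continuous.measurable).enorm
  rw [← lintegral_add_left h1, show 2 * a * motherMass / M = 2 * a * (motherMass / M) by ring,
    ENNReal.ofReal_mul (by positivity), ← lintegral_cell_mother i, ← lintegral_const_mul]
  swap
  · exact (contDiff_mother.continuous.measurable.comp (by fun_prop)).enorm
  refine setLIntegral_mono' measurableSet_Ioo fun x hx => ?_
  have hx' := Set.Ioo_subset_Ico_self hx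
  rw [bumpSum_eq_of_mem i.2 hx', bumpSum_eq_of_mem i.2 hx', signs_flipSign_self]
  set w := signs a θ i with hw
  set t := mother (M * x - (i : ℕ))
  have h2 : 2 * a = |2 * w| := by rw [abs_mul, hw, abs_signs ha]; norm_num
  have h3 : ENNReal.ofReal (2 * a) * ‖t‖ₑ = ‖2 * w * t‖ₑ := by
    rw [h2, ← Real.norm_eq_abs, ofReal_norm, enorm_mul (2 * w)]
  rw [h3, show 2 * w * t = (g x - -w * t) - (g x - w * t) by ring, add_comm]
  exact enorm_sub_le

/-- The `L¹`-error is additive over the cells, and on a probability space it is below the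
`L^q`-error. -/
theorem sum_cell_le_loss {M : ℕ} {q : ℝ≥0∞} (hq : 1 ≤ q) {g f : ℝ → ℝ} (hg : Measurable g)
    (hf : Measurable f) :
    ∑ i : Fin M, ∫⁻ x in Set.Ioo (((i : ℕ) : ℝ) / M) (((i : ℕ) + 1 : ℝ) / M), ‖g x - f x‖ₑ ≤
      loss q g f := by
  refine le_trans ?_ (eLpNorm_le_eLpNorm_of_exponent_le hq (hg.sub hf).aestronglyMeasurable)
  rw [eLpNorm_one_eq_lintegral_enorm, torus]
  have hdis : Pairwise (Function.onFun Disjoint fun i : Fin M =>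
      Set.Ioo (((i : ℕ) : ℝ) / M) (((i : ℕ) + 1 : ℝ) / M)) := by
    intro i j hij
    refine Set.disjoint_left.2 fun x hx hy => hij ?_
    have hM : (0 : ℝ) < M := by exact_mod_cast (Nat.zero_le _).trans_lt i.2
    have a1 := (div_lt_iff₀ hM).1 hx.1
    have a2 := (lt_div_iff₀ hM).1 hx.2
    have b1 := (div_lt_iff₀ hM).1 hy.1
    have b2 := (lt_div_iff₀ hM).1 hy.2
    have c1 : ((i : ℕ) : ℝ) < (j : ℕ) + 1 := a1.trans b2
    have c2 : ((j : ℕ) : ℝ) < (i : ℕ) + 1 := b1.trans a2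
    have c3 : (i : ℕ) < (j : ℕ) + 1 := by exact_mod_cast c1
    have c4 : (j : ℕ) < (i : ℕ) + 1 := by exact_mod_cast c2
    exact Fin.ext (by omega)
  have h := lintegral_iUnion (μ := volume) (fun i : Fin M => measurableSet_Ioo) hdis
    (fun x => ‖g x - f x‖ₑ)
  rw [tsum_fintype] at h
  rw [← h]
  refine lintegral_mono_set (Set.iUnion_subset fun i x hx => ?_)
  have hM : (0 : ℝ) < M := by exact_mod_cast (Nat.zero_le _).trans_lt i.2
  refine ⟨lt_of_le_of_lt (by positivity) hx.1, hx.2.le.trans ?_⟩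
  rw [div_le_one hM]
  exact_mod_cast i.2

/-- Assouad's lower bound for the bumps `± a` on `M` cells. -/
theorem le_of_forall_lintegral_loss_le {M n : ℕ} (hM : 1 ≤ M) {a : ℝ} (ha : 0 ≤ a) {q : ℝ≥0∞}
    (hq : 1 ≤ q) {v : ℝ≥0} (hv : v ≠ 0) {T : (Fin n → ℝ) → ℝ → ℝ}
    (hT : Measurable (Function.uncurry T)) {W : ℝ≥0∞}
    (hW : ∀ θ : Fin M → Bool, ∫⁻ z, loss q (T (sample n (bumpSum M 0 (signs a θ)) + z))
      (bumpSum M 0 (signs a θ)) ∂(Measure.pi fun _ : Fin n => gaussianReal 0 v) ≤ W) :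
    ENNReal.ofReal (a * motherMass *
      Real.exp (-(((n : ℝ) / M + 1) * (a * motherBound 0) ^ 2) / v) / 2) ≤ W := by
  have hM0 : (0 : ℝ) < M := by exact_mod_cast hM
  set π := Measure.pi fun _ : Fin n => gaussianReal 0 v
  set e := Real.exp (-(((n : ℝ) / M + 1) * (a * motherBound 0) ^ 2) / v) with he
  have he0 : 0 < e := Real.exp_pos _
  have hTy : ∀ y, Measurable (T y) := fun y => hT.comp measurable_prodMk_left
  let G : (Fin M → Bool) → Fin M → (Fin n → ℝ) → ℝ≥0∞ := fun θ i y =>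
    ∫⁻ x in Set.Ioo (((i : ℕ) : ℝ) / M) (((i : ℕ) + 1 : ℝ) / M),
      ‖T y x - bumpSum M 0 (signs a θ) x‖ₑ
  have hG : ∀ θ i, Measurable (G θ i) := by
    intro θ i
    have : Measurable fun w : (Fin n → ℝ) × ℝ => ‖T w.1 w.2 - bumpSum M 0 (signs a θ) w.2‖ₑ :=
      (hT.sub (contDiff_bumpSum.continuous.measurable.comp measurable_snd)).enorm
    exact this.lintegral_prod_right'
  let R : (Fin M → Bool) → Fin M → ℝ≥0∞ := fun θ i =>
    ∫⁻ z, G θ i (sample n (bumpSum M 0 (signs a θ)) + z) ∂π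
  have hR : ∀ θ, ∑ i, R θ i ≤ W := by
    intro θ
    refine le_trans ?_ (hW θ)
    have hm : ∀ i ∈ Finset.univ, Measurable fun z =>
        G θ i (sample n (bumpSum M 0 (signs a θ)) + z) :=
      fun i _ => (hG θ i).comp (by fun_prop)
    rw [← lintegral_finsetSum _ hm]
    exact lintegral_mono fun z => sum_cell_le_loss hq (hTy _) contDiff_bumpSum.continuous.measurable
  -- The samples of the two sign patterns are written as midpoint plus and minus half the
  -- difference, the form needed for symmetric Gaussian shifts.
  have hpair : ∀ θ i, ENNReal.ofReal (2 * a * motherMass / M) * ENNReal.ofReal (e / 2) ≤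
      R θ i + R (flipSign i θ) i := by
    intro θ i
    have h := le_lintegral_add_lintegral hv
      ((1 / 2 : ℝ) • (sample n (bumpSum M 0 (signs a θ)) +
        sample n (bumpSum M 0 (signs a (flipSign i θ)))))
      ((1 / 2 : ℝ) • (sample n (bumpSum M 0 (signs a θ)) -
        sample n (bumpSum M 0 (signs a (flipSign i θ)))))
      (hG θ i) (hG (flipSign i θ) i) fun y => le_cell_error_add ha i θ (hTy y)
    have e1 : ∀ u w : Fin n → ℝ, (1 / 2 : ℝ) • (u + w) + (1 / 2 : ℝ) • (u - w) = u := by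
      intro u w; rw [← smul_add]; ext j; simp; ring
    have e2 : ∀ u w : Fin n → ℝ, (1 / 2 : ℝ) • (u + w) - (1 / 2 : ℝ) • (u - w) = w := by
      intro u w; rw [← smul_sub]; ext j; simp; ring
    rw [e1, e2] at h
    refine le_trans ?_ h
    rw [he]
    gcongr
    exact sum_sq_sample_flipSign_le ha i θ n
  -- Summed over all sign patterns, the flip merely permutes the terms, so the two hypotheses
  -- contribute equally.
  have hsum : ∀ i, (Fintype.card (Fin M → Bool) : ℝ≥0∞) *
      (ENNReal.ofReal (2 * a * motherMass / M) * ENNReal.ofReal (e / 2)) ≤ 2 * ∑ θ, R θ i := by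
    intro i
    have h1 : ∑ θ, R (flipSign i θ) i = ∑ θ, R θ i :=
      Equiv.sum_comp (flipSign_involutive i).toPerm fun θ => R θ i
    calc _ = ∑ _θ : Fin M → Bool,
          (ENNReal.ofReal (2 * a * motherMass / M) * ENNReal.ofReal (e / 2)) := by
          rw [Finset.sum_const, nsmul_eq_mul, Finset.card_univ]
      _ ≤ ∑ θ, (R θ i + R (flipSign i θ) i) := Finset.sum_le_sum fun θ _ => hpair θ i
      _ = _ := by rw [Finset.sum_add_distrib, h1, two_mul]
  have htot : (Fintype.card (Fin M → Bool) : ℝ≥0∞) *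
      (M * (ENNReal.ofReal (2 * a * motherMass / M) * ENNReal.ofReal (e / 2))) ≤
      (Fintype.card (Fin M → Bool) : ℝ≥0∞) * (2 * W) := by
    calc _ = ∑ _i : Fin M, (Fintype.card (Fin M → Bool) : ℝ≥0∞) *
          (ENNReal.ofReal (2 * a * motherMass / M) * ENNReal.ofReal (e / 2)) := by
          rw [Finset.sum_const, nsmul_eq_mul, Finset.card_univ, Fintype.card_fin]; ring
      _ ≤ ∑ i, 2 * ∑ θ, R θ i := Finset.sum_le_sum fun i _ => hsum i
      _ = 2 * ∑ θ, ∑ i, R θ i := by rw [← Finset.mul_sum, Finset.sum_comm]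
      _ ≤ 2 * ∑ _θ : Fin M → Bool, W := by gcongr with θ; exact hR θ
      _ = _ := by rw [Finset.sum_const, nsmul_eq_mul, Finset.card_univ]; ring
  have h2W : ENNReal.ofReal (a * motherMass * e) ≤ 2 * W := by
    have h := (ENNReal.mul_le_mul_iff_right (by simp) (by simp)).1 htot
    refine le_trans (le_of_eq ?_) h
    have := motherMass_pos
    rw [← ENNReal.ofReal_natCast M, ← ENNReal.ofReal_mul (by positivity),
      ← ENNReal.ofReal_mul (by positivity)]
    congr 1
    field_simp
  have h3 : ENNReal.ofReal (a * motherMass * e) = 2 * ENNReal.ofReal (a * motherMass * e / 2) := by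
    rw [← ENNReal.ofReal_ofNat 2, ← ENNReal.ofReal_mul (by norm_num)]
    congr 1; ring
  rw [h3] at h2W
  exact (ENNReal.mul_le_mul_iff_right (by simp) (by simp)).1 h2W

/-- The height `a = (L/K) M^{-S}` is the largest for which the norm bound keeps the bump sums in the
ball. The number `M ≈ n^{1/(2S+1)}` makes `(n/M + 1) a²` bounded, so neighbouring sign patterns
cannot be told apart, while `a` is still of order `n^{-S/(2S+1)}`. -/
theorem exists_le_minimaxRisk {σ : ℝ≥0} (hσ : 0 < σ) {S : ℝ} (hS : 0 < S) {p q : ℝ≥0∞}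
    (hp : 1 ≤ p) (hq : 1 ≤ q) {N : (ℝ → ℝ) → ℝ≥0∞} (hN : IsSmoothnessNorm S p N) {L : ℝ}
    (hL : 0 < L) :
    ∃ c : ℝ, 0 < c ∧ ∀ n : ℕ, 1 ≤ n → ENNReal.ofReal (c * (n : ℝ) ^ (-(S / (2 * S + 1)))) ≤
      minimaxRisk σ q n {f | IsCont₀ f ∧ N f ≤ ENNReal.ofReal L} := by
  obtain ⟨K, hK, hbump⟩ := exists_norm_bumpSum_le hS hp hN
  have hσ2 : σ ^ 2 ≠ 0 := pow_ne_zero 2 hσ.ne'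
  have hκ := motherMass_pos
  set Q := 2 * (L / K * motherBound 0) ^ 2 with hQ
  refine ⟨L / K * 2 ^ (-S) * motherMass * Real.exp (-Q / (σ ^ 2 : ℝ≥0)) / 2, by positivity,
    fun n hn => ?_⟩
  have hn1 : (1 : ℝ) ≤ n := by exact_mod_cast hn
  have hn0 : (0 : ℝ) < n := by linarith
  set x := (n : ℝ) ^ (1 / (2 * S + 1)) with hx
  have hx1 : 1 ≤ x := Real.one_le_rpow hn1 (by positivity)
  set M := ⌈x⌉₊ with hMdef
  have hxM : x ≤ M := Nat.le_ceil x
  have hMx : (M : ℝ) ≤ 2 * x := by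
    have := Nat.ceil_lt_add_one (show 0 ≤ x by linarith)
    linarith
  have hM1 : (1 : ℝ) ≤ M := hx1.trans hxM
  have hM0 : (0 : ℝ) < M := by linarith
  have hM : 1 ≤ M := by exact_mod_cast hM1
  set a := L / K * (M : ℝ) ^ (-S) with ha
  have ha0 : 0 < a := by positivity
  have hmem : ∀ θ : Fin M → Bool,
      bumpSum M 0 (signs a θ) ∈ {f | IsCont₀ f ∧ N f ≤ ENNReal.ofReal L} := by
    intro θ
    refine ⟨isCont₀_bumpSum hM,
      (hbump M a _ hM ha0.le fun i _ => abs_signs_le ha0.le θ i).trans (le_of_eq ?_)⟩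
    congr 1
    rw [ha, mul_assoc, ← Real.rpow_add hM0]
    simp only [neg_add_cancel, Real.rpow_zero, mul_one]
    field_simp
  have hnM : (n : ℝ) / M + 1 ≤ 2 * ((M : ℝ) ^ S) ^ 2 := by
    have h1 : (n : ℝ) ≤ (M : ℝ) ^ (2 * S + 1) := by
      calc (n : ℝ) = x ^ (2 * S + 1) := by
            rw [hx, ← Real.rpow_mul hn0.le, one_div_mul_cancel (by positivity), Real.rpow_one]
        _ ≤ _ := by gcongr
    have h2 : ((M : ℝ) ^ S) ^ 2 = (M : ℝ) ^ (2 * S) := by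
      rw [← Real.rpow_natCast, ← Real.rpow_mul hM0.le]; congr 1; push_cast; ring
    have h3 : (n : ℝ) / M ≤ (M : ℝ) ^ (2 * S) := by
      rw [div_le_iff₀ hM0, ← Real.rpow_add_one hM0.ne']; exact h1
    have h4 : (1 : ℝ) ≤ (M : ℝ) ^ (2 * S) := Real.one_le_rpow hM1 (by positivity)
    rw [h2]; linarith
  have hexp : ((n : ℝ) / M + 1) * (a * motherBound 0) ^ 2 ≤ Q := by
    have hMS : (0 : ℝ) < (M : ℝ) ^ S := by positivity
    calc _ ≤ 2 * ((M : ℝ) ^ S) ^ 2 * (a * motherBound 0) ^ 2 := by gcongr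
      _ = Q := by
          rw [ha, hQ, Real.rpow_neg hM0.le]
          field_simp
  have hrate : L / K * 2 ^ (-S) * (n : ℝ) ^ (-(S / (2 * S + 1))) ≤ a := by
    rw [ha, mul_assoc]
    gcongr
    calc (2 : ℝ) ^ (-S) * (n : ℝ) ^ (-(S / (2 * S + 1))) = (2 * x) ^ (-S) := by
          rw [Real.mul_rpow (by norm_num) (by linarith), hx, ← Real.rpow_mul hn0.le]
          congr 2; ring
      _ ≤ _ := Real.rpow_le_rpow_of_nonpos hM0 hMx (by linarith)
  refine le_iInf₂ fun T hT => ?_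
  refine le_trans ?_ (le_of_forall_lintegral_loss_le hM ha0.le hq hσ2 hT fun θ =>
    le_iSup₂_of_le (bumpSum M 0 (signs a θ)) (hmem θ) le_rfl)
  refine ENNReal.ofReal_le_ofReal ?_
  calc _ = L / K * 2 ^ (-S) * (n : ℝ) ^ (-(S / (2 * S + 1))) * motherMass *
        Real.exp (-Q / (σ ^ 2 : ℝ≥0)) / 2 := by ring
    _ ≤ _ := by gcongr

end MIND

end

/-! ### Assembly of the theorem -/

theorem mainTheorem5
    {Ω : Type*} [MeasurableSpace Ω] (P : Measure Ω) [IsProbabilityMeasure P]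
    (σ : ℝ≥0) (hσ : 0 < σ)
    (ξ : (n : ℕ) → Fin n → Ω → ℝ) (hξ : MIND.IsNoise P σ ξ)
    (k : ℕ) (s : ℝ) (hs : 1 ≤ s) (hsk : s ≤ k)
    (p q : ℝ≥0∞) (hp : 1 ≤ p) (hq : 1 ≤ q)
    -- `N` is the norm of `W^{k+s,p}_0` or of `B^{k+s,p'}_{p,0}`
    (N : (ℝ → ℝ) → ℝ≥0∞)
    (hN : N = MIND.sobolevNorm (k + s) p ∨
      ∃ (p' : ℝ≥0∞) (m : ℕ), 1 ≤ p' ∧ (k + s : ℝ) < m ∧ N = MIND.besovNorm m (k + s) p p')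
    (B : Set (Set ℝ)) (hB : MIND.IsRegular B)
    (r C₀ : ℝ) (hr : 1 / 2 ≤ r) (hC₀ : 0 < C₀)
    (hC₀' : r = 1 / 2 → (σ : ℝ) * √(5 + 2 * k) < C₀) :
    -- the estimator is well defined
    (∀ n : ℕ, 1 ≤ n → ∀ y : Fin n → ℝ,
      ∃! g : ℝ → ℝ, MIND.IsMIND k B n (MIND.threshold C₀ r n) y g) ∧
    (∀ fhat : (n : ℕ) → (Fin n → ℝ) → ℝ → ℝ,
      (∀ n : ℕ, 1 ≤ n → ∀ y : Fin n → ℝ,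
        MIND.IsMIND k B n (MIND.threshold C₀ r n) y (fhat n y)) →
      -- convergence rate
      (∀ f : ℝ → ℝ, MIND.IsCont₀ f → N f < ∞ →
        MIND.IsBigOAlmostSurely P (MIND.error q fhat ξ f) (MIND.rate k s p q r) ∧
        MIND.IsBigOInExpectation P (MIND.error q fhat ξ f) (MIND.rate k s p q r)) ∧
      -- the simplified rate for `p ≥ 2` and `q ≤ 4k + 2`; in expectation also uniformly over balls
      (2 ≤ p → q ≤ 4 * (k : ℝ≥0∞) + 2 →
        (∀ f : ℝ → ℝ, MIND.IsCont₀ f → N f < ∞ →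
          MIND.IsBigOAlmostSurely P (MIND.error q fhat ξ f) (MIND.simpleRate k s r) ∧
          MIND.IsBigOInExpectation P (MIND.error q fhat ξ f) (MIND.simpleRate k s r)) ∧
        ∀ L : ℝ≥0, 0 < L → ∃ C : ℝ, ∀ᶠ n : ℕ in atTop,
          ∀ f : ℝ → ℝ, MIND.IsCont₀ f → N f ≤ L →
            ∫⁻ ω, MIND.error q fhat ξ f n ω ∂P ≤
              ENNReal.ofReal (C * MIND.simpleRate k s r n))) ∧
    -- minimax lower bound over balls, with the same power of `n`
    (2 ≤ p → q ≤ 4 * (k : ℝ≥0∞) + 2 → ∀ L : ℝ≥0, 0 < L →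
      ∃ c : ℝ, 0 < c ∧ ∀ᶠ n : ℕ in atTop,
        ENNReal.ofReal (c * (n : ℝ) ^ (-((k + s) / (2 * k + 2 * s + 1)))) ≤
          MIND.minimaxRisk σ q n {f | MIND.IsCont₀ f ∧ N f ≤ L}) := by
  have hk : 1 ≤ k := by exact_mod_cast hs.trans hsk
  have hN' : MIND.IsSmoothnessNorm (k + s) p N := hN
  have main : ∀ fhat : (n : ℕ) → (Fin n → ℝ) → ℝ → ℝ,
      (∀ n : ℕ, 1 ≤ n → ∀ y : Fin n → ℝ,
        MIND.IsMIND k B n (MIND.threshold C₀ r n) y (fhat n y)) →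
      ∀ f : ℝ → ℝ, MIND.IsCont₀ f → N f < ∞ →
        MIND.IsBigOAlmostSurely P (MIND.error q fhat ξ f) (MIND.rate k s p q r) ∧
        MIND.IsBigOInExpectation P (MIND.error q fhat ξ f) (MIND.rate k s p q r) := by
    intro fhat hfhat f hf hfN
    -- A single function is treated as a member of the ball whose radius is its own norm; the
    -- constant is then deterministic.
    obtain ⟨C, hC⟩ := MIND.exists_error_le (q := q) hξ hσ hk hs hsk hp hN' hB hr hC₀ hC₀' hfhat
      (ENNReal.toReal_nonneg (a := N f))
    have hfL : N f ≤ ENNReal.ofReal (N f).toReal := by rw [ENNReal.ofReal_toReal hfN.ne]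
    refine ⟨⟨C, ?_⟩, fun n hn =>
      MIND.aemeasurable_error hξ hk hC₀ hq hfhat hf.continuous hn, C, ?_⟩
    · filter_upwards [MIND.ae_eventually_notMem_noiseBad hξ hk hσ hr hC₀ hC₀'] with ω hω
      filter_upwards [hC, hω] with n h1 h2
      exact (h1 f hf hfL).1 ω h2
    · filter_upwards [hC] with n h1
      exact (h1 f hf hfL).2
  refine ⟨fun n hn y => MIND.existsUnique_isMIND hk hn (MIND.threshold_nonneg hC₀ hn),
    fun fhat hfhat => ⟨main fhat hfhat, fun hp2 hqk => ?_⟩, fun _ _ L hL => ?_⟩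
  · have hrate : MIND.rate k s p q r = MIND.simpleRate k s r :=
      funext fun n => MIND.rate_eq_simpleRate (by linarith) hp2 hqk r n
    refine ⟨fun f hf hfN => hrate ▸ main fhat hfhat f hf hfN, fun L _ => ?_⟩
    obtain ⟨C, hC⟩ := MIND.exists_error_le (q := q) hξ hσ hk hs hsk hp hN' hB hr hC₀ hC₀' hfhat
      (NNReal.coe_nonneg L)
    refine ⟨C, ?_⟩
    filter_upwards [hC] with n h f hf hfN
    rw [← hrate]
    exact (h f hf (by rwa [ENNReal.ofReal_coe_nnreal])).2
  · obtain ⟨c, hc, h⟩ := MIND.exists_le_minimaxRisk hσ (S := k + s) (by positivity) hp hq hN'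
      (NNReal.coe_pos.2 hL)
    refine ⟨c, hc, ?_⟩
    filter_upwards [eventually_ge_atTop 1] with n hn
    have h' := h n hn
    rw [ENNReal.ofReal_coe_nnreal, mul_add] at h'
    exact h'
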